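/- Let $M$ be a smooth manifold, $n\ge 0$, and let $(\mathbf E=\bigoplus_{i=-n}^{-1}E_i\to M,\mu)$ be an admissible $n$-coalgebra bundle: $\mu:\mathbf E\to\mathbf E\otimes\mathbf E$ is a smooth, degree-preserving, coassociative, graded cocommutative vector bundle map over $\mathrm{id}_M$ such that $\mathrm{im}(\mu|_{E_i})=K^\mu_i$ for $i=-n,\dots,-2$. Here $\mu^k:\mathbf E\to\mathbf E^{\otimes(k+1)}$ denotes the iterated comultiplication and $K^\mu_i$ is the set of the elements $e$ of degree $i$ of $\mathbf E\otimes\mathbf E$ with $\tau\cdot(\mu^k\otimes\mu^l)(e)=\tau'\cdot(\mu^{k'}\otimes\mu^{l'})(e)$ whenever $k+l=k'+l'$ and $\tau,\tau'\in S_{k+l+2}$ (acting with Koszul signs). Let $\mathcal M=\mathcal F(\mathbf E,\mu)=(M,C_{\mathcal M})$ be the corresponding $n$-manifold, $C_{\mathcal M}=\Gamma_{\mathrm{Sym}\,\mathbf E^*}/\mathcal I_\mu$, where $\mathcal I_\mu$ is the sheaf of ideals generated by $\omega\cdot\eta-\mu^*(\omega,\eta)$ for homogeneous sections $\omega,\eta$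 of $\mathbf E^*$ with $|\omega|+|\eta|\le n$, and let $\mathcal T^k_{\mathcal M}$ be the sheaf of degree $k$ derivations of $C_{\mathcal M}$. A distribution on $\mathcal M$ of rank $d_0|\cdots|d_n$ is a graded subsheaf $\mathcal D\subseteq\mathcal T^\bullet_{\mathcal M}$ of $C_{\mathcal M}$-modules such that each point of $M$ has an open neighbourhood $U$ on which there are local generators: vector fields $X_k^{i}\in\mathcal T^{-k}_{\mathcal M}(U)$ ($k=0,\dots,n$, $i=1,\dots,d_k$) that generate the $C_{\mathcal M}(U)$-module $\mathcal D(U)$ and whose tangent vectors $f\mapsto X_k^i(f)^0(x)$ are linearly independent at each $x\in U$. Let $\mathbf E^*_{\mathbb R}=\mathbb R_M\oplus\mathbf E^*$ with the multiplication $m$ given by $\mu^*$ and by scalar multiplication, and for $k=0,\dots,n$ let $\mathrm{Der}(\mathbf E^*_{\mathbb R},m)_{-k}\to M$ be the vector bundle whose sections are the degree $-k$ derivations $D$ of $\mathbf E^*_{\mathbb R}$ with $D(m(e,e'))=m(D(e),e')+(-1)^{k|e|}m(e,D(e'))$ for homogeneous $e,e'$ with $|e|+|e'|\le n$. Vector fields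 of degree $-k$ on $\mathcal M$ are identified with sections of this bundle by restricting them to functions of degree at most $n$. Let $\Theta_{i,-(k+i)}:E_{-i}^*\otimes\mathrm{Der}(\mathbf E^*_{\mathbb R},m)_{-(k+i)}\to\mathrm{Der}(\mathbf E^*_{\mathbb R},m)_{-k}$, $\omega\otimes D\mapsto m(\omega,D(\cdot))$, and let $\mathrm{res}_k$ be the restriction of derivations to the part of $\mathbf E^*_{\mathbb R}$ of degrees $0,\dots,k$. Then distributions $\mathcal D$ on $\mathcal M$ correspond bijectively, through $\Gamma_{C_k}=\mathcal D\cap\mathcal T^{-k}_{\mathcal M}$ for $k=0,\dots,n$, to collections of (constant rank) vector subbundles $C_k\subseteq\mathrm{Der}(\mathbf E^*_{\mathbb R},m)_{-k}$, $k=0,\dots,n$, such that for each $k$ $$\sum_{i=1}^{n-k}\Theta_{i,-(k+i)}(E_{-i}^*\otimes C_{k+i})=\ker(\mathrm{res}_k)\cap C_k .$$ Moreover, for such a collection the intersections $\ker(\mathrm{res}_k)\cap C_k$ have constant rank, and vector fields $X_k^i\in\mathcal T^{-k}_{\mathcal M}(U)$ ($k=0,\dots,n$, $i=1,\dots,d_k$)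 on an open set $U\subseteq M$ are local generators of $\mathcal D$ over $U$ (generating $\mathcal D(U)$ and linearly independent at each point of $U$) if and only if they are sections of the $C_k$ and, for each $k$, the classes of $X_k^1,\dots,X_k^{d_k}$ form a frame over $U$ of $C_k/(\ker(\mathrm{res}_k)\cap C_k)$. -/

import Mathlib

open scoped Manifold ContDiff TensorProduct
open TopologicalSpace

noncomputable section

namespace NManifold

/-! ## Linear algebra in one fibre

The graded vector bundle `𝐄 = E₋ₙ ⊕ ⋯ ⊕ E₋₁` is given by a family `E : Fin n → M → Type`, where the
index `i : Fin n` stands for the summand `E₋₍ᵢ₊₁₎`. -/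

section Fibre

variable {n : ℕ} {M : Type*} (E : Fin n → M → Type*)
  [∀ i x, AddCommGroup (E i x)] [∀ i x, Module ℝ (E i x)]

/-- The fibre `𝐄ₓ`. -/
abbrev Fib (x : M) : Type _ := ∀ i : Fin n, E i x

/-- The fibre of the graded dual `𝐄*`; the component `i` has degree `i + 1`. -/
abbrev DualFib (x : M) : Type _ := ∀ i : Fin n, Module.Dual ℝ (E i x)

/-- The fibre of the extended bundle `𝐄*_ℝ = ℝ_M ⊕ 𝐄*`, with `ℝ_M` in degree `0`. -/
abbrev ERFib (x : M) : Type _ := ℝ × DualFib E x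

/-- A tuple of functionals on the summands as a functional on `𝐄ₓ`. -/
def pair (x : M) : DualFib E x →ₗ[ℝ] Module.Dual ℝ (Fib E x) :=
  (LinearMap.lsum ℝ (fun i => E i x) ℝ).toLinearMap

/-- The projection of `𝐄ₓ` onto its summand `i`, as an endomorphism of `𝐄ₓ`. -/
def projEnd (x : M) (i : Fin n) : Fib E x →ₗ[ℝ] Fib E x :=
  LinearMap.single ℝ (fun j => E j x) i ∘ₗ LinearMap.proj i

/-- The part of `𝐄ₓ ⊗ 𝐄ₓ` of degree `-l`. -/
def tensorDeg (x : M) (l : ℕ) : Submodule ℝ (Fib E x ⊗[ℝ] Fib E x) :=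
  Submodule.span ℝ {z | ∃ (i j : Fin n) (a : E i x) (b : E j x),
    ((i : ℕ) + 1) + ((j : ℕ) + 1) = l ∧ z = (Pi.single i a : Fib E x) ⊗ₜ (Pi.single j b : Fib E x)}

/-- The graded flip of `𝐄ₓ ⊗ 𝐄ₓ`: `e ⊗ e' ↦ (-1)^{|e||e'|} e' ⊗ e`. -/
def braid (x : M) : Fib E x ⊗[ℝ] Fib E x →ₗ[ℝ] Fib E x ⊗[ℝ] Fib E x :=
  ∑ i : Fin n, ∑ j : Fin n, ((-1 : ℝ) ^ (((i : ℕ) + 1) * ((j : ℕ) + 1))) •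
    ((TensorProduct.comm ℝ (Fib E x) (Fib E x)).toLinearMap ∘ₗ
      TensorProduct.map (projEnd E x i) (projEnd E x j))

/-- The Koszul sign of the rearrangement `v₁ ⊗ ⋯ ⊗ vₚ ↦ v_{τ 1} ⊗ ⋯ ⊗ v_{τ p}`, where `v_a` lies in
the summand `c a`: one factor `(-1)^{|v||w|}` for each pair `v, w` whose order is reversed. -/
def koszulSign {p : ℕ} (τ : Equiv.Perm (Fin p)) (c : Fin p → Fin n) : ℤ :=
  ∏ a : Fin p, ∏ b : Fin p,
    if a < b ∧ τ b < τ a then (-1 : ℤ) ^ (((c (τ a) : ℕ) + 1) * ((c (τ b) : ℕ) + 1)) else 1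

/-- The graded braiding action of a permutation on the tensor power `𝐄ₓ^{⊗ p}`. -/
def braidPerm (x : M) {p : ℕ} (τ : Equiv.Perm (Fin p)) :
    TensorPower ℝ p (Fib E x) →ₗ[ℝ] TensorPower ℝ p (Fib E x) :=
  ∑ c : Fin p → Fin n, ((koszulSign τ c : ℤ) : ℝ) •
    ((PiTensorProduct.reindex ℝ (fun _ : Fin p => Fib E x) τ.symm).toLinearMap ∘ₗ
      PiTensorProduct.map (fun a => projEnd E x (c a)))

/-- The identification of `𝐄ₓ` with its first tensor power. -/
def toPowOne (x : M) : Fib E x →ₗ[ℝ] TensorPower ℝ 1 (Fib E x) :=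
  (PiTensorProduct.subsingletonEquiv (s := fun _ : Fin 1 => Fib E x) (0 : Fin 1)).symm.toLinearMap

variable {E}

/-- The iterated comultiplication `μᵏ : 𝐄ₓ → 𝐄ₓ^{⊗ (k+1)}`, `μ⁰ = id`, `μᵏ⁺¹ = (id ⊗ μᵏ) ∘ μ`. -/
def comulIter {x : M} (μ : Fib E x →ₗ[ℝ] Fib E x ⊗[ℝ] Fib E x) :
    (k : ℕ) → Fib E x →ₗ[ℝ] TensorPower ℝ (k + 1) (Fib E x)
  | 0 => toPowOne E x
  | k + 1 => (TensorPower.cast ℝ (Fib E x) (by omega : 1 + (k + 1) = k + 1 + 1)).toLinearMap ∘ₗ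
      TensorPower.mulEquiv.toLinearMap ∘ₗ
      TensorProduct.map
        (toPowOne E x)
        (comulIter μ k) ∘ₗ μ

/-- The map `μᵏ ⊗ μˡ : 𝐄ₓ ⊗ 𝐄ₓ → 𝐄ₓ^{⊗ p}`, where `p = (k+1) + (l+1)`. -/
def comulIter₂ {x : M} (μ : Fib E x →ₗ[ℝ] Fib E x ⊗[ℝ] Fib E x) (k l p : ℕ)
    (h : (k + 1) + (l + 1) = p) :
    Fib E x ⊗[ℝ] Fib E x →ₗ[ℝ] TensorPower ℝ p (Fib E x) :=
  (TensorPower.cast ℝ (Fib E x) h).toLinearMap ∘ₗ TensorPower.mulEquiv.toLinearMap ∘ₗ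
    TensorProduct.map (comulIter μ k) (comulIter μ l)

/-- The space `𝐊^μ ⊆ 𝐄ₓ ⊗ 𝐄ₓ` of the elements `e` such that
`τ · (μᵏ ⊗ μˡ)(e) = τ' · (μᵏ' ⊗ μˡ')(e)` whenever `k + l = k' + l'`, for all permutations
`τ, τ'` of the `k + l + 2` factors. -/
def kSpace {x : M} (μ : Fib E x →ₗ[ℝ] Fib E x ⊗[ℝ] Fib E x) :
    Submodule ℝ (Fib E x ⊗[ℝ] Fib E x) :=
  ⨅ (p : ℕ) (k : ℕ) (l : ℕ) (k' : ℕ) (l' : ℕ) (h : (k + 1) + (l + 1) = p)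
    (h' : (k' + 1) + (l' + 1) = p) (τ : Equiv.Perm (Fin p)) (τ' : Equiv.Perm (Fin p)),
    LinearMap.eqLocus (braidPerm E x τ ∘ₗ comulIter₂ μ k l p h)
      (braidPerm E x τ' ∘ₗ comulIter₂ μ k' l' p h')

/-- The multiplication `μ*` on the dual: `⟨μ*(ξ, η), e⟩ = ⟨ξ ⊗ η, μ e⟩`. -/
def mulStar {x : M} (μ : Fib E x →ₗ[ℝ] Fib E x ⊗[ℝ] Fib E x) :
    DualFib E x →ₗ[ℝ] DualFib E x →ₗ[ℝ] DualFib E x :=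
  ((TensorProduct.mk ℝ (Module.Dual ℝ (Fib E x)) (Module.Dual ℝ (Fib E x))).compl₁₂
    (pair E x) (pair E x)).compr₂
    ((LinearMap.pi fun i => Module.Dual.transpose (R := ℝ) (LinearMap.single ℝ (fun j => E j x) i))
      ∘ₗ Module.Dual.transpose (R := ℝ) μ ∘ₗ TensorProduct.dualDistrib ℝ (Fib E x) (Fib E x))

/-- The multiplication `m` of the extended algebra bundle `𝐄*_ℝ`: it is given by `μ*` on `𝐄*` and by
scalar multiplication with `ℝ_M`. -/
def erMul {x : M} (μ : Fib E x →ₗ[ℝ] Fib E x ⊗[ℝ] Fib E x) :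
    ERFib E x →ₗ[ℝ] ERFib E x →ₗ[ℝ] ERFib E x :=
  LinearMap.mk₂ ℝ (fun a b => (a.1 * b.1, a.1 • b.2 + b.1 • a.2 + mulStar μ a.2 b.2))
    (fun a a' b => by
      ext1
      · simp [add_mul]
      · simp only [Prod.fst_add, Prod.snd_add, map_add, LinearMap.add_apply, add_smul, smul_add]
        abel)
    (fun c a b => by
      ext1
      · simp [mul_assoc]
      · simp only [Prod.smul_fst, Prod.smul_snd, map_smul, LinearMap.smul_apply, smul_add,
          smul_eq_mul, mul_smul, smul_comm b.1 c a.2])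
    (fun a b b' => by
      ext1
      · simp [mul_add]
      · simp only [Prod.fst_add, Prod.snd_add, map_add, add_smul, smul_add]
        abel)
    (fun c a b => by
      ext1
      · simp [mul_left_comm]
      · simp only [Prod.smul_fst, Prod.smul_snd, map_smul, smul_add, smul_eq_mul, mul_smul,
          smul_comm a.1 c b.2])

variable (E)

/-- The elements of degree `l` of `𝐄*_ℝ`. -/
def erDeg (x : M) (l : ℤ) : Submodule ℝ (ERFib E x) where
  carrier := {w | (l ≠ 0 → w.1 = 0) ∧ ∀ i : Fin n, l ≠ ((i : ℕ) : ℤ) + 1 → w.2 i = 0}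
  add_mem' := by
    rintro a b ⟨h1, h2⟩ ⟨h3, h4⟩
    exact ⟨fun h => by simp [h1 h, h3 h], fun i h => by simp [h2 i h, h4 i h]⟩
  zero_mem' := ⟨fun _ => rfl, fun _ _ => rfl⟩
  smul_mem' := by
    rintro c a ⟨h1, h2⟩
    exact ⟨fun h => by simp [h1 h], fun i h => by simp [h2 i h]⟩

/-- The relations `a · b = (-1)^{|a||b|} b · a` that define the graded symmetric algebra. -/
inductive SymRel (x : M) :
    TensorAlgebra ℝ (DualFib E x) → TensorAlgebra ℝ (DualFib E x) → Prop
  | swap (i j : Fin n) (a : Module.Dual ℝ (E i x)) (b : Module.Dual ℝ (E j x)) :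
      SymRel x
        (TensorAlgebra.ι ℝ (Pi.single i a : DualFib E x) *
          TensorAlgebra.ι ℝ (Pi.single j b : DualFib E x))
        (((-1 : ℤ) ^ (((i : ℕ) + 1) * ((j : ℕ) + 1))) •
          (TensorAlgebra.ι ℝ (Pi.single j b : DualFib E x) *
            TensorAlgebra.ι ℝ (Pi.single i a : DualFib E x)))

/-- The fibre of the graded symmetric algebra `Sym 𝐄*`. -/
def SymFib (x : M) : Type _ := RingQuot (SymRel E x)

instance (x : M) : Ring (SymFib E x) := inferInstanceAs (Ring (RingQuot (SymRel E x)))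

instance (x : M) : Algebra ℝ (SymFib E x) := inferInstanceAs (Algebra ℝ (RingQuot (SymRel E x)))

/-- The quotient map from the tensor algebra. -/
def toSymFib (x : M) : TensorAlgebra ℝ (DualFib E x) →ₐ[ℝ] SymFib E x :=
  RingQuot.mkAlgHom ℝ (SymRel E x)

/-- The inclusion of `𝐄*` into `Sym 𝐄*`. -/
def symι (x : M) : DualFib E x →ₗ[ℝ] SymFib E x :=
  (toSymFib E x).toLinearMap ∘ₗ TensorAlgebra.ι ℝ

/-- The map `𝐄*_ℝ → Sym 𝐄*`, `(f, ξ) ↦ f · 1 + ξ`. -/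
def erToSym (x : M) : ERFib E x →ₗ[ℝ] SymFib E x :=
  LinearMap.coprod (Algebra.linearMap ℝ (SymFib E x)) (symι E x)

/-- The elements of degree `l` of `Sym 𝐄*`. -/
def symDeg (x : M) (l : ℤ) : Submodule ℝ (SymFib E x) :=
  Submodule.span ℝ {z | ∃ w : List (Σ i : Fin n, Module.Dual ℝ (E i x)),
    (w.map fun p => ((p.1 : ℕ) : ℤ) + 1).sum = l ∧
    z = (w.map fun p => symι E x (Pi.single p.1 p.2)).prod}

/-- The augmentation `Sym 𝐄* → ℝ`, i.e. the component of degree `0`. -/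
def symAug (x : M) : SymFib E x →ₐ[ℝ] ℝ :=
  RingQuot.liftAlgHom ℝ ⟨TensorAlgebra.lift ℝ (0 : DualFib E x →ₗ[ℝ] ℝ), by
    rintro _ _ ⟨i, j, a, b⟩
    simp⟩

lemma symAug_erToSym (x : M) (w : ERFib E x) : symAug E x (erToSym E x w) = w.1 := by
  have h : symAug E x (symι E x w.2) = 0 := by
    change RingQuot.liftAlgHom ℝ _ (RingQuot.mkAlgHom ℝ _ _) = _
    simp
  simp [erToSym, h]

end Fibre

/-! ## Smooth sections and coalgebra bundles -/

section Sections

variable (d : ℕ) {n : ℕ} {M : Type*} [TopologicalSpace M] [ChartedSpace (EuclideanSpace ℝ (Fin d)) M]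
  (F : Fin n → Type*) [∀ i, NormedAddCommGroup (F i)] [∀ i, NormedSpace ℝ (F i)]
  (E : Fin n → M → Type*) [∀ i x, AddCommGroup (E i x)] [∀ i x, Module ℝ (E i x)]
  [∀ i, TopologicalSpace (Bundle.TotalSpace (F i) (E i))] [∀ i x, TopologicalSpace (E i x)]
  [∀ i, FiberBundle (F i) (E i)]

/-- Smooth sections of `𝐄` over the open set `U`. -/
def SmoothSec (U : Opens M) (e : ∀ x : U, Fib E (x : M)) : Prop :=
  ∀ i : Fin n, ContMDiff (𝓡 d) ((𝓡 d).prod 𝓘(ℝ, F i)) ∞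
    (fun x : U => (⟨(x : M), e x i⟩ : Bundle.TotalSpace (F i) (E i)))

/-- Smooth sections of the dual bundle `𝐄*` over `U`: their pairing with every smooth local section
of `𝐄` is smooth. -/
def SmoothDual (U : Opens M) (ξ : ∀ x : U, DualFib E (x : M)) : Prop :=
  ∀ (V : Opens M) (h : V ≤ U) (e : ∀ x : V, Fib E (x : M)), SmoothSec d F E V e →
    ∀ i : Fin n, ContMDiff (𝓡 d) 𝓘(ℝ, ℝ) ∞ (fun x : V => ξ ⟨(x : M), h x.2⟩ i (e x i))

/-- The smooth sections of `𝐄*_ℝ` over `U`. -/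
def ERSec (U : Opens M) : Submodule ℝ (∀ x : U, ERFib E (x : M)) where
  carrier := {s | ContMDiff (𝓡 d) 𝓘(ℝ, ℝ) ∞ (fun x => (s x).1) ∧
    SmoothDual d F E U (fun x => (s x).2)}
  add_mem' := fun {a b} ha hb => ⟨ha.1.add hb.1, fun V h e he i =>
    (ha.2 V h e he i).add (hb.2 V h e he i)⟩
  zero_mem' := ⟨contMDiff_const, fun _ _ _ _ _ => contMDiff_const⟩
  smul_mem' := fun c a ha => by
    have hc : ∀ V : Opens M, ContMDiff (𝓡 d) 𝓘(ℝ, ℝ) ∞ (fun _ : V => c) :=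
      fun V => contMDiff_const
    exact ⟨(hc U).smul ha.1, fun V h e he i => (hc V).smul (ha.2 V h e he i)⟩

/-- Restriction of smooth sections of `𝐄*_ℝ`. -/
def erRes {U V : Opens M} (h : V ≤ U) : ERSec d F E U →ₗ[ℝ] ERSec d F E V where
  toFun s := ⟨fun x => s.1 ⟨(x : M), h x.2⟩, s.2.1.comp (contMDiff_inclusion h),
    fun W hW e he i => s.2.2 W (hW.trans h) e he i⟩
  map_add' _ _ := rfl
  map_smul' _ _ := rfl

/-- An `n`-coalgebra bundle structure on `𝐄`: a smooth, degree-preserving, coassociative and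
graded cocommutative vector bundle map `μ : 𝐄 → 𝐄 ⊗ 𝐄` over the identity of `M`. -/
structure CoalgebraBundle where
  /-- the comultiplication `μ` -/
  comul : ∀ x : M, Fib E x →ₗ[ℝ] Fib E x ⊗[ℝ] Fib E x
  smooth : ∀ (U : Opens M) (e : ∀ x : U, Fib E (x : M)) (ξ η : ∀ x : U, DualFib E (x : M)),
    SmoothSec d F E U e → SmoothDual d F E U ξ → SmoothDual d F E U η →
    ContMDiff (𝓡 d) 𝓘(ℝ, ℝ) ∞ (fun x : U =>
      TensorProduct.dualDistrib ℝ (Fib E (x : M)) (Fib E (x : M))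
        (pair E (x : M) (ξ x) ⊗ₜ pair E (x : M) (η x)) (comul x (e x)))
  degree : ∀ (x : M) (i : Fin n) (e : E i x),
    comul x (Pi.single i e) ∈ tensorDeg E x ((i : ℕ) + 1)
  coassoc : ∀ x : M, (TensorProduct.assoc ℝ (Fib E x) (Fib E x) (Fib E x)).toLinearMap ∘ₗ
    (comul x).rTensor (Fib E x) ∘ₗ comul x = (comul x).lTensor (Fib E x) ∘ₗ comul x
  cocomm : ∀ x : M, braid E x ∘ₗ comul x = comul x

variable {d F E}

/-- Admissibility: `im(μ₋ₗ) = K^μ₋ₗ` for `l = 2, …, n`. -/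
def CoalgebraBundle.IsAdmissible (A : CoalgebraBundle d F E) : Prop :=
  ∀ (x : M) (i : Fin n), 2 ≤ (i : ℕ) + 1 →
    LinearMap.range (A.comul x ∘ₗ LinearMap.single ℝ (fun j => E j x) i) =
      kSpace (A.comul x) ⊓ tensorDeg E x ((i : ℕ) + 1)

end Sections

/-! ## The sheaf of functions `C_𝓜 = Γ_{Sym 𝐄*} / 𝓘_μ` of `𝓜 = 𝓕(𝐄, μ)` -/

section Functions

variable (d : ℕ) {n : ℕ} {M : Type*} [TopologicalSpace M] [ChartedSpace (EuclideanSpace ℝ (Fin d)) M]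
  (F : Fin n → Type*) [∀ i, NormedAddCommGroup (F i)] [∀ i, NormedSpace ℝ (F i)]
  (E : Fin n → M → Type*) [∀ i x, AddCommGroup (E i x)] [∀ i x, Module ℝ (E i x)]
  [∀ i, TopologicalSpace (Bundle.TotalSpace (F i) (E i))] [∀ i x, TopologicalSpace (E i x)]
  [∀ i, FiberBundle (F i) (E i)]

/-- Restriction of arbitrary (not necessarily smooth) sections of `Sym 𝐄*`. -/
def rawRes {U V : Opens M} (h : V ≤ U) :
    (∀ x : U, SymFib E (x : M)) →ₐ[ℝ] (∀ x : V, SymFib E (x : M)) where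
  toFun s := fun x => s ⟨(x : M), h x.2⟩
  map_one' := rfl
  map_mul' _ _ := rfl
  map_zero' := rfl
  map_add' _ _ := rfl
  commutes' _ := rfl

/-- The sections of `Sym 𝐄*` over `U` that are polynomials in smooth functions and smooth sections
of `𝐄*` over `U`. -/
def polySec (U : Opens M) : Subalgebra ℝ (∀ x : U, SymFib E (x : M)) :=
  Algebra.adjoin ℝ {s | ∃ e ∈ ERSec d F E U, s = fun x : U => erToSym E (x : M) (e x)}

lemma rawRes_mem_polySec {U V : Opens M} (h : V ≤ U) {s : ∀ x : U, SymFib E (x : M)}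
    (hs : s ∈ polySec d F E U) : rawRes E h s ∈ polySec d F E V := by
  have : (polySec d F E U).map (rawRes E h) ≤ polySec d F E V := by
    unfold polySec
    rw [AlgHom.map_adjoin]
    apply Algebra.adjoin_mono
    rintro _ ⟨_, ⟨e, he, rfl⟩, rfl⟩
    exact ⟨(erRes d F E h ⟨e, he⟩).1, (erRes d F E h ⟨e, he⟩).2, rfl⟩
  exact this ⟨s, hs, rfl⟩

/-- `Γ_{Sym 𝐄*}(U)`: the smooth sections of `Sym 𝐄*`, i.e. those that are, near each point,
polynomials in smooth functions and smooth sections of `𝐄*`. -/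
def symSec (U : Opens M) : Subalgebra ℝ (∀ x : U, SymFib E (x : M)) where
  carrier := {s | ∀ x : U, ∃ (W : Opens M) (h : W ≤ U), (x : M) ∈ W ∧
    rawRes E h s ∈ polySec d F E W}
  add_mem' := by
    intro a b ha hb x
    obtain ⟨W, h, hx, hW⟩ := ha x
    obtain ⟨W', h', hx', hW'⟩ := hb x
    refine ⟨W ⊓ W', inf_le_left.trans h, ⟨hx, hx'⟩, ?_⟩
    rw [map_add]
    exact add_mem (rawRes_mem_polySec d F E inf_le_left hW)
      (rawRes_mem_polySec d F E inf_le_right hW')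
  mul_mem' := by
    intro a b ha hb x
    obtain ⟨W, h, hx, hW⟩ := ha x
    obtain ⟨W', h', hx', hW'⟩ := hb x
    refine ⟨W ⊓ W', inf_le_left.trans h, ⟨hx, hx'⟩, ?_⟩
    rw [map_mul]
    exact mul_mem (rawRes_mem_polySec d F E inf_le_left hW)
      (rawRes_mem_polySec d F E inf_le_right hW')
  algebraMap_mem' := fun r x => ⟨U, le_rfl, x.2, by
    rw [AlgHom.commutes]
    exact Subalgebra.algebraMap_mem _ r⟩

/-- Restriction of smooth sections of `Sym 𝐄*`. -/
def symRes {U V : Opens M} (h : V ≤ U) : symSec d F E U →ₐ[ℝ] symSec d F E V :=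
  ((rawRes E h).comp (symSec d F E U).val).codRestrict (symSec d F E V) (by
    intro s x
    obtain ⟨W, hW, hx, hs⟩ := s.2 ⟨(x : M), h x.2⟩
    exact ⟨W ⊓ V, inf_le_right, ⟨hx, x.2⟩, rawRes_mem_polySec d F E inf_le_left hs⟩)

lemma symRes_symRes {U V W V' : Opens M} (h : V ≤ U) (h' : W ≤ V) (k : V' ≤ U) (k' : W ≤ V')
    (s : symSec d F E U) : symRes d F E h' (symRes d F E h s) =
      symRes d F E k' (symRes d F E k s) :=
  Subtype.ext (funext fun _ => rfl)

/-- Smooth sections of `𝐄*_ℝ` as smooth sections of `Sym 𝐄*`. -/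
def erToSymSec (U : Opens M) : ERSec d F E U →ₗ[ℝ] symSec d F E U where
  toFun e := ⟨fun x => erToSym E (x : M) (e.1 x), fun x => ⟨U, le_rfl, x.2,
    Algebra.subset_adjoin ⟨e.1, e.2, rfl⟩⟩⟩
  map_add' a b := Subtype.ext (funext fun x => map_add (erToSym E (x : M)) (a.1 x) (b.1 x))
  map_smul' c a := Subtype.ext (funext fun x => map_smul (erToSym E (x : M)) c (a.1 x))

variable {d F E}

namespace CoalgebraBundle

variable (A : CoalgebraBundle d F E)

/-- The generators `ξ · η - μ*(ξ, η)` of `𝓘_μ(U)`, where `ξ, η` are homogeneous smooth sections of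
`𝐄*` over `U` with `|ξ| + |η| ≤ n` (on such sections `m` is `μ*`). -/
def idealGen (U : Opens M) : Set (symSec d F E U) :=
  {z | ∃ (a b : ℕ) (ξ η : ERSec d F E U), 0 < a ∧ 0 < b ∧ a + b ≤ n ∧
    (∀ x : U, ξ.1 x ∈ erDeg E (x : M) (a : ℤ)) ∧ (∀ x : U, η.1 x ∈ erDeg E (x : M) (b : ℤ)) ∧
    ∀ x : U, z.1 x = erToSym E (x : M) (ξ.1 x) * erToSym E (x : M) (η.1 x) -
      erToSym E (x : M) (erMul (A.comul (x : M)) (ξ.1 x) (η.1 x))}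

/-- The sheaf of ideals `𝓘_μ`: the sections that are locally in the ideal spanned by the
generators. -/
def InIdeal (U : Opens M) (s : symSec d F E U) : Prop :=
  ∀ x : U, ∃ (W : Opens M) (h : W ≤ U), (x : M) ∈ W ∧
    symRes d F E h s ∈ TwoSidedIdeal.span (A.idealGen W)

/-- `C_𝓜(U) = Γ_{Sym 𝐄*}(U) / 𝓘_μ(U)`. -/
def Func (U : Opens M) : Type _ := RingQuot (fun s t : symSec d F E U => A.InIdeal U (s - t))

instance (U : Opens M) : Ring (A.Func U) :=
  inferInstanceAs (Ring (RingQuot (fun s t : symSec d F E U => A.InIdeal U (s - t))))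

instance (U : Opens M) : Algebra ℝ (A.Func U) :=
  inferInstanceAs (Algebra ℝ (RingQuot (fun s t : symSec d F E U => A.InIdeal U (s - t))))

/-- The quotient map `Γ_{Sym 𝐄*}(U) → C_𝓜(U)`. -/
def toFunc (U : Opens M) : symSec d F E U →ₐ[ℝ] A.Func U := RingQuot.mkAlgHom ℝ _

lemma symRes_mem_span {U V : Opens M} (h : V ≤ U) {s : symSec d F E U}
    (hs : s ∈ TwoSidedIdeal.span (A.idealGen U)) :
    symRes d F E h s ∈ TwoSidedIdeal.span (A.idealGen V) := by
  have : TwoSidedIdeal.span (A.idealGen U) ≤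
      TwoSidedIdeal.comap (symRes d F E h) (TwoSidedIdeal.span (A.idealGen V)) := by
    rw [TwoSidedIdeal.span_le]
    rintro z ⟨a, b, ξ, η, ha, hb, hab, h1, h2, h3⟩
    refine (TwoSidedIdeal.mem_comap _).2 (TwoSidedIdeal.subset_span ?_)
    exact ⟨a, b, erRes d F E h ξ, erRes d F E h η, ha, hb, hab, fun x => h1 _, fun x => h2 _,
      fun x => h3 ⟨(x : M), h x.2⟩⟩
  exact (TwoSidedIdeal.mem_comap _).1 (this hs)

lemma inIdeal_symRes {U V : Opens M} (h : V ≤ U) {s : symSec d F E U} (hs : A.InIdeal U s) :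
    A.InIdeal V (symRes d F E h s) := by
  intro x
  obtain ⟨W, hW, hx, hm⟩ := hs ⟨(x : M), h x.2⟩
  refine ⟨W ⊓ V, inf_le_right, ⟨hx, x.2⟩, ?_⟩
  rw [symRes_symRes d F E h inf_le_right hW inf_le_left]
  exact A.symRes_mem_span inf_le_left hm

/-- Restriction of functions on `𝓜`. -/
def res {U V : Opens M} (h : V ≤ U) : A.Func U →ₐ[ℝ] A.Func V :=
  RingQuot.liftAlgHom ℝ ⟨(A.toFunc V).comp (symRes d F E h), by
    intro s t hst
    have := A.inIdeal_symRes h hst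
    rw [map_sub] at this
    exact RingQuot.mkAlgHom_rel ℝ this⟩

/-- The degree zero component of a section of `Sym 𝐄*`, at the point `x`. -/
def secEv (U : Opens M) (x : U) : symSec d F E U →ₐ[ℝ] ℝ :=
  (symAug E (x : M)).comp ((Pi.evalAlgHom ℝ (fun y : U => SymFib E (y : M)) x).comp
    (symSec d F E U).val)

lemma secEv_of_mem_span {U : Opens M} (x : U) {s : symSec d F E U}
    (hs : s ∈ TwoSidedIdeal.span (A.idealGen U)) : secEv (d := d) (F := F) (E := E) U x s = 0 := by
  have : TwoSidedIdeal.span (A.idealGen U) ≤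
      TwoSidedIdeal.comap (secEv (d := d) (F := F) (E := E) U x) ⊥ := by
    rw [TwoSidedIdeal.span_le]
    rintro z ⟨a, b, ξ, η, ha, hb, hab, h1, h2, h3⟩
    refine (TwoSidedIdeal.mem_comap _).2 ?_
    have h4 : (ξ.1 x).1 = 0 := (h1 x).1 (by omega)
    have h5 : secEv (d := d) (F := F) (E := E) U x z = symAug E (x : M) (z.1 x) := rfl
    rw [TwoSidedIdeal.mem_bot, h5, h3 x, map_sub, map_mul, symAug_erToSym, symAug_erToSym,
      symAug_erToSym, h4]
    simp [erMul, h4]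
  exact (TwoSidedIdeal.mem_bot _).1 ((TwoSidedIdeal.mem_comap _).1 (this hs))

/-- `f ↦ f⁰(x)`, the value at `x` of the degree zero component of a function on `𝓜`. -/
def ev (U : Opens M) (x : U) : A.Func U →ₐ[ℝ] ℝ :=
  RingQuot.liftAlgHom ℝ ⟨secEv U x, by
    intro s t hst
    obtain ⟨W, h, hx, hm⟩ := hst x
    have h1 := A.secEv_of_mem_span ⟨(x : M), hx⟩ hm
    have h2 : secEv (d := d) (F := F) (E := E) U x (s - t) = 0 := h1
    rwa [map_sub, sub_eq_zero] at h2⟩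

/-- `C^l_𝓜(U)`, the functions of degree `l` (zero for `l < 0`). -/
def funcDeg (U : Opens M) (l : ℤ) : Submodule ℝ (A.Func U) :=
  Submodule.map (A.toFunc U).toLinearMap
    (Submodule.comap (symSec d F E U).val.toLinearMap
      (Submodule.pi Set.univ fun x : U => symDeg E (x : M) l))

/-- The map `Γ_{𝐄*_ℝ}(U) → C_𝓜(U)`; in degrees `i = 0, …, n` it is the identification of the smooth
sections of `(𝐄*_ℝ)ᵢ` with `Cⁱ_𝓜(U)`. -/
def cls (U : Opens M) : ERSec d F E U →ₗ[ℝ] A.Func U :=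
  (A.toFunc U).toLinearMap ∘ₗ erToSymSec d F E U

/-! ## Vector fields and distributions on `𝓜` -/

/-- `𝓣^k_𝓜(U)`: the vector fields of degree `k` on `𝓜|_U`, i.e. the degree `k` derivations of
`C_𝓜(U)`. -/
def vectorField (U : Opens M) (k : ℤ) : Submodule ℝ (Module.End ℝ (A.Func U)) where
  carrier := {X | (∀ l : ℤ, ∀ f ∈ A.funcDeg U l, X f ∈ A.funcDeg U (l + k)) ∧
    ∀ l : ℤ, ∀ f ∈ A.funcDeg U l, ∀ g : A.Func U,
      X (f * g) = X f * g + ((l * k).negOnePow : ℤ) • (f * X g)}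
  add_mem' := by
    rintro X Y ⟨h1, h2⟩ ⟨h3, h4⟩
    refine ⟨fun l f hf => add_mem (h1 l f hf) (h3 l f hf), fun l f hf g => ?_⟩
    simp only [LinearMap.add_apply, h2 l f hf g, h4 l f hf g, add_mul, mul_add, smul_add]
    abel
  zero_mem' := ⟨fun _ _ _ => zero_mem _, fun _ _ _ _ => by simp⟩
  smul_mem' := by
    rintro c X ⟨h1, h2⟩
    refine ⟨fun l f hf => Submodule.smul_mem _ c (h1 l f hf), fun l f hf g => ?_⟩
    simp only [LinearMap.smul_apply, h2 l f hf g, smul_add, smul_mul_assoc, mul_smul_comm,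
      smul_comm c]

/-- The product `f X` of a function and a vector field. -/
def funcSmul {U : Opens M} (f : A.Func U) (X : Module.End ℝ (A.Func U)) :
    Module.End ℝ (A.Func U) := LinearMap.mulLeft ℝ f ∘ₗ X

/-- `Y` is the restriction of `X` to the smaller open set `V`. -/
def IsRestriction {U V : Opens M} (h : V ≤ U) (X : Module.End ℝ (A.Func U))
    (Y : Module.End ℝ (A.Func V)) : Prop :=
  ∀ f : A.Func U, Y (A.res h f) = A.res h (X f)

/-- The tangent vector `f ↦ X(f)⁰(x)` of a vector field at the point `x`. -/
def tangentAt {U : Opens M} (X : Module.End ℝ (A.Func U)) (x : U) : A.Func U →ₗ[ℝ] ℝ :=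
  (A.ev U x).toLinearMap ∘ₗ X

/-- The graded subsheaves of `C_𝓜`-modules of `𝓣^•_𝓜`, given by their homogeneous components. -/
structure GradedSubsheaf where
  /-- the sections of degree `l` over `U` -/
  sec : ∀ U : Opens M, ℤ → Submodule ℝ (Module.End ℝ (A.Func U))
  le_vectorField : ∀ (U : Opens M) (l : ℤ), sec U l ≤ A.vectorField U l
  smul_mem : ∀ (U : Opens M) (j l : ℤ), ∀ f ∈ A.funcDeg U j, ∀ X ∈ sec U l,
    A.funcSmul f X ∈ sec U (j + l)
  res_mem : ∀ {U V : Opens M} (h : V ≤ U) (l : ℤ), ∀ X ∈ sec U l, ∀ Y ∈ A.vectorField V l,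
    A.IsRestriction h X Y → Y ∈ sec V l
  locality : ∀ (U : Opens M) (l : ℤ), ∀ X ∈ A.vectorField U l,
    (∀ x : U, ∃ (V : Opens M) (h : V ≤ U), (x : M) ∈ V ∧
      ∃ Y ∈ sec V l, A.IsRestriction h X Y) → X ∈ sec U l

variable {A}

/-- The vector fields `X k i` (`k = 0, …, n`, `i = 1, …, r k`) on `𝓜|_U` have degree `-k`, are
linearly independent at each point of `U` and generate `𝓓(U)` as a `C_𝓜(U)`-module. -/
def GradedSubsheaf.IsGenerators (D : A.GradedSubsheaf) (U : Opens M) (r : Fin (n + 1) → ℕ)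
    (X : ∀ k : Fin (n + 1), Fin (r k) → Module.End ℝ (A.Func U)) : Prop :=
  (∀ (k : Fin (n + 1)) (i : Fin (r k)), X k i ∈ A.vectorField U (-((k : ℕ) : ℤ))) ∧
  (∀ x : U, LinearIndependent ℝ
    (fun p : Σ k : Fin (n + 1), Fin (r k) => A.tangentAt (X p.1 p.2) x)) ∧
  ∀ (l : ℤ) (Y : Module.End ℝ (A.Func U)), Y ∈ D.sec U l ↔
    ∃ f : ∀ k : Fin (n + 1), Fin (r k) → A.Func U,
      (∀ (k : Fin (n + 1)) (i : Fin (r k)), f k i ∈ A.funcDeg U (l + ((k : ℕ) : ℤ))) ∧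
      Y = ∑ k, ∑ i, A.funcSmul (f k i) (X k i)

/-- Distributions on `𝓜` of rank `r₀|⋯|rₙ`. -/
def GradedSubsheaf.HasRank (D : A.GradedSubsheaf) (r : Fin (n + 1) → ℕ) : Prop :=
  ∀ x : M, ∃ U : Opens M, x ∈ U ∧ ∃ X, D.IsGenerators U r X

/-- Distributions on `𝓜`. -/
def GradedSubsheaf.IsDistribution (D : A.GradedSubsheaf) : Prop :=
  ∃ r : Fin (n + 1) → ℕ, D.HasRank r

end CoalgebraBundle

/-! ## The bundles `Der(𝐄*_ℝ, m)₋ₖ` -/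

variable (d F E)

/-- The space in which the derivations of `𝐄*_ℝ` at the point `x` live. -/
def HomAt (x : M) : Type _ := ERSec d F E (⊤ : Opens M) →ₗ[ℝ] ERFib E x

instance (x : M) : AddCommGroup (HomAt d F E x) :=
  inferInstanceAs (AddCommGroup (ERSec d F E (⊤ : Opens M) →ₗ[ℝ] ERFib E x))

instance (x : M) : Module ℝ (HomAt d F E x) :=
  inferInstanceAs (Module ℝ (ERSec d F E (⊤ : Opens M) →ₗ[ℝ] ERFib E x))

instance (x : M) : FunLike (HomAt d F E x) (ERSec d F E (⊤ : Opens M)) (ERFib E x) :=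
  inferInstanceAs (FunLike (ERSec d F E (⊤ : Opens M) →ₗ[ℝ] ERFib E x) _ _)

/-- An element of `HomAt` as a linear map. -/
def homAtEquiv (x : M) : HomAt d F E x ≃ₗ[ℝ] (ERSec d F E (⊤ : Opens M) →ₗ[ℝ] ERFib E x) :=
  LinearEquiv.refl ℝ _

variable {d F E} in
@[simp] lemma homAt_add_apply {x : M} (δ ε : HomAt d F E x) (e : ERSec d F E (⊤ : Opens M)) :
    (δ + ε) e = δ e + ε e := rfl

variable {d F E} in
@[simp] lemma homAt_zero_apply {x : M} (e : ERSec d F E (⊤ : Opens M)) :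
    (0 : HomAt d F E x) e = 0 := rfl

variable {d F E} in
@[simp] lemma homAt_smul_apply {x : M} (c : ℝ) (δ : HomAt d F E x)
    (e : ERSec d F E (⊤ : Opens M)) : (c • δ) e = c • δ e := rfl

/-- The smooth global sections of `𝐄*_ℝ` of degree at most `r`, i.e. the sections of the extended
algebra bundle of the truncation `𝐄^{≤ r}`. -/
def erSecLE (r : ℕ) : Submodule ℝ (ERSec d F E (⊤ : Opens M)) where
  carrier := {e | ∀ (x : (⊤ : Opens M)) (i : Fin n), r < (i : ℕ) + 1 → (e.1 x).2 i = 0}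
  add_mem' := fun {a b} ha hb x i h => by
    have h1 := ha x i h
    have h2 := hb x i h
    simp only [Submodule.coe_add, Pi.add_apply, Prod.snd_add, h1, h2, add_zero]
  zero_mem' := fun _ _ _ => rfl
  smul_mem' := fun c a ha x i h => by
    have h1 := ha x i h
    simp only [Submodule.coe_smul, Pi.smul_apply, Prod.smul_snd, h1, smul_zero]

/-- The restriction map `res_r` in the fibre over `x`: a derivation of `𝐄*_ℝ` is restricted to the
sections of degree at most `r`. -/
def resAt (r : ℕ) (x : M) :
    HomAt d F E x →ₗ[ℝ] (erSecLE d F E r →ₗ[ℝ] ERFib E x) :=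
  LinearMap.domRestrict' (erSecLE d F E r) ∘ₗ (homAtEquiv d F E x).toLinearMap

variable {d F E}

namespace CoalgebraBundle

variable (A : CoalgebraBundle d F E)

/-- The fibre of `Der(𝐄*_ℝ, m)₋ₖ` at `x`: the derivations `δ` of degree `-k` at `x` (maps from
sections to the fibre over `x`) that are compatible with `m`,
`δ(m(e, e')) = m(δ e, e'(x)) + (-1)^{k|e|} m(e(x), δ e')` for `|e| + |e'| ≤ n`.
For `|e| = 0` this is the Leibniz rule `δ(f e') = v(f) e'(x) + f(x) δ e'`, whose symbol `v` is the
restriction of `δ` to functions. -/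
def derFib (k : ℕ) (x : M) : Submodule ℝ (HomAt d F E x) where
  carrier := {δ |
    (∀ (a : ℤ) (e : ERSec d F E (⊤ : Opens M)), (∀ y : (⊤ : Opens M), e.1 y ∈ erDeg E (y : M) a) →
      δ e ∈ erDeg E x (a - k)) ∧
    ∀ (a b : ℕ) (e e' e'' : ERSec d F E (⊤ : Opens M)), a + b ≤ n →
      (∀ y : (⊤ : Opens M), e.1 y ∈ erDeg E (y : M) (a : ℤ)) → (∀ y : (⊤ : Opens M), e'.1 y ∈ erDeg E (y : M) (b : ℤ)) →
      (∀ y : (⊤ : Opens M), e''.1 y = erMul (A.comul (y : M)) (e.1 y) (e'.1 y)) →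
      δ e'' = erMul (A.comul x) (δ e) (e'.1 ⟨x, trivial⟩) +
        ((-1 : ℤ) ^ (k * a)) • erMul (A.comul x) (e.1 ⟨x, trivial⟩) (δ e')}
  add_mem' := by
    rintro δ ε ⟨h1, h2⟩ ⟨h3, h4⟩
    refine ⟨fun a e he => add_mem (h1 a e he) (h3 a e he), fun a b e e' e'' hab he he' he'' => ?_⟩
    simp only [homAt_add_apply, LinearMap.add_apply, h2 a b e e' e'' hab he he' he'', h4 a b e e' e'' hab he he' he'',
      map_add, smul_add]
    abel
  zero_mem' := ⟨fun _ _ _ => zero_mem _, fun _ _ _ _ _ _ _ _ _ => by simp⟩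
  smul_mem' := by
    rintro c δ ⟨h1, h2⟩
    refine ⟨fun a e he => Submodule.smul_mem _ c (h1 a e he),
      fun a b e e' e'' hab he he' he'' => ?_⟩
    simp only [homAt_smul_apply, LinearMap.smul_apply, h2 a b e e' e'' hab he he' he'', map_smul, smul_add,
      smul_comm c]

/-- The smooth sections of `Der(𝐄*_ℝ, m)₋ₖ` over `U`. -/
def IsDerSection (U : Opens M) (k : ℕ) (δ : ∀ x : U, HomAt d F E (x : M)) : Prop :=
  (∀ x : U, δ x ∈ A.derFib k (x : M)) ∧
  ∀ e : ERSec d F E (⊤ : Opens M), (fun x : U => δ x e) ∈ ERSec d F E U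

/-- `C` is a smooth vector subbundle (of constant rank) of `Der(𝐄*_ℝ, m)₋ₖ`. -/
def IsSubbundle (k : ℕ) (C : ∀ x : M, Submodule ℝ (HomAt d F E x)) : Prop :=
  ∃ r : ℕ, ∀ x₀ : M, ∃ U : Opens M, x₀ ∈ U ∧
    ∃ δ : Fin r → ∀ x : U, HomAt d F E (x : M), (∀ i, A.IsDerSection U k (δ i)) ∧
      ∀ x : U, LinearIndependent ℝ (fun i => δ i x) ∧
        Submodule.span ℝ (Set.range fun i => δ i x) = C (x : M)

/-- The map `Θ` in the fibre over `x`: `Θ(ξ ⊗ δ) = m(ξ, δ(·))` for `ξ ∈ (E*₋₍ᵢ₊₁₎)ₓ`. -/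
def theta (i : Fin n) (x : M) :
    Module.Dual ℝ (E i x) →ₗ[ℝ] HomAt d F E x →ₗ[ℝ] HomAt d F E x :=
  LinearMap.mk₂ ℝ (fun ξ δ => (homAtEquiv d F E x).symm
      (erMul (A.comul x) ((0 : ℝ), Pi.single i ξ) ∘ₗ homAtEquiv d F E x δ))
    (fun ξ η δ => by
      rw [← map_add, ← LinearMap.add_comp, ← map_add, Prod.mk_add_mk, add_zero, Pi.single_add])
    (fun c ξ δ => by
      rw [← map_smul, ← LinearMap.smul_comp, ← map_smul, Prod.smul_mk, smul_zero, Pi.single_smul])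
    (fun ξ δ ε => by rw [map_add, LinearMap.comp_add, map_add])
    (fun c ξ δ => by rw [map_smul, LinearMap.comp_smul, map_smul])

/-- Collections of vector subbundles `C_k ⊆ Der(𝐄*_ℝ, m)₋ₖ`, `k = 0, …, n`, such that
`∑_{i = 1}^{n - k} Θ(E*₋ᵢ ⊗ C_{k+i}) = ker(res_k) ∩ C_k` for each `k` (the index `i : Fin n` stands
for `i + 1`). -/
def IsSubbundleFamily (C : Fin (n + 1) → ∀ x : M, Submodule ℝ (HomAt d F E x)) : Prop :=
  (∀ k : Fin (n + 1), A.IsSubbundle k (C k)) ∧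
  ∀ (k : Fin (n + 1)) (x : M),
    (⨆ (i : Fin n) (h : (k : ℕ) + ((i : ℕ) + 1) < n + 1),
      Submodule.map₂ (A.theta i x) ⊤ (C ⟨(k : ℕ) + ((i : ℕ) + 1), h⟩ x)) =
    LinearMap.ker (resAt d F E k x) ⊓ C k x

/-- The derivation `δ` at `x` is the value at `x` of the derivation of `𝐄*_ℝ` given by the vector
field `X`: `δ(e) = X(e)(x)`, where sections of `𝐄*_ℝ` are identified with functions on `𝓜` of
degree at most `n`. -/
def IsValueAt {U : Opens M} (X : Module.End ℝ (A.Func U)) (x : U) (δ : HomAt d F E (x : M)) : Prop :=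
  ∀ e : ERSec d F E (⊤ : Opens M), ∃ e' : ERSec d F E U,
    X (A.cls U (erRes d F E le_top e)) = A.cls U e' ∧ δ e = e'.1 x

variable {A}

/-- `Γ_{C_k} = 𝓓 ∩ 𝓣^{-k}_𝓜` for `k = 0, …, n`, where vector fields of degree `-k` are identified
with smooth sections of `Der(𝐄*_ℝ, m)₋ₖ`. -/
def GradedSubsheaf.Corresponds (D : A.GradedSubsheaf)
    (C : Fin (n + 1) → ∀ x : M, Submodule ℝ (HomAt d F E x)) : Prop :=
  ∀ (k : Fin (n + 1)) (U : Opens M),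
    (∀ X ∈ D.sec U (-((k : ℕ) : ℤ)), ∃ δ : ∀ x : U, HomAt d F E (x : M),
      A.IsDerSection U k δ ∧ (∀ x : U, δ x ∈ C k (x : M)) ∧ ∀ x : U, A.IsValueAt X x (δ x)) ∧
    (∀ δ : ∀ x : U, HomAt d F E (x : M),
      A.IsDerSection U k δ → (∀ x : U, δ x ∈ C k (x : M)) →
        ∃ X ∈ D.sec U (-((k : ℕ) : ℤ)), ∀ x : U, A.IsValueAt X x (δ x))

variable (A)

/-- The vector fields `X k i` are sections of `C_k` over `U` whose classes form a frame of the
quotient bundle `C_k / (ker(res_k) ∩ C_k)` over `U`, for each `k = 0, …, n`. -/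
def IsQuotientFrame (C : Fin (n + 1) → ∀ x : M, Submodule ℝ (HomAt d F E x)) (U : Opens M)
    (r : Fin (n + 1) → ℕ) (X : ∀ k : Fin (n + 1), Fin (r k) → Module.End ℝ (A.Func U)) : Prop :=
  ∀ (k : Fin (n + 1)) (x : U), ∃ δ : Fin (r k) → C k (x : M),
    (∀ i, A.IsValueAt (X k i) x (δ i).1) ∧
    LinearIndependent ℝ (fun i =>
      ((LinearMap.ker (resAt d F E k (x : M))).submoduleOf (C k (x : M))).mkQ (δ i)) ∧
    Submodule.span ℝ (Set.range fun i =>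
      ((LinearMap.ker (resAt d F E k (x : M))).submoduleOf (C k (x : M))).mkQ (δ i)) = ⊤

end CoalgebraBundle

end Functions

end NManifold

end

open scoped Manifold ContDiff TensorProduct
open TopologicalSpace

noncomputable section

namespace NManifold

/-! ## Signs -/

/-! The proof has an analytic half, which turns vector fields into sections of a bundle, and an
algebraic half, which is a triangularity argument in one fibre.

Functions of degree at most `n` are sections of `𝐄*_ℝ`. They are polynomials in such sections, and
as long as the degree stays at most `n` the relations of the ideal replace every product by a
product in `𝐄*_ℝ` (`exists_cls_of_mem_funcDeg`). Nothing is lost, because the functions act on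
`𝐄*_ℝ` and a section is recovered by acting on the unit (`act_cls_one`). All functions are locally
polynomials in these, so a vector field of degree `-k` is determined by its values on sections of
`𝐄*_ℝ` (`agreeOn_of_vfVal`). Conversely a smooth section of derivations extends to `Sym 𝐄*` by a
twisted Leibniz rule. The extension preserves the ideal exactly because of the compatibility with
`m` in total degree at most `n` (`exists_vf_of_isDerSection`).

In one fibre the decisive fact is that a derivation of degree `-l` kills sections of degree less
than `l` and has scalar values in degree `l` (`derFib_erSecLE`). Consequently, for a family of
derivations of degrees `0, …, -n`, independence modulo `ker(res_k)` for every `k` is the same as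
independence of the tangent vectors (`linearIndependent_tangentAt_iff`), and it implies independence
over `𝐄*_ℝ` (`thetaER_independent`). For the spaces generated by such a family, the part in
`ker(res_k)` consists of the combinations of members of degree below `-k` with coefficients of
positive degree, which is the condition on the `C_k` (`frameSpan_condition`). Conversely, if the
condition holds, a frame modulo the kernels generates all `C_k`, by a descending induction in the
manner of Nakayama's lemma (`FibreFamily.eq_frameSpan`).

Two points make this uniform over `M`. The numbers of frame members are determined by the ranks of
the `C_k` through a unitriangular system (`frame_ranks_unique`), so they are constant. Pointwise
coefficients with respect to an independent family are unique and, by Cramer's rule, smooth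
(`exists_smooth_coefficients`).

A distribution is sent to the spaces of values of its sections, and a family of subbundles to the
sheaf generated by the fields with values in it. These constructions are mutually inverse because a
locally generated sheaf is determined by its parts of degrees `0, …, -n`
(`GradedSubsheaf.Corresponds.eq`). The criterion for generators is then the fibrewise statement
together with a partition of unity (`mem_generated_of_local`). -/

/-- The sign `(-1)^l` as an integer. -/
def sg (l : ℤ) : ℤ := (l.negOnePow : ℤ)

lemma sg_def (l : ℤ) : sg l = (l.negOnePow : ℤ) := rfl

@[simp] lemma sg_zero : sg 0 = 1 := rfl

lemma sg_add (a b : ℤ) : sg (a + b) = sg a * sg b := by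
  simp [sg, Int.negOnePow_add]

@[simp] lemma sg_neg (a : ℤ) : sg (-a) = sg a := by simp [sg]

lemma sg_sub (a b : ℤ) : sg (a - b) = sg a * sg b := by
  rw [sub_eq_add_neg, sg_add, sg_neg]

lemma sg_mul_self (a : ℤ) : sg a * sg a = 1 := by
  rw [← sg_sub, sub_self, sg_zero]

lemma sg_natCast (k : ℕ) : sg (k : ℤ) = (-1 : ℤ) ^ k := Int.coe_negOnePow_natCast k

/-! ## The multiplication of the extended algebra in one fibre -/

section FibreAlgebra

variable {n : ℕ} {M : Type*} {E : Fin n → M → Type*}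
  [∀ i x, AddCommGroup (E i x)] [∀ i x, Module ℝ (E i x)] {x : M}

lemma pair_apply (ξ : DualFib E x) (e : Fib E x) : pair E x ξ e = ∑ i, ξ i (e i) := by
  simp [pair, LinearMap.lsum_apply]

@[simp] lemma pair_single (ξ : DualFib E x) (i : Fin n) (e : E i x) :
    pair E x ξ (Pi.single i e) = ξ i e := by
  rw [pair_apply, Finset.sum_eq_single i] <;> simp +contextual

lemma pair_injective : Function.Injective (pair E x) := by
  intro ξ η h
  ext i e
  rw [← pair_single ξ, ← pair_single η, h]

lemma mulStar_apply (μ : Fib E x →ₗ[ℝ] Fib E x ⊗[ℝ] Fib E x) (ξ η : DualFib E x) (i : Fin n)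
    (e : E i x) : mulStar μ ξ η i e =
      TensorProduct.dualDistrib ℝ (Fib E x) (Fib E x) (pair E x ξ ⊗ₜ pair E x η)
        (μ (Pi.single i e)) := rfl

lemma pair_mulStar (μ : Fib E x →ₗ[ℝ] Fib E x ⊗[ℝ] Fib E x) (ξ η : DualFib E x) :
    pair E x (mulStar μ ξ η) =
      TensorProduct.dualDistrib ℝ (Fib E x) (Fib E x) (pair E x ξ ⊗ₜ pair E x η) ∘ₗ μ := by
  apply LinearMap.pi_ext'
  intro i
  ext e
  simp [mulStar_apply]

/-- Coassociativity transposes to associativity: both sides are the threefold functional `f ⊗ g ⊗ k`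
evaluated on the two bracketings of the iterated comultiplication, which `h` identifies. -/
lemma dualDistrib_coassoc {V : Type*} [AddCommGroup V] [Module ℝ V] (μ : V →ₗ[ℝ] V ⊗[ℝ] V)
    (h : (TensorProduct.assoc ℝ V V V).toLinearMap ∘ₗ μ.rTensor V ∘ₗ μ = μ.lTensor V ∘ₗ μ)
    (f g k : Module.Dual ℝ V) :
    TensorProduct.dualDistrib ℝ V V
        ((TensorProduct.dualDistrib ℝ V V (f ⊗ₜ g) ∘ₗ μ : Module.Dual ℝ V) ⊗ₜ k) ∘ₗ μ =
      TensorProduct.dualDistrib ℝ V V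
        (f ⊗ₜ (TensorProduct.dualDistrib ℝ V V (g ⊗ₜ k) ∘ₗ μ : Module.Dual ℝ V)) ∘ₗ μ := by
  have h1 : TensorProduct.dualDistrib ℝ V V
        ((TensorProduct.dualDistrib ℝ V V (f ⊗ₜ g) ∘ₗ μ : Module.Dual ℝ V) ⊗ₜ k) =
      TensorProduct.dualDistrib ℝ (V ⊗[ℝ] V) V
        ((TensorProduct.dualDistrib ℝ V V (f ⊗ₜ g)) ⊗ₜ k) ∘ₗ μ.rTensor V := by
    ext a b; simp
  have h2 : TensorProduct.dualDistrib ℝ V V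
        (f ⊗ₜ (TensorProduct.dualDistrib ℝ V V (g ⊗ₜ k) ∘ₗ μ : Module.Dual ℝ V)) =
      TensorProduct.dualDistrib ℝ V (V ⊗[ℝ] V)
        (f ⊗ₜ (TensorProduct.dualDistrib ℝ V V (g ⊗ₜ k))) ∘ₗ μ.lTensor V := by
    ext a b; simp
  have h3 : TensorProduct.dualDistrib ℝ (V ⊗[ℝ] V) V
        ((TensorProduct.dualDistrib ℝ V V (f ⊗ₜ g)) ⊗ₜ k) =
      TensorProduct.dualDistrib ℝ V (V ⊗[ℝ] V)
        (f ⊗ₜ (TensorProduct.dualDistrib ℝ V V (g ⊗ₜ k))) ∘ₗ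
        (TensorProduct.assoc ℝ V V V).toLinearMap := by
    ext a b c; simp [mul_assoc]
  rw [h1, h2, h3, LinearMap.comp_assoc, LinearMap.comp_assoc, LinearMap.comp_assoc, h]

lemma mulStar_assoc {μ : Fib E x →ₗ[ℝ] Fib E x ⊗[ℝ] Fib E x}
    (h : (TensorProduct.assoc ℝ (Fib E x) (Fib E x) (Fib E x)).toLinearMap ∘ₗ
      μ.rTensor (Fib E x) ∘ₗ μ = μ.lTensor (Fib E x) ∘ₗ μ) (ξ η ζ : DualFib E x) :
    mulStar μ (mulStar μ ξ η) ζ = mulStar μ ξ (mulStar μ η ζ) := by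
  apply pair_injective
  rw [pair_mulStar, pair_mulStar, pair_mulStar, pair_mulStar]
  exact dualDistrib_coassoc μ h _ _ _

lemma erMul_apply (μ : Fib E x →ₗ[ℝ] Fib E x ⊗[ℝ] Fib E x) (a b : ERFib E x) :
    erMul μ a b = (a.1 * b.1, a.1 • b.2 + b.1 • a.2 + mulStar μ a.2 b.2) := rfl

lemma erMul_assoc {μ : Fib E x →ₗ[ℝ] Fib E x ⊗[ℝ] Fib E x}
    (h : (TensorProduct.assoc ℝ (Fib E x) (Fib E x) (Fib E x)).toLinearMap ∘ₗ
      μ.rTensor (Fib E x) ∘ₗ μ = μ.lTensor (Fib E x) ∘ₗ μ) (a b c : ERFib E x) :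
    erMul μ (erMul μ a b) c = erMul μ a (erMul μ b c) := by
  simp only [erMul_apply, map_add, map_smul, LinearMap.add_apply, LinearMap.smul_apply,
    mulStar_assoc h, Prod.mk.injEq, mul_assoc, true_and]
  module

@[simp] lemma erMul_scalar (μ : Fib E x →ₗ[ℝ] Fib E x ⊗[ℝ] Fib E x) (c : ℝ) (b : ERFib E x) :
    erMul μ (c, 0) b = c • b := by
  ext1 <;> simp [erMul_apply]

@[simp] lemma erMul_scalar' (μ : Fib E x →ₗ[ℝ] Fib E x ⊗[ℝ] Fib E x) (c : ℝ) (b : ERFib E x) :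
    erMul μ b (c, 0) = c • b := by
  ext1 <;> simp [erMul_apply, mul_comm]

lemma scalar_mem_erDeg (c : ℝ) : ((c, 0) : ERFib E x) ∈ erDeg E x 0 :=
  ⟨fun h => absurd rfl h, fun _ _ => rfl⟩

lemma single_mem_erDeg (i : Fin n) (ξ : Module.Dual ℝ (E i x)) :
    ((0, Pi.single i ξ) : ERFib E x) ∈ erDeg E x ((i : ℕ) + 1) := by
  refine ⟨fun _ => rfl, fun j hj => ?_⟩
  have : j ≠ i := by rintro rfl; exact hj rfl
  simp [this]

lemma eq_scalar_of_mem_erDeg_zero {w : ERFib E x} (h : w ∈ erDeg E x 0) : w = (w.1, 0) := by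
  ext1
  · rfl
  · funext i
    exact h.2 i (by positivity)

lemma eq_single_of_mem_erDeg {w : ERFib E x} {i : Fin n} (h : w ∈ erDeg E x ((i : ℕ) + 1)) :
    w = (0, Pi.single i (w.2 i)) := by
  ext1
  · exact h.1 (by positivity)
  · funext j
    by_cases hj : j = i
    · subst hj; simp
    · simp only [Pi.single_eq_of_ne hj]
      refine h.2 j fun h' => hj (Fin.ext ?_)
      omega

lemma eq_zero_of_mem_erDeg {w : ERFib E x} {l : ℤ} (h : w ∈ erDeg E x l)
    (hl : l < 0 ∨ (n : ℤ) < l) : w = 0 := by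
  ext1
  · exact h.1 (by omega)
  · funext i
    exact h.2 i (by omega)

/-- A homogeneous element is a scalar, lies in one summand, or vanishes. -/
lemma erDeg_cases {w : ERFib E x} {l : ℤ} (h : w ∈ erDeg E x l) :
    (l = 0 ∧ w = (w.1, 0)) ∨ (∃ i : Fin n, l = (i : ℕ) + 1 ∧ w = (0, Pi.single i (w.2 i))) ∨
      w = 0 := by
  by_cases h0 : l = 0
  · subst h0
    exact Or.inl ⟨rfl, eq_scalar_of_mem_erDeg_zero h⟩
  by_cases h1 : l < 0 ∨ (n : ℤ) < l
  · exact Or.inr (Or.inr (eq_zero_of_mem_erDeg h h1))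
  · refine Or.inr (Or.inl ⟨⟨(l - 1).toNat, by omega⟩, by simp; omega, ?_⟩)
    apply eq_single_of_mem_erDeg
    convert h
    simp; omega

lemma erFib_decomp (w : ERFib E x) : w = (w.1, 0) + ∑ i, ((0, Pi.single i (w.2 i)) : ERFib E x) := by
  ext1
  · simp [Prod.fst_sum]
  · funext j
    simp [Prod.snd_sum, Finset.sum_apply]

/-- The dual form of degree preservation: `μ` maps the summand `k` into tensors whose degrees add up
to that of `k`, and functionals supported on the summands `i` and `j` kill these when their own
degrees do not. -/
lemma mulStar_single_mem (μ : Fib E x →ₗ[ℝ] Fib E x ⊗[ℝ] Fib E x)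
    (hμ : ∀ (i : Fin n) (e : E i x), μ (Pi.single i e) ∈ tensorDeg E x ((i : ℕ) + 1))
    (i j : Fin n) (ξ : Module.Dual ℝ (E i x)) (η : Module.Dual ℝ (E j x)) (k : Fin n)
    (hk : ((i : ℕ) + 1) + ((j : ℕ) + 1) ≠ (k : ℕ) + 1) :
    mulStar μ (Pi.single i ξ) (Pi.single j η) k = 0 := by
  ext e
  rw [mulStar_apply]
  have : tensorDeg E x ((k : ℕ) + 1) ≤ LinearMap.ker
      (TensorProduct.dualDistrib ℝ (Fib E x) (Fib E x)
        (pair E x (Pi.single i ξ) ⊗ₜ pair E x (Pi.single j η))) := by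
    refine Submodule.span_le.2 ?_
    rintro _ ⟨i', j', a, b, h, rfl⟩
    simp only [SetLike.mem_coe, LinearMap.mem_ker, TensorProduct.dualDistrib_apply, pair_single]
    by_cases h1 : i' = i
    · by_cases h2 : j' = j
      · subst h1 h2; exact absurd h hk
      · simp [Pi.single_eq_of_ne h2]
    · simp [Pi.single_eq_of_ne h1]
  exact this (hμ k e)

lemma erMul_mem_erDeg (μ : Fib E x →ₗ[ℝ] Fib E x ⊗[ℝ] Fib E x)
    (hμ : ∀ (i : Fin n) (e : E i x), μ (Pi.single i e) ∈ tensorDeg E x ((i : ℕ) + 1))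
    {a b : ℤ} {v w : ERFib E x} (hv : v ∈ erDeg E x a) (hw : w ∈ erDeg E x b) :
    erMul μ v w ∈ erDeg E x (a + b) := by
  obtain ⟨rfl, hv'⟩ | ⟨i, rfl, hv'⟩ | rfl := erDeg_cases hv
  · rw [hv', erMul_scalar, zero_add]
    exact Submodule.smul_mem _ _ hw
  · obtain ⟨rfl, hw'⟩ | ⟨j, rfl, hw'⟩ | rfl := erDeg_cases hw
    · rw [hw', erMul_scalar', add_zero]
      exact Submodule.smul_mem _ _ hv
    · rw [hv', hw', erMul_apply]
      refine ⟨fun _ => by simp, fun k hk => ?_⟩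
      simp only [zero_smul, add_zero, zero_add]
      refine mulStar_single_mem μ hμ i j _ _ k ?_
      intro h; apply hk; omega
    · simp
  · simp

/-- Graded cocommutativity transposes to graded commutativity: the pairing is evaluated on the
flipped tensor, first on pure tensors. -/
lemma mulStar_single_comm {μ : Fib E x →ₗ[ℝ] Fib E x ⊗[ℝ] Fib E x}
    (hμ : braid E x ∘ₗ μ = μ)
    (i j : Fin n) (ξ : Module.Dual ℝ (E i x)) (η : Module.Dual ℝ (E j x)) :
    mulStar μ (Pi.single i ξ) (Pi.single j η) =
      sg (((i : ℕ) + 1) * ((j : ℕ) + 1)) • mulStar μ (Pi.single j η) (Pi.single i ξ) := by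
  have key : TensorProduct.dualDistrib ℝ (Fib E x) (Fib E x)
        (pair E x (Pi.single i ξ) ⊗ₜ pair E x (Pi.single j η)) ∘ₗ braid E x =
      sg (((i : ℕ) + 1) * ((j : ℕ) + 1)) • TensorProduct.dualDistrib ℝ (Fib E x) (Fib E x)
        (pair E x (Pi.single j η) ⊗ₜ pair E x (Pi.single i ξ)) := by
    have hs : ((-1 : ℝ) ^ (((j : ℕ) + 1) * ((i : ℕ) + 1))) =
        ((sg (((i : ℕ) + 1) * ((j : ℕ) + 1)) : ℤ) : ℝ) := by
      rw [mul_comm]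
      have := sg_natCast (((i : ℕ) + 1) * ((j : ℕ) + 1))
      push_cast at this
      rw [this]; simp
    apply TensorProduct.ext'
    intro a b
    simp only [braid, LinearMap.comp_apply, LinearMap.sum_apply, LinearMap.smul_apply,
      TensorProduct.map_tmul, LinearEquiv.coe_coe, TensorProduct.comm_tmul, map_sum, map_smul,
      TensorProduct.dualDistrib_apply, projEnd, LinearMap.single_apply, LinearMap.proj_apply,
      pair_single]
    -- The flip exchanges the two factors, so the only surviving term of the double sum is the one
    -- indexed by `(j, i)`.
    rw [Finset.sum_eq_single j, Finset.sum_eq_single i]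
    · have h1 : pair E x (Pi.single j η) a = η (a j) := by
        rw [pair_apply, Finset.sum_eq_single j]
        · simp
        · intro k _ hk; simp [Pi.single_eq_of_ne hk]
        · simp
      have h2 : pair E x (Pi.single i ξ) b = ξ (b i) := by
        rw [pair_apply, Finset.sum_eq_single i]
        · simp
        · intro k _ hk; simp [Pi.single_eq_of_ne hk]
        · simp
      rw [h1, h2, hs]
      simp [mul_comm]
    · intro k _ hk; simp [Pi.single_eq_of_ne hk]
    · simp
    · intro k _ hk
      refine Finset.sum_eq_zero fun l _ => ?_
      simp [Pi.single_eq_of_ne hk]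
    · simp
  funext k
  ext e
  rw [mulStar_apply]
  conv_lhs => rw [← hμ]
  have := LinearMap.congr_fun key (μ (Pi.single k e))
  rw [LinearMap.comp_apply] at this ⊢
  rw [this]
  simp [mulStar_apply]

lemma erMul_comm {μ : Fib E x →ₗ[ℝ] Fib E x ⊗[ℝ] Fib E x}
    (hμ : braid E x ∘ₗ μ = μ) {a b : ℤ} {v w : ERFib E x} (hv : v ∈ erDeg E x a)
    (hw : w ∈ erDeg E x b) : erMul μ v w = sg (a * b) • erMul μ w v := by
  obtain ⟨rfl, hv'⟩ | ⟨i, rfl, hv'⟩ | rfl := erDeg_cases hv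
  · rw [hv', erMul_scalar, erMul_scalar']; simp
  · obtain ⟨rfl, hw'⟩ | ⟨j, rfl, hw'⟩ | rfl := erDeg_cases hw
    · rw [hw', erMul_scalar, erMul_scalar']; simp
    · rw [hv', hw', erMul_apply, erMul_apply]
      simp only [zero_smul, add_zero, zero_add, mul_zero]
      rw [mulStar_single_comm hμ]
      ext1 <;> simp
    · simp
  · simp

end FibreAlgebra

/-! ## The graded symmetric algebra in one fibre -/

section SymAlgebra

variable {n : ℕ} {M : Type*} {E : Fin n → M → Type*}
  [∀ i x, AddCommGroup (E i x)] [∀ i x, Module ℝ (E i x)] {x : M}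

lemma toSymFib_surjective : Function.Surjective (toSymFib E x) :=
  RingQuot.mkAlgHom_surjective ℝ _

lemma symι_single_comm (i j : Fin n) (a : Module.Dual ℝ (E i x)) (b : Module.Dual ℝ (E j x)) :
    symι E x (Pi.single i a) * symι E x (Pi.single j b) =
      sg (((i : ℕ) + 1) * ((j : ℕ) + 1)) • (symι E x (Pi.single j b) * symι E x (Pi.single i a)) := by
  have h : toSymFib E x _ = toSymFib E x _ := RingQuot.mkAlgHom_rel ℝ (SymRel.swap i j a b)
  rw [map_mul, map_zsmul, map_mul] at h
  have := sg_natCast (((i : ℕ) + 1) * ((j : ℕ) + 1))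
  push_cast at this
  rw [this]
  exact h

lemma symι_eq_sum (ξ : DualFib E x) : symι E x ξ = ∑ i, symι E x (Pi.single i (ξ i)) := by
  rw [← map_sum, Finset.univ_sum_single]

/-- Everything is reached from `1` by left multiplication with generators. The statement is
strengthened to `t * s` for all `s ∈ N`, which lets the induction over the tensor algebra pass
through products. -/
lemma symFib_induction (N : Submodule ℝ (SymFib E x)) (h1 : 1 ∈ N)
    (h2 : ∀ (i : Fin n) (ξ : Module.Dual ℝ (E i x)), ∀ s ∈ N, symι E x (Pi.single i ξ) * s ∈ N)
    (s : SymFib E x) : s ∈ N := by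
  obtain ⟨t, rfl⟩ := toSymFib_surjective s
  suffices h : ∀ s ∈ N, toSymFib E x t * s ∈ N by simpa using h 1 h1
  induction t using TensorAlgebra.induction with
  | algebraMap r =>
    intro s hs
    rw [AlgHom.commutes, ← Algebra.smul_def]
    exact N.smul_mem r hs
  | ι ξ =>
    intro s hs
    have : toSymFib E x (TensorAlgebra.ι ℝ ξ) = symι E x ξ := rfl
    rw [this, symι_eq_sum, Finset.sum_mul]
    exact N.sum_mem fun i _ => h2 i _ s hs
  | mul a b ha hb =>
    intro s hs
    rw [map_mul, mul_assoc]
    exact ha _ (hb _ hs)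
  | add a b ha hb =>
    intro s hs
    rw [map_add, add_mul]
    exact N.add_mem (ha _ hs) (hb _ hs)

/-- The universal property of the graded symmetric algebra. -/
def symLift {B : Type*} [Ring B] [Algebra ℝ B] (f : DualFib E x →ₗ[ℝ] B)
    (hf : ∀ (i j : Fin n) (a : Module.Dual ℝ (E i x)) (b : Module.Dual ℝ (E j x)),
      f (Pi.single i a) * f (Pi.single j b) =
        sg (((i : ℕ) + 1) * ((j : ℕ) + 1)) • (f (Pi.single j b) * f (Pi.single i a))) :
    SymFib E x →ₐ[ℝ] B :=
  RingQuot.liftAlgHom ℝ ⟨TensorAlgebra.lift ℝ f, by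
    rintro _ _ ⟨i, j, a, b⟩
    rw [map_mul, map_zsmul, map_mul]
    simp only [TensorAlgebra.lift_ι_apply]
    have := sg_natCast (((i : ℕ) + 1) * ((j : ℕ) + 1))
    push_cast at this
    rw [hf i j a b, this]⟩

@[simp] lemma symLift_symι {B : Type*} [Ring B] [Algebra ℝ B] (f : DualFib E x →ₗ[ℝ] B) (hf)
    (ξ : DualFib E x) : symLift f hf (symι E x ξ) = f ξ := by
  change RingQuot.liftAlgHom ℝ _ (RingQuot.mkAlgHom ℝ _ (TensorAlgebra.ι ℝ ξ)) = _
  rw [RingQuot.liftAlgHom_mkAlgHom_apply, TensorAlgebra.lift_ι_apply]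

lemma erToSym_apply (w : ERFib E x) : erToSym E x w = algebraMap ℝ _ w.1 + symι E x w.2 := by
  simp [erToSym]

@[simp] lemma erToSym_scalar (c : ℝ) : erToSym E x (c, 0) = algebraMap ℝ _ c := by
  simp [erToSym_apply]

@[simp] lemma erToSym_single (ξ : DualFib E x) : erToSym E x (0, ξ) = symι E x ξ := by
  simp [erToSym_apply]

/-! ### The action on the extended algebra -/

/-- The action of `Sym 𝐄*` on `𝐄*_ℝ` that extends the multiplication of `𝐄*_ℝ`. -/
def symAct (μ : Fib E x →ₗ[ℝ] Fib E x ⊗[ℝ] Fib E x)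
    (h : (TensorProduct.assoc ℝ (Fib E x) (Fib E x) (Fib E x)).toLinearMap ∘ₗ
      μ.rTensor (Fib E x) ∘ₗ μ = μ.lTensor (Fib E x) ∘ₗ μ) (hμ : braid E x ∘ₗ μ = μ) :
    SymFib E x →ₐ[ℝ] Module.End ℝ (ERFib E x) :=
  symLift (B := Module.End ℝ (ERFib E x))
    (erMul μ ∘ₗ LinearMap.inr ℝ ℝ (DualFib E x) : DualFib E x →ₗ[ℝ] Module.End ℝ (ERFib E x)) (by
    intro i j a b
    apply LinearMap.ext
    intro w
    simp only [LinearMap.comp_apply, LinearMap.inr_apply, Module.End.mul_apply,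
      LinearMap.smul_apply]
    rw [← erMul_assoc h, ← erMul_assoc h,
      erMul_comm hμ (single_mem_erDeg i a) (single_mem_erDeg j b), map_zsmul,
      LinearMap.smul_apply])

lemma symAct_erToSym (μ : Fib E x →ₗ[ℝ] Fib E x ⊗[ℝ] Fib E x) (h) (hμ) (w : ERFib E x) :
    symAct μ h hμ (erToSym E x w) = erMul μ w := by
  rw [erToSym_apply, map_add, AlgHom.commutes, symAct, symLift_symι]
  apply LinearMap.ext
  intro v
  simp only [LinearMap.add_apply, Module.algebraMap_end_apply, LinearMap.comp_apply,
    LinearMap.inr_apply]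
  rw [← erMul_scalar μ w.1 v, ← LinearMap.add_apply, ← map_add]
  simp

/-! ### The grading -/

lemma symι_single_mem_symDeg (i : Fin n) (ξ : Module.Dual ℝ (E i x)) :
    symι E x (Pi.single i ξ) ∈ symDeg E x ((i : ℕ) + 1) :=
  Submodule.subset_span ⟨[⟨i, ξ⟩], by simp, by simp⟩

lemma one_mem_symDeg : (1 : SymFib E x) ∈ symDeg E x 0 :=
  Submodule.subset_span ⟨[], by simp, by simp⟩

lemma algebraMap_mem_symDeg (c : ℝ) : algebraMap ℝ (SymFib E x) c ∈ symDeg E x 0 := by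
  rw [Algebra.algebraMap_eq_smul_one]
  exact Submodule.smul_mem _ _ one_mem_symDeg

lemma mul_mem_symDeg {a b : ℤ} {s t : SymFib E x} (hs : s ∈ symDeg E x a)
    (ht : t ∈ symDeg E x b) : s * t ∈ symDeg E x (a + b) := by
  have := Submodule.mul_mem_mul hs ht
  refine (?_ : symDeg E x a * symDeg E x b ≤ symDeg E x (a + b)) this
  rw [symDeg, symDeg, Submodule.span_mul_span]
  refine Submodule.span_le.2 ?_
  rintro _ ⟨_, ⟨v, hv, rfl⟩, _, ⟨w, hw, rfl⟩, rfl⟩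
  exact Submodule.subset_span ⟨v ++ w, by simp [hv, hw], by simp⟩

lemma erToSym_mem_symDeg {l : ℤ} {w : ERFib E x} (hw : w ∈ erDeg E x l) :
    erToSym E x w ∈ symDeg E x l := by
  obtain ⟨rfl, h⟩ | ⟨i, rfl, h⟩ | rfl := erDeg_cases hw
  · rw [h, erToSym_scalar]; exact algebraMap_mem_symDeg _
  · rw [h, erToSym_single]; exact symι_single_mem_symDeg _ _
  · simp

/-- Induction on homogeneous elements of `Sym 𝐄*`. -/
lemma symDeg_induction (P : ℤ → SymFib E x → Prop) (zero : ∀ l, P l 0)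
    (add : ∀ l s t, P l s → P l t → P l (s + t)) (smul : ∀ l (c : ℝ) s, P l s → P l (c • s))
    (one : P 0 1)
    (mul : ∀ l (i : Fin n) (ξ : Module.Dual ℝ (E i x)) s, s ∈ symDeg E x l → P l s →
      P ((i : ℕ) + 1 + l) (symι E x (Pi.single i ξ) * s)) {l : ℤ} {s : SymFib E x}
    (hs : s ∈ symDeg E x l) : P l s := by
  induction hs using Submodule.span_induction with
  | mem s h =>
    obtain ⟨w, hw, rfl⟩ := h
    induction w generalizing l with
    | nil => simp at hw; subst hw; simpa using one
    | cons p w ih =>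
      simp only [List.map_cons, List.sum_cons, List.prod_cons] at hw ⊢
      subst hw
      exact mul _ _ _ _ (Submodule.subset_span ⟨w, rfl, rfl⟩) (ih rfl)
  | zero => exact zero l
  | add s t _ _ h1 h2 => exact add l s t h1 h2
  | smul c s _ h => exact smul l c s h

lemma symDeg_comm {a b : ℤ} {s t : SymFib E x} (hs : s ∈ symDeg E x a) (ht : t ∈ symDeg E x b) :
    s * t = sg (a * b) • (t * s) := by
  refine symDeg_induction (fun a s => s * t = sg (a * b) • (t * s)) (by simp) ?_ ?_ (by simp) ?_ hs
  · intro l s s' h h'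
    rw [add_mul, h, h', mul_add t, smul_add]
  · intro l c s h
    rw [smul_mul_assoc, h, mul_smul_comm, smul_comm]
  · intro l i ξ s _ h
    have h1 : symι E x (Pi.single i ξ) * t = sg (((i : ℕ) + 1) * b) • (t * symι E x (Pi.single i ξ)) := by
      refine symDeg_induction (fun b t => symι E x (Pi.single i ξ) * t =
        sg (((i : ℕ) + 1) * b) • (t * symι E x (Pi.single i ξ))) (by simp) ?_ ?_ (by simp) ?_ ht
      · intro l s s' h h'
        rw [mul_add, h, h', add_mul s, smul_add]
      · intro l c s h
        rw [mul_smul_comm, h, smul_mul_assoc, smul_comm]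
      · intro l j η s _ h
        rw [← mul_assoc, symι_single_comm, smul_mul_assoc, mul_assoc, h, mul_smul_comm, smul_smul,
          ← sg_add, ← mul_add, mul_assoc]
    rw [mul_assoc, h, mul_smul_comm, ← mul_assoc, h1, smul_mul_assoc, smul_smul, ← sg_add,
      ← add_mul, mul_assoc, add_comm l]

/-- The grading of `Sym 𝐄*` as a homomorphism to polynomials. -/
def gradeHom (x : M) : SymFib E x →ₐ[ℝ] Polynomial (SymFib E x) :=
  symLift (∑ i : Fin n, (LinearMap.restrictScalars ℝ (Polynomial.monomial ((i : ℕ) + 1))) ∘ₗ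
      symι E x ∘ₗ LinearMap.single ℝ (fun i => Module.Dual ℝ (E i x)) i ∘ₗ LinearMap.proj i) (by
    have key : ∀ (i : Fin n) (a : Module.Dual ℝ (E i x)),
      (∑ i : Fin n, (LinearMap.restrictScalars ℝ (Polynomial.monomial ((i : ℕ) + 1))) ∘ₗ
      symι E x ∘ₗ LinearMap.single ℝ (fun i => Module.Dual ℝ (E i x)) i ∘ₗ LinearMap.proj i)
        (Pi.single i a) = Polynomial.monomial ((i : ℕ) + 1) (symι E x (Pi.single i a)) := by
      intro i a
      rw [LinearMap.sum_apply, Finset.sum_eq_single i]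
      · simp
      · intro j _ hj; simp [Pi.single_eq_of_ne hj]
      · simp
    intro i j a b
    rw [key, key, Polynomial.monomial_mul_monomial, Polynomial.monomial_mul_monomial,
      symι_single_comm, map_zsmul, add_comm ((i : ℕ) + 1)])

lemma gradeHom_single (i : Fin n) (a : Module.Dual ℝ (E i x)) :
    gradeHom x (symι E x (Pi.single i a)) =
      Polynomial.monomial ((i : ℕ) + 1) (symι E x (Pi.single i a)) := by
  rw [gradeHom, symLift_symι, LinearMap.sum_apply, Finset.sum_eq_single i]
  · simp
  · intro j _ hj; simp [Pi.single_eq_of_ne hj]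
  · simp

/-- Homogeneous components can thus be read off as coefficients of a polynomial. Negative degrees
are carried along separately, since `toNat` would merge them with degree zero. -/
lemma gradeHom_of_mem {l : ℤ} {s : SymFib E x} (hs : s ∈ symDeg E x l) :
    (l < 0 → s = 0) ∧ gradeHom x s = Polynomial.monomial l.toNat s := by
  refine symDeg_induction (fun l s => (l < 0 → s = 0) ∧
    gradeHom x s = Polynomial.monomial l.toNat s) (by simp) ?_ ?_ ?_ ?_ hs
  · rintro l s t ⟨h1, h2⟩ ⟨h3, h4⟩
    refine ⟨fun h => by rw [h1 h, h3 h, add_zero], by rw [map_add, map_add, h2, h4]⟩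
  · rintro l c s ⟨h1, h2⟩
    refine ⟨fun h => by rw [h1 h, smul_zero], ?_⟩
    rw [map_smul, h2, Polynomial.smul_monomial]
  · exact ⟨fun h => absurd h (by simp), by simp⟩
  · rintro l i ξ s - ⟨h1, h2⟩
    by_cases hl : l < 0
    · simp [h1 hl]
    · refine ⟨fun h => by omega, ?_⟩
      rw [map_mul, h2, gradeHom_single, Polynomial.monomial_mul_monomial]
      congr 2
      omega

lemma eq_zero_of_mem_symDeg_neg {l : ℤ} (hl : l < 0) {s : SymFib E x} (hs : s ∈ symDeg E x l) :
    s = 0 := (gradeHom_of_mem hs).1 hl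

/-- Homogeneous components are unique. -/
lemma eq_of_sum_symDeg {ι : Type*} (F : Finset ι) (l : ι → ℤ) (hl : Function.Injective l)
    (t : ι → SymFib E x) (ht : ∀ i ∈ F, t i ∈ symDeg E x (l i)) {s : SymFib E x} {i₀ : ι}
    (hi₀ : i₀ ∈ F) (hs : s ∈ symDeg E x (l i₀)) (h : s = ∑ i ∈ F, t i) : s = t i₀ := by
  by_cases h0 : l i₀ < 0
  · rw [eq_zero_of_mem_symDeg_neg h0 hs, eq_zero_of_mem_symDeg_neg h0 (ht i₀ hi₀)]
  have h1 := congrArg (fun z => (gradeHom x z).coeff (l i₀).toNat) h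
  simp only [map_sum] at h1
  rw [(gradeHom_of_mem hs).2, Polynomial.coeff_monomial_same, Polynomial.finsetSum_coeff,
    Finset.sum_eq_single_of_mem i₀ hi₀, (gradeHom_of_mem (ht i₀ hi₀)).2,
    Polynomial.coeff_monomial_same] at h1
  · exact h1
  · intro j hj hne
    rw [(gradeHom_of_mem (ht j hj)).2]
    by_cases hj0 : l j < 0
    · rw [eq_zero_of_mem_symDeg_neg hj0 (ht j hj)]; simp
    · rw [Polynomial.coeff_monomial, if_neg]
      intro h'
      exact hne (hl (by omega))

/-! ### Functoriality and twisted derivations -/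

/-- The homomorphism `Sym 𝐄*_y → Sym 𝐄*_x` induced by linear maps of the summands. -/
def symMap {y : M} (φ : ∀ i, Module.Dual ℝ (E i y) →ₗ[ℝ] Module.Dual ℝ (E i x)) :
    SymFib E y →ₐ[ℝ] SymFib E x :=
  symLift (symι E x ∘ₗ LinearMap.pi fun i => φ i ∘ₗ LinearMap.proj i) (by
    have key : ∀ i (a : Module.Dual ℝ (E i y)),
        (LinearMap.pi fun i => φ i ∘ₗ LinearMap.proj i) (Pi.single i a : DualFib E y) =
          Pi.single i (φ i a) := by
      intro i a
      funext j
      by_cases h : j = i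
      · subst h; simp
      · simp [Pi.single_eq_of_ne h]
    intro i j a b
    simp only [LinearMap.comp_apply, key]
    exact symι_single_comm i j _ _)

lemma symMap_symι {y : M} (φ : ∀ i, Module.Dual ℝ (E i y) →ₗ[ℝ] Module.Dual ℝ (E i x))
    (ξ : DualFib E y) : symMap φ (symι E y ξ) = symι E x fun i => φ i (ξ i) := by
  rw [symMap, symLift_symι]; rfl

lemma symMap_id (s : SymFib E x) : symMap (fun _ => LinearMap.id) s = s := by
  refine symFib_induction (LinearMap.eqLocus (symMap (fun _ => LinearMap.id)).toLinearMap
    LinearMap.id) (by simp) ?_ s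
  intro i ξ s hs
  simp only [LinearMap.mem_eqLocus, AlgHom.toLinearMap_apply, LinearMap.id_apply] at hs ⊢
  rw [map_mul, hs, symMap_symι]
  rfl

/-- The automorphism `s ↦ (-1)^{k|s|} s` of `Sym 𝐄*`. -/
def symSign (k : ℤ) (x : M) : SymFib E x →ₐ[ℝ] SymFib E x :=
  symMap fun i => sg (k * ((i : ℕ) + 1)) • LinearMap.id

lemma symSign_of_mem (k : ℤ) {l : ℤ} {s : SymFib E x} (hs : s ∈ symDeg E x l) :
    symSign k x s = sg (k * l) • s := by
  refine symDeg_induction (fun l s => symSign k x s = sg (k * l) • s) (by simp) ?_ ?_ (by simp)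
    ?_ hs
  · intro l s t h1 h2
    rw [map_add, h1, h2, smul_add]
  · intro l c s h
    rw [map_smul, h, smul_comm]
  · intro l i ξ s _ h
    have : (fun j : Fin n => (sg (k * ((j : ℕ) + 1)) • (LinearMap.id : Module.Dual ℝ (E j x) →ₗ[ℝ] _))
        (Pi.single (M := fun j => Module.Dual ℝ (E j x)) i ξ j)) =
        sg (k * ((i : ℕ) + 1)) • (Pi.single i ξ : DualFib E x) := by
      funext j
      by_cases hj : j = i
      · subst hj; simp
      · simp [Pi.single_eq_of_ne hj]
    rw [map_mul, h, symSign, symMap_symι, this, map_zsmul, smul_mul_smul_comm, ← sg_add, ← mul_add]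

/-- The extension of a linear map `Δ` of degree `-k` to a twisted derivation of `Sym 𝐄*`. -/
lemma exists_twisted_derivation (k : ℤ) (Δ : DualFib E x →ₗ[ℝ] SymFib E x)
    (hΔ : ∀ i (ξ : Module.Dual ℝ (E i x)), Δ (Pi.single i ξ) ∈ symDeg E x ((i : ℕ) + 1 - k)) :
    ∃ D : SymFib E x →ₗ[ℝ] SymFib E x, D 1 = 0 ∧ ∀ i (ξ : Module.Dual ℝ (E i x)) s,
      D (symι E x (Pi.single i ξ) * s) = Δ (Pi.single i ξ) * s +
        sg (k * ((i : ℕ) + 1)) • (symι E x (Pi.single i ξ) * D s) := by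
  -- A map `D` is a derivation twisted by the automorphism `σ = symSign k` exactly when `s ↦ !![σ s,
  -- D s; 0, s]` is multiplicative. So `D` is found as the upper right entry of the homomorphism
  -- that the universal property attaches to the values on generators.
  let f : DualFib E x →ₗ[ℝ] Matrix (Fin 2) (Fin 2) (SymFib E x) :=
    { toFun := fun ξ => !![symSign k x (symι E x ξ), Δ ξ; 0, symι E x ξ]
      map_add' := by intro a b; ext i j; fin_cases i <;> fin_cases j <;> simp
      map_smul' := by intro c b; ext i j; fin_cases i <;> fin_cases j <;> simp }
  have hf : ∀ i (a : Module.Dual ℝ (E i x)), f (Pi.single i a) =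
      !![sg (k * ((i : ℕ) + 1)) • symι E x (Pi.single i a), Δ (Pi.single i a);
        0, symι E x (Pi.single i a)] := by
    intro i a
    change !![symSign k x (symι E x (Pi.single i a)), Δ (Pi.single i a);
      0, symι E x (Pi.single i a)] = _
    rw [symSign_of_mem k (symι_single_mem_symDeg i a)]
  let H := symLift f (by
    intro i j a b
    rw [hf, hf, Matrix.mul_fin_two, Matrix.mul_fin_two, Matrix.smul_of]
    have e1 := symι_single_comm i j a b
    have e2 := symDeg_comm (symι_single_mem_symDeg i a) (hΔ j b)
    have e3 := symDeg_comm (hΔ i a) (symι_single_mem_symDeg j b)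
    congr 1
    funext p q
    fin_cases p <;> fin_cases q
    · simp only [Fin.zero_eta, Matrix.of_apply, Matrix.cons_val', Matrix.cons_val_zero,
        mul_zero, add_zero, Matrix.smul_cons, Matrix.smul_empty, Pi.smul_apply, Matrix.cons_val_fin_one]
      rw [smul_mul_smul_comm, smul_mul_smul_comm, e1, smul_smul, smul_smul]
      congr 1
      ring
    -- The upper right entry is the only one that involves `Δ`; its degree, lowered by `k`, produces
    -- the signs that have to cancel.
    · have s1 : sg (k * ((i : ℕ) + 1)) * sg (((i : ℕ) + 1) * ((j : ℕ) + 1 - k)) =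
          sg (((i : ℕ) + 1) * ((j : ℕ) + 1)) := by
        rw [mul_sub, sg_sub, mul_left_comm, mul_comm k, sg_mul_self, mul_one]
      have s2 : sg (((i : ℕ) + 1 - k) * ((j : ℕ) + 1)) =
          sg (((i : ℕ) + 1) * ((j : ℕ) + 1)) * sg (k * ((j : ℕ) + 1)) := by
        rw [sub_mul, sg_sub]
      simp only [Fin.zero_eta, Fin.mk_one, Matrix.of_apply, Matrix.cons_val', Matrix.cons_val_zero,
        Matrix.cons_val_one, Matrix.smul_cons, Matrix.smul_empty, Pi.smul_apply,
        Matrix.cons_val_fin_one]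
      rw [smul_mul_assoc, e2, e3, smul_smul, s1, s2, smul_mul_assoc, smul_add, smul_smul, add_comm]
    · simp
    · simp [e1])
  have hH : ∀ s, H s 1 0 = 0 ∧ H s 1 1 = s := by
    intro s
    let e (p q : Fin 2) : SymFib E x →ₗ[ℝ] SymFib E x :=
      (LinearMap.proj q ∘ₗ LinearMap.proj p) ∘ₗ H.toLinearMap
    refine symFib_induction ((LinearMap.ker (e 1 0)) ⊓ (LinearMap.eqLocus (e 1 1) LinearMap.id))
      ⟨?_, ?_⟩ ?_ s
    · change H 1 1 0 = 0
      simp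
    · change H 1 1 1 = 1
      simp
    · rintro i ξ s ⟨h1, h2⟩
      have h1 : H s 1 0 = 0 := h1
      have h2 : H s 1 1 = s := h2
      constructor
      · change H _ 1 0 = 0
        rw [map_mul, symLift_symι, hf, Matrix.mul_apply]
        simp [h1]
      · change H _ 1 1 = _
        rw [map_mul, symLift_symι, hf, Matrix.mul_apply]
        simp [h2]
  refine ⟨(LinearMap.proj 1 ∘ₗ LinearMap.proj 0) ∘ₗ H.toLinearMap, ?_, ?_⟩
  · change H 1 0 1 = 0
    simp
  · intro i ξ s
    change H _ 0 1 = _ + _ • (_ * H s 0 1)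
    rw [map_mul, symLift_symι, hf, Matrix.mul_apply]
    simp only [Fin.sum_univ_two, Matrix.of_apply, Matrix.cons_val', Matrix.cons_val_zero,
        Matrix.cons_val_one, Matrix.cons_val_fin_one]
    rw [(hH s).2, smul_mul_assoc, add_comm]

end SymAlgebra

/-! ## Smoothness on open subsets -/

section Smoothness

variable {d : ℕ} {M : Type*} [TopologicalSpace M] [ChartedSpace (EuclideanSpace ℝ (Fin d)) M]

section Local

variable {B : Type*} [NormedAddCommGroup B] [NormedSpace ℝ B] {H : Type*} [TopologicalSpace H]
  {I : ModelWithCorners ℝ B H} {M' : Type*} [TopologicalSpace M'] [ChartedSpace H M']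

lemma contMDiff_opens_iff {U : Opens M} {f : U → M'} {f' : M → M'} (h : ∀ y : U, f y = f' y) :
    ContMDiff (𝓡 d) I ∞ f ↔ ∀ x : U, ContMDiffAt (𝓡 d) I ∞ f' (x : M) := by
  have : f = fun y : U => f' y := funext h
  subst this
  exact forall_congr' fun x => contMDiffAt_subtype_iff

lemma contMDiff_opens_of_local {U : Opens M} {f : U → M'}
    (h : ∀ x : U, ∃ (V : Opens M) (hV : V ≤ U), (x : M) ∈ V ∧
      ContMDiff (𝓡 d) I ∞ (fun y : V => f ⟨y, hV y.2⟩)) : ContMDiff (𝓡 d) I ∞ f := by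
  classical
  intro x
  let f' : M → M' := fun y => if hy : y ∈ U then f ⟨y, hy⟩ else f x
  have hf' : ∀ y : U, f y = f' y := fun y => by simp [f']
  obtain ⟨V, hV, hx, hs⟩ := h x
  rw [contMDiff_opens_iff (f' := f') fun y => hf' ⟨y, hV y.2⟩] at hs
  have := hs ⟨x, hx⟩
  rw [← contMDiffAt_subtype_iff (U := U) (x := x)] at this
  convert this using 1
  exact funext hf'

end Local

/-- A smooth bump function: it is `1` near `x` and vanishes on an open set that covers `M` together
with the given neighbourhood of `x`. -/
lemma exists_bump [T2Space M] [IsManifold (𝓡 d) ∞ M] {U : Opens M} {x : M} (hx : x ∈ U) :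
    ∃ (χ : M → ℝ) (N Z : Opens M), ContMDiff (𝓡 d) 𝓘(ℝ, ℝ) ∞ χ ∧ x ∈ N ∧ N ≤ U ∧
      (∀ y ∈ N, χ y = 1) ∧ (∀ y ∈ Z, χ y = 0) ∧ ∀ y, y ∈ U ∨ y ∈ Z := by
  obtain ⟨f, -, hf⟩ := (SmoothBumpFunction.nhds_basis_tsupport (I := 𝓡 d) x).mem_iff.1
    (U.isOpen.mem_nhds hx)
  obtain ⟨N, hN, hNo, hxN⟩ := mem_nhds_iff.1 f.eventuallyEq_one
  refine ⟨f, ⟨N, hNo⟩ ⊓ U, ⟨(tsupport f)ᶜ, (isClosed_tsupport _).isOpen_compl⟩, f.contMDiff,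
    ⟨hxN, hx⟩, inf_le_right, fun y hy => hN hy.1, fun y hy => image_eq_zero_of_notMem_tsupport hy,
    fun y => ?_⟩
  by_cases h : y ∈ tsupport f
  · exact Or.inl (hf h)
  · exact Or.inr h

/-- The restriction of a smooth function on `M`. -/
lemma contMDiff_restrict {B : Type*} [NormedAddCommGroup B] [NormedSpace ℝ B] {f : M → B}
    (hf : ContMDiff (𝓡 d) 𝓘(ℝ, B) ∞ f) (U : Opens M) :
    ContMDiff (𝓡 d) 𝓘(ℝ, B) ∞ (fun y : U => f y) := hf.comp contMDiff_subtype_val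

end Smoothness

/-! ## Sections of `𝐄*_ℝ` -/

section ERSections

variable {d : ℕ} {n : ℕ} {M : Type*} [TopologicalSpace M]
  [ChartedSpace (EuclideanSpace ℝ (Fin d)) M]
  {F : Fin n → Type*} [∀ i, NormedAddCommGroup (F i)] [∀ i, NormedSpace ℝ (F i)]
  {E : Fin n → M → Type*} [∀ i x, AddCommGroup (E i x)] [∀ i x, Module ℝ (E i x)]
  [∀ i, TopologicalSpace (Bundle.TotalSpace (F i) (E i))] [∀ i x, TopologicalSpace (E i x)]
  [∀ i, FiberBundle (F i) (E i)]

lemma SmoothSec.restrict {U V : Opens M} (h : V ≤ U) {e : ∀ x : U, Fib E (x : M)}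
    (he : SmoothSec d F E U e) : SmoothSec d F E V (fun x => e ⟨x, h x.2⟩) :=
  fun i => (he i).comp (contMDiff_inclusion h)

lemma SmoothDual.restrict {U V : Opens M} (h : V ≤ U) {ξ : ∀ x : U, DualFib E (x : M)}
    (hξ : SmoothDual d F E U ξ) : SmoothDual d F E V (fun x => ξ ⟨x, h x.2⟩) :=
  fun W hW e he i => hξ W (hW.trans h) e he i

/-- Smoothness of sections of `𝐄*_ℝ` is local. -/
lemma erSec_of_local {U : Opens M} {s : ∀ x : U, ERFib E (x : M)}
    (h : ∀ x : U, ∃ (V : Opens M) (hV : V ≤ U), (x : M) ∈ V ∧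
      (fun y : V => s ⟨y, hV y.2⟩) ∈ ERSec d F E V) : s ∈ ERSec d F E U := by
  refine ⟨contMDiff_opens_of_local fun x => ?_, fun W hW e he i =>
    contMDiff_opens_of_local fun x => ?_⟩
  · obtain ⟨V, hV, hx, hs⟩ := h x
    exact ⟨V, hV, hx, hs.1⟩
  · obtain ⟨V, hV, hx, hs⟩ := h ⟨x, hW x.2⟩
    exact ⟨W ⊓ V, inf_le_left, ⟨x.2, hx⟩,
      hs.2 (W ⊓ V) inf_le_right _ (he.restrict inf_le_left) i⟩

lemma erSec_smul {U : Opens M} {f : U → ℝ} (hf : ContMDiff (𝓡 d) 𝓘(ℝ, ℝ) ∞ f)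
    {s : ∀ x : U, ERFib E (x : M)} (hs : s ∈ ERSec d F E U) :
    (fun x => f x • s x) ∈ ERSec d F E U :=
  ⟨hf.mul hs.1, fun V h e he i => (hf.comp (contMDiff_inclusion h)).mul (hs.2 V h e he i)⟩

lemma erSec_scalar {U : Opens M} {f : U → ℝ} (hf : ContMDiff (𝓡 d) 𝓘(ℝ, ℝ) ∞ f) :
    (fun x : U => ((f x, 0) : ERFib E (x : M))) ∈ ERSec d F E U :=
  ⟨hf, fun _ _ _ _ _ => contMDiff_const⟩

lemma erSec_single {U : Opens M} {s : ∀ x : U, ERFib E (x : M)} (hs : s ∈ ERSec d F E U)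
    (i : Fin n) : (fun x : U => ((0, Pi.single i ((s x).2 i)) : ERFib E (x : M))) ∈
      ERSec d F E U := by
  refine ⟨contMDiff_const, fun V h e he j => ?_⟩
  by_cases hj : j = i
  · subst hj
    simpa using hs.2 V h e he j
  · simpa [Pi.single_eq_of_ne hj] using contMDiff_const

lemma erSec_sum {U : Opens M} {ι : Type*} (t : Finset ι) (s : ι → ∀ x : U, ERFib E (x : M))
    (hs : ∀ i ∈ t, s i ∈ ERSec d F E U) : (fun x => ∑ i ∈ t, s i x) ∈ ERSec d F E U := by
  have := (ERSec d F E U).sum_mem hs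
  convert this using 1
  funext x
  rw [Finset.sum_apply]

/-- The sections of `𝐄*_ℝ` over `U` that are homogeneous of degree `l`. -/
def HomSec (U : Opens M) (l : ℤ) (e : ERSec d F E U) : Prop :=
  ∀ x : U, e.1 x ∈ erDeg E (x : M) l

/-- The degree zero component of a section. -/
def erComp₀ {U : Opens M} (e : ERSec d F E U) : ERSec d F E U :=
  ⟨fun x => ((e.1 x).1, 0), erSec_scalar e.2.1⟩

/-- The component of degree `i + 1` of a section. -/
def erComp {U : Opens M} (e : ERSec d F E U) (i : Fin n) : ERSec d F E U :=
  ⟨fun x => (0, Pi.single i ((e.1 x).2 i)), erSec_single e.2 i⟩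

lemma erComp₀_homSec {U : Opens M} (e : ERSec d F E U) : HomSec U 0 (erComp₀ e) :=
  fun _ => scalar_mem_erDeg _

lemma erComp_homSec {U : Opens M} (e : ERSec d F E U) (i : Fin n) :
    HomSec U (((i : ℕ) + 1 : ℕ) : ℤ) (erComp e i) := fun _ => by
  push_cast
  exact single_mem_erDeg _ _

lemma erSec_decomp {U : Opens M} (e : ERSec d F E U) : e = erComp₀ e + ∑ i, erComp e i := by
  apply Subtype.ext
  funext x
  rw [Submodule.coe_add, Submodule.coe_sum, Pi.add_apply, Finset.sum_apply]
  exact erFib_decomp (e.1 x)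

/-- A statement that is additive holds for all sections if it holds for the homogeneous ones. -/
lemma erSec_induction {U : Opens M} {P : ERSec d F E U → Prop}
    (add : ∀ e e', P e → P e' → P (e + e'))
    (hom : ∀ (a : ℕ) e, a ≤ n → HomSec U (a : ℤ) e → P e) (e : ERSec d F E U) : P e := by
  rw [erSec_decomp e]
  refine add _ _ (hom 0 _ (Nat.zero_le _) (erComp₀_homSec e)) ?_
  have : ∀ t : Finset (Fin n), P (∑ i ∈ t, erComp e i) := by
    intro t
    induction t using Finset.cons_induction with
    | empty =>
      rw [Finset.sum_empty]
      exact hom 0 0 (Nat.zero_le _) fun _ => Submodule.zero_mem _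
    | cons i t hi ih =>
      rw [Finset.sum_cons]
      exact add _ _ (hom ((i : ℕ) + 1) _ i.2 (erComp_homSec e i)) ih
  exact this _

/-- The product of a smooth function and a section of `𝐄*_ℝ`. -/
def fsmul {U : Opens M} {f : U → ℝ} (hf : ContMDiff (𝓡 d) 𝓘(ℝ, ℝ) ∞ f) (e : ERSec d F E U) :
    ERSec d F E U := ⟨fun x => f x • e.1 x, erSec_smul hf e.2⟩

variable (F E) in
/-- A smooth function as a section of `𝐄*_ℝ`. -/
def fsec {U : Opens M} {f : U → ℝ} (hf : ContMDiff (𝓡 d) 𝓘(ℝ, ℝ) ∞ f) : ERSec d F E U :=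
  ⟨fun x => (f x, 0), erSec_scalar hf⟩

lemma fsec_homSec {U : Opens M} {f : U → ℝ} (hf : ContMDiff (𝓡 d) 𝓘(ℝ, ℝ) ∞ f) :
    HomSec U 0 (fsec F E hf) := fun _ => scalar_mem_erDeg _

lemma HomSec.restrict {U V : Opens M} (h : V ≤ U) {l : ℤ} {e : ERSec d F E U}
    (he : HomSec U l e) : HomSec V l (erRes d F E h e) := fun x => he ⟨x, h x.2⟩

lemma smoothSec_single [∀ i, VectorBundle ℝ (F i) (E i)] {U : Opens M} {i : Fin n} {e : ∀ x : U, E i (x : M)}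
    (he : ContMDiff (𝓡 d) ((𝓡 d).prod 𝓘(ℝ, F i)) ∞
      (fun x : U => (⟨(x : M), e x⟩ : Bundle.TotalSpace (F i) (E i)))) :
    SmoothSec d F E U (fun x => Pi.single i (e x)) := by
  intro j
  by_cases hj : j = i
  · subst hj; simpa using he
  · simp only [Pi.single_eq_of_ne hj]
    exact (Bundle.contMDiff_zeroSection ℝ (E j) (IB := 𝓡 d) (n := ∞)).comp contMDiff_subtype_val

/-- The product of smooth sections of `𝐄*_ℝ` is smooth. -/
lemma erSec_mul [∀ i, VectorBundle ℝ (F i) (E i)] (A : CoalgebraBundle d F E) {U : Opens M}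
    {s t : ∀ x : U, ERFib E (x : M)} (hs : s ∈ ERSec d F E U) (ht : t ∈ ERSec d F E U) :
    (fun x : U => erMul (A.comul (x : M)) (s x) (t x)) ∈ ERSec d F E U := by
  refine ⟨hs.1.mul ht.1, fun V h e he i => ?_⟩
  have h1 := A.smooth V (fun x => Pi.single i (e x i)) _ _ (smoothSec_single (he i))
    (hs.2.restrict h) (ht.2.restrict h)
  exact (((hs.1.comp (contMDiff_inclusion h)).mul (ht.2 V h e he i)).add
    ((ht.1.comp (contMDiff_inclusion h)).mul (hs.2 V h e he i))).add h1

/-- The product of sections of `𝐄*_ℝ`. -/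
def secMul [∀ i, VectorBundle ℝ (F i) (E i)] (A : CoalgebraBundle d F E) {U : Opens M}
    (s t : ERSec d F E U) : ERSec d F E U :=
  ⟨fun x : U => erMul (A.comul (x : M)) (s.1 x) (t.1 x), erSec_mul A s.2 t.2⟩

lemma HomSec.secMul [∀ i, VectorBundle ℝ (F i) (E i)] (A : CoalgebraBundle d F E) {U : Opens M}
    {s t : ERSec d F E U} {a b : ℤ} (hs : HomSec U a s) (ht : HomSec U b t) :
    HomSec U (a + b) (secMul A s t) :=
  fun x => erMul_mem_erDeg _ (A.degree (x : M)) (hs x) (ht x)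

/-- Extension by zero of the product of a bump function and a section of `𝐄*_ℝ`. -/
lemma exists_extension {U V Z : Opens M} (hUV : V ≤ U) {χ : M → ℝ}
    (hχ : ContMDiff (𝓡 d) 𝓘(ℝ, ℝ) ∞ χ)
    (hZ : ∀ y ∈ Z, χ y = 0) (hVZ : ∀ y, y ∈ V ∨ y ∈ Z) (e : ERSec d F E V) :
    ∃ e' : ERSec d F E U, (∀ y : V, e'.1 ⟨y, hUV y.2⟩ = χ y • e.1 y) ∧
      (∀ y : U, (y : M) ∈ Z → e'.1 y = 0) ∧ ∀ l, HomSec V l e → HomSec U l e' := by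
  classical
  let s : ∀ x : U, ERFib E (x : M) := fun x => if h : (x : M) ∈ V then χ x • e.1 ⟨x, h⟩ else 0
  have hs : ∀ y : U, (y : M) ∈ Z → s y = 0 := by
    intro y hy
    simp only [s]
    split_ifs
    · rw [hZ y hy, zero_smul]
    · rfl
  have hsV : ∀ y : V, s ⟨y, hUV y.2⟩ = χ y • e.1 y := fun y => by simp [s]
  refine ⟨⟨s, erSec_of_local fun x => ?_⟩, hsV, hs, fun l hl x => ?_⟩
  · rcases hVZ x with hx | hx
    · refine ⟨V, hUV, hx, ?_⟩
      simp only [hsV]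
      exact erSec_smul (contMDiff_restrict hχ V) e.2
    · refine ⟨Z ⊓ U, inf_le_right, ⟨hx, x.2⟩, ?_⟩
      have : (fun y : (Z ⊓ U : Opens M) => s ⟨y, y.2.2⟩) = 0 := funext fun y => hs _ y.2.1
      rw [this]
      exact Submodule.zero_mem _
  · simp only [s]
    split_ifs with h
    · exact Submodule.smul_mem _ _ (hl ⟨x, h⟩)
    · exact Submodule.zero_mem _

/-- A section agrees near each point with a global section. -/
lemma exists_global [T2Space M] [IsManifold (𝓡 d) ∞ M] {U : Opens M} {x : M} (hx : x ∈ U)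
    (e : ERSec d F E U) : ∃ (N : Opens M) (hN : N ≤ U) (e' : ERSec d F E (⊤ : Opens M)), x ∈ N ∧
      (∀ y : N, e'.1 ⟨y, trivial⟩ = e.1 ⟨y, hN y.2⟩) ∧ ∀ l, HomSec U l e → HomSec ⊤ l e' := by
  obtain ⟨χ, N, Z, hχ, hxN, hN, h1, h0, hc⟩ := exists_bump (d := d) hx
  obtain ⟨e', he', -, hl⟩ := exists_extension le_top hχ h0 hc e
  refine ⟨N, hN, e', hxN, fun y => ?_, hl⟩
  rw [he' ⟨y, hN y.2⟩, h1 y y.2, one_smul]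

end ERSections

/-! ## Local frames -/

section Frames

variable {d : ℕ} {n : ℕ} {M : Type*} [TopologicalSpace M] [T2Space M]
  [ChartedSpace (EuclideanSpace ℝ (Fin d)) M] [IsManifold (𝓡 d) ∞ M]
  {F : Fin n → Type*} [∀ i, NormedAddCommGroup (F i)] [∀ i, NormedSpace ℝ (F i)]
  [∀ i, FiniteDimensional ℝ (F i)]
  {E : Fin n → M → Type*} [∀ i x, AddCommGroup (E i x)] [∀ i x, Module ℝ (E i x)]
  [∀ i, TopologicalSpace (Bundle.TotalSpace (F i) (E i))] [∀ i x, TopologicalSpace (E i x)]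
  [∀ i, FiberBundle (F i) (E i)] [∀ i, VectorBundle ℝ (F i) (E i)]
  [∀ i, ContMDiffVectorBundle ∞ (F i) (E i) (𝓡 d)]

/-- Local frames of the summands near a point and the dual frames, extended to all of `M`. -/
structure DualFrame (d : ℕ) {n : ℕ} {M : Type*} [TopologicalSpace M]
    [ChartedSpace (EuclideanSpace ℝ (Fin d)) M]
    (F : Fin n → Type*) [∀ i, NormedAddCommGroup (F i)] [∀ i, NormedSpace ℝ (F i)]
    (E : Fin n → M → Type*) [∀ i x, AddCommGroup (E i x)] [∀ i x, Module ℝ (E i x)]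
    [∀ i, TopologicalSpace (Bundle.TotalSpace (F i) (E i))] [∀ i x, TopologicalSpace (E i x)]
    [∀ i, FiberBundle (F i) (E i)] (W : Opens M) where
  /-- the frame of `E i` -/
  vec : ∀ i, Fin (Module.finrank ℝ (F i)) → ∀ y : M, E i y
  /-- the dual frame -/
  cov : ∀ i, Fin (Module.finrank ℝ (F i)) → ERSec d F E (⊤ : Opens M)
  cov_hom : ∀ (i : Fin n) α, HomSec ⊤ (((i : ℕ) + 1 : ℕ) : ℤ) (cov i α)
  smooth : ∀ (U : Opens M) (e : ERSec d F E U) i α,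
    ContMDiff (𝓡 d) 𝓘(ℝ, ℝ) ∞ (fun y : U => (e.1 y).2 i (vec i α y))
  dual : ∀ (y : W) i α β, ((cov i α).1 ⟨y, trivial⟩).2 i (vec i β y) = if β = α then 1 else 0
  expand : ∀ (y : W) i (ξ : Module.Dual ℝ (E i (y : M))),
    ξ = ∑ α, ξ (vec i α y) • ((cov i α).1 ⟨y, trivial⟩).2 i

-- Frame and dual frame of a trivialization are both multiplied by a bump function. This makes them
-- global and the coefficients smooth everywhere, while duality and the expansion formula hold only
-- on `W`, where the bump function is `1`.
variable (F E) in
lemma exists_dualFrame (x : M) : ∃ W : Opens M, x ∈ W ∧ Nonempty (DualFrame d F E W) := by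
  classical
  haveI : ∀ i, ContMDiffVectorBundle 1 (F i) (E i) (𝓡 d) := fun i =>
    ContMDiffVectorBundle.of_le (n := ∞) (by norm_cast)
  let t := fun i => trivializationAt (F i) (E i) x
  let b := fun i => Module.finBasis ℝ (F i)
  let W₀ : Opens M := ⟨⋂ i, (t i).baseSet, isOpen_iInter_of_finite fun i => (t i).open_baseSet⟩
  have hW₀ : ∀ i, ∀ y ∈ W₀, y ∈ (t i).baseSet := fun i y hy => Set.mem_iInter.1 hy i
  have hx : x ∈ W₀ := Set.mem_iInter.2 fun i => FiberBundle.mem_baseSet_trivializationAt' x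
  obtain ⟨χ, N, Z, hχ, hxN, hN, h1, h0, hc⟩ := exists_bump (d := d) hx
  let coe : ∀ i, Fin (Module.finrank ℝ (F i)) → ∀ y : M, Module.Dual ℝ (E i y) :=
    fun i α y => (t i).localFrameCoeff (𝓡 d) (b i) α y
  have hcoe : ∀ i α, (fun y : W₀ => ((0, Pi.single i (coe i α y)) : ERFib E (y : M))) ∈
      ERSec d F E W₀ := by
    intro i α
    refine ⟨contMDiff_const, fun V h e he j => ?_⟩
    by_cases hj : j = i
    · subst hj
      let e' : ∀ y : M, E j y := fun y => if hy : y ∈ V then e ⟨y, hy⟩ j else 0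
      have he' : ∀ y : V, e y j = e' y := fun y => by simp [e']
      have h2 := (contMDiff_opens_iff (f := fun y : V =>
        (⟨y, e y j⟩ : Bundle.TotalSpace (F j) (E j)))
        (f' := fun y => ⟨y, e' y⟩) fun y => by simp only [he']).1 (he j)
      refine (contMDiff_opens_iff (f' := fun y => coe j α y (e' y)) fun y => ?_).2 fun y => ?_
      · simp [he']
      · exact contMDiffAt_localFrameCoeff (b j) (hW₀ j _ (h y.2)) (h2 y) α
    · simpa [Pi.single_eq_of_ne hj] using contMDiff_const
  choose cov hcov1 hcov2 hcov3 using fun (i : Fin n) α =>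
    exists_extension le_top hχ h0 hc ⟨_, hcoe i α⟩
  refine ⟨N, hxN, ⟨⟨fun i α y => χ y • (t i).localFrame (b i) α y, cov, ?_, ?_, ?_, ?_⟩⟩⟩
  · intro i α
    refine hcov3 i α _ fun y => ?_
    push_cast
    exact single_mem_erDeg _ _
  · intro U e i α
    refine contMDiff_opens_of_local fun y => ?_
    rcases hc y with hy | hy
    · refine ⟨U ⊓ W₀, inf_le_left, ⟨y.2, hy⟩, ?_⟩
      have h2 : SmoothSec d F E (U ⊓ W₀ : Opens M)
          (fun y => Pi.single i ((t i).localFrame (b i) α y)) := by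
        apply smoothSec_single
        refine (contMDiff_opens_iff (f' := fun y =>
          (⟨y, (t i).localFrame (b i) α y⟩ : Bundle.TotalSpace (F i) (E i))) fun y => rfl).2
          fun y => ?_
        exact contMDiffAt_localFrame_of_mem ∞ (t i) (b i) α (hW₀ i _ y.2.2)
      have h3 := e.2.2 _ inf_le_left _ h2 i
      simp only [Pi.single_eq_same] at h3
      simp only [map_smul, smul_eq_mul]
      exact (contMDiff_restrict hχ _).mul h3
    · refine ⟨U ⊓ Z, inf_le_left, ⟨y.2, hy⟩, ?_⟩
      have : (fun y : (U ⊓ Z : Opens M) => (e.1 ⟨y, y.2.1⟩).2 i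
          (χ y • (t i).localFrame (b i) α y)) = fun _ => 0 := by
        funext y
        rw [h0 y y.2.2, zero_smul, map_zero]
      exact this ▸ contMDiff_const
  · intro y i α β
    rw [hcov1 i α ⟨y, hN y.2⟩, h1 y y.2]
    have hy := hW₀ i y (hN y.2)
    simp only [one_smul, Pi.single_eq_same, coe]
    rw [Bundle.Trivialization.localFrameCoeff_apply_of_mem_baseSet _ _ hy,
      Bundle.Trivialization.localFrame_apply_of_mem_baseSet _ _ hy]
    simp [Finsupp.single_apply]
  · intro y i ξ
    have hy := hW₀ i y (hN y.2)
    ext v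
    rw [LinearMap.sum_apply]
    conv_lhs => rw [← ((t i).basisAt (b i) hy).sum_repr v, map_sum]
    refine Finset.sum_congr rfl fun α _ => ?_
    rw [hcov1 i α ⟨y, hN y.2⟩, h1 y y.2]
    simp only [one_smul, Pi.single_eq_same, coe, LinearMap.smul_apply]
    -- The coefficient functional is evaluated on sections; `v` is turned into one by the value zero
    -- away from `y`.
    have h3 := Bundle.Trivialization.localFrameCoeff_apply_of_mem_baseSet (I := 𝓡 d) (t i) (b i) hy
      (fun z => if h : z = y then h ▸ v else 0) α
    simp only [dite_true] at h3
    rw [h3, Bundle.Trivialization.localFrame_apply_of_mem_baseSet _ _ hy, map_smul, smul_eq_mul,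
      smul_eq_mul, mul_comm]

end Frames

/-! ## Polynomial sections of `Sym 𝐄*` -/

section Polynomials

variable {d : ℕ} {n : ℕ} {M : Type*} [TopologicalSpace M] [T2Space M]
  [ChartedSpace (EuclideanSpace ℝ (Fin d)) M] [IsManifold (𝓡 d) ∞ M]
  {F : Fin n → Type*} [∀ i, NormedAddCommGroup (F i)] [∀ i, NormedSpace ℝ (F i)]
  {E : Fin n → M → Type*} [∀ i x, AddCommGroup (E i x)] [∀ i x, Module ℝ (E i x)]
  [∀ i, TopologicalSpace (Bundle.TotalSpace (F i) (E i))] [∀ i x, TopologicalSpace (E i x)]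
  [∀ i, FiberBundle (F i) (E i)] [∀ i, VectorBundle ℝ (F i) (E i)]

variable (d F) in
/-- Homogeneous polynomials of degree `l` in the smooth sections of `𝐄*_ℝ` over `U`. -/
inductive HomPoly (U : Opens M) : ℤ → (∀ x : U, SymFib E (x : M)) → Prop
  | zero (l : ℤ) : HomPoly U l 0
  | one : HomPoly U 0 1
  | add {l : ℤ} {s t : ∀ x : U, SymFib E (x : M)} :
      HomPoly U l s → HomPoly U l t → HomPoly U l (s + t)
  | mul {l : ℤ} (a : ℕ) (e : ERSec d F E U) (he : HomSec U (a : ℤ) e)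
      {s : ∀ x : U, SymFib E (x : M)} :
      HomPoly U l s → HomPoly U (a + l) ((fun x : U => erToSym E (x : M) (e.1 x)) * s)

lemma polySec_le_symSec (U : Opens M) : polySec d F E U ≤ symSec d F E U :=
  fun _ hs x => ⟨U, le_rfl, x.2, hs⟩

lemma HomPoly.mem_polySec {U : Opens M} {l : ℤ} {s : ∀ x : U, SymFib E (x : M)}
    (h : HomPoly d F U l s) : s ∈ polySec d F E U := by
  induction h with
  | zero => exact zero_mem _
  | one => exact one_mem _
  | add _ _ h1 h2 => exact add_mem h1 h2
  | mul a e he _ h => exact mul_mem (Algebra.subset_adjoin ⟨e.1, e.2, rfl⟩) h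

lemma HomPoly.mem_symDeg {U : Opens M} {l : ℤ} {s : ∀ x : U, SymFib E (x : M)}
    (h : HomPoly d F U l s) (x : U) : s x ∈ symDeg E (x : M) l := by
  induction h with
  | zero => exact Submodule.zero_mem _
  | one => exact one_mem_symDeg
  | add _ _ h1 h2 => exact Submodule.add_mem _ h1 h2
  | mul a e he _ h => exact mul_mem_symDeg (erToSym_mem_symDeg (he x)) h

lemma HomPoly.mul_poly {U : Opens M} {k l : ℤ} {s t : ∀ x : U, SymFib E (x : M)}
    (hs : HomPoly d F U k s) (ht : HomPoly d F U l t) : HomPoly d F U (k + l) (s * t) := by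
  induction hs with
  | zero => rw [zero_mul]; exact .zero _
  | one => rwa [zero_add, one_mul]
  | add _ _ h1 h2 => rw [add_mul]; exact .add h1 h2
  | mul a e he _ h => rw [mul_assoc, add_assoc]; exact .mul a e he h

lemma HomPoly.of_hom {U : Opens M} (a : ℕ) (e : ERSec d F E U) (he : HomSec U (a : ℤ) e) :
    HomPoly d F U a (fun x : U => erToSym E (x : M) (e.1 x)) := by
  have := HomPoly.mul a e he .one
  rwa [mul_one, add_zero] at this

lemma HomPoly.smul {U : Opens M} {l : ℤ} {s : ∀ x : U, SymFib E (x : M)}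
    (h : HomPoly d F U l s) (c : ℝ) : HomPoly d F U l (c • s) := by
  have h1 : ContMDiff (𝓡 d) 𝓘(ℝ, ℝ) ∞ (fun _ : U => c) := contMDiff_const
  have := HomPoly.mul 0 (fsec F E h1) (fsec_homSec h1) h
  rw [Nat.cast_zero, zero_add] at this
  convert this using 1
  funext x
  simp [fsec, Algebra.smul_def]

/-- Every polynomial section is a finite sum of homogeneous ones. -/
lemma polySec_decomp {U : Opens M} {s : ∀ x : U, SymFib E (x : M)} (hs : s ∈ polySec d F E U) :
    ∃ t : ℤ →₀ (∀ x : U, SymFib E (x : M)), (∀ l, HomPoly d F U l (t l)) ∧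
      s = t.sum fun _ v => v := by
  classical
  have key : ∀ {l : ℤ} {s : ∀ x : U, SymFib E (x : M)}, HomPoly d F U l s →
      ∃ t : ℤ →₀ (∀ x : U, SymFib E (x : M)), (∀ l, HomPoly d F U l (t l)) ∧
      s = t.sum fun _ v => v := by
    intro l s h
    refine ⟨Finsupp.single l s, fun l' => ?_, by simp⟩
    by_cases hl : l = l'
    · subst hl; simpa using h
    · rw [Finsupp.single_eq_of_ne (Ne.symm hl)]; exact .zero _
  let S : Submodule ℝ (∀ x : U, SymFib E (x : M)) := Submodule.span ℝ {s | ∃ l, HomPoly d F U l s}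
  have hS : S ≤ Subalgebra.toSubmodule (polySec d F E U) :=
    Submodule.span_le.2 fun s ⟨_, h⟩ => h.mem_polySec
  have h1 : (1 : ∀ x : U, SymFib E (x : M)) ∈ S := Submodule.subset_span ⟨0, .one⟩
  have h2 : ∀ a b, a ∈ S → b ∈ S → a * b ∈ S := by
    intro a b ha hb
    have := Submodule.mul_mem_mul ha hb
    rw [Submodule.span_mul_span] at this
    refine Submodule.span_mono ?_ this
    rintro _ ⟨_, ⟨k, hk⟩, _, ⟨l, hl⟩, rfl⟩
    exact ⟨_, hk.mul_poly hl⟩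
  have hspan : polySec d F E U ≤ S.toSubalgebra h1 h2 := by
    refine Algebra.adjoin_le ?_
    rintro _ ⟨e, he, rfl⟩
    refine erSec_induction (P := fun e : ERSec d F E U =>
      (fun x : U => erToSym E (x : M) (e.1 x)) ∈ S) ?_ ?_ ⟨e, he⟩
    · intro e e' h h'
      convert Submodule.add_mem _ h h' using 1
      funext x
      simp
    · intro a e _ he
      exact Submodule.subset_span ⟨a, .of_hom a e he⟩
  have hs' : s ∈ Submodule.span ℝ {s | ∃ l, HomPoly d F U l s} := hspan hs
  clear hspan
  induction hs' using Submodule.span_induction with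
  | mem s h => obtain ⟨l, hl⟩ := h; exact key hl
  | zero => exact key (.zero 0)
  | add a b ha hb iha ihb =>
    obtain ⟨t, ht, h1⟩ := iha (hS ha)
    obtain ⟨t', ht', h2⟩ := ihb (hS hb)
    refine ⟨t + t', fun l => .add (ht l) (ht' l), ?_⟩
    rw [Finsupp.sum_add_index' (fun _ => rfl) (fun _ _ _ => rfl), h1, h2]
  | smul c a ha iha =>
    obtain ⟨t, ht, h1⟩ := iha (hS ha)
    refine ⟨c • t, fun l => (ht l).smul c, ?_⟩
    rw [Finsupp.sum_smul_index' (fun _ => rfl), h1, Finsupp.smul_sum]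

/-- A polynomial section that is homogeneous at each point is a homogeneous polynomial. -/
lemma homPoly_of_mem_symDeg {U : Opens M} {s : ∀ x : U, SymFib E (x : M)}
    (hs : s ∈ polySec d F E U) {l : ℤ} (hl : ∀ x : U, s x ∈ symDeg E (x : M) l) :
    HomPoly d F U l s := by
  classical
  obtain ⟨t, ht, h⟩ := polySec_decomp hs
  have : s = t l := by
    funext x
    -- The degree `l` is inserted because it may be absent from the support, in which case its
    -- component is zero.
    refine eq_of_sum_symDeg (insert l t.support) id Function.injective_id (fun k => t k x)
      (fun k _ => (ht k).mem_symDeg x) (Finset.mem_insert_self _ _) (hl x) ?_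
    conv_lhs => rw [h]
    rw [Finsupp.sum, Finset.sum_apply]
    refine Finset.sum_subset (Finset.subset_insert _ _) fun k _ hk => ?_
    rw [Finsupp.notMem_support_iff.1 hk]
    rfl
  rw [this]
  exact ht l

/-- A homogeneous polynomial agrees near each point with a global one. -/
lemma HomPoly.exists_global {U : Opens M} {l : ℤ} {s : ∀ x : U, SymFib E (x : M)}
    (hs : HomPoly d F U l s) {x : M} (hx : x ∈ U) : ∃ (N : Opens M) (hN : N ≤ U)
      (s' : ∀ x : (⊤ : Opens M), SymFib E (x : M)), x ∈ N ∧ HomPoly d F ⊤ l s' ∧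
      ∀ y : N, s' ⟨y, trivial⟩ = s ⟨y, hN y.2⟩ := by
  induction hs with
  | zero => exact ⟨U, le_rfl, 0, hx, .zero _, fun _ => rfl⟩
  | one => exact ⟨U, le_rfl, 1, hx, .one, fun _ => rfl⟩
  | add _ _ h1 h2 =>
    obtain ⟨N, hN, s, hxN, hs, h⟩ := h1
    obtain ⟨N', hN', s', hxN', hs', h'⟩ := h2
    refine ⟨N ⊓ N', inf_le_left.trans hN, s + s', ⟨hxN, hxN'⟩, .add hs hs', fun y => ?_⟩
    rw [Pi.add_apply, Pi.add_apply, h ⟨y, y.2.1⟩, h' ⟨y, y.2.2⟩]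
  | mul a e he _ h2 =>
    obtain ⟨N, hN, e', hxN, h, hl⟩ := NManifold.exists_global hx e
    obtain ⟨N', hN', s', hxN', hs', h'⟩ := h2
    refine ⟨N ⊓ N', inf_le_left.trans hN, _, ⟨hxN, hxN'⟩, .mul a e' (hl _ he) hs', fun y => ?_⟩
    rw [Pi.mul_apply, Pi.mul_apply, h ⟨y, y.2.1⟩, h' ⟨y, y.2.2⟩]

/-- A smooth section of `Sym 𝐄*` agrees near each point with a global polynomial. -/
lemma symSec_exists_global {U : Opens M} (s : symSec d F E U) {x : M} (hx : x ∈ U) :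
    ∃ (N : Opens M) (hN : N ≤ U) (s' : ∀ x : (⊤ : Opens M), SymFib E (x : M)),
      x ∈ N ∧ s' ∈ polySec d F E ⊤ ∧ ∀ y : N, s' ⟨y, trivial⟩ = s.1 ⟨y, hN y.2⟩ := by
  obtain ⟨W, hW, hxW, hs⟩ := s.2 ⟨x, hx⟩
  obtain ⟨t, ht, h⟩ := polySec_decomp hs
  choose N hN s' hxN hs' h' using fun l => (ht l).exists_global hxW
  let N₀ : Opens M := ⟨(W : Set M) ∩ ⋂ l ∈ t.support, (N l : Set M),
    W.isOpen.inter (isOpen_biInter_finset fun l _ => (N l).isOpen)⟩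
  refine ⟨N₀, fun y hy => hW hy.1, ∑ l ∈ t.support, s' l,
    ⟨hxW, Set.mem_iInter₂.2 fun l _ => hxN l⟩, sum_mem fun l _ => (hs' l).mem_polySec,
    fun y => ?_⟩
  have h3 : s.1 ⟨y, hW y.2.1⟩ = rawRes E hW s.1 ⟨y, y.2.1⟩ := rfl
  rw [h3, h, Finsupp.sum, Finset.sum_apply, Finset.sum_apply]
  exact Finset.sum_congr rfl fun l hl => h' l ⟨y, Set.mem_iInter₂.1 y.2.2 l hl⟩

lemma symSec_exists_global_hom {U : Opens M} (s : symSec d F E U) {l : ℤ}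
    (hl : ∀ x : U, s.1 x ∈ symDeg E (x : M) l) {x : M} (hx : x ∈ U) :
    ∃ (N : Opens M) (hN : N ≤ U) (s' : ∀ x : (⊤ : Opens M), SymFib E (x : M)),
      x ∈ N ∧ HomPoly d F ⊤ l s' ∧ ∀ y : N, s' ⟨y, trivial⟩ = s.1 ⟨y, hN y.2⟩ := by
  obtain ⟨W, hW, hxW, hs⟩ := s.2 ⟨x, hx⟩
  obtain ⟨N, hN, s', hxN, hs', h⟩ :=
    (homPoly_of_mem_symDeg hs fun y => hl ⟨y, hW y.2⟩).exists_global hxW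
  exact ⟨N, hN.trans hW, s', hxN, hs', h⟩

/-- Smoothness of sections of `Sym 𝐄*` is local. -/
lemma symSec_of_local {U : Opens M} {s : ∀ x : U, SymFib E (x : M)}
    (h : ∀ x : U, ∃ (V : Opens M) (hV : V ≤ U), (x : M) ∈ V ∧
      rawRes E hV s ∈ symSec d F E V) : s ∈ symSec d F E U := by
  intro x
  obtain ⟨V, hV, hx, hs⟩ := h x
  obtain ⟨W, hW, hxW, hs'⟩ := hs ⟨x, hx⟩
  exact ⟨W, hW.trans hV, hxW, hs'⟩

end Polynomials

/-! ## The functions on `𝓜` -/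

namespace CoalgebraBundle

section FuncAPI

variable {d : ℕ} {n : ℕ} {M : Type*} [TopologicalSpace M] [T2Space M]
  [ChartedSpace (EuclideanSpace ℝ (Fin d)) M] [IsManifold (𝓡 d) ∞ M]
  {F : Fin n → Type*} [∀ i, NormedAddCommGroup (F i)] [∀ i, NormedSpace ℝ (F i)]
  {E : Fin n → M → Type*} [∀ i x, AddCommGroup (E i x)] [∀ i x, Module ℝ (E i x)]
  [∀ i, TopologicalSpace (Bundle.TotalSpace (F i) (E i))] [∀ i x, TopologicalSpace (E i x)]
  [∀ i, FiberBundle (F i) (E i)] [∀ i, VectorBundle ℝ (F i) (E i)]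

variable (A : CoalgebraBundle d F E)

/-- The ideal `𝓘_μ(U)`. -/
def idealAt (U : Opens M) : TwoSidedIdeal (symSec d F E U) :=
  TwoSidedIdeal.mk' {s | A.InIdeal U s}
    (fun x => ⟨U, le_rfl, x.2, by rw [map_zero]; exact TwoSidedIdeal.zero_mem _⟩)
    (fun {a b} ha hb x => by
      obtain ⟨W, h, hx, hW⟩ := ha x
      obtain ⟨W', h', hx', hW'⟩ := hb x
      refine ⟨W ⊓ W', inf_le_left.trans h, ⟨hx, hx'⟩, ?_⟩
      rw [map_add]
      have h1 := A.symRes_mem_span (inf_le_left : W ⊓ W' ≤ W) hW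
      have h2 := A.symRes_mem_span (inf_le_right : W ⊓ W' ≤ W') hW'
      exact TwoSidedIdeal.add_mem _ h1 h2)
    (fun {a} ha x => by
      obtain ⟨W, h, hx, hW⟩ := ha x
      refine ⟨W, h, hx, ?_⟩
      rw [map_neg]
      exact TwoSidedIdeal.neg_mem _ hW)
    (fun {a b} hb x => by
      obtain ⟨W, h, hx, hW⟩ := hb x
      refine ⟨W, h, hx, ?_⟩
      rw [map_mul]
      exact TwoSidedIdeal.mul_mem_left _ _ _ hW)
    (fun {a b} hb x => by
      obtain ⟨W, h, hx, hW⟩ := hb x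
      refine ⟨W, h, hx, ?_⟩
      rw [map_mul]
      exact TwoSidedIdeal.mul_mem_right _ _ _ hW)

lemma mem_idealAt {U : Opens M} {s : symSec d F E U} : s ∈ A.idealAt U ↔ A.InIdeal U s :=
  TwoSidedIdeal.mem_mk' _ _ _ _ _ _ _

lemma toFunc_surjective (U : Opens M) : Function.Surjective (A.toFunc U) :=
  RingQuot.mkAlgHom_surjective ℝ _

/-- `RingQuot` only forces related elements to be equal. That nothing else becomes zero holds
because the relation comes from an ideal: the induced map to the quotient by `idealAt` detects
membership. -/
lemma toFunc_eq_zero {U : Opens M} {s : symSec d F E U} :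
    A.toFunc U s = 0 ↔ A.InIdeal U s := by
  constructor
  · intro h
    let f : RingQuot (fun s t : symSec d F E U => A.InIdeal U (s - t)) →+*
        (A.idealAt U).ringCon.Quotient :=
      RingQuot.lift ⟨(A.idealAt U).ringCon.mk', fun s t hst => by
        refine (RingCon.eq _).2 ?_
        rw [TwoSidedIdeal.rel_iff]
        exact A.mem_idealAt.2 hst⟩
    have h1 : f (RingQuot.mkRingHom _ s) = (A.idealAt U).ringCon.mk' s :=
      RingQuot.lift_mkRingHom_apply _ _ _
    have h2 : RingQuot.mkRingHom (fun s t : symSec d F E U => A.InIdeal U (s - t)) s = 0 := by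
      rw [← RingQuot.mkAlgHom_coe ℝ]
      exact h
    rw [h2, map_zero] at h1
    have h3 : ((0 : symSec d F E U) : (A.idealAt U).ringCon.Quotient) = s := h1
    rw [RingCon.eq, TwoSidedIdeal.rel_iff, zero_sub] at h3
    have h4 := TwoSidedIdeal.neg_mem _ h3
    rw [neg_neg] at h4
    exact A.mem_idealAt.1 h4
  · intro h
    have := RingQuot.mkAlgHom_rel ℝ (s := fun s t : symSec d F E U => A.InIdeal U (s - t))
      (x := s) (y := 0) (by rwa [sub_zero])
    rw [map_zero] at this
    exact this

@[simp] lemma res_toFunc {U V : Opens M} (h : V ≤ U) (s : symSec d F E U) :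
    A.res h (A.toFunc U s) = A.toFunc V (symRes d F E h s) :=
  RingQuot.liftAlgHom_mkAlgHom_apply ℝ _ _ _

@[simp] lemma ev_toFunc {U : Opens M} (x : U) (s : symSec d F E U) :
    A.ev U x (A.toFunc U s) = secEv U x s :=
  RingQuot.liftAlgHom_mkAlgHom_apply ℝ _ _ _

lemma res_res {U V W : Opens M} (h : V ≤ U) (h' : W ≤ V) (f : A.Func U) :
    A.res h' (A.res h f) = A.res (h'.trans h) f := by
  obtain ⟨s, rfl⟩ := A.toFunc_surjective U f
  rw [res_toFunc, res_toFunc, res_toFunc]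
  rfl

lemma res_self {U : Opens M} (f : A.Func U) : A.res le_rfl f = f := by
  obtain ⟨s, rfl⟩ := A.toFunc_surjective U f
  rw [res_toFunc]
  rfl

/-- A function that vanishes locally is zero. -/
lemma func_eq_zero_of_local {U : Opens M} {f : A.Func U}
    (h : ∀ x : U, ∃ (V : Opens M) (hV : V ≤ U), (x : M) ∈ V ∧ A.res hV f = 0) : f = 0 := by
  obtain ⟨s, rfl⟩ := A.toFunc_surjective U f
  refine A.toFunc_eq_zero.2 fun x => ?_
  obtain ⟨V, hV, hx, hs⟩ := h x
  rw [res_toFunc, toFunc_eq_zero] at hs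
  obtain ⟨W, hW, hxW, hm⟩ := hs ⟨x, hx⟩
  exact ⟨W, hW.trans hV, hxW, hm⟩

lemma func_ext_of_local {U : Opens M} {f g : A.Func U}
    (h : ∀ x : U, ∃ (V : Opens M) (hV : V ≤ U), (x : M) ∈ V ∧ A.res hV f = A.res hV g) :
    f = g := by
  refine sub_eq_zero.1 (A.func_eq_zero_of_local fun x => ?_)
  obtain ⟨V, hV, hx, hs⟩ := h x
  exact ⟨V, hV, hx, by rw [map_sub, hs, sub_self]⟩

/-! ### The action on the extended algebra -/

/-- The action of `Γ_{Sym 𝐄*}(U)` on the fibre of `𝐄*_ℝ` at a point. -/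
def secAct {U : Opens M} (x : U) : symSec d F E U →ₐ[ℝ] Module.End ℝ (ERFib E (x : M)) :=
  (symAct (A.comul (x : M)) (A.coassoc x) (A.cocomm x)).comp
    ((Pi.evalAlgHom ℝ (fun y : U => SymFib E (y : M)) x).comp (symSec d F E U).val)

lemma secAct_apply {U : Opens M} (x : U) (s : symSec d F E U) :
    A.secAct x s = symAct (A.comul (x : M)) (A.coassoc x) (A.cocomm x) (s.1 x) := rfl

/-- A generator `ξ · η - μ*(ξ, η)` acts by zero because `𝐄*_ℝ` is associative. Hence the action
descends to functions, where it serves to read off values. -/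
lemma secAct_of_inIdeal {U : Opens M} (x : U) {s : symSec d F E U} (hs : A.InIdeal U s) :
    A.secAct x s = 0 := by
  obtain ⟨W, hW, hxW, hm⟩ := hs x
  have h1 : A.secAct x s = A.secAct ⟨x, hxW⟩ (symRes d F E hW s) := rfl
  rw [h1]
  have : TwoSidedIdeal.span (A.idealGen W) ≤
      TwoSidedIdeal.comap (A.secAct (⟨x, hxW⟩ : W)) ⊥ := by
    rw [TwoSidedIdeal.span_le]
    rintro z ⟨a, b, ξ, η, ha, hb, hab, hξ, hη, hz⟩
    refine (TwoSidedIdeal.mem_comap _).2 ?_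
    rw [TwoSidedIdeal.mem_bot, secAct_apply, hz, map_sub, map_mul, symAct_erToSym, symAct_erToSym,
      symAct_erToSym, sub_eq_zero]
    apply LinearMap.ext
    intro w
    exact (erMul_assoc (A.coassoc x) _ _ _).symm
  exact (TwoSidedIdeal.mem_bot _).1 ((TwoSidedIdeal.mem_comap _).1 (this hm))

/-- The action of the functions on `𝓜` on the fibre of `𝐄*_ℝ` at a point. -/
def act {U : Opens M} (x : U) : A.Func U →ₐ[ℝ] Module.End ℝ (ERFib E (x : M)) :=
  RingQuot.liftAlgHom ℝ ⟨A.secAct x, fun s t hst => by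
    have := A.secAct_of_inIdeal x hst
    rwa [map_sub, sub_eq_zero] at this⟩

@[simp] lemma act_toFunc {U : Opens M} (x : U) (s : symSec d F E U) :
    A.act x (A.toFunc U s) = A.secAct x s :=
  RingQuot.liftAlgHom_mkAlgHom_apply ℝ _ _ _

lemma cls_apply {U : Opens M} (e : ERSec d F E U) :
    A.cls U e = A.toFunc U (erToSymSec d F E U e) := rfl

@[simp] lemma act_cls {U : Opens M} (x : U) (e : ERSec d F E U) :
    A.act x (A.cls U e) = erMul (A.comul (x : M)) (e.1 x) := by
  rw [cls_apply, act_toFunc, secAct_apply]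
  exact symAct_erToSym _ _ _ _

/-- Acting on the unit recovers a section from its class. This is the source of injectivity of
`cls`, and `act x f (1, 0)` serves as the value at `x` of a function of degree at most `n`. -/
lemma act_cls_one {U : Opens M} (x : U) (e : ERSec d F E U) :
    A.act x (A.cls U e) (1, 0) = e.1 x := by
  rw [act_cls, erMul_scalar', one_smul]

lemma act_res {U V : Opens M} (h : V ≤ U) (x : V) (f : A.Func U) :
    A.act x (A.res h f) = A.act ⟨x, h x.2⟩ f := by
  obtain ⟨s, rfl⟩ := A.toFunc_surjective U f
  rw [res_toFunc, act_toFunc, act_toFunc]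
  rfl

lemma res_cls {U V : Opens M} (h : V ≤ U) (e : ERSec d F E U) :
    A.res h (A.cls U e) = A.cls V (erRes d F E h e) := by
  rw [cls_apply, res_toFunc]
  rfl

lemma ev_cls {U : Opens M} (x : U) (e : ERSec d F E U) : A.ev U x (A.cls U e) = (e.1 x).1 := by
  rw [cls_apply, ev_toFunc]
  exact symAug_erToSym E x _

lemma ev_res {U V : Opens M} (h : V ≤ U) (x : V) (f : A.Func U) :
    A.ev V x (A.res h f) = A.ev U ⟨x, h x.2⟩ f := by
  obtain ⟨s, rfl⟩ := A.toFunc_surjective U f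
  rw [res_toFunc, ev_toFunc, ev_toFunc]
  rfl

/-! ### Degrees -/

lemma mem_funcDeg {U : Opens M} {l : ℤ} {f : A.Func U} : f ∈ A.funcDeg U l ↔
    ∃ s : symSec d F E U, (∀ x : U, s.1 x ∈ symDeg E (x : M) l) ∧ A.toFunc U s = f := by
  constructor
  · rintro ⟨s, hs, rfl⟩
    exact ⟨s, fun x => hs x trivial, rfl⟩
  · rintro ⟨s, hs, rfl⟩
    exact ⟨s, fun x _ => hs x, rfl⟩

lemma one_mem_funcDeg (U : Opens M) : (1 : A.Func U) ∈ A.funcDeg U 0 :=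
  A.mem_funcDeg.2 ⟨1, fun _ => one_mem_symDeg, map_one _⟩

lemma mul_mem_funcDeg {U : Opens M} {a b : ℤ} {f g : A.Func U} (hf : f ∈ A.funcDeg U a)
    (hg : g ∈ A.funcDeg U b) : f * g ∈ A.funcDeg U (a + b) := by
  obtain ⟨s, hs, rfl⟩ := A.mem_funcDeg.1 hf
  obtain ⟨t, ht, rfl⟩ := A.mem_funcDeg.1 hg
  exact A.mem_funcDeg.2 ⟨s * t, fun x => mul_mem_symDeg (hs x) (ht x), map_mul _ _ _⟩

lemma funcDeg_comm {U : Opens M} {a b : ℤ} {f g : A.Func U} (hf : f ∈ A.funcDeg U a)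
    (hg : g ∈ A.funcDeg U b) : f * g = sg (a * b) • (g * f) := by
  obtain ⟨s, hs, rfl⟩ := A.mem_funcDeg.1 hf
  obtain ⟨t, ht, rfl⟩ := A.mem_funcDeg.1 hg
  rw [← map_mul, ← map_mul, ← map_zsmul]
  congr 1
  apply Subtype.ext
  funext x
  exact symDeg_comm (hs x) (ht x)

lemma res_mem_funcDeg {U V : Opens M} (h : V ≤ U) {l : ℤ} {f : A.Func U}
    (hf : f ∈ A.funcDeg U l) : A.res h f ∈ A.funcDeg V l := by
  obtain ⟨s, hs, rfl⟩ := A.mem_funcDeg.1 hf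
  exact A.mem_funcDeg.2 ⟨symRes d F E h s, fun x => hs ⟨x, h x.2⟩, (A.res_toFunc h s).symm⟩

lemma cls_mem_funcDeg {U : Opens M} {l : ℤ} {e : ERSec d F E U} (he : HomSec U l e) :
    A.cls U e ∈ A.funcDeg U l :=
  A.mem_funcDeg.2 ⟨erToSymSec d F E U e, fun x => erToSym_mem_symDeg (he x), rfl⟩

lemma funcDeg_neg {U : Opens M} {l : ℤ} (hl : l < 0) {f : A.Func U}
    (hf : f ∈ A.funcDeg U l) : f = 0 := by
  obtain ⟨s, hs, rfl⟩ := A.mem_funcDeg.1 hf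
  have : s = 0 := Subtype.ext (funext fun x => eq_zero_of_mem_symDeg_neg hl (hs x))
  rw [this, map_zero]

lemma homSec_eq_zero {U : Opens M} {l : ℤ} (hl : l < 0 ∨ (n : ℤ) < l) {e : ERSec d F E U}
    (he : HomSec U l e) : e = 0 :=
  Subtype.ext (funext fun x => eq_zero_of_mem_erDeg (he x) hl)

/-- On homogeneous sections of total degree at most `n` the product of functions is the product
of `𝐄*_ℝ`. -/
lemma cls_mul {U : Opens M} {a b : ℤ} {e e' : ERSec d F E U} (he : HomSec U a e)
    (he' : HomSec U b e') (hab : a + b ≤ n) : A.cls U e * A.cls U e' = A.cls U (secMul A e e') := by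
  have z : ∀ e'' : ERSec d F E U, secMul A 0 e'' = 0 ∧ secMul A e'' 0 = 0 := fun e'' =>
    ⟨Subtype.ext (funext fun x => by simp [secMul]), Subtype.ext (funext fun x => by simp [secMul])⟩
  -- The ideal has generators only for positive degrees. A factor of degree zero is a smooth
  -- function, and then the identity holds already in `Sym 𝐄*`; factors of negative degree vanish.
  rcases lt_trichotomy a 0 with ha | rfl | ha
  · rw [homSec_eq_zero (Or.inl ha) he, (z e').1, map_zero, zero_mul]
  · rw [cls_apply, cls_apply, cls_apply, ← map_mul]
    congr 1
    apply Subtype.ext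
    funext x
    change erToSym E (x : M) (e.1 x) * erToSym E (x : M) (e'.1 x) =
      erToSym E (x : M) (erMul (A.comul (x : M)) (e.1 x) (e'.1 x))
    rw [eq_scalar_of_mem_erDeg_zero (he x), erMul_scalar, erToSym_scalar, map_smul,
      Algebra.smul_def]
  rcases lt_trichotomy b 0 with hb | rfl | hb
  · rw [homSec_eq_zero (Or.inl hb) he', (z e).2, map_zero, mul_zero]
  · rw [cls_apply, cls_apply, cls_apply, ← map_mul]
    congr 1
    apply Subtype.ext
    funext x
    change erToSym E (x : M) (e.1 x) * erToSym E (x : M) (e'.1 x) =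
      erToSym E (x : M) (erMul (A.comul (x : M)) (e.1 x) (e'.1 x))
    rw [eq_scalar_of_mem_erDeg_zero (he' x), erMul_scalar', erToSym_scalar, map_smul,
      Algebra.smul_def, Algebra.commutes]
  · rw [cls_apply, cls_apply, cls_apply, ← map_mul, ← sub_eq_zero, ← map_sub, toFunc_eq_zero]
    refine fun x => ⟨U, le_rfl, x.2, TwoSidedIdeal.subset_span ?_⟩
    exact ⟨a.toNat, b.toNat, e, e', by omega, by omega, by omega,
      by rwa [Int.toNat_of_nonneg ha.le], by rwa [Int.toNat_of_nonneg hb.le], fun _ => rfl⟩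

/-- Homogeneous polynomials of degree `l` in the classes of sections of `𝐄*_ℝ`. -/
inductive FuncPoly (U : Opens M) : ℤ → A.Func U → Prop
  | zero (l : ℤ) : FuncPoly U l 0
  | one : FuncPoly U 0 1
  | add {l : ℤ} {f g : A.Func U} : FuncPoly U l f → FuncPoly U l g → FuncPoly U l (f + g)
  | mul {l : ℤ} (a : ℕ) (e : ERSec d F E U) (he : HomSec U (a : ℤ) e) {f : A.Func U} :
      FuncPoly U l f → FuncPoly U (a + l) (A.cls U e * f)

lemma FuncPoly.of_homPoly {U : Opens M} {l : ℤ} {s : ∀ x : U, SymFib E (x : M)}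
    (h : HomPoly d F U l s) : A.FuncPoly U l (A.toFunc U ⟨s, polySec_le_symSec U h.mem_polySec⟩) := by
  induction h with
  | zero l =>
    convert FuncPoly.zero (A := A) l using 1
    exact map_zero (A.toFunc U)
  | one =>
    convert FuncPoly.one (A := A) (U := U) using 1
    exact map_one (A.toFunc U)
  | @add l s t hs ht h1 h2 =>
    convert FuncPoly.add h1 h2 using 1
    rw [← map_add]
    rfl
  | mul a e he hs h =>
    have : A.toFunc U ⟨_, polySec_le_symSec U (HomPoly.mul a e he hs).mem_polySec⟩ =
        A.cls U e * A.toFunc U ⟨_, polySec_le_symSec U hs.mem_polySec⟩ := by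
      rw [cls_apply, ← map_mul]
      rfl
    rw [this]
    exact .mul a e he h

variable {A}

lemma FuncPoly.mem_funcDeg {U : Opens M} {l : ℤ} {f : A.Func U} (h : A.FuncPoly U l f) :
    f ∈ A.funcDeg U l := by
  induction h with
  | zero l => exact Submodule.zero_mem _
  | one => exact A.one_mem_funcDeg U
  | add _ _ h1 h2 => exact Submodule.add_mem _ h1 h2
  | mul a e he _ h => exact A.mul_mem_funcDeg (A.cls_mem_funcDeg he) h

lemma FuncPoly.restrict {U V : Opens M} (hV : V ≤ U) {l : ℤ} {f : A.Func U}
    (h : A.FuncPoly U l f) : A.FuncPoly V l (A.res hV f) := by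
  induction h with
  | zero => rw [map_zero]; exact .zero _
  | one => rw [map_one]; exact .one
  | add _ _ h1 h2 => rw [map_add]; exact .add h1 h2
  | mul a e he _ h =>
    rw [map_mul, res_cls]
    exact .mul a (erRes d F E hV e) (he.restrict hV) h

/-- As long as the total degree is at most `n`, the ideal allows each product of generators to be
replaced by a product in `𝐄*_ℝ`, so the whole polynomial collapses to one class. -/
lemma FuncPoly.exists_cls {U : Opens M} {l : ℤ} {f : A.Func U} (h : A.FuncPoly U l f)
    (hl : l ≤ n) : ∃ e, HomSec U l e ∧ A.cls U e = f := by
  induction h with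
  | zero => exact ⟨0, fun _ => Submodule.zero_mem _, map_zero _⟩
  | one =>
    have hc : ContMDiff (𝓡 d) 𝓘(ℝ, ℝ) ∞ (fun _ : U => (1 : ℝ)) := contMDiff_const
    refine ⟨fsec F E hc, fsec_homSec hc, ?_⟩
    rw [cls_apply, ← map_one (A.toFunc U)]
    congr 1
    apply Subtype.ext
    funext x
    change erToSym E (x : M) (1, 0) = 1
    simp
  | add _ _ h1 h2 =>
    obtain ⟨e, he, rfl⟩ := h1 hl
    obtain ⟨e', he', rfl⟩ := h2 hl
    exact ⟨e + e', fun x => Submodule.add_mem _ (he x) (he' x), map_add _ _ _⟩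
  | @mul l a e he f hf h =>
    by_cases h0 : l < 0
    · rw [A.funcDeg_neg h0 hf.mem_funcDeg, mul_zero]
      exact ⟨0, fun _ => Submodule.zero_mem _, map_zero _⟩
    obtain ⟨e', he', rfl⟩ := h (by omega)
    exact ⟨secMul A e e', he.secMul A he', (A.cls_mul he he' hl).symm⟩

variable (A)

/-- A function agrees near each point with a function on `M` that is a polynomial in global
sections. -/
lemma func_exists_global {U : Opens M} (f : A.Func U) {x : M} (hx : x ∈ U) :
    ∃ (N : Opens M) (hN : N ≤ U) (f' : A.Func ⊤), x ∈ N ∧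
      f' ∈ Submodule.span ℝ {g | ∃ l, A.FuncPoly ⊤ l g} ∧ A.res le_top f' = A.res hN f := by
  obtain ⟨s, rfl⟩ := A.toFunc_surjective U f
  obtain ⟨N, hN, s', hxN, hs', h⟩ := symSec_exists_global s hx
  obtain ⟨t, ht, rfl⟩ := polySec_decomp hs'
  refine ⟨N, hN, A.toFunc ⊤ ⟨_, polySec_le_symSec ⊤ hs'⟩, hxN, ?_, ?_⟩
  · have : (⟨_, polySec_le_symSec ⊤ hs'⟩ : symSec d F E ⊤) =
        ∑ l ∈ t.support, ⟨t l, polySec_le_symSec ⊤ (ht l).mem_polySec⟩ := by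
      apply Subtype.ext
      simp [Finsupp.sum]
    rw [this, map_sum]
    exact Submodule.sum_mem _ fun l _ => Submodule.subset_span ⟨l, .of_homPoly A (ht l)⟩
  · rw [res_toFunc, res_toFunc]
    congr 1
    exact Subtype.ext (funext fun y => h y)

lemma func_exists_global_hom {U : Opens M} {l : ℤ} {f : A.Func U} (hf : f ∈ A.funcDeg U l) {x : M}
    (hx : x ∈ U) : ∃ (N : Opens M) (hN : N ≤ U) (f' : A.Func ⊤), x ∈ N ∧
      A.FuncPoly ⊤ l f' ∧ A.res le_top f' = A.res hN f := by
  obtain ⟨s, hs, rfl⟩ := A.mem_funcDeg.1 hf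
  obtain ⟨N, hN, s', hxN, hs', h⟩ := symSec_exists_global_hom s hs hx
  refine ⟨N, hN, _, hxN, .of_homPoly A hs', ?_⟩
  rw [res_toFunc, res_toFunc]
  congr 1
  exact Subtype.ext (funext fun y => h y)

/-- In degrees at most `n` the functions are the sections of `𝐄*_ℝ`. -/
lemma exists_cls_of_mem_funcDeg {U : Opens M} {l : ℤ} (hl : l ≤ n) {f : A.Func U}
    (hf : f ∈ A.funcDeg U l) : ∃ e, HomSec U l e ∧ A.cls U e = f := by
  have key : ∀ x : U, ∃ (N : Opens M) (hN : N ≤ U) (e : ERSec d F E N), (x : M) ∈ N ∧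
      HomSec N l e ∧ A.cls N e = A.res hN f := by
    intro x
    obtain ⟨N, hN, f', hxN, hf', h⟩ := A.func_exists_global_hom hf x.2
    obtain ⟨e, he, h'⟩ := (hf'.restrict le_top).exists_cls hl (U := N)
    exact ⟨N, hN, e, hxN, he, h'.trans h⟩
  have hval : ∀ (N : Opens M) (hN : N ≤ U) (e : ERSec d F E N), A.cls N e = A.res hN f →
      ∀ y : N, A.act ⟨y, hN y.2⟩ f (1, 0) = e.1 y := by
    intro N hN e h y
    rw [← act_cls_one, h, act_res]
  -- The local representatives are glued through the action on the unit, which does not depend on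
  -- how they were chosen.
  let s : ∀ x : U, ERFib E (x : M) := fun x => A.act x f (1, 0)
  have hs : s ∈ ERSec d F E U := erSec_of_local fun x => by
    obtain ⟨N, hN, e, hx, -, h⟩ := key x
    refine ⟨N, hN, hx, ?_⟩
    convert e.2 using 1
    exact funext fun y => hval N hN e h y
  refine ⟨⟨s, hs⟩, fun x => ?_, A.func_ext_of_local fun x => ?_⟩
  · obtain ⟨N, hN, e, hx, he, h⟩ := key x
    change A.act x f (1, 0) ∈ _
    rw [hval N hN e h ⟨x, hx⟩]
    exact he _
  · obtain ⟨N, hN, e, hx, -, h⟩ := key x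
    refine ⟨N, hN, hx, ?_⟩
    rw [res_cls, ← h]
    congr 1
    exact Subtype.ext (funext fun y => hval N hN e h y)

end FuncAPI

end CoalgebraBundle

/-! ## Gluing of functions -/

namespace CoalgebraBundle

section Gluing

variable {d : ℕ} {n : ℕ} {M : Type*} [TopologicalSpace M] [T2Space M]
  [ChartedSpace (EuclideanSpace ℝ (Fin d)) M] [IsManifold (𝓡 d) ∞ M]
  {F : Fin n → Type*} [∀ i, NormedAddCommGroup (F i)] [∀ i, NormedSpace ℝ (F i)]
  {E : Fin n → M → Type*} [∀ i x, AddCommGroup (E i x)] [∀ i x, Module ℝ (E i x)]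
  [∀ i, TopologicalSpace (Bundle.TotalSpace (F i) (E i))] [∀ i x, TopologicalSpace (E i x)]
  [∀ i, FiberBundle (F i) (E i)] [∀ i, VectorBundle ℝ (F i) (E i)]

variable (A : CoalgebraBundle d F E)

/-- A smooth function on `U` as a function on `𝓜|_U`. -/
def fn {U : Opens M} {f : U → ℝ} (hf : ContMDiff (𝓡 d) 𝓘(ℝ, ℝ) ∞ f) : A.Func U :=
  A.cls U (fsec F E hf)

lemma fn_mem_funcDeg {U : Opens M} {f : U → ℝ} (hf : ContMDiff (𝓡 d) 𝓘(ℝ, ℝ) ∞ f) :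
    A.fn hf ∈ A.funcDeg U 0 := A.cls_mem_funcDeg (fsec_homSec hf)

lemma res_fn {U V : Opens M} (h : V ≤ U) {f : U → ℝ} (hf : ContMDiff (𝓡 d) 𝓘(ℝ, ℝ) ∞ f)
    {g : V → ℝ} (hg : ContMDiff (𝓡 d) 𝓘(ℝ, ℝ) ∞ g) (hfg : ∀ x : V, f ⟨x, h x.2⟩ = g x) :
    A.res h (A.fn hf) = A.fn hg := by
  rw [fn, fn, res_cls]
  congr 1
  apply Subtype.ext
  funext x
  exact congrArg (fun c => ((c, 0) : ERFib E (x : M))) (hfg x)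

lemma fn_const {U : Opens M} {f : U → ℝ} (hf : ContMDiff (𝓡 d) 𝓘(ℝ, ℝ) ∞ f) {c : ℝ}
    (hc : ∀ x, f x = c) : A.fn hf = algebraMap ℝ _ c := by
  rw [fn, cls_apply, ← AlgHom.commutes (A.toFunc U)]
  congr 1
  apply Subtype.ext
  funext x
  change erToSym E (x : M) (f x, 0) = algebraMap ℝ _ c
  rw [hc x, erToSym_scalar]

lemma res_fn_const {U V : Opens M} (h : V ≤ U) {f : U → ℝ}
    (hf : ContMDiff (𝓡 d) 𝓘(ℝ, ℝ) ∞ f) {c : ℝ} (hc : ∀ x : V, f ⟨x, h x.2⟩ = c) :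
    A.res h (A.fn hf) = algebraMap ℝ _ c := by
  rw [A.res_fn h hf contMDiff_const hc]
  exact A.fn_const _ fun _ => rfl

lemma fn_sum {U : Opens M} {ι : Type*} (S : Finset ι) {f : ι → U → ℝ}
    (hf : ∀ i, ContMDiff (𝓡 d) 𝓘(ℝ, ℝ) ∞ (f i)) {g : U → ℝ}
    (hg : ContMDiff (𝓡 d) 𝓘(ℝ, ℝ) ∞ g) (h : ∀ x, ∑ i ∈ S, f i x = g x) :
    ∑ i ∈ S, A.fn (hf i) = A.fn hg := by
  simp only [fn]
  rw [← map_sum]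
  congr 1
  apply Subtype.ext
  funext x
  rw [Submodule.coe_sum, Finset.sum_apply]
  ext1
  · rw [Prod.fst_sum]
    exact h x
  · rw [Prod.snd_sum]
    exact Finset.sum_const_zero

/-- Local functions are glued by a partition of unity. -/
lemma exists_glue [SecondCountableTopology M] {ι : Type*} {U : Opens M} (V : U → Opens M)
    (hV : ∀ x, V x ≤ U) (hx : ∀ x : U, (x : M) ∈ V x) (f : ∀ x : U, ι → A.Func (V x))
    (L : ι → ℤ) : ∃ g : ι → A.Func U,
      (∀ i, (∀ x, f x i ∈ A.funcDeg (V x) (L i)) → g i ∈ A.funcDeg U (L i)) ∧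
      ∀ y : U, ∃ (N : Opens M) (hN : N ≤ U) (S : Finset U) (hS : ∀ x ∈ S, N ≤ V x)
        (ρ : U → N → ℝ) (hρ : ∀ x, ContMDiff (𝓡 d) 𝓘(ℝ, ℝ) ∞ (ρ x)), (y : M) ∈ N ∧
        (∑ x ∈ S, A.fn (hρ x) = 1) ∧
        ∀ i, A.res hN (g i) = ∑ x ∈ S.attach, A.fn (hρ x) * A.res (hS x x.2) (f x i) := by
  classical
  haveI : LocallyCompactSpace M := ChartedSpace.locallyCompactSpace (EuclideanSpace ℝ (Fin d)) M
  haveI : LocallyCompactSpace U := U.isOpen.locallyCompactSpace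
  obtain ⟨ρ, hρ⟩ := SmoothPartitionOfUnity.exists_isSubordinate (𝓡 d) (M := U)
    (isClosed_univ (X := U)) (fun x : U => {z : U | (z : M) ∈ V x})
    (fun x => (V x).isOpen.preimage continuous_subtype_val)
    (fun x _ => Set.mem_iUnion.2 ⟨x, hx x⟩)
  -- Lifts to `Sym 𝐄*` are chosen homogeneous whenever the function is, so that one choice also
  -- serves the statement on degrees.
  have hlift : ∀ x i, ∃ s : symSec d F E (V x), A.toFunc (V x) s = f x i ∧
      (f x i ∈ A.funcDeg (V x) (L i) → ∀ y : V x, s.1 y ∈ symDeg E (y : M) (L i)) := by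
    intro x i
    by_cases h : f x i ∈ A.funcDeg (V x) (L i)
    · obtain ⟨s, hs, h'⟩ := A.mem_funcDeg.1 h
      exact ⟨s, h', fun _ => hs⟩
    · obtain ⟨s, hs⟩ := A.toFunc_surjective (V x) (f x i)
      exact ⟨s, hs, fun h' => absurd h' h⟩
  choose s hs hsdeg using hlift
  let t : U → ι → ∀ y : U, SymFib E (y : M) := fun x i y =>
    if h : (y : M) ∈ V x then ρ x y • (s x i).1 ⟨y, h⟩ else 0
  let σ : ι → ∀ y : U, SymFib E (y : M) := fun i y => ∑ᶠ x, t x i y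
  have ht0 : ∀ x i y, ρ x y = 0 → t x i y = 0 := by
    intro x i y h
    simp only [t]
    split_ifs
    · rw [h, zero_smul]
    · rfl
  have key : ∀ y : U, ∃ (N : Opens M) (hN : N ≤ U) (S : Finset U) (_ : ∀ x ∈ S, N ≤ V x),
      (y : M) ∈ N ∧ ∀ z : N, (∑ x ∈ S, ρ x ⟨z, hN z.2⟩ = 1) ∧
        ∀ i, σ i ⟨z, hN z.2⟩ = ∑ x ∈ S, t x i ⟨z, hN z.2⟩ := by
    intro y
    obtain ⟨N₁, hN₁, hN₁o, hyN₁⟩ := eventually_nhds_iff.1 (ρ.eventually_finsupport_subset y)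
    -- These are the members of the partition whose closed support contains `y`: subordination puts
    -- `y` in the corresponding `V x`, and near `y` all other members vanish.
    let S := ρ.fintsupport y
    have hSV : ∀ x ∈ S, (y : M) ∈ V x := fun x hxS =>
      hρ x ((SmoothPartitionOfUnity.mem_fintsupport_iff ρ y x).1 hxS)
    let N₂ : Opens U := ⟨N₁ ∩ ⋂ x ∈ S, {z : U | (z : M) ∈ V x}, hN₁o.inter
      (isOpen_biInter_finset fun x _ => (V x).isOpen.preimage continuous_subtype_val)⟩
    let N : Opens M := ⟨Subtype.val '' (N₂ : Set U), U.isOpen.isOpenMap_subtype_val _ N₂.isOpen⟩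
    have hN : N ≤ U := by
      rintro _ ⟨z, -, rfl⟩
      exact z.2
    have hN' : ∀ z : N, (⟨z, hN z.2⟩ : U) ∈ N₂ := by
      rintro ⟨_, ⟨z, hz, rfl⟩⟩
      exact hz
    refine ⟨N, hN, S, fun x hxS z hz => ?_, ⟨y, ⟨hyN₁, Set.mem_iInter₂.2 hSV⟩, rfl⟩,
      fun z => ⟨?_, fun i => ?_⟩⟩
    · exact Set.mem_iInter₂.1 (hN' ⟨z, hz⟩).2 x hxS
    · exact ρ.sum_finsupport' _ (Set.mem_univ _) (hN₁ _ (hN' z).1)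
    · refine finsum_eq_sum_of_support_subset _ fun x hxt => ?_
      refine hN₁ _ (hN' z).1 ((SmoothPartitionOfUnity.mem_finsupport ρ _).2 ?_)
      intro h0
      exact hxt (ht0 x i _ h0)
  have hρN : ∀ (N : Opens M) (hN : N ≤ U) (x : U), ContMDiff (𝓡 d) 𝓘(ℝ, ℝ) ∞
      (fun z : N => ρ x ⟨z, hN z.2⟩) := fun N hN x =>
    (ρ x).contMDiff.comp (contMDiff_inclusion hN)
  have hσN : ∀ (N : Opens M) (hN : N ≤ U) (S : Finset U) (hS : ∀ x ∈ S, N ≤ V x) (i : ι),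
      (∀ z : N, σ i ⟨z, hN z.2⟩ = ∑ x ∈ S, t x i ⟨z, hN z.2⟩) →
      rawRes E hN (σ i) = (∑ x ∈ S.attach, erToSymSec d F E N (fsec F E (hρN N hN x)) *
        symRes d F E (hS x x.2) (s x i) : symSec d F E N).1 := by
    intro N hN S hS i h
    funext z
    change σ i ⟨z, hN z.2⟩ = _
    rw [h z, ← Finset.sum_attach]
    rw [AddSubmonoidClass.coe_finset_sum, Finset.sum_apply]
    refine Finset.sum_congr rfl fun x _ => ?_
    have hz : (z : M) ∈ V x := hS x x.2 z.2
    simp only [t, dif_pos hz]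
    change _ = erToSym E (z : M) (ρ x ⟨z, hN z.2⟩, 0) * (s x i).1 ⟨z, hz⟩
    rw [erToSym_scalar, Algebra.smul_def]
  have hσ : ∀ i, σ i ∈ symSec d F E U := fun i => symSec_of_local fun y => by
    obtain ⟨N, hN, S, hS, hy, h⟩ := key y
    refine ⟨N, hN, hy, ?_⟩
    rw [hσN N hN S hS i fun z => (h z).2 i]
    exact Subtype.mem _
  refine ⟨fun i => A.toFunc U ⟨σ i, hσ i⟩, fun i hi => ?_, fun y => ?_⟩
  · refine A.mem_funcDeg.2 ⟨_, fun y => ?_, rfl⟩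
    obtain ⟨N, hN, S, hS, hy, h⟩ := key y
    change σ i y ∈ _
    rw [(h ⟨y, hy⟩).2 i]
    refine Submodule.sum_mem _ fun x hxS => ?_
    simp only [t]
    split_ifs
    · exact Submodule.smul_mem _ _ (hsdeg x i (hi x) ⟨y, by assumption⟩)
    · exact Submodule.zero_mem _
  · obtain ⟨N, hN, S, hS, hy, h⟩ := key y
    refine ⟨N, hN, S, hS, fun x z => ρ x ⟨z, hN z.2⟩, hρN N hN, hy, ?_, fun i => ?_⟩
    · rw [A.fn_sum S (hρN N hN) contMDiff_const fun z => (h z).1, A.fn_const _ fun _ => rfl,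
        map_one]
    · rw [res_toFunc]
      have : symRes d F E hN ⟨σ i, hσ i⟩ = ∑ x ∈ S.attach,
          erToSymSec d F E N (fsec F E (hρN N hN x)) * symRes d F E (hS x x.2) (s x i) :=
        Subtype.ext (hσN N hN S hS i fun z => (h z).2 i)
      rw [this, map_sum]
      refine Finset.sum_congr rfl fun x _ => ?_
      rw [map_mul, ← res_toFunc, hs]
      rfl

/-- Compatible local functions glue to a function. -/
lemma exists_sheaf_glue [SecondCountableTopology M] {U : Opens M} (V : U → Opens M)
    (hV : ∀ x, V x ≤ U) (hx : ∀ x : U, (x : M) ∈ V x) (f : ∀ x : U, A.Func (V x))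
    (hf : ∀ x y (N : Opens M) (h : N ≤ V x) (h' : N ≤ V y), A.res h (f x) = A.res h' (f y)) :
    ∃ g : A.Func U, (∀ x, A.res (hV x) g = f x) ∧
      ∀ l, (∀ x, f x ∈ A.funcDeg (V x) l) → g ∈ A.funcDeg U l := by
  have key : ∀ l : ℤ, ∃ g : A.Func U, (∀ x, A.res (hV x) g = f x) ∧
      ((∀ x, f x ∈ A.funcDeg (V x) l) → g ∈ A.funcDeg U l) := by
    intro l
    obtain ⟨g, hg, h⟩ := A.exists_glue (ι := Unit) V hV hx (fun x _ => f x) (fun _ => l)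
    refine ⟨g (), fun x => A.func_ext_of_local fun y => ?_, hg ()⟩
    obtain ⟨N, hN, S, hS, ρ, hρ, hy, h1, h2⟩ := h ⟨y, hV x y.2⟩
    refine ⟨N ⊓ V x, inf_le_right, ⟨hy, y.2⟩, ?_⟩
    rw [res_res]
    have h3 : A.res (inf_le_left.trans hN : N ⊓ V x ≤ U) (g ()) =
      A.res (inf_le_left : N ⊓ V x ≤ N) (A.res hN (g ())) := (A.res_res _ _ _).symm
    rw [h3, h2 (), map_sum]
    have h4 := congrArg (A.res (inf_le_left : N ⊓ V x ≤ N)) h1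
    rw [map_sum, map_one, ← Finset.sum_attach] at h4
    rw [← one_mul (A.res (inf_le_right : N ⊓ V x ≤ V x) (f x)), ← h4, Finset.sum_mul]
    refine Finset.sum_congr rfl fun z _ => ?_
    rw [map_mul, res_res]
    congr 1
    exact hf _ _ _ _ _
  -- The degree `0` is arbitrary: gluing prescribes a degree in advance, but the result is
  -- determined by its restrictions and so is the same for every degree.
  obtain ⟨g, hg, -⟩ := key 0
  refine ⟨g, hg, fun l hl => ?_⟩
  obtain ⟨g', hg', h⟩ := key l
  have : g = g' := A.func_ext_of_local fun x => ⟨V x, hV x, hx x, by rw [hg, hg']⟩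
  rw [this]
  exact h hl

end Gluing

/-! ## Vector fields -/

section VectorFields

variable {d : ℕ} {n : ℕ} {M : Type*} [TopologicalSpace M] [T2Space M]
  [ChartedSpace (EuclideanSpace ℝ (Fin d)) M] [IsManifold (𝓡 d) ∞ M]
  {F : Fin n → Type*} [∀ i, NormedAddCommGroup (F i)] [∀ i, NormedSpace ℝ (F i)]
  {E : Fin n → M → Type*} [∀ i x, AddCommGroup (E i x)] [∀ i x, Module ℝ (E i x)]
  [∀ i, TopologicalSpace (Bundle.TotalSpace (F i) (E i))] [∀ i x, TopologicalSpace (E i x)]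
  [∀ i, FiberBundle (F i) (E i)] [∀ i, VectorBundle ℝ (F i) (E i)]

variable {A : CoalgebraBundle d F E}

lemma vf_deg {U : Opens M} {k l : ℤ} {X : Module.End ℝ (A.Func U)} (hX : X ∈ A.vectorField U k)
    {f : A.Func U} (hf : f ∈ A.funcDeg U l) : X f ∈ A.funcDeg U (l + k) := hX.1 l f hf

lemma vf_leibniz {U : Opens M} {k l : ℤ} {X : Module.End ℝ (A.Func U)}
    (hX : X ∈ A.vectorField U k) {f : A.Func U} (hf : f ∈ A.funcDeg U l) (g : A.Func U) :
    X (f * g) = X f * g + sg (l * k) • (f * X g) := hX.2 l f hf g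

lemma vf_one {U : Opens M} {k : ℤ} {X : Module.End ℝ (A.Func U)} (hX : X ∈ A.vectorField U k) :
    X 1 = 0 := by
  have := vf_leibniz hX (A.one_mem_funcDeg U) 1
  rw [one_mul, one_mul, mul_one, zero_mul, sg_zero, one_smul] at this
  exact left_eq_add.1 this

/-- Vector fields are local. -/
lemma vf_local {U N : Opens M} (hN : N ≤ U) {k : ℤ} {X : Module.End ℝ (A.Func U)}
    (hX : X ∈ A.vectorField U k) {f : A.Func U} (hf : A.res hN f = 0) : A.res hN (X f) = 0 := by
  refine A.func_eq_zero_of_local fun x => ?_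
  obtain ⟨χ, N', Z, hχ, hxN, hN', h1, h0, hc⟩ := exists_bump (d := d) x.2
  refine ⟨N', hN', hxN, ?_⟩
  have hχU := contMDiff_restrict hχ U
  -- The product `χ f` is zero, so the Leibniz rule applied to it leaves only `X f` on the set where
  -- `χ = 1` and `f` vanishes.
  have h2 : A.fn hχU * f = 0 := A.func_eq_zero_of_local fun y => by
    rcases hc y with hy | hy
    · exact ⟨N, hN, hy, by rw [map_mul, hf, mul_zero]⟩
    · refine ⟨Z ⊓ U, inf_le_right, ⟨hy, y.2⟩, ?_⟩
      rw [map_mul, A.res_fn_const inf_le_right hχU (c := 0) fun z => h0 z z.2.1, map_zero, zero_mul]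
  have h3 := vf_leibniz hX (A.fn_mem_funcDeg hχU) f
  rw [h2, map_zero, zero_mul, sg_zero, one_smul] at h3
  have h4 := congrArg (A.res (hN'.trans hN)) h3
  rw [map_zero, map_add, map_mul, map_mul,
    A.res_fn_const (hN'.trans hN) hχU (c := 1) fun z => h1 z z.2, map_one, one_mul,
    ← A.res_res hN hN' f, hf, map_zero, mul_zero, zero_add] at h4
  rw [res_res]
  exact h4.symm

lemma vf_congr {U N : Opens M} (hN : N ≤ U) {k : ℤ} {X : Module.End ℝ (A.Func U)}
    (hX : X ∈ A.vectorField U k) {f g : A.Func U} (h : A.res hN f = A.res hN g) :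
    A.res hN (X f) = A.res hN (X g) := by
  rw [← sub_eq_zero, ← map_sub, ← map_sub]
  exact vf_local hN hX (by rw [map_sub, h, sub_self])

variable (A) in
/-- Two endomorphisms of functions agree on `N`, tested on global functions. -/
def AgreeOn {U V N : Opens M} (hU : N ≤ U) (hV : N ≤ V) (X : Module.End ℝ (A.Func U))
    (Y : Module.End ℝ (A.Func V)) : Prop :=
  ∀ f : A.Func ⊤, A.res hU (X (A.res le_top f)) = A.res hV (Y (A.res le_top f))

lemma AgreeOn.symm {U V N : Opens M} {hU : N ≤ U} {hV : N ≤ V} {X : Module.End ℝ (A.Func U)}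
    {Y : Module.End ℝ (A.Func V)} (h : A.AgreeOn hU hV X Y) : A.AgreeOn hV hU Y X :=
  fun f => (h f).symm

lemma AgreeOn.trans {U V W N : Opens M} {hU : N ≤ U} {hV : N ≤ V} {hW : N ≤ W}
    {X : Module.End ℝ (A.Func U)} {Y : Module.End ℝ (A.Func V)} {Z : Module.End ℝ (A.Func W)}
    (h : A.AgreeOn hU hV X Y) (h' : A.AgreeOn hV hW Y Z) : A.AgreeOn hU hW X Z :=
  fun f => (h f).trans (h' f)

lemma AgreeOn.mono {U V N N' : Opens M} {hU : N ≤ U} {hV : N ≤ V} {X : Module.End ℝ (A.Func U)}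
    {Y : Module.End ℝ (A.Func V)} (h : A.AgreeOn hU hV X Y) (hN : N' ≤ N) :
    A.AgreeOn (hN.trans hU) (hN.trans hV) X Y := by
  intro f
  rw [← A.res_res hU hN, h f, res_res]

lemma IsRestriction.agreeOn {U V : Opens M} {h : V ≤ U} {X : Module.End ℝ (A.Func U)}
    {Y : Module.End ℝ (A.Func V)} (hXY : A.IsRestriction h X Y) : A.AgreeOn h le_rfl X Y := by
  intro f
  rw [← hXY, res_res, res_self]

/-- Every function agrees near each point with the restriction of a global one, and vector fields
are local; so testing on global functions suffices. -/
lemma AgreeOn.isRestriction {U V : Opens M} {h : V ≤ U} {k : ℤ} {X : Module.End ℝ (A.Func U)}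
    {Y : Module.End ℝ (A.Func V)} (hX : X ∈ A.vectorField U k) (hY : Y ∈ A.vectorField V k)
    (hXY : A.AgreeOn h le_rfl X Y) : A.IsRestriction h X Y := by
  intro f
  refine A.func_ext_of_local fun x => ?_
  obtain ⟨N, hN, f', hxN, -, hf'⟩ := A.func_exists_global f (h x.2)
  refine ⟨N ⊓ V, inf_le_right, ⟨hxN, x.2⟩, ?_⟩
  have h1 : A.res (inf_le_right.trans h : N ⊓ V ≤ U) (A.res le_top f') =
      A.res (inf_le_right.trans h : N ⊓ V ≤ U) f := by
    have := congrArg (A.res (inf_le_left : N ⊓ V ≤ N)) hf'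
    rw [res_res, res_res] at this
    rw [res_res, this]
  have h2 := hXY.mono (inf_le_right : N ⊓ V ≤ V) f'
  rw [res_res, ← vf_congr _ hX h1, h2]
  refine vf_congr _ hY ?_
  rw [res_res, ← h1, res_res, res_res]

/-- Vector fields that agree on sections of `𝐄*_ℝ` agree. -/
lemma agreeOn_of_cls {U V N : Opens M} {hU : N ≤ U} {hV : N ≤ V} {k : ℤ}
    {X : Module.End ℝ (A.Func U)} {Y : Module.End ℝ (A.Func V)} (hX : X ∈ A.vectorField U k)
    (hY : Y ∈ A.vectorField V k) (h : ∀ e : ERSec d F E (⊤ : Opens M),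
      A.res hU (X (A.cls U (erRes d F E le_top e))) =
        A.res hV (Y (A.cls V (erRes d F E le_top e)))) : A.AgreeOn hU hV X Y := by
  have one' : ∀ W : Opens M, A.res (le_top : W ≤ ⊤) 1 = 1 := fun W => map_one _
  have key : ∀ l f, A.FuncPoly ⊤ l f →
      A.res hU (X (A.res le_top f)) = A.res hV (Y (A.res le_top f)) := by
    intro l f hf
    induction hf with
    | zero => simp only [map_zero]
    | one => rw [one', one', vf_one hX, vf_one hY, map_zero, map_zero]
    | add _ _ h1 h2 => simp only [map_add, h1, h2]
    | mul a e he hf ih =>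
      rw [map_mul (A.res (le_top : U ≤ ⊤)), map_mul (A.res (le_top : V ≤ ⊤)), res_cls, res_cls,
        vf_leibniz hX (A.cls_mem_funcDeg (he.restrict le_top)),
        vf_leibniz hY (A.cls_mem_funcDeg (he.restrict le_top))]
      simp only [map_add, map_mul, map_zsmul, h, ih, res_cls, res_res]
      rfl
  have key' : ∀ f ∈ Submodule.span ℝ {f | ∃ l, A.FuncPoly ⊤ l f},
      A.res hU (X (A.res le_top f)) = A.res hV (Y (A.res le_top f)) := by
    intro f hf
    induction hf using Submodule.span_induction with
    | mem g hg => obtain ⟨l, hl⟩ := hg; exact key l g hl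
    | zero => simp only [map_zero]
    | add a b _ _ ha hb => simp only [map_add, ha, hb]
    | smul c a _ ha => simp only [map_smul, ha]
  intro f
  refine A.func_ext_of_local fun x => ?_
  obtain ⟨N', hN', f', hxN, hs, hf'⟩ := A.func_exists_global f (x := x) trivial
  refine ⟨N' ⊓ N, inf_le_right, ⟨hxN, x.2⟩, ?_⟩
  have h1 : ∀ (W : Opens M) (hW : N' ⊓ N ≤ W), A.res hW (A.res le_top f) =
      A.res hW (A.res le_top f') := by
    intro W hW
    have := congrArg (A.res (inf_le_left : N' ⊓ N ≤ N')) hf'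
    rw [res_res, res_res] at this
    rw [res_res, res_res, this]
  rw [res_res, res_res, vf_congr _ hX (h1 U _), vf_congr _ hY (h1 V _), ← A.res_res hU inf_le_right,
    ← A.res_res hV inf_le_right]
  exact congrArg _ (key' f' hs)

end VectorFields

end CoalgebraBundle

/-! ## Gluing of vector fields -/

namespace CoalgebraBundle

section VectorFieldGluing

variable {d : ℕ} {n : ℕ} {M : Type*} [TopologicalSpace M] [T2Space M]
  [ChartedSpace (EuclideanSpace ℝ (Fin d)) M] [IsManifold (𝓡 d) ∞ M]
  {F : Fin n → Type*} [∀ i, NormedAddCommGroup (F i)] [∀ i, NormedSpace ℝ (F i)]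
  {E : Fin n → M → Type*} [∀ i x, AddCommGroup (E i x)] [∀ i x, Module ℝ (E i x)]
  [∀ i, TopologicalSpace (Bundle.TotalSpace (F i) (E i))] [∀ i x, TopologicalSpace (E i x)]
  [∀ i, FiberBundle (F i) (E i)] [∀ i, VectorBundle ℝ (F i) (E i)]


variable {A : CoalgebraBundle d F E}

/-- Restriction to a smaller open set of an equality of restrictions. -/
lemma res_congr {U V W N : Opens M} {hU : W ≤ U} {hV : W ≤ V} {f : A.Func U} {g : A.Func V}
    (h : A.res hU f = A.res hV g) (hN : N ≤ W) :
    A.res (hN.trans hU) f = A.res (hN.trans hV) g := by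
  rw [← A.res_res hU hN, h, res_res]

/-- Vector fields that agree on overlaps glue to a vector field. -/
lemma exists_vf_glue [SecondCountableTopology M] {U : Opens M} {k : ℤ} (V W : U → Opens M)
    (hV : ∀ x, V x ≤ U) (hx : ∀ x : U, (x : M) ∈ V x) (hW : ∀ x, V x ≤ W x)
    (X : ∀ x : U, Module.End ℝ (A.Func (W x))) (hX : ∀ x, X x ∈ A.vectorField (W x) k)
    (hXX : ∀ x y, A.AgreeOn ((inf_le_left : V x ⊓ V y ≤ V x).trans (hW x))
      ((inf_le_right : V x ⊓ V y ≤ V y).trans (hW y)) (X x) (X y)) :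
    ∃ Y ∈ A.vectorField U k, ∀ x, A.AgreeOn (hV x) (hW x) Y (X x) := by
  -- On a small set the value of a local field depends neither on the field chosen from the cover
  -- nor on the global function that represents the argument there.
  have compat : ∀ x y (N : Opens M) (h : N ≤ V x) (h' : N ≤ V y) (f g : A.Func ⊤),
      A.res (le_top : N ≤ ⊤) f = A.res le_top g →
      A.res (h.trans (hW x)) (X x (A.res le_top f)) =
        A.res (h'.trans (hW y)) (X y (A.res le_top g)) := by
    intro x y N h h' f g hfg
    rw [(hXX x y).mono (le_inf h h') f]
    refine vf_congr _ (hX y) ?_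
    rw [res_res, res_res, hfg]
  -- `R g h` expresses that `h` is the value of the glued field at `g`: wherever `g` is represented
  -- by a global function, `h` is the value of the local field at that representative.
  let R : A.Func U → A.Func U → Prop := fun g h => ∀ (x : U) (N : Opens M) (hN : N ≤ V x)
    (f : A.Func ⊤), A.res (le_top : N ≤ ⊤) f = A.res (hN.trans (hV x)) g →
      A.res (hN.trans (hV x)) h = A.res (hN.trans (hW x)) (X x (A.res le_top f))
  have germ : ∀ (g : A.Func U) (x : U), ∃ (N : Opens M) (hN : N ≤ V x) (f : A.Func ⊤),
      (x : M) ∈ N ∧ A.res (le_top : N ≤ ⊤) f = A.res (hN.trans (hV x)) g := by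
    intro g x
    obtain ⟨N, hN, f, hxN, -, hf⟩ := A.func_exists_global g x.2
    exact ⟨N ⊓ V x, inf_le_right, f, ⟨hxN, hx x⟩, res_congr hf inf_le_left⟩
  have germ_hom : ∀ (l : ℤ) (g : A.Func U), g ∈ A.funcDeg U l → ∀ x : U,
      ∃ (N : Opens M) (hN : N ≤ V x), ∃ f ∈ A.funcDeg ⊤ l,
      (x : M) ∈ N ∧ A.res (le_top : N ≤ ⊤) f = A.res (hN.trans (hV x)) g := by
    intro l g hg x
    obtain ⟨N, hN, f, hxN, hf', hf⟩ := A.func_exists_global_hom hg x.2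
    exact ⟨N ⊓ V x, inf_le_right, f, hf'.mem_funcDeg, ⟨hxN, hx x⟩, res_congr hf inf_le_left⟩
  -- By `compat` it is enough to test `R` on one representative near each point. Linearity and the
  -- Leibniz rule of the glued field are then inherited from the local fields.
  have weak : ∀ g h : A.Func U, (∀ x : U, ∃ (N : Opens M) (hN : N ≤ V x) (f : A.Func ⊤),
      (x : M) ∈ N ∧ A.res (le_top : N ≤ ⊤) f = A.res (hN.trans (hV x)) g ∧
      A.res (hN.trans (hV x)) h = A.res (hN.trans (hW x)) (X x (A.res le_top f))) → R g h := by
    intro g h hgh x N hN f hf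
    refine A.func_ext_of_local fun p => ?_
    obtain ⟨N', hN', f', hpN, h1, h2⟩ := hgh ⟨p, hV x (hN p.2)⟩
    refine ⟨N' ⊓ N, inf_le_right, ⟨hpN, p.2⟩, ?_⟩
    rw [res_res, res_res]
    refine (res_congr h2 (inf_le_left : N' ⊓ N ≤ N')).trans
      (compat _ x (N' ⊓ N) (inf_le_left.trans hN') (inf_le_right.trans hN) f' f ?_)
    exact (res_congr h1 inf_le_left).trans (res_congr hf (inf_le_right : N' ⊓ N ≤ N)).symm
  have ex0 : ∀ (g : A.Func U) (N : U → Opens M) (hN : ∀ x, N x ≤ V x) (f : U → A.Func ⊤),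
      (∀ x : U, (x : M) ∈ N x) →
      (∀ x, A.res (le_top : N x ≤ ⊤) (f x) = A.res ((hN x).trans (hV x)) g) →
      ∃ h, R g h ∧ ∀ l, (∀ x, f x ∈ A.funcDeg ⊤ l) → h ∈ A.funcDeg U (l + k) := by
    intro g N hN f hxN hf
    obtain ⟨h, hh, hdeg⟩ := A.exists_sheaf_glue N (fun x => (hN x).trans (hV x)) hxN
      (fun x => A.res ((hN x).trans (hW x)) (X x (A.res le_top (f x)))) (by
        intro x y N' h h'
        rw [res_res, res_res]
        exact compat x y N' (h.trans (hN x)) (h'.trans (hN y)) _ _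
          ((res_congr (hf x) h).trans (res_congr (hf y) h').symm))
    refine ⟨h, weak g h fun x => ⟨N x, hN x, f x, hxN x, hf x, hh x⟩, fun l hl => hdeg _ fun x => ?_⟩
    exact A.res_mem_funcDeg _ (vf_deg (hX x) (A.res_mem_funcDeg _ (hl x)))
  have ex : ∀ g : A.Func U, ∃ h, R g h := by
    intro g
    choose N hN f hxN hf using germ g
    obtain ⟨h, hh, -⟩ := ex0 g N hN f hxN hf
    exact ⟨h, hh⟩
  have uniq : ∀ g h h' : A.Func U, R g h → R g h' → h = h' := by
    intro g h h' h1 h2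
    refine A.func_ext_of_local fun x => ?_
    obtain ⟨N, hN, f, hxN, hf⟩ := germ g x
    exact ⟨N, hN.trans (hV x), hxN, (h1 x N hN f hf).trans (h2 x N hN f hf).symm⟩
  have germ2 : ∀ (g g' : A.Func U) (x : U), ∃ (N : Opens M) (hN : N ≤ V x) (f f' : A.Func ⊤),
      (x : M) ∈ N ∧ A.res (le_top : N ≤ ⊤) f = A.res (hN.trans (hV x)) g ∧
        A.res (le_top : N ≤ ⊤) f' = A.res (hN.trans (hV x)) g' := by
    intro g g' x
    obtain ⟨N, hN, f, hxN, hf⟩ := germ g x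
    obtain ⟨N', hN', f', hxN', hf'⟩ := germ g' x
    exact ⟨N ⊓ N', inf_le_left.trans hN, f, f', ⟨hxN, hxN'⟩, res_congr hf inf_le_left,
      res_congr hf' inf_le_right⟩
  choose Y hY using ex
  have hadd : ∀ g g', Y (g + g') = Y g + Y g' := by
    intro g g'
    refine uniq _ _ _ (hY _) (weak _ _ fun x => ?_)
    obtain ⟨N, hN, f, f', hxN, hf, hf'⟩ := germ2 g g' x
    refine ⟨N, hN, f + f', hxN, by rw [map_add, map_add, hf, hf'], ?_⟩
    rw [map_add, hY g x N hN f hf, hY g' x N hN f' hf']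
    simp only [map_add]
  have hsmul : ∀ (c : ℝ) g, Y (c • g) = c • Y g := by
    intro c g
    refine uniq _ _ _ (hY _) (weak _ _ fun x => ?_)
    obtain ⟨N, hN, f, hxN, hf⟩ := germ g x
    refine ⟨N, hN, c • f, hxN, by rw [map_smul, map_smul, hf], ?_⟩
    rw [map_smul, hY g x N hN f hf]
    simp only [map_smul]
  refine ⟨⟨⟨Y, hadd⟩, hsmul⟩, ⟨fun l g hg => ?_, fun l g hg g' => ?_⟩, fun x f => ?_⟩
  · choose N hN f hf' hxN hf using germ_hom l g hg
    obtain ⟨h, hh, hdeg⟩ := ex0 g N hN f hxN hf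
    change Y g ∈ _
    rw [uniq g _ _ (hY g) hh]
    exact hdeg l hf'
  · refine uniq _ _ _ (hY _) (weak _ _ fun x => ?_)
    obtain ⟨N, hN, f, hfl, hxN, hf⟩ := germ_hom l g hg x
    obtain ⟨N', hN', f', hxN', hf'⟩ := germ g' x
    have h1 := res_congr hf (inf_le_left : N ⊓ N' ≤ N)
    have h2 := res_congr hf' (inf_le_right : N ⊓ N' ≤ N')
    have h3 := hY g x (N ⊓ N') (inf_le_left.trans hN) f h1
    have h4 := hY g' x (N ⊓ N') (inf_le_left.trans hN) f' h2
    refine ⟨N ⊓ N', inf_le_left.trans hN, f * f', ⟨hxN, hxN'⟩, by rw [map_mul, map_mul, h1, h2], ?_⟩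
    change A.res _ (Y g * g' + sg (l * k) • (g * Y g')) = _
    rw [map_mul (A.res (le_top : W x ≤ ⊤)), vf_leibniz (hX x) (A.res_mem_funcDeg _ hfl)]
    simp only [map_add, map_mul, map_zsmul, h3, h4, res_res]
    rw [← h1, ← h2]
  · refine hY _ x (V x) le_rfl f ?_
    rw [res_res]

end VectorFieldGluing

end CoalgebraBundle

/-! ## Restriction, extension and values of vector fields -/

namespace CoalgebraBundle

section VectorFieldValues

variable {d : ℕ} {n : ℕ} {M : Type*} [TopologicalSpace M] [T2Space M]
  [ChartedSpace (EuclideanSpace ℝ (Fin d)) M] [IsManifold (𝓡 d) ∞ M]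
  {F : Fin n → Type*} [∀ i, NormedAddCommGroup (F i)] [∀ i, NormedSpace ℝ (F i)]
  {E : Fin n → M → Type*} [∀ i x, AddCommGroup (E i x)] [∀ i x, Module ℝ (E i x)]
  [∀ i, TopologicalSpace (Bundle.TotalSpace (F i) (E i))] [∀ i x, TopologicalSpace (E i x)]
  [∀ i, FiberBundle (F i) (E i)] [∀ i, VectorBundle ℝ (F i) (E i)]


variable {A : CoalgebraBundle d F E}

lemma AgreeOn.refl {U N : Opens M} (hU : N ≤ U) (X : Module.End ℝ (A.Func U)) :
    A.AgreeOn hU hU X X := fun _ => rfl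

lemma agreeOn_of_local {U V N : Opens M} {hU : N ≤ U} {hV : N ≤ V} {X : Module.End ℝ (A.Func U)}
    {Y : Module.End ℝ (A.Func V)} (h : ∀ x ∈ N, ∃ (N' : Opens M) (hN : N' ≤ N), x ∈ N' ∧
      A.AgreeOn (hN.trans hU) (hN.trans hV) X Y) : A.AgreeOn hU hV X Y := by
  intro f
  refine A.func_ext_of_local fun x => ?_
  obtain ⟨N', hN, hx, h'⟩ := h x x.2
  exact ⟨N', hN, hx, by rw [res_res, res_res, h' f]⟩

lemma AgreeOn.eq {U : Opens M} {k : ℤ} {X Y : Module.End ℝ (A.Func U)}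
    (h : A.AgreeOn le_rfl le_rfl X Y) (hX : X ∈ A.vectorField U k) (hY : Y ∈ A.vectorField U k) :
    X = Y := by
  refine LinearMap.ext fun f => ?_
  have := h.isRestriction hX hY f
  rw [res_self, res_self] at this
  exact this.symm

/-- A function on `V` need not extend to `U`. The restricted field is therefore defined through
global representatives of germs, which is gluing for a constant cover. -/
lemma exists_restriction [SecondCountableTopology M] {U V : Opens M} (h : V ≤ U) {k : ℤ}
    {X : Module.End ℝ (A.Func U)} (hX : X ∈ A.vectorField U k) :
    ∃ Y ∈ A.vectorField V k, A.IsRestriction h X Y := by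
  obtain ⟨Y, hY, h'⟩ := exists_vf_glue (fun _ : V => V) (fun _ => U) (fun _ => le_rfl)
    (fun x => x.2) (fun _ => h) (fun _ => X) (fun _ => hX) fun _ _ _ => rfl
  refine ⟨Y, hY, AgreeOn.isRestriction hX hY (agreeOn_of_local fun x hx => ?_)⟩
  exact ⟨V, le_rfl, hx, (h' ⟨x, hx⟩).symm⟩

lemma funcSmul_apply {U : Opens M} (f g : A.Func U) (X : Module.End ℝ (A.Func U)) :
    A.funcSmul f X g = f * X g := rfl

lemma funcSmul_mem {U : Opens M} {a k : ℤ} {f : A.Func U} {X : Module.End ℝ (A.Func U)}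
    (hf : f ∈ A.funcDeg U a) (hX : X ∈ A.vectorField U k) :
    A.funcSmul f X ∈ A.vectorField U (a + k) := by
  refine ⟨fun l g hg => ?_, fun l g hg g' => ?_⟩
  · rw [funcSmul_apply, show l + (a + k) = a + (l + k) by ring]
    exact A.mul_mem_funcDeg hf (vf_deg hX hg)
  · simp only [funcSmul_apply]
    rw [vf_leibniz hX hg, mul_add, mul_assoc, mul_smul_comm, ← mul_assoc f g, A.funcDeg_comm hf hg,
      smul_mul_assoc, mul_assoc g, smul_smul, mul_comm a l, mul_add, ← sg_def, sg_add,
      mul_comm (sg (l * k))]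

lemma IsRestriction.funcSmul {U V : Opens M} {h : V ≤ U} {X : Module.End ℝ (A.Func U)}
    {Y : Module.End ℝ (A.Func V)} (hXY : A.IsRestriction h X Y) (f : A.Func U) :
    A.IsRestriction h (A.funcSmul f X) (A.funcSmul (A.res h f) Y) := by
  intro g
  rw [funcSmul_apply, funcSmul_apply, map_mul, hXY g]

/-- Sections of a graded subsheaf agree locally with global ones. -/
lemma GradedSubsheaf.exists_global_section [SecondCountableTopology M] (D : A.GradedSubsheaf)
    {N : Opens M} {l : ℤ} {Y : Module.End ℝ (A.Func N)} (hY : Y ∈ D.sec N l) {x : M} (hx : x ∈ N) :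
    ∃ Z ∈ D.sec ⊤ l, ∃ (N' : Opens M) (hN' : N' ≤ N), x ∈ N' ∧ A.AgreeOn le_top hN' Z Y := by
  obtain ⟨χ, N', Z, hχ, hxN, hN', h1, h0, hc⟩ := exists_bump (d := d) hx
  have hχN := contMDiff_restrict hχ N
  have hYc : A.funcSmul (A.fn hχN) Y ∈ D.sec N l := by
    have := D.smul_mem N 0 l _ (A.fn_mem_funcDeg hχN) Y hY
    rwa [zero_add] at this
  -- The section `χ Y` on `N` and the zero section on `Z` agree on the overlap. At each point one of
  -- the two is picked, together with its agreement with both, so that the choices can be compared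
  -- and glued.
  have hex : ∀ y : (⊤ : Opens M), ∃ V : Opens M, (y : M) ∈ V ∧ ∃ X ∈ D.sec V l,
      A.AgreeOn (inf_le_left : V ⊓ N ≤ V) inf_le_right X (A.funcSmul (A.fn hχN) Y) ∧
      A.AgreeOn (inf_le_left : V ⊓ Z ≤ V) inf_le_right X (0 : Module.End ℝ (A.Func Z)) := by
    intro y
    have hz : A.AgreeOn (inf_le_left : N ⊓ Z ≤ N) (inf_le_right : N ⊓ Z ≤ Z)
        (A.funcSmul (A.fn hχN) Y) 0 := by
      intro f
      rw [funcSmul_apply, map_mul, A.res_fn_const inf_le_left hχN (c := 0) fun z => h0 z z.2.2,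
        map_zero, zero_mul, LinearMap.zero_apply, map_zero]
    rcases hc y with hy | hy
    · exact ⟨N, hy, _, hYc, AgreeOn.refl _ _, hz⟩
    · refine ⟨Z, hy, 0, zero_mem _, fun f => ?_, AgreeOn.refl _ _⟩
      exact (hz.mono (le_inf inf_le_right inf_le_left) f).symm
  choose V hV X hX hXN hXZ using hex
  obtain ⟨W, hW, hWX⟩ := exists_vf_glue V V (fun _ => le_top) hV (fun _ => le_rfl) X
    (fun y => D.le_vectorField _ _ (hX y)) (by
      refine fun y z => agreeOn_of_local fun p hp => ?_
      rcases hc p with hpN | hpZ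
      · refine ⟨V y ⊓ V z ⊓ N, inf_le_left, ⟨hp, hpN⟩, ?_⟩
        exact ((hXN y).mono (le_inf (inf_le_left.trans inf_le_left) inf_le_right)).trans
          ((hXN z).mono (le_inf (inf_le_left.trans inf_le_right) inf_le_right)).symm
      · refine ⟨V y ⊓ V z ⊓ Z, inf_le_left, ⟨hp, hpZ⟩, ?_⟩
        exact ((hXZ y).mono (le_inf (inf_le_left.trans inf_le_left) inf_le_right)).trans
          ((hXZ z).mono (le_inf (inf_le_left.trans inf_le_right) inf_le_right)).symm)
  refine ⟨W, D.locality _ _ _ hW fun y => ⟨V y, le_top, hV y, X y, hX y,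
    (hWX y).isRestriction hW (D.le_vectorField _ _ (hX y))⟩, V ⟨x, trivial⟩ ⊓ N',
    inf_le_right.trans hN', ⟨hV _, hxN⟩, ?_⟩
  refine ((hWX ⟨x, trivial⟩).mono inf_le_left).trans
    (((hXN ⟨x, trivial⟩).mono (N' := V ⟨x, trivial⟩ ⊓ N') (le_inf inf_le_left
      (inf_le_right.trans hN'))).trans fun f => ?_)
  rw [funcSmul_apply, map_mul, A.res_fn_const (inf_le_right.trans hN') hχN (c := 1) fun z =>
    h1 z z.2.2, map_one, one_mul]

/-! ### Values -/

/-- Nonpositive degree matters here: `X` does not raise degrees, so it stays in the range up to `n`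
in which functions are sections of `𝐄*_ℝ`. -/
lemma vf_exists_cls_hom {U : Opens M} {k : ℕ} {X : Module.End ℝ (A.Func U)}
    (hX : X ∈ A.vectorField U (-(k : ℤ))) {a : ℤ} {e : ERSec d F E U} (he : HomSec U a e) :
    ∃ e', HomSec U (a - k) e' ∧ A.cls U e' = X (A.cls U e) := by
  by_cases ha : a ≤ n
  · exact A.exists_cls_of_mem_funcDeg (by omega) (vf_deg hX (A.cls_mem_funcDeg he))
  · rw [homSec_eq_zero (Or.inr (not_le.1 ha)) he]
    exact ⟨0, fun x => Submodule.zero_mem _, by simp only [map_zero]⟩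

lemma vf_exists_cls {U : Opens M} {k : ℕ} {X : Module.End ℝ (A.Func U)}
    (hX : X ∈ A.vectorField U (-(k : ℤ))) (e : ERSec d F E U) :
    ∃ e', A.cls U e' = X (A.cls U e) := by
  induction e using erSec_induction with
  | add e e' h h' =>
    obtain ⟨e₁, h₁⟩ := h
    obtain ⟨e₂, h₂⟩ := h'
    exact ⟨e₁ + e₂, by simp only [map_add, h₁, h₂]⟩
  | hom a e ha he =>
    obtain ⟨e', -, h⟩ := vf_exists_cls_hom hX he
    exact ⟨e', h⟩

variable (A) in
/-- The value at a point of the derivation of `𝐄*_ℝ` given by a vector field. -/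
def vfVal {U : Opens M} (X : Module.End ℝ (A.Func U)) (x : U) : HomAt d F E (x : M) :=
  (homAtEquiv d F E (x : M)).symm
    { toFun := fun e => A.act x (X (A.cls U (erRes d F E le_top e))) (1, 0)
      map_add' := fun a b => by simp only [map_add, LinearMap.add_apply]
      map_smul' := fun c a => by simp only [map_smul, LinearMap.smul_apply, RingHom.id_apply] }

lemma homAt_ext {x : M} {δ ε : HomAt d F E x} (h : ∀ e, δ e = ε e) : δ = ε :=
  (homAtEquiv d F E x).injective (LinearMap.ext h)

lemma vfVal_apply {U : Opens M} (X : Module.End ℝ (A.Func U)) (x : U)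
    (e : ERSec d F E (⊤ : Opens M)) :
    A.vfVal X x e = A.act x (X (A.cls U (erRes d F E le_top e))) (1, 0) := rfl

lemma vfVal_add {U : Opens M} (X Y : Module.End ℝ (A.Func U)) (x : U) :
    A.vfVal (X + Y) x = A.vfVal X x + A.vfVal Y x := homAt_ext fun e => by
  rw [homAt_add_apply, vfVal_apply, LinearMap.add_apply, map_add, LinearMap.add_apply]
  rfl

lemma vfVal_zero {U : Opens M} (x : U) : A.vfVal (0 : Module.End ℝ (A.Func U)) x = 0 :=
  homAt_ext fun e => by
    rw [homAt_zero_apply, vfVal_apply, LinearMap.zero_apply, map_zero, LinearMap.zero_apply]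

lemma vfVal_sum {U : Opens M} {ι : Type*} (s : Finset ι) (X : ι → Module.End ℝ (A.Func U)) (x : U) :
    A.vfVal (∑ i ∈ s, X i) x = ∑ i ∈ s, A.vfVal (X i) x :=
  map_sum (⟨⟨fun X => A.vfVal X x, vfVal_zero x⟩, fun X Y => vfVal_add X Y x⟩ :
    Module.End ℝ (A.Func U) →+ HomAt d F E (x : M)) X s

lemma IsValueAt.eq_vfVal {U : Opens M} {X : Module.End ℝ (A.Func U)} {x : U}
    {δ : HomAt d F E (x : M)} (h : A.IsValueAt X x δ) : δ = A.vfVal X x := homAt_ext fun e => by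
  obtain ⟨e', h1, h2⟩ := h e
  rw [vfVal_apply, h1, act_cls_one, h2]

lemma isValueAt_vfVal {U : Opens M} {k : ℕ} {X : Module.End ℝ (A.Func U)}
    (hX : X ∈ A.vectorField U (-(k : ℤ))) (x : U) : A.IsValueAt X x (A.vfVal X x) := fun e => by
  obtain ⟨e', h⟩ := vf_exists_cls hX (erRes d F E le_top e)
  exact ⟨e', h.symm, by rw [vfVal_apply, ← h, act_cls_one]⟩

lemma isValueAt_iff {U : Opens M} {k : ℕ} {X : Module.End ℝ (A.Func U)}
    (hX : X ∈ A.vectorField U (-(k : ℤ))) {x : U} {δ : HomAt d F E (x : M)} :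
    A.IsValueAt X x δ ↔ A.vfVal X x = δ :=
  ⟨fun h => h.eq_vfVal.symm, fun h => h ▸ isValueAt_vfVal hX x⟩

/-- In total degree at most `n` a product of classes is the class of the product in `𝐄*_ℝ`, so the
Leibniz rule of `X` becomes compatibility with `m`. -/
lemma vfVal_isDerSection {U : Opens M} {k : ℕ} {X : Module.End ℝ (A.Func U)}
    (hX : X ∈ A.vectorField U (-(k : ℤ))) : A.IsDerSection U k (fun x => A.vfVal X x) := by
  refine ⟨fun x => ⟨fun a e he => ?_, fun a b e e' e'' hab he he' he'' => ?_⟩, fun e => ?_⟩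
  · have he1 : HomSec ⊤ a e := he
    obtain ⟨e', he', h⟩ := vf_exists_cls_hom hX (he1.restrict (le_top : U ≤ ⊤))
    rw [vfVal_apply, ← h, act_cls_one]
    exact he' x
  · have he1 : HomSec ⊤ (a : ℤ) e := he
    have he2 : HomSec ⊤ (b : ℤ) e' := he'
    have h1 : e'' = secMul A e e' := Subtype.ext (funext he'')
    have h2 : A.cls U (erRes d F E le_top e'') =
        A.cls U (erRes d F E le_top e) * A.cls U (erRes d F E le_top e') := by
      rw [h1, A.cls_mul (he1.restrict le_top) (he2.restrict le_top) (by exact_mod_cast hab)]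
      rfl
    obtain ⟨e₁, h3⟩ := vf_exists_cls hX (erRes d F E le_top e)
    obtain ⟨e₂, h4⟩ := vf_exists_cls hX (erRes d F E le_top e')
    have h5 : sg ((a : ℤ) * -(k : ℤ)) = (-1 : ℤ) ^ (k * a) := by
      rw [mul_neg, sg_neg, ← Nat.cast_mul, sg_natCast, mul_comm]
    rw [vfVal_apply, vfVal_apply, vfVal_apply, h2, vf_leibniz hX
      (A.cls_mem_funcDeg (he1.restrict le_top)), h5, ← h3, ← h4, map_add, map_zsmul, map_mul, map_mul,
      LinearMap.add_apply, LinearMap.smul_apply, Module.End.mul_apply, Module.End.mul_apply,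
      act_cls_one, act_cls_one, act_cls_one, act_cls, act_cls]
    rfl
  · obtain ⟨e', h⟩ := vf_exists_cls hX (erRes d F E le_top e)
    have : (fun x : U => A.vfVal X x e) = e'.1 := by
      funext x
      rw [vfVal_apply, ← h, act_cls_one]
    rw [this]
    exact e'.2

lemma vfVal_mem_derFib {U : Opens M} {k : ℕ} {X : Module.End ℝ (A.Func U)}
    (hX : X ∈ A.vectorField U (-(k : ℤ))) (x : U) : A.vfVal X x ∈ A.derFib k (x : M) :=
  (vfVal_isDerSection hX).1 x

lemma AgreeOn.vfVal_eq {U V N : Opens M} {hU : N ≤ U} {hV : N ≤ V} {X : Module.End ℝ (A.Func U)}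
    {Y : Module.End ℝ (A.Func V)} (h : A.AgreeOn hU hV X Y) (x : N) :
    A.vfVal X ⟨x, hU x.2⟩ = A.vfVal Y ⟨x, hV x.2⟩ := homAt_ext fun e => by
  have h1 := congrArg (A.act x) (h (A.cls ⊤ e))
  rw [act_res, act_res, res_cls, res_cls] at h1
  exact congrArg (fun φ => φ (1, 0)) h1

/-- Vector fields with the same values agree. -/
lemma agreeOn_of_vfVal {U V N : Opens M} {hU : N ≤ U} {hV : N ≤ V} {k : ℕ}
    {X : Module.End ℝ (A.Func U)} {Y : Module.End ℝ (A.Func V)}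
    (hX : X ∈ A.vectorField U (-(k : ℤ))) (hY : Y ∈ A.vectorField V (-(k : ℤ)))
    (h : ∀ x : N, A.vfVal X ⟨x, hU x.2⟩ = A.vfVal Y ⟨x, hV x.2⟩) : A.AgreeOn hU hV X Y := by
  refine agreeOn_of_cls hX hY fun e => ?_
  obtain ⟨e₁, h₁⟩ := vf_exists_cls hX (erRes d F E le_top e)
  obtain ⟨e₂, h₂⟩ := vf_exists_cls hY (erRes d F E le_top e)
  rw [← h₁, ← h₂, res_cls, res_cls]
  congr 1
  apply Subtype.ext
  funext x
  have := congrArg (fun δ : HomAt d F E (x : M) => δ e) (h x)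
  simp only [vfVal_apply, ← h₁, ← h₂, act_cls_one] at this
  exact this

lemma vf_ext_of_vfVal {U : Opens M} {k : ℕ} {X Y : Module.End ℝ (A.Func U)}
    (hX : X ∈ A.vectorField U (-(k : ℤ))) (hY : Y ∈ A.vectorField U (-(k : ℤ)))
    (h : ∀ x : U, A.vfVal X x = A.vfVal Y x) : X = Y :=
  (agreeOn_of_vfVal (hU := le_rfl) (hV := le_rfl) hX hY h).eq hX hY

/-- The product of an element of the fibre of `𝐄*_ℝ` and a derivation. -/
def thetaER (A : CoalgebraBundle d F E) (x : M) :
    ERFib E x →ₗ[ℝ] HomAt d F E x →ₗ[ℝ] HomAt d F E x :=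
  LinearMap.mk₂ ℝ (fun w δ => (homAtEquiv d F E x).symm
      (erMul (A.comul x) w ∘ₗ homAtEquiv d F E x δ))
    (fun ξ η δ => by rw [← map_add, ← LinearMap.add_comp, ← map_add])
    (fun c ξ δ => by rw [← map_smul, ← LinearMap.smul_comp, ← map_smul])
    (fun ξ δ ε => by rw [map_add, LinearMap.comp_add, map_add])
    (fun c ξ δ => by rw [map_smul, LinearMap.comp_smul, map_smul])

lemma thetaER_apply {x : M} (w : ERFib E x) (δ : HomAt d F E x) (e : ERSec d F E (⊤ : Opens M)) :
    A.thetaER x w δ e = erMul (A.comul x) w (δ e) := rfl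

lemma theta_eq_thetaER {i : Fin n} {x : M} (ξ : Module.Dual ℝ (E i x)) (δ : HomAt d F E x) :
    A.theta i x ξ δ = A.thetaER x (0, Pi.single i ξ) δ := rfl

lemma vfVal_funcSmul {U : Opens M} (w : ERSec d F E U) (X : Module.End ℝ (A.Func U)) (x : U) :
    A.vfVal (A.funcSmul (A.cls U w) X) x = A.thetaER (x : M) (w.1 x) (A.vfVal X x) :=
  homAt_ext fun e => by
    rw [thetaER_apply, vfVal_apply, vfVal_apply, funcSmul_apply, map_mul, Module.End.mul_apply,
      act_cls]

lemma tangentAt_cls {U : Opens M} {k : ℕ} {X : Module.End ℝ (A.Func U)}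
    (hX : X ∈ A.vectorField U (-(k : ℤ))) (x : U) (e : ERSec d F E (⊤ : Opens M)) :
    A.tangentAt X x (A.cls U (erRes d F E le_top e)) = (A.vfVal X x e).1 := by
  obtain ⟨e', h⟩ := vf_exists_cls hX (erRes d F E le_top e)
  rw [vfVal_apply, ← h, act_cls_one, ← ev_cls, h]
  rfl

end VectorFieldValues

end CoalgebraBundle

/-! ## Derivations at a point and their extensions to `Sym 𝐄*` -/

/-- A linear functional on a space of real functions extends to functions with values in a
vector space. -/
lemma exists_vector_valued_extension {X S : Type*} [AddCommGroup S] [Module ℝ S]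
    (C : Submodule ℝ (X → ℝ)) (v : C →ₗ[ℝ] ℝ) :
    ∃ w : (X → S) →ₗ[ℝ] S, ∀ (f : C) (s : S), w (fun y => f.1 y • s) = v f • s := by
  -- The functional is applied weakly, since `S` may have infinite dimension: `φ ↦ V (φ ∘ σ)` lies
  -- in the double dual of `S`, and the linear retraction `L` returns to `S`. The extension `V` to
  -- all functions is purely algebraic.
  obtain ⟨V, hV⟩ := LinearMap.exists_extend v
  obtain ⟨L, hL⟩ := LinearMap.exists_leftInverse_of_injective (Module.Dual.eval ℝ S)
    (LinearMap.ker_eq_bot.2 (Module.eval_apply_injective ℝ))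
  let ev : (X → S) →ₗ[ℝ] Module.Dual ℝ (Module.Dual ℝ S) :=
    { toFun := fun σ =>
        { toFun := fun φ => V fun y => φ (σ y)
          map_add' := fun φ ψ => map_add V (fun y => φ (σ y)) fun y => ψ (σ y)
          map_smul' := fun c φ => map_smul V c fun y => φ (σ y) }
      map_add' := fun σ τ => LinearMap.ext fun φ => by
        simp only [Pi.add_apply, map_add]
        exact map_add V (fun y => φ (σ y)) fun y => φ (τ y)
      map_smul' := fun c σ => LinearMap.ext fun φ => by
        simp only [Pi.smul_apply, map_smul]
        exact map_smul V c fun y => φ (σ y) }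
  refine ⟨L ∘ₗ ev, fun f s => ?_⟩
  have h1 : ev (fun y => f.1 y • s) = Module.Dual.eval ℝ S (v f • s) := by
    apply LinearMap.ext
    intro φ
    change V (fun y => φ (f.1 y • s)) = φ (v f • s)
    have h2 : (fun y => φ (f.1 y • s)) = φ s • f.1 := by
      funext y
      rw [map_smul, Pi.smul_apply, smul_eq_mul, smul_eq_mul, mul_comm]
    have h3 : V f.1 = v f := congrArg (fun g => g f) hV
    rw [h2, map_smul, h3, map_smul, smul_eq_mul, smul_eq_mul, mul_comm]
  rw [LinearMap.comp_apply, h1, ← LinearMap.comp_apply, hL, LinearMap.id_apply]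

namespace CoalgebraBundle

section Derivations

variable {d : ℕ} {n : ℕ} {M : Type*} [TopologicalSpace M] [T2Space M]
  [ChartedSpace (EuclideanSpace ℝ (Fin d)) M] [IsManifold (𝓡 d) ∞ M]
  {F : Fin n → Type*} [∀ i, NormedAddCommGroup (F i)] [∀ i, NormedSpace ℝ (F i)]
  {E : Fin n → M → Type*} [∀ i x, AddCommGroup (E i x)] [∀ i x, Module ℝ (E i x)]
  [∀ i, TopologicalSpace (Bundle.TotalSpace (F i) (E i))] [∀ i x, TopologicalSpace (E i x)]
  [∀ i, FiberBundle (F i) (E i)] [∀ i, VectorBundle ℝ (F i) (E i)]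
  [∀ i, FiniteDimensional ℝ (F i)] [∀ i, ContMDiffVectorBundle ∞ (F i) (E i) (𝓡 d)]

variable {A : CoalgebraBundle d F E}

lemma homAt_map_add {x : M} (δ : HomAt d F E x) (e e' : ERSec d F E (⊤ : Opens M)) :
    δ (e + e') = δ e + δ e' := map_add (homAtEquiv d F E x δ) e e'

lemma homAt_map_smul {x : M} (δ : HomAt d F E x) (c : ℝ) (e : ERSec d F E (⊤ : Opens M)) :
    δ (c • e) = c • δ e := map_smul (homAtEquiv d F E x δ) c e

lemma homAt_map_zero {x : M} (δ : HomAt d F E x) : δ 0 = 0 := map_zero (homAtEquiv d F E x δ)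

lemma homAt_map_sub {x : M} (δ : HomAt d F E x) (e e' : ERSec d F E (⊤ : Opens M)) :
    δ (e - e') = δ e - δ e' := map_sub (homAtEquiv d F E x δ) e e'

lemma homAt_map_sum {x : M} (δ : HomAt d F E x) {ι : Type*} (s : Finset ι)
    (e : ι → ERSec d F E (⊤ : Opens M)) : δ (∑ i ∈ s, e i) = ∑ i ∈ s, δ (e i) :=
  map_sum (homAtEquiv d F E x δ) e s

lemma derFib_deg {k : ℕ} {x : M} {δ : HomAt d F E x} (hδ : δ ∈ A.derFib k x) {a : ℤ}
    {e : ERSec d F E (⊤ : Opens M)} (he : HomSec ⊤ a e) : δ e ∈ erDeg E x (a - k) := hδ.1 a e he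

lemma derFib_mul {k : ℕ} {x : M} {δ : HomAt d F E x} (hδ : δ ∈ A.derFib k x) {a b : ℕ}
    {e e' : ERSec d F E (⊤ : Opens M)} (he : HomSec ⊤ (a : ℤ) e) (he' : HomSec ⊤ (b : ℤ) e')
    (hab : a + b ≤ n) : δ (secMul A e e') = erMul (A.comul x) (δ e) (e'.1 ⟨x, trivial⟩) +
      sg ((k : ℤ) * a) • erMul (A.comul x) (e.1 ⟨x, trivial⟩) (δ e') := by
  rw [← Nat.cast_mul, sg_natCast]
  exact hδ.2 a b e e' _ hab he he' fun _ => rfl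

/-- The restriction of a derivation to functions. -/
def symbol {x : M} (δ : HomAt d F E x) {f : (⊤ : Opens M) → ℝ}
    (hf : ContMDiff (𝓡 d) 𝓘(ℝ, ℝ) ∞ f) : ℝ := (δ (fsec F E hf)).1

/-- The image of a function has degree `-k`, hence is a scalar for `k = 0` and zero otherwise. -/
lemma derFib_fsec {k : ℕ} {x : M} {δ : HomAt d F E x} (hδ : δ ∈ A.derFib k x)
    {f : (⊤ : Opens M) → ℝ} (hf : ContMDiff (𝓡 d) 𝓘(ℝ, ℝ) ∞ f) :
    δ (fsec F E hf) = (symbol δ hf, 0) := by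
  have h := derFib_deg hδ (fsec_homSec hf)
  rcases Nat.eq_zero_or_pos k with rfl | hk
  · rw [Nat.cast_zero, sub_zero] at h
    exact eq_scalar_of_mem_erDeg_zero h
  · have h0 := eq_zero_of_mem_erDeg h (Or.inl (by omega))
    rw [symbol, h0]
    rfl

lemma symbol_eq_zero {k : ℕ} (hk : 0 < k) {x : M} {δ : HomAt d F E x} (hδ : δ ∈ A.derFib k x)
    {f : (⊤ : Opens M) → ℝ} (hf : ContMDiff (𝓡 d) 𝓘(ℝ, ℝ) ∞ f) : symbol δ hf = 0 := by
  have h := derFib_deg hδ (fsec_homSec hf)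
  rw [symbol, eq_zero_of_mem_erDeg h (Or.inl (by omega))]
  rfl

/-- For homogeneous `e` this is compatibility with `m` for a first factor of degree zero, where the
bound on the total degree costs nothing; additivity gives the general case. -/
lemma derFib_fsmul {k : ℕ} {x : M} {δ : HomAt d F E x} (hδ : δ ∈ A.derFib k x)
    {f : (⊤ : Opens M) → ℝ} (hf : ContMDiff (𝓡 d) 𝓘(ℝ, ℝ) ∞ f) (e : ERSec d F E (⊤ : Opens M)) :
    δ (fsmul hf e) = symbol δ hf • e.1 ⟨x, trivial⟩ + f ⟨x, trivial⟩ • δ e := by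
  induction e using erSec_induction with
  | add e e' h h' =>
    have : fsmul hf (e + e') = fsmul hf e + fsmul hf e' :=
      Subtype.ext (funext fun y => smul_add (f y) (e.1 y) (e'.1 y))
    rw [this, homAt_map_add, h, h', homAt_map_add, Submodule.coe_add, Pi.add_apply, smul_add,
      smul_add]
    abel
  | hom b e hb he =>
    have : fsmul hf e = secMul A (fsec F E hf) e :=
      Subtype.ext (funext fun y => (erMul_scalar _ _ _).symm)
    rw [this, derFib_mul hδ (a := 0) (fsec_homSec hf) he (by omega), derFib_fsec hδ, erMul_scalar,
      Nat.cast_zero, mul_zero, sg_zero, one_smul]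
    congr 1
    exact erMul_scalar _ _ _

/-- Derivations at a point are local. -/
lemma derFib_local {k : ℕ} {x : M} {δ : HomAt d F E x} (hδ : δ ∈ A.derFib k x) {N : Opens M}
    (hx : x ∈ N) {e : ERSec d F E (⊤ : Opens M)} (he : ∀ y : N, e.1 ⟨y, trivial⟩ = 0) :
    δ e = 0 := by
  obtain ⟨χ, N', Z, hχ, hxN, hN', h1, h0, hc⟩ := exists_bump (d := d) hx
  have hχ' := contMDiff_restrict hχ ⊤
  have h2 : fsmul hχ' e = 0 := Subtype.ext (funext fun y => by
    rcases hc y with hy | hy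
    · change χ y • e.1 y = 0
      rw [he ⟨y, hy⟩, smul_zero]
    · change χ y • e.1 y = 0
      rw [h0 y hy, zero_smul])
  have h3 := derFib_fsmul hδ hχ' e
  rw [h2, homAt_map_zero, he ⟨x, hx⟩, smul_zero, zero_add] at h3
  have h4 : χ x • δ e = 0 := h3.symm
  rwa [h1 x hxN, one_smul] at h4

lemma derFib_congr {k : ℕ} {x : M} {δ : HomAt d F E x} (hδ : δ ∈ A.derFib k x) {N : Opens M}
    (hx : x ∈ N) {e e' : ERSec d F E (⊤ : Opens M)}
    (he : ∀ y : N, e.1 ⟨y, trivial⟩ = e'.1 ⟨y, trivial⟩) : δ e = δ e' := by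
  rw [← sub_eq_zero, ← homAt_map_sub]
  exact derFib_local hδ hx fun y => by
    rw [Submodule.coe_sub, Pi.sub_apply, he y, sub_self]

/-- A derivation of `𝐄*_ℝ` at `x` extends to polynomial sections of `Sym 𝐄*`. -/
lemma exists_derivation_extension {k : ℕ} {x : M} {δ : HomAt d F E x} (hδ : δ ∈ A.derFib k x) :
    ∃ T : (∀ y : (⊤ : Opens M), SymFib E (y : M)) →ₗ[ℝ] SymFib E x, T 1 = 0 ∧
      ∀ (a : ℕ) (e : ERSec d F E (⊤ : Opens M)), HomSec ⊤ (a : ℤ) e → ∀ s ∈ polySec d F E ⊤,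
        T ((fun y : (⊤ : Opens M) => erToSym E (y : M) (e.1 y)) * s) =
          erToSym E x (δ e) * s ⟨x, trivial⟩ +
            sg ((k : ℤ) * a) • (erToSym E x (e.1 ⟨x, trivial⟩) * T s) := by
  classical
  -- Through a frame near `x`, sections of `Sym 𝐄*` are read as functions with values in the fixed
  -- algebra over `x`. The extension is the sum of a horizontal part, which differentiates the
  -- coefficients by the symbol of `δ`, and a vertical part, the twisted derivation that takes the
  -- values of `δ` on the dual frame.
  obtain ⟨W, hxW, ⟨Fr⟩⟩ := exists_dualFrame (d := d) F E x
  let x₀ : (⊤ : Opens M) := ⟨x, trivial⟩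
  let C : Submodule ℝ ((⊤ : Opens M) → ℝ) :=
    { carrier := {f | ContMDiff (𝓡 d) 𝓘(ℝ, ℝ) ∞ f}
      add_mem' := fun hf hg => ContMDiff.add hf hg
      zero_mem' := contMDiff_const
      smul_mem' := fun c f hf =>
        (contMDiff_const (I := 𝓡 d) (I' := 𝓘(ℝ, ℝ)) (c := c)).smul hf }
  let v : C →ₗ[ℝ] ℝ :=
    { toFun := fun f => symbol δ f.2
      map_add' := fun f g => by
        have : fsec F E (f + g).2 = fsec F E f.2 + fsec F E g.2 :=
          Subtype.ext (funext fun y => Prod.ext rfl (add_zero _).symm)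
        rw [symbol, this, homAt_map_add]
        rfl
      map_smul' := fun c f => by
        have : fsec F E (c • f).2 = c • fsec F E f.2 :=
          Subtype.ext (funext fun y => Prod.ext rfl (smul_zero _).symm)
        rw [symbol, this, homAt_map_smul]
        rfl }
  obtain ⟨w, hw⟩ := exists_vector_valued_extension (S := SymFib E x) C v
  have hvmul : ∀ f g : C, ∃ h : C, h.1 = (fun y => f.1 y * g.1 y) ∧
      v h = v f * g.1 x₀ + f.1 x₀ * v g := by
    intro f g
    refine ⟨⟨fun y => f.1 y * g.1 y, f.2.mul g.2⟩, rfl, ?_⟩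
    have h1 := derFib_fsmul hδ f.2 (fsec F E g.2)
    have h2 : fsmul f.2 (fsec F E g.2) = fsec F E (f.2.mul g.2) :=
      Subtype.ext (funext fun y => Prod.ext rfl (smul_zero _))
    rw [h2] at h1
    exact congrArg Prod.fst h1
  -- The map `w` is controlled only on finite sums of smooth functions times constant vectors. `P`
  -- is the space of these sums; it is shown below to contain all transported polynomial sections.
  let P : Submodule ℝ ((⊤ : Opens M) → SymFib E x) :=
    Submodule.span ℝ {σ | ∃ (f : C) (s : SymFib E x), σ = fun y => f.1 y • s}
  have hwP : ∀ (f : C) (c : SymFib E x), ∀ σ ∈ P, (fun y => f.1 y • (c * σ y)) ∈ P ∧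
      w (fun y => f.1 y • (c * σ y)) = v f • (c * σ x₀) + f.1 x₀ • (c * w σ) := by
    intro f c σ hσ
    induction hσ using Submodule.span_induction with
    | mem σ h =>
      obtain ⟨g, s, rfl⟩ := h
      obtain ⟨h, h1, h2⟩ := hvmul f g
      have h3 : (fun y => f.1 y • (c * g.1 y • s)) = fun y => h.1 y • (c * s) := by
        funext y
        rw [mul_smul_comm, smul_smul, h1]
      rw [h3]
      refine ⟨Submodule.subset_span ⟨h, _, rfl⟩, ?_⟩
      rw [hw, hw, h2, add_smul, mul_smul_comm, mul_smul_comm, smul_smul, smul_smul]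
    | zero =>
      have : (fun y => f.1 y • (c * (0 : (⊤ : Opens M) → SymFib E x) y)) = 0 := by
        funext y
        simp
      rw [this]
      exact ⟨P.zero_mem, by simp⟩
    | add a b _ _ ha hb =>
      have : (fun y => f.1 y • (c * (a + b) y)) =
          (fun y => f.1 y • (c * a y)) + fun y => f.1 y • (c * b y) := by
        funext y
        simp [mul_add]
      rw [this]
      refine ⟨P.add_mem ha.1 hb.1, ?_⟩
      rw [map_add, ha.2, hb.2, map_add, Pi.add_apply]
      simp only [mul_add, smul_add]
      abel
    | smul r a _ ha =>
      have : (fun y => f.1 y • (c * (r • a) y)) = r • fun y => f.1 y • (c * a y) := by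
        funext y
        simp [smul_comm r]
      rw [this]
      refine ⟨P.smul_mem r ha.1, ?_⟩
      rw [map_smul, ha.2, map_smul, Pi.smul_apply]
      simp only [mul_smul_comm, smul_add, smul_comm r]
  -- the transport to the fibre over `x`
  let φ : ∀ y : M, ∀ i, Module.Dual ℝ (E i y) →ₗ[ℝ] Module.Dual ℝ (E i x) := fun y i =>
    ∑ α, (LinearMap.toSpanSingleton ℝ _ (((Fr.cov i α).1 x₀).2 i)) ∘ₗ
      Module.Dual.eval ℝ _ (Fr.vec i α y)
  have hφ : ∀ y i ξ, φ y i ξ = ∑ α, ξ (Fr.vec i α y) • ((Fr.cov i α).1 x₀).2 i := by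
    intro y i ξ
    simp [φ]
  have hφx : ∀ i, φ x i = LinearMap.id := fun i => LinearMap.ext fun ξ => by
    rw [hφ]
    exact (Fr.expand ⟨x, hxW⟩ i ξ).symm
  let b : ∀ y : M, SymFib E y →ₐ[ℝ] SymFib E x := fun y => symMap (φ y)
  have hbx : ∀ s, b x s = s := fun s => by
    have : φ x = fun _ => LinearMap.id := funext hφx
    simp only [b, this, symMap_id]
  have hb : ∀ (y : M) i (ξ : Module.Dual ℝ (E i y)), b y (symι E y (Pi.single i ξ)) =
      ∑ α, ξ (Fr.vec i α y) • erToSym E x ((Fr.cov i α).1 x₀) := by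
    intro y i ξ
    have h1 : (fun j => φ y j (Pi.single (M := fun j => Module.Dual ℝ (E j y)) i ξ j)) =
        (Pi.single i (φ y i ξ) : DualFib E x) := by
      funext j
      by_cases h : j = i
      · subst h; simp
      · simp [Pi.single_eq_of_ne h]
    simp only [b]
    rw [symMap_symι, h1, hφ]
    have h2 : ∀ α, erToSym E x ((Fr.cov i α).1 x₀) =
        symι E x (Pi.single i (((Fr.cov i α).1 x₀).2 i)) := fun α => by
      have := Fr.cov_hom i α x₀
      push_cast at this
      rw [eq_single_of_mem_erDeg this, erToSym_single]
      simp
    simp only [h2]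
    rw [← LinearMap.single_apply ℝ (fun j => Module.Dual ℝ (E j x)), map_sum, map_sum]
    simp only [map_smul, LinearMap.single_apply]
  -- the vertical part
  let Δ : DualFib E x →ₗ[ℝ] SymFib E x := ∑ i, ∑ α,
    (LinearMap.toSpanSingleton ℝ _ (erToSym E x (δ (Fr.cov i α)))) ∘ₗ
      Module.Dual.eval ℝ _ (Fr.vec i α x) ∘ₗ LinearMap.proj i
  have hΔ : ∀ i (ξ : Module.Dual ℝ (E i x)), Δ (Pi.single i ξ) =
      ∑ α, ξ (Fr.vec i α x) • erToSym E x (δ (Fr.cov i α)) := by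
    intro i ξ
    simp only [Δ, LinearMap.sum_apply, LinearMap.comp_apply, LinearMap.proj_apply]
    rw [Finset.sum_eq_single i]
    · simp
    · intro j _ hj
      simp [Pi.single_eq_of_ne hj]
    · simp
  obtain ⟨D, hD1, hD⟩ := exists_twisted_derivation (E := E) (x := x) k Δ (by
    intro i ξ
    rw [hΔ]
    refine Submodule.sum_mem _ fun α _ => Submodule.smul_mem _ _ (erToSym_mem_symDeg ?_)
    have := derFib_deg hδ (Fr.cov_hom i α)
    push_cast at this
    exact this)
  -- A homogeneous generator is transported to finitely many smooth coefficients `f j` times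
  -- constants `c j`. Then `δ e` is the symbol applied to the coefficients plus a vertical term `q`,
  -- which is zero in degree zero and the value of `Δ` in degrees `1, …, n`.
  have claim : ∀ (a : ℕ) (e : ERSec d F E (⊤ : Opens M)), HomSec ⊤ (a : ℤ) e →
      ∃ (m : ℕ) (f : Fin m → C) (c : Fin m → SymFib E x) (q : SymFib E x),
        (∀ y : (⊤ : Opens M), b y (erToSym E (y : M) (e.1 y)) = ∑ j, (f j).1 y • c j) ∧
        erToSym E x (δ e) = ∑ j, v (f j) • c j + q ∧
        ∀ t, D (erToSym E x (e.1 x₀) * t) =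
          q * t + sg ((k : ℤ) * a) • (erToSym E x (e.1 x₀) * D t) := by
    intro a e he
    rcases Nat.eq_zero_or_pos a with rfl | ha
    · have h1 : ∀ y, e.1 y = ((e.1 y).1, 0) := fun y => eq_scalar_of_mem_erDeg_zero (he y)
      have h2 : e = fsec F E e.2.1 := Subtype.ext (funext h1)
      refine ⟨1, fun _ => ⟨_, e.2.1⟩, fun _ => 1, 0, fun y => ?_, ?_, fun t => ?_⟩
      · rw [h1 y, erToSym_scalar, AlgHom.commutes, Fin.sum_univ_one, Algebra.algebraMap_eq_smul_one]
      · rw [Fin.sum_univ_one, add_zero]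
        conv_lhs => rw [h2]
        rw [derFib_fsec hδ, erToSym_scalar, Algebra.algebraMap_eq_smul_one]
        rfl
      · rw [h1 x₀, erToSym_scalar, ← Algebra.smul_def, ← Algebra.smul_def, map_smul, zero_mul,
          Nat.cast_zero, mul_zero, sg_zero, one_smul, zero_add]
    by_cases han : a ≤ n
    · obtain ⟨i, rfl⟩ : ∃ i : Fin n, a = (i : ℕ) + 1 :=
        ⟨⟨a - 1, by omega⟩, (Nat.succ_pred_eq_of_pos ha).symm⟩
      have h1 : ∀ y, e.1 y = (0, Pi.single i ((e.1 y).2 i)) := fun y =>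
        eq_single_of_mem_erDeg (by have := he y; push_cast at this; exact this)
      have hf := fun α => Fr.smooth ⊤ e i α
      have h2 : δ e = ∑ α, (symbol δ (hf α) • (Fr.cov i α).1 x₀ +
          (e.1 x₀).2 i (Fr.vec i α x) • δ (Fr.cov i α)) := by
        have h3 : δ e = δ (∑ α, fsmul (hf α) (Fr.cov i α)) := derFib_congr hδ hxW fun y => by
          have h4 : ∀ α, (Fr.cov i α).1 ⟨y, trivial⟩ =
              (0, Pi.single i (((Fr.cov i α).1 ⟨y, trivial⟩).2 i)) := fun α =>
            eq_single_of_mem_erDeg (by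
              have := Fr.cov_hom i α ⟨y, trivial⟩; push_cast at this; exact this)
          rw [h1, Submodule.coe_sum, Finset.sum_apply]
          ext1
          · rw [Prod.fst_sum]
            refine (Finset.sum_eq_zero fun α _ => ?_).symm
            change _ • ((Fr.cov i α).1 ⟨y, trivial⟩).1 = 0
            rw [h4 α, smul_zero]
          · rw [Prod.snd_sum]
            have h5 : ∀ α, ((fsmul (hf α) (Fr.cov i α)).1 ⟨y, trivial⟩).2 =
                (e.1 ⟨y, trivial⟩).2 i (Fr.vec i α y) •
                  (Pi.single i (((Fr.cov i α).1 ⟨y, trivial⟩).2 i) : DualFib E (y : M)) := fun α => by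
              change _ • ((Fr.cov i α).1 ⟨y, trivial⟩).2 = _
              rw [h4 α]
              simp
            simp only [h5]
            conv_lhs => rw [Fr.expand y i ((e.1 ⟨y, trivial⟩).2 i)]
            rw [← LinearMap.single_apply ℝ (fun j => Module.Dual ℝ (E j (y : M))), map_sum]
            simp only [map_smul, LinearMap.single_apply]
        rw [h3, homAt_map_sum]
        exact Finset.sum_congr rfl fun α _ => derFib_fsmul hδ (hf α) _
      refine ⟨_, fun α => ⟨_, hf α⟩, fun α => erToSym E x ((Fr.cov i α).1 x₀),
        Δ (Pi.single i ((e.1 x₀).2 i)), fun y => ?_, ?_, fun t => ?_⟩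
      · rw [h1 y, erToSym_single, hb]
      · rw [h2, Finset.sum_add_distrib, map_add, map_sum, map_sum, hΔ]
        simp only [map_smul]
        rfl
      · rw [h1 x₀, erToSym_single, hD]
        simp
    · have h0 : e = 0 := homSec_eq_zero (Or.inr (by omega)) he
      refine ⟨0, fun j => j.elim0, fun j => j.elim0, 0, fun y => ?_, ?_, fun t => ?_⟩
      · rw [h0]
        simp
      · rw [h0, homAt_map_zero]
        simp
      · rw [h0]
        simp
  have hbmul : ∀ (a : ℕ) (e : ERSec d F E (⊤ : Opens M)), HomSec ⊤ (a : ℤ) e → ∀ (m : ℕ)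
      (f : Fin m → C) (c : Fin m → SymFib E x),
      (∀ y : (⊤ : Opens M), b y (erToSym E (y : M) (e.1 y)) = ∑ j, (f j).1 y • c j) →
      ∀ s : ∀ y : (⊤ : Opens M), SymFib E (y : M),
      (fun y : (⊤ : Opens M) => b y (((fun y : (⊤ : Opens M) => erToSym E (y : M) (e.1 y)) * s) y)) =
        ∑ j, fun y => (f j).1 y • (c j * b y (s y)) := by
    intro a e he m f c h s
    funext y
    rw [Pi.mul_apply, map_mul, h y, Finset.sum_mul, Finset.sum_apply]
    simp only [smul_mul_assoc]
  have hP : ∀ s ∈ polySec d F E ⊤, (fun y : (⊤ : Opens M) => b y (s y)) ∈ P := by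
    have h1 : ∀ l s, HomPoly d F ⊤ l s → (fun y : (⊤ : Opens M) => b y (s y)) ∈ P := by
      intro l s hs
      induction hs with
      | zero =>
        simp only [Pi.zero_apply, map_zero]
        exact P.zero_mem
      | one =>
        refine Submodule.subset_span ⟨⟨fun _ => 1, contMDiff_const⟩, 1, ?_⟩
        funext y
        rw [Pi.one_apply, map_one, one_smul]
      | add _ _ h1 h2 =>
        simp only [Pi.add_apply, map_add]
        exact P.add_mem h1 h2
      | mul a e he _ ih =>
        obtain ⟨m, f, c, q, h, -, -⟩ := claim a e he
        rw [hbmul a e he m f c h]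
        exact P.sum_mem fun j _ => (hwP (f j) (c j) _ ih).1
    intro s hs
    obtain ⟨t, ht, rfl⟩ := polySec_decomp hs
    have h2 : (fun y : (⊤ : Opens M) => b y ((t.sum fun _ v => v) y)) =
        ∑ l ∈ t.support, fun y : (⊤ : Opens M) => b y (t l y) := by
      funext y
      rw [Finsupp.sum, Finset.sum_apply, Finset.sum_apply, map_sum]
    rw [h2]
    exact P.sum_mem fun l _ => h1 l _ (ht l)
  -- The horizontal part is compatible with the sign of the twisted rule: for `k = 0` the sign is
  -- trivial, and for `k > 0` the symbol and with it the horizontal part vanish.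
  have hsg : ∀ (a : ℕ), ∀ σ ∈ P, sg ((k : ℤ) * a) • w σ = w σ := by
    intro a σ hσ
    rcases Nat.eq_zero_or_pos k with rfl | hk
    · rw [Nat.cast_zero, zero_mul, sg_zero, one_smul]
    · have : w σ = 0 := by
        induction hσ using Submodule.span_induction with
        | mem σ h =>
          obtain ⟨f, s, rfl⟩ := h
          have : v f = 0 := symbol_eq_zero hk hδ f.2
          rw [hw, this, zero_smul]
        | zero => exact map_zero _
        | add a b _ _ ha hb => rw [map_add, ha, hb, add_zero]
        | smul r a _ ha => rw [map_smul, ha, smul_zero]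
      rw [this, smul_zero]
  let B : (∀ y : (⊤ : Opens M), SymFib E (y : M)) →ₗ[ℝ] ((⊤ : Opens M) → SymFib E x) :=
    { toFun := fun s y => b y (s y)
      map_add' := fun s t => funext fun y => map_add _ _ _
      map_smul' := fun c s => funext fun y => map_smul (b y) c (s y) }
  refine ⟨w ∘ₗ B + D ∘ₗ LinearMap.proj x₀, ?_, fun a e he s hs => ?_⟩
  · have h1 : B 1 = fun y => (1 : ℝ) • (1 : SymFib E x) := by
      funext y
      rw [one_smul]
      exact map_one (b y)
    have h2 : v ⟨fun _ => 1, contMDiff_const⟩ = 0 := by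
      obtain ⟨h, h1, h2⟩ := hvmul ⟨fun _ => 1, contMDiff_const⟩ ⟨fun _ => 1, contMDiff_const⟩
      have h3 : h = ⟨fun _ => 1, contMDiff_const⟩ := Subtype.ext (by rw [h1]; simp)
      rw [h3] at h2
      simpa using h2
    rw [LinearMap.add_apply, LinearMap.comp_apply, h1, hw ⟨fun _ => 1, contMDiff_const⟩, h2,
      zero_smul, zero_add]
    exact hD1
  · obtain ⟨m, f, c, q, h1, h2, h3⟩ := claim a e he
    have h4 := hbmul a e he m f c h1 s
    have h5 := h1 x₀
    rw [hbx] at h5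
    have h6 : ∀ j, w (fun y => (f j).1 y • (c j * b y (s y))) =
        v (f j) • (c j * s x₀) + (f j).1 x₀ • (c j * w (B s)) := fun j => by
      rw [(hwP (f j) (c j) _ (hP s hs)).2]
      congr 3
      exact hbx _
    have h7 : w (B ((fun y : (⊤ : Opens M) => erToSym E (y : M) (e.1 y)) * s)) =
        (∑ j, v (f j) • c j) * s x₀ + erToSym E x (e.1 x₀) * w (B s) := by
      rw [h5, Finset.sum_mul, Finset.sum_mul, ← Finset.sum_add_distrib]
      refine (congrArg w h4).trans ?_
      rw [map_sum]
      refine Finset.sum_congr rfl fun j _ => ?_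
      rw [h6, smul_mul_assoc, smul_mul_assoc]
    simp only [LinearMap.add_apply, LinearMap.comp_apply, LinearMap.proj_apply, Pi.mul_apply]
    rw [h7, h3, h2, mul_add, smul_add, add_mul, ← mul_smul_comm _ _ (w (B s)),
      show sg ((k : ℤ) * a) • w (B s) = w (B s) from hsg a _ (hP s hs)]
    abel

end Derivations

end CoalgebraBundle

/-! ## The vector field of a section of `Der(𝐄*_ℝ, m)₋ₖ` -/

namespace CoalgebraBundle

section Extension

variable {d : ℕ} {n : ℕ} {M : Type*} [TopologicalSpace M] [T2Space M]
  [ChartedSpace (EuclideanSpace ℝ (Fin d)) M] [IsManifold (𝓡 d) ∞ M]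
  {F : Fin n → Type*} [∀ i, NormedAddCommGroup (F i)] [∀ i, NormedSpace ℝ (F i)]
  {E : Fin n → M → Type*} [∀ i x, AddCommGroup (E i x)] [∀ i x, Module ℝ (E i x)]
  [∀ i, TopologicalSpace (Bundle.TotalSpace (F i) (E i))] [∀ i x, TopologicalSpace (E i x)]
  [∀ i, FiberBundle (F i) (E i)] [∀ i, VectorBundle ℝ (F i) (E i)]
  [∀ i, FiniteDimensional ℝ (F i)] [∀ i, ContMDiffVectorBundle ∞ (F i) (E i) (𝓡 d)]

variable {A : CoalgebraBundle d F E}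

lemma toFunc_eq_iff {U : Opens M} {s t : symSec d F E U} :
    A.toFunc U s = A.toFunc U t ↔ A.InIdeal U (s - t) := by
  rw [← sub_eq_zero, ← map_sub, toFunc_eq_zero]

/-- The smooth operator on sections of `Sym 𝐄*` given by extensions of derivations. -/
lemma exists_symSec_operator {k : ℕ} {U : Opens M} {δ : ∀ x : U, HomAt d F E (x : M)}
    (hδ : A.IsDerSection U k δ) :
    ∃ T : ∀ x : U, (∀ y : (⊤ : Opens M), SymFib E (y : M)) →ₗ[ℝ] SymFib E (x : M),
    ∃ X : symSec d F E U →ₗ[ℝ] symSec d F E U,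
      (∀ x, T x 1 = 0) ∧
      (∀ (x : U) (a : ℕ) (e : ERSec d F E (⊤ : Opens M)), HomSec ⊤ (a : ℤ) e →
        ∀ s ∈ polySec d F E ⊤,
        T x ((fun y : (⊤ : Opens M) => erToSym E (y : M) (e.1 y)) * s) =
          erToSym E (x : M) (δ x e) * s ⟨x, trivial⟩ +
            sg ((k : ℤ) * a) • (erToSym E (x : M) (e.1 ⟨x, trivial⟩) * T x s)) ∧
      ∀ (s : symSec d F E U) (p : ∀ y : (⊤ : Opens M), SymFib E (y : M)), p ∈ polySec d F E ⊤ →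
        ∀ (N : Opens M) (hN : N ≤ U), (∀ y : N, p ⟨y, trivial⟩ = s.1 ⟨y, hN y.2⟩) →
        ∀ x : N, (X s).1 ⟨x, hN x.2⟩ = T ⟨x, hN x.2⟩ p := by
  choose T hT1 hT using fun x : U => exists_derivation_extension (hδ.1 x)
  -- The product rule with a bump function makes `T x` local on polynomial sections, so it can be
  -- applied to germs of smooth sections by choosing global polynomial representatives.
  have hloc : ∀ (x : U) (N : Opens M), (x : M) ∈ N → ∀ p ∈ polySec d F E ⊤,
      (∀ y : N, p ⟨y, trivial⟩ = 0) → T x p = 0 := by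
    intro x N hx p hp h
    obtain ⟨χ, N', Z, hχ, hxN, hN', h1, h0, hc⟩ := exists_bump (d := d) hx
    have hχ' := contMDiff_restrict hχ ⊤
    have h2 : (fun y : (⊤ : Opens M) => erToSym E (y : M) ((fsec F E hχ').1 y)) * p = 0 := by
      funext y
      change erToSym E (y : M) (χ y, 0) * p y = 0
      rcases hc y with hy | hy
      · rw [h ⟨y, hy⟩, mul_zero]
      · rw [h0 y hy, erToSym_scalar, map_zero, zero_mul]
    have h3 := hT x 0 _ (fsec_homSec hχ') p hp
    rw [h2, map_zero, h ⟨x, hx⟩, mul_zero, zero_add, Nat.cast_zero, mul_zero, sg_zero,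
      one_smul] at h3
    have h4 : erToSym E (x : M) (χ x, 0) * T x p = 0 := h3.symm
    rwa [h1 x hxN, erToSym_scalar, map_one, one_mul] at h4
  have hcongr : ∀ (x : U) (N : Opens M), (x : M) ∈ N → ∀ p ∈ polySec d F E ⊤,
      ∀ q ∈ polySec d F E ⊤, (∀ y : N, p ⟨y, trivial⟩ = q ⟨y, trivial⟩) → T x p = T x q := by
    intro x N hx p hp q hq h
    rw [← sub_eq_zero, ← map_sub]
    exact hloc x N hx _ (sub_mem hp hq) fun y => by rw [Pi.sub_apply, h y, sub_self]
  -- The extensions `T x` were chosen point by point. Smooth dependence on `x` still holds, because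
  -- the product rule reduces `T x` of a polynomial to the values of `δ` on its generators.
  have hsm : ∀ p ∈ polySec d F E ⊤, (fun x : U => T x p) ∈ symSec d F E U := by
    have h1 : ∀ l p, HomPoly d F ⊤ l p → (fun x : U => T x p) ∈ symSec d F E U := by
      intro l p hp
      induction hp with
      | zero =>
        simp only [map_zero]
        exact zero_mem (symSec d F E U)
      | one =>
        simp only [hT1]
        exact zero_mem (symSec d F E U)
      | add _ _ h1 h2 =>
        simp only [map_add]
        exact add_mem h1 h2
      | mul a e he hs ih =>
        rw [funext fun x => hT x a e he _ hs.mem_polySec]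
        refine add_mem (mul_mem (erToSymSec d F E U ⟨_, hδ.2 e⟩).2
          (symRes d F E le_top ⟨_, polySec_le_symSec ⊤ hs.mem_polySec⟩).2)
          (zsmul_mem (mul_mem (erToSymSec d F E U (erRes d F E le_top e)).2 ih) _)
    intro p hp
    obtain ⟨t, ht, rfl⟩ := polySec_decomp hp
    have h2 : (fun x : U => T x (t.sum fun _ v => v)) =
        ∑ l ∈ t.support, fun x : U => T x (t l) := by
      funext x
      rw [Finsupp.sum, map_sum, Finset.sum_apply]
    rw [h2]
    exact sum_mem fun l _ => h1 l _ (ht l)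
  choose N hN p hxN hp h using fun (s : symSec d F E U) (x : U) => symSec_exists_global s x.2
  have hX : ∀ (s : symSec d F E U) (q : ∀ y : (⊤ : Opens M), SymFib E (y : M)),
      q ∈ polySec d F E ⊤ → ∀ (N' : Opens M) (hN' : N' ≤ U),
      (∀ y : N', q ⟨y, trivial⟩ = s.1 ⟨y, hN' y.2⟩) →
      ∀ x : N', T ⟨x, hN' x.2⟩ (p s ⟨x, hN' x.2⟩) = T ⟨x, hN' x.2⟩ q := by
    intro s q hq N' hN' h' x
    refine hcongr _ (N s ⟨x, hN' x.2⟩ ⊓ N') ⟨hxN s _, x.2⟩ _ (hp s _) _ hq fun y => ?_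
    rw [h s _ ⟨y, y.2.1⟩, h' ⟨y, y.2.2⟩]
  have hXm : ∀ s : symSec d F E U, (fun x : U => T x (p s x)) ∈ symSec d F E U := by
    intro s
    refine symSec_of_local fun x => ⟨N s x, hN s x, hxN s x, ?_⟩
    have : rawRes E (hN s x) (fun x : U => T x (p s x)) =
        rawRes E (hN s x) (fun y : U => T y (p s x)) := by
      funext y
      exact hX s (p s x) (hp s x) (N s x) (hN s x) (h s x) y
    rw [this]
    exact (symRes d F E (hN s x) ⟨_, hsm _ (hp s x)⟩).2
  refine ⟨T, ⟨⟨fun s => ⟨_, hXm s⟩, fun s t => Subtype.ext (funext fun x => ?_)⟩,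
    fun c s => Subtype.ext (funext fun x => ?_)⟩, hT1, hT, fun s q hq N' hN' h' x =>
      hX s q hq N' hN' h' x⟩
  · refine (hX (s + t) (p s x + p t x) (add_mem (hp s x) (hp t x)) (N s x ⊓ N t x)
      (inf_le_left.trans (hN s x)) (fun y => ?_) ⟨x, hxN s x, hxN t x⟩).trans (map_add (T x) _ _)
    rw [Pi.add_apply, h s x ⟨y, y.2.1⟩, h t x ⟨y, y.2.2⟩]
    rfl
  · refine (hX (c • s) (c • p s x) (Subalgebra.smul_mem _ (hp s x) c) (N s x) (hN s x)
      (fun y => ?_) ⟨x, hxN s x⟩).trans (map_smul (T x) _ _)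
    rw [Pi.smul_apply, h s x y]
    rfl

open scoped Pointwise in
/-- Every smooth section of `Der(𝐄*_ℝ, m)₋ₖ` is the derivation given by a vector field. -/
theorem exists_vf_of_isDerSection {k : ℕ} {U : Opens M} {δ : ∀ x : U, HomAt d F E (x : M)}
    (hδ : A.IsDerSection U k δ) :
    ∃ X ∈ A.vectorField U (-(k : ℤ)), ∀ x : U, A.vfVal X x = δ x := by
  obtain ⟨T, X, hT1, hT, hX⟩ := exists_symSec_operator hδ
  have germ : ∀ (s : symSec d F E U) (x : U), ∃ (N : Opens M) (hN : N ≤ U)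
      (p : ∀ y : (⊤ : Opens M), SymFib E (y : M)), (x : M) ∈ N ∧ p ∈ polySec d F E ⊤ ∧
      (∀ y : N, p ⟨y, trivial⟩ = s.1 ⟨y, hN y.2⟩) ∧ (X s).1 x = T x p := by
    intro s x
    obtain ⟨N, hN, p, hxN, hp, h⟩ := symSec_exists_global s x.2
    exact ⟨N, hN, p, hxN, hp, h, hX s p hp N hN h ⟨x, hxN⟩⟩
  have germ_hom : ∀ (s : symSec d F E U) (l : ℤ), (∀ x : U, s.1 x ∈ symDeg E (x : M) l) →
      ∀ x : U, ∃ (N : Opens M) (hN : N ≤ U)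
      (p : ∀ y : (⊤ : Opens M), SymFib E (y : M)), (x : M) ∈ N ∧ HomPoly d F ⊤ l p ∧
      (∀ y : N, p ⟨y, trivial⟩ = s.1 ⟨y, hN y.2⟩) ∧ (X s).1 x = T x p := by
    intro s l hl x
    obtain ⟨N, hN, p, hxN, hp, h⟩ := symSec_exists_global_hom s hl x.2
    exact ⟨N, hN, p, hxN, hp, h, hX s p hp.mem_polySec N hN h ⟨x, hxN⟩⟩
  have hTdeg : ∀ (x : U) l p, HomPoly d F ⊤ l p → T x p ∈ symDeg E (x : M) (l - k) := by
    intro x l p hp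
    induction hp with
    | zero => rw [map_zero]; exact Submodule.zero_mem _
    | one => rw [hT1]; exact Submodule.zero_mem _
    | add _ _ h1 h2 => rw [map_add]; exact Submodule.add_mem _ h1 h2
    | @mul l a e he s hs ih =>
      rw [hT x a e he _ hs.mem_polySec]
      refine Submodule.add_mem _ ?_ (zsmul_mem ?_ _)
      · have := mul_mem_symDeg (erToSym_mem_symDeg (derFib_deg (hδ.1 x) he))
          (hs.mem_symDeg ⟨x, trivial⟩)
        rwa [sub_add_eq_add_sub] at this
      · have := mul_mem_symDeg (erToSym_mem_symDeg (he ⟨x, trivial⟩)) ih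
        rwa [← add_sub_assoc] at this
  have hTmul : ∀ (x : U) l p, HomPoly d F ⊤ l p → ∀ q ∈ polySec d F E ⊤,
      T x (p * q) = T x p * q ⟨x, trivial⟩ + sg (k * l) • (p ⟨x, trivial⟩ * T x q) := by
    intro x l p hp q hq
    induction hp with
    | zero => simp
    | one => simp [hT1]
    | add _ _ h1 h2 =>
      rw [add_mul, map_add, h1, h2, map_add, Pi.add_apply, add_mul, add_mul, smul_add]
      abel
    | @mul l a e he s hs ih =>
      rw [mul_assoc, hT x a e he _ (mul_mem hs.mem_polySec hq), ih, hT x a e he _ hs.mem_polySec]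
      simp only [Pi.mul_apply, mul_add, smul_add, add_mul, mul_assoc, smul_mul_assoc,
        mul_smul_comm, smul_smul, sg_add]
      abel
  have hXdeg : ∀ (s : symSec d F E U) (l : ℤ), (∀ x : U, s.1 x ∈ symDeg E (x : M) l) →
      ∀ x : U, (X s).1 x ∈ symDeg E (x : M) (l - k) := by
    intro s l hl x
    obtain ⟨N, hN, p, hxN, hp, h, h'⟩ := germ_hom s l hl x
    rw [h']
    exact hTdeg x l p hp
  have hXmul : ∀ (s : symSec d F E U) (l : ℤ), (∀ x : U, s.1 x ∈ symDeg E (x : M) l) →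
      ∀ t : symSec d F E U, X (s * t) = X s * t + sg (k * l) • (s * X t) := by
    intro s l hl t
    apply Subtype.ext
    funext x
    obtain ⟨N, hN, p, hxN, hp, h, h'⟩ := germ_hom s l hl x
    obtain ⟨N', hN', q, hxN', hq, g, g'⟩ := germ t x
    have h1 := hX (s * t) (p * q) (mul_mem hp.mem_polySec hq) (N ⊓ N') (inf_le_left.trans hN)
      (fun y => by rw [Pi.mul_apply, h ⟨y, y.2.1⟩, g ⟨y, y.2.2⟩]; rfl) ⟨x, hxN, hxN'⟩
    refine h1.trans ?_
    rw [hTmul _ l p hp q hq, ← h', ← g', h ⟨x, hxN⟩, g ⟨x, hxN'⟩]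
    rfl
  have hTe : ∀ (x : U) (e : ERSec d F E (⊤ : Opens M)),
      T x (fun y : (⊤ : Opens M) => erToSym E (y : M) (e.1 y)) = erToSym E (x : M) (δ x e) := by
    intro x e
    induction e using erSec_induction with
    | add e e' h h' =>
      rw [homAt_map_add, map_add, ← h, ← h', ← map_add]
      congr 1
      funext y
      exact map_add _ _ _
    | hom a e ha he =>
      have := hT x a e he 1 (one_mem _)
      rwa [mul_one, Pi.one_apply, mul_one, hT1, mul_zero, smul_zero, add_zero] at this
  let D : ERSec d F E (⊤ : Opens M) → ERSec d F E U := fun e => ⟨_, hδ.2 e⟩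
  have hXe : ∀ e : ERSec d F E (⊤ : Opens M),
      X (erToSymSec d F E U (erRes d F E le_top e)) = erToSymSec d F E U (D e) := by
    intro e
    apply Subtype.ext
    funext x
    exact (hX _ (fun y : (⊤ : Opens M) => erToSym E (y : M) (e.1 y))
      (Algebra.subset_adjoin ⟨e.1, e.2, rfl⟩) U le_rfl (fun _ => rfl) x).trans (hTe x e)
  let r : symSec d F E ⊤ →ₐ[ℝ] symSec d F E U := symRes d F E le_top
  have hXf : ∀ (s : symSec d F E U) (l : ℤ), (∀ x : U, s.1 x ∈ symDeg E (x : M) l) →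
      ∀ t : symSec d F E U, A.toFunc U (X (s * t)) =
        A.toFunc U (X s) * A.toFunc U t + sg (k * l) • (A.toFunc U s * A.toFunc U (X t)) := by
    intro s l hl t
    rw [hXmul s l hl, map_add, map_mul, map_zsmul, map_mul]
  -- The elements `τ g υ`, with `g` a relation, span the ideal. By the product rule it is enough
  -- that both `g` and `X g` vanish in the quotient; `τ` has to be split into homogeneous parts for
  -- the signs to make sense.
  have hgen : ∀ (a b : ℕ) (ξ η : ERSec d F E (⊤ : Opens M)), HomSec ⊤ (a : ℤ) ξ →
      HomSec ⊤ (b : ℤ) η → a + b ≤ n → ∀ τ ∈ polySec d F E ⊤, ∀ υ : symSec d F E U,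
      ∀ hτ, A.toFunc U (X (r ⟨τ, hτ⟩ * (r (erToSymSec d F E ⊤ ξ * erToSymSec d F E ⊤ η -
        erToSymSec d F E ⊤ (secMul A ξ η)) * υ))) = 0 := by
    intro a b ξ η hξ hη hab τ hτp υ hτ
    set g := r (erToSymSec d F E ⊤ ξ * erToSymSec d F E ⊤ η - erToSymSec d F E ⊤ (secMul A ξ η))
      with hg
    have hr : ∀ e, r (erToSymSec d F E ⊤ e) = erToSymSec d F E U (erRes d F E le_top e) :=
      fun e => rfl
    have hξU := hξ.restrict (le_top : U ≤ ⊤)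
    have hηU := hη.restrict (le_top : U ≤ ⊤)
    have hD : ∀ (c : ℤ) e, HomSec ⊤ c e → HomSec U (c - k) (D e) := fun c e he x =>
      derFib_deg (hδ.1 x) he
    have hgdeg : ∀ x : U, g.1 x ∈ symDeg E (x : M) (a + b) := fun x =>
      Submodule.sub_mem _ (mul_mem_symDeg (erToSym_mem_symDeg (hξ ⟨x, trivial⟩))
        (erToSym_mem_symDeg (hη ⟨x, trivial⟩)))
        (erToSym_mem_symDeg (HomSec.secMul A hξ hη ⟨x, trivial⟩))
    have hg0 : A.toFunc U g = 0 := by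
      rw [hg, map_sub, map_mul, map_sub, map_mul, hr, hr, hr, ← cls_apply, ← cls_apply, ← cls_apply,
        A.cls_mul hξU hηU (by exact_mod_cast hab), sub_eq_zero]
      rfl
    -- This is where compatibility with `m` is used: `X g` is the relation for `δ ξ` and `η` plus,
    -- up to sign, the one for `ξ` and `δ η`. The total degree has not grown, so both hold in the
    -- quotient.
    have hXg : A.toFunc U (X g) = 0 := by
      have h1 : D (secMul A ξ η) = secMul A (D ξ) (erRes d F E le_top η) +
          sg ((k : ℤ) * a) • secMul A (erRes d F E le_top ξ) (D η) :=
        Subtype.ext (funext fun x => derFib_mul (hδ.1 x) hξ hη hab)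
      rw [hg, map_sub, map_mul, map_sub, map_sub, hr, hr, hr,
        hXf _ a fun x => erToSym_mem_symDeg (hξU x), hXe, hXe, hXe]
      simp only [← cls_apply]
      rw [A.cls_mul (hD a ξ hξ) hηU (by omega), A.cls_mul hξU (hD b η hη) (by omega), h1, map_add,
        LinearMap.map_smul_of_tower, sub_self]
    have hgυ : A.toFunc U (X (g * υ)) = 0 := by
      rw [hXf g _ hgdeg, hXg, hg0, zero_mul, zero_mul, smul_zero, add_zero]
    have hmain : ∀ l τ, HomPoly d F ⊤ l τ → ∀ hτ : τ ∈ symSec d F E ⊤,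
        A.toFunc U (X (r ⟨τ, hτ⟩ * (g * υ))) = 0 := by
      intro l τ h hτ
      rw [hXf _ l (fun x => h.mem_symDeg ⟨x, trivial⟩), hgυ, map_mul (A.toFunc U) g, hg0, zero_mul,
        mul_zero, mul_zero, smul_zero, add_zero]
    obtain ⟨t, ht, rfl⟩ := polySec_decomp hτp
    have h2 : (⟨_, hτ⟩ : symSec d F E ⊤) =
        ∑ l ∈ t.support, ⟨t l, polySec_le_symSec ⊤ (ht l).mem_polySec⟩ := by
      apply Subtype.ext
      rw [AddSubmonoidClass.coe_finset_sum]
      rfl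
    rw [h2, map_sum, Finset.sum_mul, map_sum, map_sum]
    exact Finset.sum_eq_zero fun l _ => hmain l _ (ht l) _
  have hideal : ∀ s : symSec d F E U, A.InIdeal U s → A.toFunc U (X s) = 0 := by
    intro s hs
    refine A.func_eq_zero_of_local fun x => ?_
    obtain ⟨W, hW, hxW, hm⟩ := hs x
    rw [TwoSidedIdeal.mem_span_iff_mem_addSubgroup_closure] at hm
    -- Membership in the ideal is local, with factors defined on `W` only. Near `x` every factor is
    -- replaced by a global one, so that the calculation for global factors applies.
    have key : ∀ z : symSec d F E W, z ∈ AddSubgroup.closure ((Set.univ : Set (symSec d F E W)) * A.idealGen W * Set.univ) →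
        ∃ N : Opens M, ∃ hN : N ≤ W, ∃ p : symSec d F E ⊤, (x : M) ∈ N ∧ p.1 ∈ polySec d F E ⊤ ∧
          (∀ y : N, p.1 ⟨y, trivial⟩ = z.1 ⟨y, hN y.2⟩) ∧ A.toFunc U (X (r p)) = 0 := by
      intro z hz
      induction hz using AddSubgroup.closure_induction with
      | mem z hz =>
        obtain ⟨_, ⟨τ, -, g, hg, rfl⟩, υ, -, rfl⟩ := hz
        obtain ⟨a, b, ξ, η, -, -, hab, hξ, hη, hg⟩ := hg
        obtain ⟨N₁, hN₁, τ', hx₁, hτ', h₁⟩ := symSec_exists_global τ hxW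
        obtain ⟨N₂, hN₂, υ', hx₂, hυ', h₂⟩ := symSec_exists_global υ hxW
        obtain ⟨N₃, hN₃, ξ', hx₃, h₃, hξ'⟩ := NManifold.exists_global hxW ξ
        obtain ⟨N₄, hN₄, η', hx₄, h₄, hη'⟩ := NManifold.exists_global hxW η
        refine ⟨N₁ ⊓ N₂ ⊓ (N₃ ⊓ N₄), (inf_le_left.trans inf_le_left).trans hN₁,
          ⟨τ', polySec_le_symSec ⊤ hτ'⟩ * ((erToSymSec d F E ⊤ ξ' * erToSymSec d F E ⊤ η' -
            erToSymSec d F E ⊤ (secMul A ξ' η')) * ⟨υ', polySec_le_symSec ⊤ hυ'⟩),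
          ⟨⟨hx₁, hx₂⟩, hx₃, hx₄⟩, ?_, fun y => ?_, ?_⟩
        · have he : ∀ e : ERSec d F E (⊤ : Opens M), (erToSymSec d F E ⊤ e).1 ∈ polySec d F E ⊤ :=
            fun e => Algebra.subset_adjoin ⟨e.1, e.2, rfl⟩
          exact mul_mem hτ' (mul_mem (sub_mem (mul_mem (he _) (he _)) (he _)) hυ')
        · have e1 := h₁ ⟨y, y.2.1.1⟩
          have e2 := h₂ ⟨y, y.2.1.2⟩
          have e3 := h₃ ⟨y, y.2.2.1⟩
          have e4 := h₄ ⟨y, y.2.2.2⟩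
          change τ' ⟨y, trivial⟩ * ((erToSym E (y : M) (ξ'.1 ⟨y, trivial⟩) *
            erToSym E (y : M) (η'.1 ⟨y, trivial⟩) - erToSym E (y : M)
              (erMul (A.comul (y : M)) (ξ'.1 ⟨y, trivial⟩) (η'.1 ⟨y, trivial⟩))) *
              υ' ⟨y, trivial⟩) = τ.1 ⟨y, _⟩ * g.1 ⟨y, _⟩ * υ.1 ⟨y, _⟩
          rw [e1, e2, e3, e4, hg, mul_assoc]
        · rw [map_mul r, map_mul r]
          exact hgen a b ξ' η' (hξ' _ hξ) (hη' _ hη) hab τ' hτ' _ _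
      | zero => exact ⟨W, le_rfl, 0, hxW, zero_mem _, fun _ => rfl, by simp only [map_zero]⟩
      | add z z' _ _ h h' =>
        obtain ⟨N, hN, p, hx, hp, h1, h2⟩ := h
        obtain ⟨N', hN', p', hx', hp', h1', h2'⟩ := h'
        refine ⟨N ⊓ N', inf_le_left.trans hN, p + p', ⟨hx, hx'⟩, add_mem hp hp', fun y => ?_, ?_⟩
        · exact congrArg₂ (· + ·) (h1 ⟨y, y.2.1⟩) (h1' ⟨y, y.2.2⟩)
        · simp only [map_add, h2, h2', add_zero]
      | neg z _ h =>
        obtain ⟨N, hN, p, hx, hp, h1, h2⟩ := h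
        refine ⟨N, hN, -p, hx, neg_mem hp, fun y => congrArg (- ·) (h1 y), ?_⟩
        simp only [map_neg, h2, neg_zero]
    obtain ⟨N, hN, p, hxN, hp, h1, h2⟩ := key _ hm
    refine ⟨N, hN.trans hW, hxN, ?_⟩
    have h3 : symRes d F E (hN.trans hW) (X s) = symRes d F E (hN.trans hW) (X (r p)) := by
      apply Subtype.ext
      funext y
      exact (hX s p.1 hp N (hN.trans hW) h1 y).trans
        (hX (r p) p.1 hp N (hN.trans hW) (fun _ => rfl) y).symm
    rw [res_toFunc, h3, ← res_toFunc, h2, map_zero]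
  -- Since `X` preserves the ideal, the operator it induces on the quotient can be computed with any
  -- linear choice `σ` of representatives.
  obtain ⟨σ, hσ⟩ := LinearMap.exists_rightInverse_of_surjective (A.toFunc U).toLinearMap
    (LinearMap.range_eq_top.2 (A.toFunc_surjective U))
  have hσ' : ∀ s, A.toFunc U (X (σ (A.toFunc U s))) = A.toFunc U (X s) := by
    intro s
    rw [← sub_eq_zero, ← map_sub, ← map_sub]
    refine hideal _ (A.toFunc_eq_iff.1 ?_)
    exact congrArg (fun f => f (A.toFunc U s)) hσ
  refine ⟨(A.toFunc U).toLinearMap ∘ₗ X ∘ₗ σ, ⟨fun l f hf => ?_, fun l f hf g => ?_⟩, fun x => ?_⟩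
  · obtain ⟨s, hs, rfl⟩ := A.mem_funcDeg.1 hf
    change A.toFunc U (X (σ (A.toFunc U s))) ∈ _
    rw [hσ', ← sub_eq_add_neg]
    exact A.mem_funcDeg.2 ⟨_, hXdeg s l hs, rfl⟩
  · obtain ⟨s, hs, rfl⟩ := A.mem_funcDeg.1 hf
    obtain ⟨t, rfl⟩ := A.toFunc_surjective U g
    rw [← map_mul]
    change A.toFunc U (X (σ (A.toFunc U (s * t)))) = A.toFunc U (X (σ (A.toFunc U s))) * _ +
      _ • (_ * A.toFunc U (X (σ (A.toFunc U t))))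
    rw [hσ', hσ', hσ', hXf s l hs, ← sg_def, mul_neg, sg_neg, mul_comm (k : ℤ)]
  · refine homAt_ext fun e => ?_
    rw [vfVal_apply, cls_apply]
    change A.act x (A.toFunc U (X (σ (A.toFunc U _)))) (1, 0) = _
    rw [hσ', hXe, ← cls_apply, act_cls_one]

end Extension

end CoalgebraBundle

/-! ## Frames modulo the kernels of the restriction maps, in one fibre -/

namespace CoalgebraBundle

section FibreFrames

variable {d : ℕ} {n : ℕ} {M : Type*} [TopologicalSpace M] [T2Space M]
  [ChartedSpace (EuclideanSpace ℝ (Fin d)) M] [IsManifold (𝓡 d) ∞ M]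
  {F : Fin n → Type*} [∀ i, NormedAddCommGroup (F i)] [∀ i, NormedSpace ℝ (F i)]
  {E : Fin n → M → Type*} [∀ i x, AddCommGroup (E i x)] [∀ i x, Module ℝ (E i x)]
  [∀ i, TopologicalSpace (Bundle.TotalSpace (F i) (E i))] [∀ i x, TopologicalSpace (E i x)]
  [∀ i, FiberBundle (F i) (E i)] [∀ i, VectorBundle ℝ (F i) (E i)]
  [∀ i, FiniteDimensional ℝ (F i)] [∀ i, ContMDiffVectorBundle ∞ (F i) (E i) (𝓡 d)]

variable {A : CoalgebraBundle d F E}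

lemma thetaER_scalar {x : M} (c : ℝ) (δ : HomAt d F E x) : A.thetaER x (c, 0) δ = c • δ :=
  homAt_ext fun e => by rw [thetaER_apply, erMul_scalar, homAt_smul_apply]

lemma thetaER_thetaER {x : M} (v w : ERFib E x) (δ : HomAt d F E x) :
    A.thetaER x v (A.thetaER x w δ) = A.thetaER x (erMul (A.comul x) v w) δ :=
  homAt_ext fun e => by
    rw [thetaER_apply, thetaER_apply, thetaER_apply, erMul_assoc (A.coassoc x)]

/-- Derivations of degree `-k` vanish on sections of degree less than `k`, and have scalar values
on sections of degree at most `k`. -/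
lemma derFib_erSecLE {k l : ℕ} (hkl : k ≤ l) {x : M} {δ : HomAt d F E x} (hδ : δ ∈ A.derFib l x)
    {e : ERSec d F E (⊤ : Opens M)} (he : e ∈ erSecLE d F E k) :
    δ e = ((δ e).1, 0) ∧ (k < l → δ e = 0) := by
  -- The components of `e` have degree at most `k`, so those of `δ e` have degree at most `k - l ≤
  -- 0`, and negative degrees contain only zero.
  have key : ∀ (S : Submodule ℝ (ERFib E x)), (∀ m : ℤ, m ≤ (k : ℤ) - l → erDeg E x m ≤ S) →
      δ e ∈ S := by
    intro S hS
    rw [erSec_decomp e, homAt_map_add, homAt_map_sum]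
    refine S.add_mem (hS _ ?_ (derFib_deg hδ (erComp₀_homSec e))) (S.sum_mem fun i _ => ?_)
    · omega
    by_cases hi : k < (i : ℕ) + 1
    · have : erComp e i = 0 := Subtype.ext (funext fun y => by
        change ((0 : ℝ), (Pi.single i ((e.1 y).2 i) : DualFib E (y : M))) = 0
        rw [he y i hi, Pi.single_zero]
        rfl)
      rw [this, homAt_map_zero]
      exact S.zero_mem
    · exact hS _ (by push_cast; omega) (derFib_deg hδ (erComp_homSec e i))
  constructor
  · refine eq_scalar_of_mem_erDeg_zero (key _ fun m hm w hw => ?_)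
    rcases eq_or_ne m 0 with rfl | h
    · exact hw
    · rw [eq_zero_of_mem_erDeg hw (Or.inl (by omega))]
      exact Submodule.zero_mem _
  · intro h
    exact (Submodule.mem_bot ℝ).1 (key ⊥ fun m hm w hw =>
      (Submodule.mem_bot ℝ).2 (eq_zero_of_mem_erDeg hw (Or.inl (by omega))))

lemma mem_ker_resAt {k : ℕ} {x : M} {δ : HomAt d F E x} :
    δ ∈ LinearMap.ker (resAt d F E k x) ↔ ∀ e ∈ erSecLE d F E k, δ e = 0 := by
  rw [LinearMap.mem_ker]
  constructor
  · intro h e he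
    exact congrArg (fun φ => φ ⟨e, he⟩) h
  · intro h
    exact LinearMap.ext fun e => h e.1 e.2

/-- Derivations of degree below `-k` kill all sections of degree at most `k`, and so do their
multiples. -/
lemma thetaER_mem_ker {k l : ℕ} (hkl : k < l) {x : M} {δ : HomAt d F E x}
    (hδ : δ ∈ A.derFib l x) (w : ERFib E x) :
    A.thetaER x w δ ∈ LinearMap.ker (resAt d F E k x) :=
  mem_ker_resAt.2 fun e he => by
    rw [thetaER_apply, (derFib_erSecLE hkl.le hδ he).2 hkl, map_zero]

/-- Independence modulo the kernel of the restriction map. -/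
def ResIndependent (k : ℕ) {x : M} {ι : Type*} [Fintype ι] (δ : ι → HomAt d F E x) : Prop :=
  ∀ c : ι → ℝ, ∑ i, c i • δ i ∈ LinearMap.ker (resAt d F E k x) → ∀ i, c i = 0

lemma homAt_sum_apply {x : M} {ι : Type*} (s : Finset ι) (δ : ι → HomAt d F E x)
    (e : ERSec d F E (⊤ : Opens M)) : (∑ i ∈ s, δ i) e = ∑ i ∈ s, δ i e := by
  have : ∀ γ : HomAt d F E x, γ e = LinearMap.applyₗ e (homAtEquiv d F E x γ) := fun _ => rfl
  rw [this, map_sum, map_sum]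
  rfl

/-- Triangularity: on sections of degree at most `k` the derivations of larger index vanish and
those of index `k` are scalars. With the coefficients of smaller index known to be zero, one row of
the relation remains. -/
lemma thetaER_independent_step {r : Fin (n + 1) → ℕ} {x : M} {δ : ∀ k, Fin (r k) → HomAt d F E x}
    (hδ : ∀ (k : Fin (n + 1)) i, δ k i ∈ A.derFib k x) {w : ∀ k, Fin (r k) → ERFib E x}
    (h : ∑ k, ∑ i, A.thetaER x (w k i) (δ k i) = 0) (k : Fin (n + 1))
    (hw : ∀ k' < k, ∀ i, w k' i = 0) {e : ERSec d F E (⊤ : Opens M)}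
    (he : e ∈ erSecLE d F E (k : ℕ)) : ∑ i, (δ k i e).1 • w k i = 0 := by
  have h4 := congrArg (fun γ : HomAt d F E x => γ e) h
  simp only [homAt_sum_apply, thetaER_apply] at h4
  rw [homAt_zero_apply, Finset.sum_eq_single k] at h4
  · rw [← h4]
    refine Finset.sum_congr rfl fun i _ => ?_
    rw [(derFib_erSecLE le_rfl (hδ k i) he).1, erMul_scalar']
  · intro k' _ hk'
    refine Finset.sum_eq_zero fun i _ => ?_
    rcases lt_or_gt_of_ne hk' with h5 | h5
    · rw [hw k' h5 i, map_zero, LinearMap.zero_apply]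
    · rw [(derFib_erSecLE (Fin.le_def.1 h5.le) (hδ k' i) he).2 h5, map_zero]
  · exact fun h5 => absurd (Finset.mem_univ _) h5

/-- Derivations that are independent modulo the kernels of the restriction maps are independent
over `𝐄*_ℝ`. -/
lemma thetaER_independent {r : Fin (n + 1) → ℕ} {x : M} {δ : ∀ k, Fin (r k) → HomAt d F E x}
    (hδ : ∀ (k : Fin (n + 1)) i, δ k i ∈ A.derFib k x)
    (hind : ∀ k : Fin (n + 1), ResIndependent k (δ k))
    (w : ∀ k, Fin (r k) → ERFib E x) (h : ∑ k, ∑ i, A.thetaER x (w k i) (δ k i) = 0) :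
    ∀ (k : Fin (n + 1)) i, w k i = 0 := by
  have key : ∀ m : ℕ, ∀ k : Fin (n + 1), (k : ℕ) = m → ∀ i, w k i = 0 := by
    intro m
    induction m using Nat.strong_induction_on with
    | _ m ih =>
    intro k hk
    have h1 := fun e he => thetaER_independent_step hδ h k (fun k' hk' => ih k' (hk ▸ hk') k' rfl)
      (e := e) he
    -- Independence modulo the kernel concerns real coefficients; it is applied to each coordinate
    -- of the coefficients in `𝐄*_ℝ` separately.
    have h2 : ∀ a : Fin (r k) → ℝ, (∀ e ∈ erSecLE d F E (k : ℕ), ∑ i, (δ k i e).1 * a i = 0) →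
        ∀ i, a i = 0 := by
      refine fun a ha => hind k a (mem_ker_resAt.2 fun e he => ?_)
      rw [homAt_sum_apply]
      refine Prod.ext ?_ ?_
      · rw [Prod.fst_sum, Prod.fst_zero, ← ha e he]
        exact Finset.sum_congr rfl fun i _ => mul_comm _ _
      · rw [Prod.snd_sum]
        refine Finset.sum_eq_zero fun i _ => ?_
        rw [homAt_smul_apply, (derFib_erSecLE le_rfl (hδ k i) he).1]
        exact smul_zero _
    have h3 := h2 (fun i => (w k i).1) fun e he => by
      have := congrArg Prod.fst (h1 e he)
      rwa [Prod.fst_sum] at this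
    have h4 : ∀ (j : Fin n) (v : E j x), ∀ i, (w k i).2 j v = 0 := fun j v =>
      h2 (fun i => (w k i).2 j v) fun e he => by
        have := congrArg (fun u : ERFib E x => u.2 j v) (h1 e he)
        simp only [Prod.snd_sum, Finset.sum_apply, LinearMap.sum_apply] at this
        exact this
    exact fun i => Prod.ext (h3 i) (funext fun j => LinearMap.ext fun v => h4 j v i)
  exact fun k => key _ k rfl

/-- The derivations of degree `-l` that are combinations of the given ones over `𝐄*_ℝ`. -/
def frameSpan (A : CoalgebraBundle d F E) {r : Fin (n + 1) → ℕ} {x : M}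
    (δ : ∀ k, Fin (r k) → HomAt d F E x) (l : ℤ) : Submodule ℝ (HomAt d F E x) where
  carrier := {γ | ∃ w : ∀ k, Fin (r k) → ERFib E x, (∀ (k : Fin (n + 1)) i, w k i ∈ erDeg E x ((k : ℕ) - l)) ∧
    γ = ∑ k, ∑ i, A.thetaER x (w k i) (δ k i)}
  add_mem' := by
    rintro _ _ ⟨w, hw, rfl⟩ ⟨w', hw', rfl⟩
    refine ⟨fun k i => w k i + w' k i, fun k i => Submodule.add_mem _ (hw k i) (hw' k i), ?_⟩
    simp only [map_add, LinearMap.add_apply, Finset.sum_add_distrib]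
  zero_mem' := ⟨fun _ _ => 0, fun _ _ => Submodule.zero_mem _, by simp⟩
  smul_mem' := by
    rintro c _ ⟨w, hw, rfl⟩
    refine ⟨fun k i => c • w k i, fun k i => Submodule.smul_mem _ c (hw k i), ?_⟩
    simp only [map_smul, LinearMap.smul_apply, Finset.smul_sum]

lemma thetaER_mem_frameSpan {r : Fin (n + 1) → ℕ} {x : M} (δ : ∀ k, Fin (r k) → HomAt d F E x)
    {l : ℤ} {k : Fin (n + 1)} (i : Fin (r k)) {w : ERFib E x} (hw : w ∈ erDeg E x ((k : ℕ) - l)) :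
    A.thetaER x w (δ k i) ∈ A.frameSpan δ l := by
  classical
  refine ⟨fun k' => if h : k' = k then Function.update 0 (h ▸ i) w else 0, fun k' i' => ?_, ?_⟩
  · by_cases h : k' = k
    · subst h
      by_cases h' : i' = i
      · subst h'; simpa using hw
      · simp [Function.update_of_ne h']
    · simp [h]
  · rw [Finset.sum_eq_single k]
    · rw [Finset.sum_eq_single i]
      · simp
      · intro i' _ h
        simp [Function.update_of_ne h]
      · simp
    · intro k' _ h
      simp [h]
    · simp

lemma mem_frameSpan_self {r : Fin (n + 1) → ℕ} {x : M} (δ : ∀ k, Fin (r k) → HomAt d F E x)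
    (k : Fin (n + 1)) (i : Fin (r k)) : δ k i ∈ A.frameSpan δ ((k : ℕ) : ℤ) := by
  have : A.thetaER x (1, 0) (δ k i) ∈ A.frameSpan δ ((k : ℕ) : ℤ) :=
    thetaER_mem_frameSpan δ i (by rw [sub_self]; exact scalar_mem_erDeg 1)
  rwa [thetaER_scalar, one_smul] at this

lemma thetaER_frameSpan {r : Fin (n + 1) → ℕ} {x : M} (δ : ∀ k, Fin (r k) → HomAt d F E x)
    {l m : ℤ} {γ : HomAt d F E x} (hγ : γ ∈ A.frameSpan δ l) {v : ERFib E x}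
    (hv : v ∈ erDeg E x (l - m)) : A.thetaER x v γ ∈ A.frameSpan δ m := by
  obtain ⟨w, hw, rfl⟩ := hγ
  refine ⟨fun k i => erMul (A.comul x) v (w k i), fun k i => ?_, ?_⟩
  · have := erMul_mem_erDeg _ (A.degree x) hv (hw k i)
    rwa [sub_add_sub_comm, add_comm l, add_sub_add_right_eq_sub] at this
  · simp only [map_sum, thetaER_thetaER]

/-- A family of spaces of derivations that satisfies the compatibility condition, at one point. -/
structure FibreFamily (A : CoalgebraBundle d F E) (x : M)
    (C : Fin (n + 1) → Submodule ℝ (HomAt d F E x)) : Prop where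
  condition : ∀ k : Fin (n + 1),
    (⨆ (i : Fin n) (h : (k : ℕ) + ((i : ℕ) + 1) < n + 1),
      Submodule.map₂ (A.theta i x) ⊤ (C ⟨(k : ℕ) + ((i : ℕ) + 1), h⟩)) =
    LinearMap.ker (resAt d F E k x) ⊓ C k

/-- The condition on the kernels makes the family stable under multiplication by elements of
positive degree; degree zero acts by scalars, and there is nothing in other degrees. -/
lemma FibreFamily.thetaER_mem {x : M} {C : Fin (n + 1) → Submodule ℝ (HomAt d F E x)}
    (hC : A.FibreFamily x C) {k l : Fin (n + 1)} {γ : HomAt d F E x} (hγ : γ ∈ C k)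
    {w : ERFib E x} (hw : w ∈ erDeg E x ((k : ℕ) - (l : ℕ))) : A.thetaER x w γ ∈ C l := by
  rcases erDeg_cases hw with ⟨h, h'⟩ | ⟨i, h, h'⟩ | h'
  · have : k = l := Fin.ext (by omega)
    subst this
    rw [h', thetaER_scalar]
    exact (C k).smul_mem _ hγ
  · have hk : (l : ℕ) + ((i : ℕ) + 1) = k := by omega
    have hlt : (l : ℕ) + ((i : ℕ) + 1) < n + 1 := hk ▸ k.2
    have hk' : k = ⟨(l : ℕ) + ((i : ℕ) + 1), hlt⟩ := Fin.ext hk.symm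
    rw [h', ← theta_eq_thetaER]
    refine (hC.condition l ▸ (inf_le_right : LinearMap.ker (resAt d F E l x) ⊓ C l ≤ C l) : _ ≤ C l)
      (Submodule.mem_iSup_of_mem i (Submodule.mem_iSup_of_mem hlt ?_))
    rw [← hk']
    exact Submodule.apply_mem_map₂ _ trivial hγ
  · rw [h', map_zero]
    exact (C l).zero_mem

/-- A frame modulo the kernels of the restriction maps generates the family over `𝐄*_ℝ`. -/
lemma FibreFamily.eq_frameSpan {x : M} {C : Fin (n + 1) → Submodule ℝ (HomAt d F E x)}
    (hC : A.FibreFamily x C) {r : Fin (n + 1) → ℕ} {δ : ∀ k, Fin (r k) → HomAt d F E x}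
    (hδ : ∀ k i, δ k i ∈ C k)
    (hspan : ∀ k : Fin (n + 1), C k ≤ Submodule.span ℝ (Set.range (δ k)) ⊔ LinearMap.ker (resAt d F E k x))
    (k : Fin (n + 1)) : C k = A.frameSpan δ ((k : ℕ) : ℤ) := by
  apply le_antisymm
  -- Descending induction on `k`, as in Nakayama's lemma: an element of `C k` is a combination of
  -- the frame up to an element of the kernel, and by the condition the latter consists of multiples
  -- of elements of `C k'` with `k' > k`.
  · have key : ∀ m : ℕ, ∀ k : Fin (n + 1), n - (k : ℕ) = m → C k ≤ A.frameSpan δ ((k : ℕ) : ℤ) := by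
      intro m
      induction m using Nat.strong_induction_on with
      | _ m ih =>
      intro k hk γ hγ
      obtain ⟨α, hα, β, hβ, rfl⟩ := Submodule.mem_sup.1 (hspan k hγ)
      have hαC : α ∈ C k := (Submodule.span_le.2 (by rintro _ ⟨i, rfl⟩; exact hδ k i)) hα
      have hβC : β ∈ LinearMap.ker (resAt d F E k x) ⊓ C k :=
        ⟨hβ, by have := (C k).sub_mem hγ hαC; rwa [add_sub_cancel_left] at this⟩
      refine Submodule.add_mem _ ?_ ?_
      · exact (Submodule.span_le.2 (by rintro _ ⟨i, rfl⟩; exact mem_frameSpan_self δ k i)) hα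
      · rw [← hC.condition k] at hβC
        refine (iSup_le fun i => iSup_le fun h => Submodule.map₂_le.2 fun ξ _ γ hγ => ?_ :
          _ ≤ A.frameSpan δ ((k : ℕ) : ℤ)) hβC
        rw [theta_eq_thetaER]
        refine thetaER_frameSpan δ (ih _ ?_ _ rfl hγ) ?_
        · dsimp only
          omega
        · have := single_mem_erDeg i ξ
          dsimp only
          convert this using 2
          push_cast
          ring
    exact key _ k rfl
  · rintro _ ⟨w, hw, rfl⟩
    exact Submodule.sum_mem _ fun k' _ => Submodule.sum_mem _ fun i _ =>
      hC.thetaER_mem (hδ k' i) (hw k' i)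

end FibreFrames

end CoalgebraBundle

/-! ## Local frames of `𝐄*_ℝ` and smooth coefficients -/

section LinearAlgebra

lemma linearIndependent_mkQ_iff {V ι : Type*} [AddCommGroup V] [Module ℝ V] [Fintype ι]
    (K C : Submodule ℝ V) (δ : ι → C) :
    LinearIndependent ℝ (fun i => (K.submoduleOf C).mkQ (δ i)) ↔
      ∀ c : ι → ℝ, ∑ i, c i • (δ i : V) ∈ K → ∀ i, c i = 0 := by
  rw [Fintype.linearIndependent_iff]
  refine forall_congr' fun c => ?_
  have : ∑ i, c i • (K.submoduleOf C).mkQ (δ i) = (K.submoduleOf C).mkQ (∑ i, c i • δ i) := by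
    simp only [map_sum, map_smul]
  rw [this, Submodule.mkQ_apply, Submodule.Quotient.mk_eq_zero, Submodule.submoduleOf,
    Submodule.mem_comap, map_sum]
  rfl

lemma span_mkQ_eq_top_iff {V ι : Type*} [AddCommGroup V] [Module ℝ V]
    (K C : Submodule ℝ V) (δ : ι → C) :
    Submodule.span ℝ (Set.range fun i => (K.submoduleOf C).mkQ (δ i)) = ⊤ ↔
      C ≤ Submodule.span ℝ (Set.range fun i => (δ i : V)) ⊔ K := by
  have h1 : (Set.range fun i => (K.submoduleOf C).mkQ (δ i)) =
      (K.submoduleOf C).mkQ '' Set.range δ := by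
    rw [← Set.range_comp]; rfl
  have h2 : (Set.range fun i => (δ i : V)) = C.subtype '' Set.range δ := by
    rw [← Set.range_comp]; rfl
  rw [h1, h2, ← Submodule.map_span, Submodule.map_mkQ_eq_top, ← Submodule.map_span]
  constructor
  · intro h x hx
    have h3 : (⟨x, hx⟩ : C) ∈ K.submoduleOf C ⊔ Submodule.span ℝ (Set.range δ) :=
      h ▸ Submodule.mem_top
    obtain ⟨a, ha, b, hb, hab⟩ := Submodule.mem_sup.1 h3
    refine Submodule.mem_sup.2 ⟨b, ⟨b, hb, rfl⟩, a, ha, ?_⟩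
    rw [add_comm]
    exact congrArg Subtype.val hab
  · intro h
    refine eq_top_iff.2 fun x _ => ?_
    obtain ⟨_, ⟨b, hb, rfl⟩, a, ha, hab⟩ := Submodule.mem_sup.1 (h x.2)
    refine Submodule.mem_sup.2 ⟨x - b, ?_, b, hb, sub_add_cancel _ _⟩
    change (x : V) - b ∈ K
    rw [← hab]
    simpa using ha

/-- Finitely many functions that separate `ι → ℝ` contain a square nonsingular system. -/
lemma exists_det_ne_zero {Φ ι : Type*} [Fintype ι] [DecidableEq ι] (v : Φ → ι → ℝ)
    (h : ∀ c : ι → ℝ, (∀ φ, ∑ j, v φ j * c j = 0) → c = 0) :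
    ∃ f : ι → Φ, (Matrix.of fun a j => v (f a) j).det ≠ 0 := by
  -- If the vectors failed to span, a nonzero functional would vanish on all of them, and its
  -- coordinates would be a vector `c` excluded by `h`.
  have htop : Submodule.span ℝ (Set.range v) = ⊤ := by
    by_contra hne
    obtain ⟨f, hf, hle⟩ := Submodule.exists_le_ker_of_lt_top _ (lt_top_iff_ne_top.2 hne)
    have hfv : ∀ u : ι → ℝ, f u = ∑ j, u j * f (Pi.single j 1) := by
      intro u
      conv_lhs => rw [pi_eq_sum_univ' u]
      rw [map_sum]
      refine Finset.sum_congr rfl fun j _ => ?_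
      rw [map_smul, smul_eq_mul]
    have := h (fun j => f (Pi.single j 1)) fun φ => by
      rw [← hfv]
      exact hle (Submodule.subset_span ⟨φ, rfl⟩)
    refine hf (LinearMap.ext fun u => ?_)
    rw [hfv]
    exact Finset.sum_eq_zero fun j _ => by rw [congrFun this j]; exact mul_zero _
  obtain ⟨b, hb, hspan, hli⟩ := exists_linearIndependent ℝ (Set.range v)
  let B := Module.Basis.mk hli (by rw [Subtype.range_coe, hspan, htop])
  let e := (Pi.basisFun ℝ ι).indexEquiv B
  choose g hg using fun a : ι => hb (e a).2
  refine ⟨g, ?_⟩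
  rw [← isUnit_iff_ne_zero, ← Matrix.isUnit_iff_isUnit_det,
    ← Matrix.linearIndependent_rows_iff_isUnit]
  have : (Matrix.of fun a j => v (g a) j).row = (Subtype.val : b → ι → ℝ) ∘ e := by
    funext a
    exact hg a
  rw [this]
  exact hli.comp _ e.injective

end LinearAlgebra

section Frames

variable {d : ℕ} {n : ℕ} {M : Type*} [TopologicalSpace M] [T2Space M]
  [ChartedSpace (EuclideanSpace ℝ (Fin d)) M] [IsManifold (𝓡 d) ∞ M]
  {F : Fin n → Type*} [∀ i, NormedAddCommGroup (F i)] [∀ i, NormedSpace ℝ (F i)]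
  {E : Fin n → M → Type*} [∀ i x, AddCommGroup (E i x)] [∀ i x, Module ℝ (E i x)]
  [∀ i, TopologicalSpace (Bundle.TotalSpace (F i) (E i))] [∀ i x, TopologicalSpace (E i x)]
  [∀ i, FiberBundle (F i) (E i)] [∀ i, VectorBundle ℝ (F i) (E i)]
  [∀ i, FiniteDimensional ℝ (F i)] [∀ i, ContMDiffVectorBundle ∞ (F i) (E i) (𝓡 d)]

lemma contMDiff_det {M' : Type*} [TopologicalSpace M'] [ChartedSpace (EuclideanSpace ℝ (Fin d)) M']
    {ι : Type*} [Fintype ι] [DecidableEq ι] {Q : M' → Matrix ι ι ℝ}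
    (hQ : ∀ a j, ContMDiff (𝓡 d) 𝓘(ℝ, ℝ) ∞ fun y => Q y a j) :
    ContMDiff (𝓡 d) 𝓘(ℝ, ℝ) ∞ fun y => (Q y).det := by
  simp only [Matrix.det_apply']
  exact contMDiff_finsetSum fun σ _ => contMDiff_const.mul (contMDiff_finsetProd fun i _ => hQ _ _)

variable (F) in
/-- The index set of the local frames of `𝐄*_ℝ`. -/
abbrev FrameIndex : Type := Option (Σ i : Fin n, Fin (Module.finrank ℝ (F i)))

/-- The degrees of the members of a frame. -/
def FrameIndex.deg : FrameIndex F → ℕ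
  | none => 0
  | some p => (p.1 : ℕ) + 1

namespace DualFrame

variable {W : Opens M} (B : DualFrame d F E W)

/-- The members of the frame of `𝐄*_ℝ`. -/
def sec : FrameIndex F → ERSec d F E (⊤ : Opens M)
  | none => fsec F E (f := fun _ => 1) contMDiff_const
  | some p => B.cov p.1 p.2

/-- The coefficients with respect to the frame of `𝐄*_ℝ`. -/
def coef (y : M) : FrameIndex F → ERFib E y → ℝ
  | none => fun w => w.1
  | some p => fun w => w.2 p.1 (B.vec p.1 p.2 y)

lemma sec_hom (b : FrameIndex F) : HomSec ⊤ (FrameIndex.deg b : ℤ) (B.sec b) := by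
  cases b with
  | none => exact fsec_homSec (f := fun _ => (1 : ℝ)) contMDiff_const
  | some p => exact B.cov_hom p.1 p.2

lemma coef_add (y : M) (b : FrameIndex F) (v w : ERFib E y) :
    B.coef y b (v + w) = B.coef y b v + B.coef y b w := by
  cases b <;> rfl

lemma coef_smul (y : M) (b : FrameIndex F) (c : ℝ) (w : ERFib E y) :
    B.coef y b (c • w) = c * B.coef y b w := by
  cases b <;> rfl

lemma coef_zero (y : M) (b : FrameIndex F) : B.coef y b (0 : ERFib E y) = 0 := by
  cases b <;> rfl

lemma coef_sum (y : M) (b : FrameIndex F) {ι : Type*} (s : Finset ι) (w : ι → ERFib E y) :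
    B.coef y b (∑ i ∈ s, w i) = ∑ i ∈ s, B.coef y b (w i) :=
  map_sum (AddMonoidHom.mk' (B.coef y b) (B.coef_add y b)) w s

lemma coef_smooth {U : Opens M} (e : ERSec d F E U) (b : FrameIndex F) :
    ContMDiff (𝓡 d) 𝓘(ℝ, ℝ) ∞ fun y : U => B.coef y b (e.1 y) := by
  cases b with
  | none => exact e.2.1
  | some p => exact B.smooth U e p.1 p.2

lemma expand_sec (y : W) (w : ERFib E (y : M)) :
    w = ∑ b, B.coef y b w • (B.sec b).1 ⟨y, trivial⟩ := by
  rw [Fintype.sum_option, Fintype.sum_sigma]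
  conv_lhs => rw [erFib_decomp w]
  refine congrArg₂ (· + ·) ?_ (Finset.sum_congr rfl fun i _ => ?_)
  · change _ = w.1 • ((1 : ℝ), (0 : DualFib E (y : M)))
    rw [Prod.smul_mk, smul_zero, smul_eq_mul, mul_one]
  · have h : ∀ α, (B.cov i α).1 ⟨y, trivial⟩ =
        ((0 : ℝ), (Pi.single i (((B.cov i α).1 ⟨y, trivial⟩).2 i) : DualFib E (y : M))) :=
      fun α => eq_single_of_mem_erDeg (by exact_mod_cast B.cov_hom i α ⟨y, trivial⟩)
    have h2 : ∑ α, B.coef y (some ⟨i, α⟩) w • (B.sec (some ⟨i, α⟩)).1 ⟨y, trivial⟩ =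
        ∑ α, LinearMap.inr ℝ ℝ (DualFib E (y : M)) (LinearMap.single ℝ _ i
          (w.2 i (B.vec i α y) • ((B.cov i α).1 ⟨y, trivial⟩).2 i)) := by
      refine Finset.sum_congr rfl fun α _ => ?_
      rw [map_smul, map_smul]
      exact congrArg (w.2 i (B.vec i α y) • ·) (h α)
    rw [h2, ← map_sum, ← map_sum, ← B.expand y i (w.2 i)]
    rfl

lemma coef_sec [DecidableEq (FrameIndex F)] (y : W) (b b' : FrameIndex F) :
    B.coef y b ((B.sec b').1 ⟨y, trivial⟩) = if b = b' then 1 else 0 := by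
  rcases b with _ | ⟨i, α⟩ <;> rcases b' with _ | ⟨j, β⟩
  · rw [if_pos rfl]; rfl
  · rw [if_neg (by simp)]
    exact (B.cov_hom j β ⟨y, trivial⟩).1 (by omega)
  · rw [if_neg (by simp)]
    rfl
  · by_cases hij : i = j
    · subst hij
      refine (B.dual y i β α).trans (if_congr ?_ rfl rfl)
      simp
    · rw [if_neg (by simp [hij])]
      have : ((B.cov j β).1 ⟨y, trivial⟩).2 i = 0 :=
        (B.cov_hom j β ⟨y, trivial⟩).2 i (by
          intro h
          exact hij (Fin.ext (by push_cast at h; omega)))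
      change ((B.cov j β).1 ⟨y, trivial⟩).2 i _ = 0
      rw [this]
      rfl

lemma coef_eq_zero {y : M} {l : ℤ} {w : ERFib E y} (hw : w ∈ erDeg E y l) {b : FrameIndex F}
    (hb : (FrameIndex.deg b : ℤ) ≠ l) : B.coef y b w = 0 := by
  rcases b with _ | ⟨i, α⟩
  · exact hw.1 hb.symm
  · change w.2 i _ = 0
    rw [hw.2 i (fun h => hb (by rw [h]; rfl))]
    rfl

end DualFrame

/-- Every element of a fibre is the value of a global section of the same degree. -/
lemma exists_homSec_value {x : M} {l : ℤ} {w : ERFib E x} (hw : w ∈ erDeg E x l) :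
    ∃ e : ERSec d F E (⊤ : Opens M), HomSec ⊤ l e ∧ e.1 ⟨x, trivial⟩ = w := by
  obtain ⟨W, hx, ⟨B⟩⟩ := exists_dualFrame (d := d) F E x
  refine ⟨∑ b, B.coef x b w • B.sec b, fun y => ?_, ?_⟩
  · rw [AddSubmonoidClass.coe_finsetSum, Finset.sum_apply]
    refine Submodule.sum_mem _ fun b _ => ?_
    by_cases hb : (FrameIndex.deg b : ℤ) = l
    · exact Submodule.smul_mem _ _ (hb ▸ B.sec_hom b y)
    · rw [B.coef_eq_zero hw hb, zero_smul]
      exact Submodule.zero_mem _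
  · rw [AddSubmonoidClass.coe_finsetSum, Finset.sum_apply]
    exact (B.expand_sec ⟨x, hx⟩ w).symm

/-- Smooth families that are independent at one point, even if only tested on some sections, are so
nearby, and smooth combinations of them have smooth coefficients. -/
lemma exists_smooth_coefficients {U : Opens M} {ι : Type*} [Fintype ι]
    (γ : ι → ∀ y : U, HomAt d F E (y : M))
    (hγ : ∀ j (e : ERSec d F E (⊤ : Opens M)), (fun y : U => γ j y e) ∈ ERSec d F E U)
    (P : Submodule ℝ (ERSec d F E (⊤ : Opens M))) (x₀ : U)
    (h₀ : ∀ c : ι → ℝ, (∀ e ∈ P, (∑ j, c j • γ j x₀) e = 0) → ∀ j, c j = 0) :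
    ∃ (N : Opens M) (hN : N ≤ U), (x₀ : M) ∈ N ∧
      (∀ (y : N) (c : ι → ℝ), (∀ e ∈ P, (∑ j, c j • γ j ⟨y, hN y.2⟩) e = 0) → ∀ j, c j = 0) ∧
      ∀ c : N → ι → ℝ, (∀ e : ERSec d F E (⊤ : Opens M),
        (fun y : N => (∑ j, c y j • γ j ⟨y, hN y.2⟩) e) ∈ ERSec d F E N) →
        ∀ j, ContMDiff (𝓡 d) 𝓘(ℝ, ℝ) ∞ fun y => c y j := by
  classical
  obtain ⟨W, hxW, ⟨B⟩⟩ := exists_dualFrame (d := d) F E (x₀ : M)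
  have hsum : ∀ (y : U) (b : FrameIndex F) (e : ERSec d F E (⊤ : Opens M)) (c : ι → ℝ),
      B.coef y b ((∑ j, c j • γ j y) e) = ∑ j, B.coef y b (γ j y e) * c j := by
    intro y b e c
    rw [CoalgebraBundle.homAt_sum_apply, B.coef_sum]
    refine Finset.sum_congr rfl fun j _ => ?_
    rw [homAt_smul_apply, B.coef_smul, mul_comm]
  -- Finitely many pairs of a section in `P` and a coordinate already detect independence at `x₀`.
  -- The resulting determinant is smooth, hence nonzero nearby.
  obtain ⟨f, hf⟩ := exists_det_ne_zero
    (fun (φ : P × FrameIndex F) j => B.coef x₀ φ.2 (γ j x₀ φ.1.1)) (fun c hc => by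
      refine funext fun j => h₀ c (fun e he => ?_) j
      rw [B.expand_sec ⟨x₀, hxW⟩ ((∑ j, c j • γ j x₀) e)]
      refine Finset.sum_eq_zero fun b _ => ?_
      rw [hsum, hc (⟨e, he⟩, b), zero_smul])
  let Q : U → Matrix ι ι ℝ := fun y => Matrix.of fun a j => B.coef y (f a).2 (γ j y (f a).1.1)
  have hQ : ∀ a j, ContMDiff (𝓡 d) 𝓘(ℝ, ℝ) ∞ fun y => Q y a j := fun a j =>
    B.coef_smooth ⟨_, hγ j (f a).1.1⟩ (f a).2
  have hdet := contMDiff_det hQ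
  let N : Opens M := ⟨Subtype.val '' {y : U | (Q y).det ≠ 0},
    U.2.isOpenMap_subtype_val _ (isOpen_ne_fun hdet.continuous continuous_const)⟩
  have hN : N ≤ U := by
    rintro _ ⟨y, _, rfl⟩
    exact y.2
  have hdetN : ∀ y : N, (Q ⟨y, hN y.2⟩).det ≠ 0 := by
    rintro ⟨_, y, hy, rfl⟩
    exact hy
  have hvec : ∀ (y : U) (c : ι → ℝ) a, (Q y).mulVec c a =
      B.coef y (f a).2 ((∑ j, c j • γ j y) (f a).1.1) := fun y c a => (hsum y _ _ c).symm
  refine ⟨N, hN, ⟨x₀, hf, rfl⟩, fun y c hc => ?_, fun c hc j => ?_⟩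
  · refine congrFun (Matrix.eq_zero_of_mulVec_eq_zero (hdetN y) (funext fun a => ?_))
    rw [hvec, hc _ (f a).1.2, B.coef_zero]
    rfl
  -- Cramer's rule: the replaced column consists of coordinates of the given smooth combination, so
  -- each coefficient is a quotient of smooth determinants.
  · have h1 : ∀ y : N, c y j = ((Q ⟨y, hN y.2⟩).updateCol j
        fun a => (Q ⟨y, hN y.2⟩).mulVec (c y) a).det / (Q ⟨y, hN y.2⟩).det := by
      intro y
      rw [eq_div_iff (hdetN y), ← Matrix.cramer_apply, Matrix.cramer_eq_adjugate_mulVec]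
      change _ = ((Q ⟨y, hN y.2⟩).adjugate.mulVec ((Q ⟨y, hN y.2⟩).mulVec (c y))) j
      rw [Matrix.mulVec_mulVec, Matrix.adjugate_mul, Matrix.smul_mulVec, Matrix.one_mulVec,
        Pi.smul_apply, smul_eq_mul, mul_comm]
    have hinc : ∀ {g : U → ℝ}, ContMDiff (𝓡 d) 𝓘(ℝ, ℝ) ∞ g →
        ContMDiff (𝓡 d) 𝓘(ℝ, ℝ) ∞ fun y : N => g ⟨y, hN y.2⟩ :=
      fun hg => hg.comp (contMDiff_inclusion hN)
    rw [funext h1]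
    refine ContMDiff.div₀ (contMDiff_det fun a i => ?_) (hinc hdet) hdetN
    by_cases hij : i = j
    · subst hij
      simp only [Matrix.updateCol_self, hvec]
      exact B.coef_smooth ⟨_, hc (f a).1.1⟩ (f a).2
    · simp only [Matrix.updateCol_ne hij]
      exact hinc (hQ a i)

end Frames

/-! ## Vector fields that are independent modulo the kernels of the restriction maps -/

namespace CoalgebraBundle

section ResFrames

variable {d : ℕ} {n : ℕ} {M : Type*} [TopologicalSpace M] [T2Space M]
  [ChartedSpace (EuclideanSpace ℝ (Fin d)) M] [IsManifold (𝓡 d) ∞ M]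
  {F : Fin n → Type*} [∀ i, NormedAddCommGroup (F i)] [∀ i, NormedSpace ℝ (F i)]
  {E : Fin n → M → Type*} [∀ i x, AddCommGroup (E i x)] [∀ i x, Module ℝ (E i x)]
  [∀ i, TopologicalSpace (Bundle.TotalSpace (F i) (E i))] [∀ i x, TopologicalSpace (E i x)]
  [∀ i, FiberBundle (F i) (E i)] [∀ i, VectorBundle ℝ (F i) (E i)]
  [∀ i, FiniteDimensional ℝ (F i)] [∀ i, ContMDiffVectorBundle ∞ (F i) (E i) (𝓡 d)]

variable {A : CoalgebraBundle d F E}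

/-- The products of the members of a frame of `𝐄*_ℝ` with a family of derivations. -/
def frameProduct (A : CoalgebraBundle d F E) {W : Opens M} (B : DualFrame d F E W)
    {r : Fin (n + 1) → ℕ} {y : M} (δ : ∀ k, Fin (r k) → HomAt d F E y)
    (j : (Σ k, Fin (r k)) × FrameIndex F) : HomAt d F E y :=
  A.thetaER y ((B.sec j.2).1 ⟨y, trivial⟩) (δ j.1.1 j.1.2)

lemma sum_smul_frameProduct {W : Opens M} (B : DualFrame d F E W) {r : Fin (n + 1) → ℕ} {y : M}
    (δ : ∀ k, Fin (r k) → HomAt d F E y) (c : (Σ k, Fin (r k)) × FrameIndex F → ℝ) :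
    ∑ j, c j • A.frameProduct B δ j =
      ∑ k, ∑ i, A.thetaER y (∑ b, c (⟨k, i⟩, b) • (B.sec b).1 ⟨y, trivial⟩) (δ k i) := by
  rw [Fintype.sum_prod_type, Fintype.sum_sigma]
  refine Finset.sum_congr rfl fun k _ => Finset.sum_congr rfl fun i _ => ?_
  rw [map_sum, LinearMap.sum_apply]
  refine Finset.sum_congr rfl fun b _ => ?_
  rw [map_smul, LinearMap.smul_apply]
  rfl

/-- A real relation among the products is a relation over `𝐄*_ℝ` whose coefficients are expanded in
the frame; these coefficients vanish, and so do their coordinates. -/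
lemma frameProduct_independent {W : Opens M} (B : DualFrame d F E W) {r : Fin (n + 1) → ℕ} {y : M}
    (hy : y ∈ W) {δ : ∀ k, Fin (r k) → HomAt d F E y}
    (hδ : ∀ (k : Fin (n + 1)) i, δ k i ∈ A.derFib k y)
    (hind : ∀ k : Fin (n + 1), ResIndependent k (δ k)) :
    LinearIndependent ℝ (A.frameProduct B δ) := by
  classical
  refine Fintype.linearIndependent_iff.2 fun c hc => ?_
  rw [sum_smul_frameProduct] at hc
  have h := thetaER_independent hδ hind _ hc
  rintro ⟨⟨k, i⟩, b⟩
  have h1 := congrArg (B.coef y b) (h k i)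
  rw [B.coef_sum, B.coef_zero, Finset.sum_eq_single b] at h1
  · rwa [B.coef_smul, B.coef_sec ⟨y, hy⟩, if_pos rfl, mul_one] at h1
  · intro b' _ hb
    rw [B.coef_smul, B.coef_sec ⟨y, hy⟩, if_neg hb.symm, mul_zero]
  · exact fun h => absurd (Finset.mem_univ _) h

/-- The products of degree `-l`. -/
def DegIndex (F : Fin n → Type*) [∀ i, NormedAddCommGroup (F i)] [∀ i, NormedSpace ℝ (F i)]
    (r : Fin (n + 1) → ℕ) (l : ℤ) : Type :=
  {j : (Σ k, Fin (r k)) × FrameIndex F // (FrameIndex.deg j.2 : ℤ) = (j.1.1 : ℕ) - l}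

instance (r : Fin (n + 1) → ℕ) (l : ℤ) : Fintype (DegIndex F r l) :=
  inferInstanceAs (Fintype {j : (Σ k, Fin (r k)) × FrameIndex F //
    (FrameIndex.deg j.2 : ℤ) = (j.1.1 : ℕ) - l})

lemma frameSpan_eq_span {W : Opens M} (B : DualFrame d F E W) {r : Fin (n + 1) → ℕ} {y : M}
    (hy : y ∈ W) (δ : ∀ k, Fin (r k) → HomAt d F E y) (l : ℤ) :
    A.frameSpan δ l =
      Submodule.span ℝ (Set.range fun j : DegIndex F r l => A.frameProduct B δ j.1) := by
  apply le_antisymm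
  · rintro _ ⟨w, hw, rfl⟩
    refine Submodule.sum_mem _ fun k _ => Submodule.sum_mem _ fun i _ => ?_
    rw [B.expand_sec ⟨y, hy⟩ (w k i), map_sum, LinearMap.sum_apply]
    refine Submodule.sum_mem _ fun b _ => ?_
    rw [map_smul, LinearMap.smul_apply]
    by_cases hb : (FrameIndex.deg b : ℤ) = (k : ℕ) - l
    · exact Submodule.smul_mem _ _ (Submodule.subset_span ⟨⟨(⟨k, i⟩, b), hb⟩, rfl⟩)
    · rw [B.coef_eq_zero (hw k i) hb, zero_smul]
      exact Submodule.zero_mem _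
  · refine Submodule.span_le.2 ?_
    rintro _ ⟨⟨⟨⟨k, i⟩, b⟩, hb⟩, rfl⟩
    refine thetaER_mem_frameSpan δ i ?_
    rw [← (hb : (FrameIndex.deg b : ℤ) = (k : ℕ) - l)]
    exact B.sec_hom b ⟨y, trivial⟩

variable (F) in
/-- The rank of the part of degree `l` of `𝐄*_ℝ`. -/
def frameRank (l : ℤ) : ℕ := Fintype.card {b : FrameIndex F // (FrameIndex.deg b : ℤ) = l}

variable (F) in
lemma frameRank_zero : frameRank F 0 = 1 := by
  refine Fintype.card_eq_one_iff.2 ⟨⟨none, rfl⟩, ?_⟩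
  rintro ⟨_ | p, hb⟩
  · rfl
  · exact absurd hb (by simp only [FrameIndex.deg]; omega)

variable (F) in
lemma frameRank_neg {l : ℤ} (hl : l < 0) : frameRank F l = 0 :=
  Fintype.card_eq_zero_iff.2 ⟨fun b => by have := b.2; omega⟩

lemma card_degIndex (r : Fin (n + 1) → ℕ) (l : ℤ) :
    Fintype.card (DegIndex F r l) = ∑ k, r k * frameRank F ((k : ℕ) - l) := by
  let e : DegIndex F r l ≃
      Σ k : Fin (n + 1), Fin (r k) × {b : FrameIndex F // (FrameIndex.deg b : ℤ) = (k : ℕ) - l} :=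
    { toFun := fun j => ⟨j.1.1.1, j.1.1.2, j.1.2, j.2⟩
      invFun := fun j => ⟨(⟨j.1, j.2.1⟩, j.2.2.1), j.2.2.2⟩
      left_inv := fun _ => rfl
      right_inv := fun _ => rfl }
  rw [Fintype.card_congr e, Fintype.card_sigma]
  refine Finset.sum_congr rfl fun k _ => ?_
  rw [Fintype.card_prod, Fintype.card_fin]
  rfl

/-- The products of a frame of `𝐄*_ℝ` with the family, taken in the right degree, form a basis. So
the dimension depends only on the numbers `r` and the ranks of the summands. -/
lemma finrank_frameSpan {r : Fin (n + 1) → ℕ} {y : M}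
    {δ : ∀ k, Fin (r k) → HomAt d F E y} (hδ : ∀ (k : Fin (n + 1)) i, δ k i ∈ A.derFib k y)
    (hind : ∀ k : Fin (n + 1), ResIndependent k (δ k)) (l : ℤ) :
    Module.finrank ℝ (A.frameSpan δ l) = ∑ k, r k * frameRank F ((k : ℕ) - l) := by
  obtain ⟨W, hy, ⟨B⟩⟩ := exists_dualFrame (d := d) F E y
  rw [frameSpan_eq_span B hy, ← card_degIndex]
  exact finrank_span_eq_card ((frameProduct_independent B hy hδ hind).comp _
    Subtype.val_injective)

variable (F) in
/-- The ranks of the spaces spanned by a frame determine the number of its members. -/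
lemma frame_ranks_unique {q q' : Fin (n + 1) → ℕ}
    (h : ∀ l : Fin (n + 1), ∑ k : Fin (n + 1), q k * frameRank F ((k : ℕ) - (l : ℕ)) =
      ∑ k : Fin (n + 1), q' k * frameRank F ((k : ℕ) - (l : ℕ))) : q = q' := by
  -- The system is triangular with ones on the diagonal, since `frameRank` is zero in negative
  -- degrees and one in degree zero; it is solved from the index `n` downwards.
  have key : ∀ m : ℕ, ∀ k : Fin (n + 1), n - (k : ℕ) = m → q k = q' k := by
    intro m
    induction m using Nat.strong_induction_on with
    | _ m ih =>
    intro k hk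
    have h1 := h k
    rw [← Finset.add_sum_erase _ _ (Finset.mem_univ k),
      ← Finset.add_sum_erase _ _ (Finset.mem_univ k), sub_self, frameRank_zero, mul_one,
      mul_one] at h1
    have h2 : ∑ x ∈ Finset.univ.erase k, q x * frameRank F ((x : ℕ) - (k : ℕ)) =
        ∑ x ∈ Finset.univ.erase k, q' x * frameRank F ((x : ℕ) - (k : ℕ)) := by
      refine Finset.sum_congr rfl fun x hx => ?_
      rcases lt_or_gt_of_ne (Finset.ne_of_mem_erase hx) with h3 | h3
      · rw [frameRank_neg F (by have := Fin.lt_def.1 h3; omega), mul_zero, mul_zero]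
      · rw [ih (n - (x : ℕ)) (by have := Fin.lt_def.1 h3; omega) x rfl]
    omega
  exact funext fun k => key _ k rfl

/-- A vector field whose values are combinations of the values of an independent family is a
combination of that family. -/
lemma exists_frame_coefficients {U : Opens M} {r : Fin (n + 1) → ℕ}
    {X : ∀ k : Fin (n + 1), Fin (r k) → Module.End ℝ (A.Func U)}
    (hX : ∀ (k : Fin (n + 1)) i, X k i ∈ A.vectorField U (-((k : ℕ) : ℤ)))
    (hind : ∀ (x : U) (k : Fin (n + 1)), ResIndependent k fun i => A.vfVal (X k i) x)
    {l : ℕ} {Z : Module.End ℝ (A.Func U)} (hZ : Z ∈ A.vectorField U (-(l : ℤ)))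
    (hspan : ∀ x : U, A.vfVal Z x ∈ A.frameSpan (fun k i => A.vfVal (X k i) x) l) :
    ∃ f : ∀ k : Fin (n + 1), Fin (r k) → A.Func U,
      (∀ (k : Fin (n + 1)) i, f k i ∈ A.funcDeg U (-(l : ℤ) + ((k : ℕ) : ℤ))) ∧
      Z = ∑ k, ∑ i, A.funcSmul (f k i) (X k i) := by
  choose w hw hZw using hspan
  -- The coefficients were chosen pointwise. Since the frame products are independent, the
  -- coordinates of these coefficients are unique, and they are smooth because the combination is.
  have hws : ∀ (k : Fin (n + 1)) i, (fun x => w x k i) ∈ ERSec d F E U := by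
    intro k i
    refine erSec_of_local fun x₀ => ?_
    obtain ⟨W, hxW, ⟨B⟩⟩ := exists_dualFrame (d := d) F E (x₀ : M)
    let δ : ∀ y : (U ⊓ W : Opens M), ∀ k, Fin (r k) → HomAt d F E (y : M) :=
      fun y k i => A.vfVal (X k i) ⟨y, y.2.1⟩
    obtain ⟨N, hN, hxN, -, hc⟩ := exists_smooth_coefficients (U := U ⊓ W)
      (fun (j : (Σ k, Fin (r k)) × FrameIndex F) y => A.frameProduct B (δ y) j)
      (fun j e => erSec_mul A (erRes d F E le_top (B.sec j.2)).2
        (erRes d F E inf_le_left ⟨_, (vfVal_isDerSection (hX j.1.1 j.1.2)).2 e⟩).2)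
      ⊤ ⟨x₀, x₀.2, hxW⟩ (fun c hc => Fintype.linearIndependent_iff.1
        (frameProduct_independent B hxW (fun k i => vfVal_mem_derFib (hX k i) _)
          (hind x₀)) c (homAt_ext fun e => hc e trivial))
    refine ⟨N, hN.trans inf_le_left, hxN, ?_⟩
    have h1 := hc (fun y j => B.coef y j.2 (w ⟨y, (hN y.2).1⟩ j.1.1 j.1.2)) fun e => by
      have h2 : ∀ y : N, ∑ j, B.coef y j.2 (w ⟨y, (hN y.2).1⟩ j.1.1 j.1.2) •
          A.frameProduct B (δ ⟨y, hN y.2⟩) j = A.vfVal Z ⟨y, (hN y.2).1⟩ := by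
        intro y
        rw [sum_smul_frameProduct, hZw]
        refine Finset.sum_congr rfl fun k _ => Finset.sum_congr rfl fun i _ => ?_
        exact congrArg (fun v => A.thetaER (y : M) v (A.vfVal (X k i) ⟨y, (hN y.2).1⟩))
          (B.expand_sec ⟨y, (hN y.2).2⟩ (w ⟨y, (hN y.2).1⟩ k i)).symm
      simp only [h2]
      exact (erRes d F E (hN.trans inf_le_left) ⟨_, (vfVal_isDerSection hZ).2 e⟩).2
    have h3 : (fun y : N => w ⟨y, (hN y.2).1⟩ k i) = fun y : N => ∑ b,
        B.coef y b (w ⟨y, (hN y.2).1⟩ k i) • (B.sec b).1 ⟨y, trivial⟩ :=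
      funext fun y => B.expand_sec ⟨y, (hN y.2).2⟩ _
    rw [h3]
    exact erSec_sum _ _ fun b _ => erSec_smul (h1 (⟨k, i⟩, b)) (erRes d F E le_top (B.sec b)).2
  have hf : ∀ (k : Fin (n + 1)) i, A.cls U ⟨_, hws k i⟩ ∈
      A.funcDeg U (-(l : ℤ) + ((k : ℕ) : ℤ)) := fun k i => A.cls_mem_funcDeg fun x => by
    rw [neg_add_eq_sub]
    exact hw x k i
  refine ⟨fun k i => A.cls U ⟨_, hws k i⟩, hf, vf_ext_of_vfVal hZ
    (sum_mem fun k _ => sum_mem fun i _ => ?_) fun x => ?_⟩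
  · have := funcSmul_mem (hf k i) (hX k i)
    rwa [add_neg_cancel_right] at this
  · simp only [vfVal_sum, vfVal_funcSmul]
    exact hZw x

lemma tangentAt_funcSum {U : Opens M} {ι : Type*} (s : Finset ι) (c : ι → ℝ)
    (X : ι → Module.End ℝ (A.Func U)) (x : U) :
    A.tangentAt (∑ i ∈ s, c i • X i) x = ∑ i ∈ s, c i • A.tangentAt (X i) x := by
  refine LinearMap.ext fun f => ?_
  simp [tangentAt, map_sum]

/-- A vector field has tangent vector zero if its value is in the kernel of the restriction. -/
lemma tangentAt_eq_zero {U : Opens M} {k : ℕ} {X : Module.End ℝ (A.Func U)}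
    (hX : X ∈ A.vectorField U (-(k : ℤ))) (x : U)
    (h : A.vfVal X x ∈ LinearMap.ker (resAt d F E k (x : M))) : A.tangentAt X x = 0 := by
  have h1 : ∀ e : ERSec d F E (⊤ : Opens M), (A.vfVal X x e).1 = 0 := by
    refine erSec_induction (fun e e' he he' => ?_) (fun a e ha he => ?_)
    · rw [homAt_map_add, Prod.fst_add, he, he', add_zero]
    -- Up to degree `k` the kernel condition applies; beyond it the value of the derivation has
    -- positive degree and no scalar part.
    · by_cases hak : a ≤ k
      · rw [mem_ker_resAt.1 h e fun y i hi => (he y).2 i (by omega)]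
        rfl
      · exact (derFib_deg (vfVal_mem_derFib hX x) he).1 (by omega)
  have h2 : ∀ l f, A.FuncPoly ⊤ l f → A.tangentAt X x (A.res le_top f) = 0 := by
    intro l f hf
    induction hf with
    | zero => rw [map_zero, map_zero]
    | one =>
      rw [map_one]
      change A.ev U x (X 1) = 0
      rw [vf_one hX, map_zero]
    | add _ _ ha hb => rw [map_add, map_add, ha, hb, add_zero]
    | mul a e he _ ih =>
      rw [map_mul, res_cls]
      change A.ev U x (X _) = 0
      rw [vf_leibniz hX (A.cls_mem_funcDeg (he.restrict le_top)), map_add, map_mul, map_zsmul,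
        map_mul]
      have h3 := tangentAt_cls hX x e
      rw [h1] at h3
      change A.ev U x (X _) = 0 at h3
      change A.ev U x (X _) = 0 at ih
      rw [h3, ih, zero_mul, mul_zero, smul_zero, add_zero]
  refine LinearMap.ext fun f => ?_
  obtain ⟨N, hN, f', hxN, hf', hff⟩ := A.func_exists_global f x.2
  have h4 : A.tangentAt X x (A.res le_top f') = 0 := by
    have : Submodule.span ℝ {g | ∃ l, A.FuncPoly ⊤ l g} ≤
        LinearMap.ker (A.tangentAt X x ∘ₗ (A.res le_top).toLinearMap) :=
      Submodule.span_le.2 fun g ⟨l, hg⟩ => h2 l g hg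
    exact this hf'
  have h5 := vf_congr hN hX (f := A.res le_top f') (g := f) (by rw [res_res, hff])
  have h6 := congrArg (A.ev N ⟨x, hxN⟩) h5
  rw [ev_res, ev_res] at h6
  exact h6.symm.trans h4

/-- Pointwise independence of the tangent vectors. -/
lemma linearIndependent_tangentAt_iff {U : Opens M} {r : Fin (n + 1) → ℕ}
    {X : ∀ k : Fin (n + 1), Fin (r k) → Module.End ℝ (A.Func U)}
    (hX : ∀ (k : Fin (n + 1)) i, X k i ∈ A.vectorField U (-((k : ℕ) : ℤ))) (x : U) :
    LinearIndependent ℝ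
      (fun p : Σ k : Fin (n + 1), Fin (r k) => A.tangentAt (X p.1 p.2) x) ↔
    ∀ k : Fin (n + 1), ResIndependent k fun i => A.vfVal (X k i) x := by
  rw [Fintype.linearIndependent_iff]
  constructor
  · intro h k c hc
    have hsum : ∑ i, c i • X k i ∈ A.vectorField U (-((k : ℕ) : ℤ)) :=
      sum_mem fun i _ => Submodule.smul_mem _ _ (hX k i)
    have h1 : A.vfVal (∑ i, c i • X k i) x = ∑ i, c i • A.vfVal (X k i) x := by
      rw [vfVal_sum]
      refine Finset.sum_congr rfl fun i _ => homAt_ext fun e => ?_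
      rw [homAt_smul_apply, vfVal_apply, vfVal_apply, LinearMap.smul_apply, map_smul,
        LinearMap.smul_apply]
    have h2 := tangentAt_eq_zero hsum x (by rw [h1]; exact hc)
    rw [tangentAt_funcSum] at h2
    classical
    have h3 := h (fun p => if hp : p.1 = k then c (hp ▸ p.2) else 0) (by
      rw [Fintype.sum_sigma, Finset.sum_eq_single k]
      · simpa using h2
      · intro k' _ hk
        simp [hk]
      · simp)
    intro i
    simpa using h3 ⟨k, i⟩
  · intro h c hc
    -- Ascending induction on `k`: on sections of degree at most `k`, tangent vectors of larger
    -- index vanish and those of smaller index already have coefficient zero, so the relation is one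
    -- between restrictions of the members of index `k`.
    have key : ∀ m : ℕ, ∀ k : Fin (n + 1), (k : ℕ) = m → ∀ i, c ⟨k, i⟩ = 0 := by
      intro m
      induction m using Nat.strong_induction_on with
      | _ m ih =>
      intro k hk
      refine h k (fun i => c ⟨k, i⟩) (mem_ker_resAt.2 fun e he => ?_)
      have h1 := congrArg (fun τ => τ (A.cls U (erRes d F E le_top e))) hc
      simp only [LinearMap.sum_apply, LinearMap.smul_apply, LinearMap.zero_apply] at h1
      rw [Fintype.sum_sigma, Finset.sum_eq_single k] at h1
      · rw [homAt_sum_apply]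
        refine Prod.ext ?_ ?_
        · rw [Prod.fst_sum, Prod.fst_zero, ← h1]
          refine Finset.sum_congr rfl fun i _ => ?_
          rw [tangentAt_cls (hX k i)]
          rfl
        · rw [Prod.snd_sum]
          refine Finset.sum_eq_zero fun i _ => ?_
          rw [homAt_smul_apply, (derFib_erSecLE le_rfl (vfVal_mem_derFib (hX k i) x) he).1]
          exact smul_zero _
      · intro k' _ hk'
        refine Finset.sum_eq_zero fun i _ => ?_
        rcases lt_or_gt_of_ne hk' with h5 | h5
        · rw [ih k' (hk ▸ h5) k' rfl i, zero_smul]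
        · rw [tangentAt_cls (hX k' i),
            (derFib_erSecLE (Fin.le_def.1 h5.le) (vfVal_mem_derFib (hX k' i) x) he).2 h5]
          exact smul_zero _
      · exact fun h5 => absurd (Finset.mem_univ _) h5
    exact fun p => key _ p.1 rfl p.2

end ResFrames

end CoalgebraBundle

/-! ## Locally generated sheaves of vector fields -/

namespace CoalgebraBundle

section LocallyGenerated

variable {d : ℕ} {n : ℕ} {M : Type*} [TopologicalSpace M] [T2Space M]
  [ChartedSpace (EuclideanSpace ℝ (Fin d)) M] [IsManifold (𝓡 d) ∞ M]
  {F : Fin n → Type*} [∀ i, NormedAddCommGroup (F i)] [∀ i, NormedSpace ℝ (F i)]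
  {E : Fin n → M → Type*} [∀ i x, AddCommGroup (E i x)] [∀ i x, Module ℝ (E i x)]
  [∀ i, TopologicalSpace (Bundle.TotalSpace (F i) (E i))] [∀ i x, TopologicalSpace (E i x)]
  [∀ i, FiberBundle (F i) (E i)] [∀ i, VectorBundle ℝ (F i) (E i)]
  [∀ i, FiniteDimensional ℝ (F i)] [∀ i, ContMDiffVectorBundle ∞ (F i) (E i) (𝓡 d)]

variable {A : CoalgebraBundle d F E}

/-- At one point, the condition on the kernels of the restriction maps holds for the spaces that are
generated by a family that is independent modulo these kernels. -/
lemma frameSpan_condition {r : Fin (n + 1) → ℕ} {x : M} {δ : ∀ k, Fin (r k) → HomAt d F E x}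
    (hδ : ∀ (k : Fin (n + 1)) i, δ k i ∈ A.derFib k x)
    (hind : ∀ k : Fin (n + 1), ResIndependent k (δ k))
    (hle : ∀ l : Fin (n + 1), A.frameSpan δ (l : ℕ) ≤ A.derFib l x) (k : Fin (n + 1)) :
    (⨆ (i : Fin n) (_ : (k : ℕ) + ((i : ℕ) + 1) < n + 1),
      Submodule.map₂ (A.theta i x) ⊤ (A.frameSpan δ (((k : ℕ) + ((i : ℕ) + 1) : ℕ) : ℤ))) =
    LinearMap.ker (resAt d F E k x) ⊓ A.frameSpan δ (k : ℕ) := by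
  apply le_antisymm
  · refine iSup_le fun i => iSup_le fun h => Submodule.map₂_le.2 fun ξ _ γ hγ => ?_
    rw [theta_eq_thetaER]
    refine ⟨thetaER_mem_ker (l := (k : ℕ) + ((i : ℕ) + 1)) (by omega)
      (hle ⟨(k : ℕ) + ((i : ℕ) + 1), h⟩ hγ) _, thetaER_frameSpan δ hγ ?_⟩
    have := single_mem_erDeg i ξ
    convert this using 2
    push_cast
    ring
  · rintro _ ⟨hker, w, hw, rfl⟩
    have hgt : ∀ k' : Fin (n + 1), k < k' → ∀ i,
        A.thetaER x (w k' i) (δ k' i) ∈ LinearMap.ker (resAt d F E k x) := fun k' h i =>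
      thetaER_mem_ker (Fin.lt_def.1 h) (hδ k' i) _
    have hlt : ∀ k' : Fin (n + 1), k' < k → ∀ i, w k' i = 0 := fun k' h i =>
      eq_zero_of_mem_erDeg (hw k' i) (Or.inl (by have := Fin.lt_def.1 h; omega))
    have heq : ∀ i, w k i = ((w k i).1, 0) := fun i =>
      eq_scalar_of_mem_erDeg_zero (by have := hw k i; rwa [sub_self] at this)
    -- Modulo the kernel only the scalar coefficients at index `k` survive, and independence makes
    -- them zero. What remains has index larger than `k`, hence coefficients of positive degree.
    have hk : ∀ i, (w k i).1 = 0 := by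
      refine hind k _ ?_
      have h1 : ∑ i, (w k i).1 • δ k i = ∑ i, A.thetaER x (w k i) (δ k i) :=
        Finset.sum_congr rfl fun i _ => by
          conv_rhs => rw [heq i]
          rw [thetaER_scalar]
      rw [h1]
      rw [← Finset.add_sum_erase _ _ (Finset.mem_univ k)] at hker
      refine ((LinearMap.ker (resAt d F E k x)).add_mem_iff_left
        (Submodule.sum_mem _ fun k' hk' => Submodule.sum_mem _ fun i _ => ?_)).1 hker
      rcases lt_or_gt_of_ne (Finset.ne_of_mem_erase hk') with h | h
      · rw [hlt k' h i, map_zero]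
        exact Submodule.zero_mem _
      · exact hgt k' h i
    refine Submodule.sum_mem _ fun k' _ => Submodule.sum_mem _ fun i _ => ?_
    rcases lt_trichotomy k' k with h | rfl | h
    · rw [hlt k' h i, map_zero]
      exact Submodule.zero_mem _
    · rw [heq i, hk i]
      change A.thetaER x 0 _ ∈ _
      rw [map_zero]
      exact Submodule.zero_mem _
    · have h' := Fin.lt_def.1 h
      rcases erDeg_cases (hw k' i) with ⟨h1, -⟩ | ⟨j, h1, h2⟩ | h2
      · omega
      · have hj : (k : ℕ) + ((j : ℕ) + 1) = k' := by omega
        refine Submodule.mem_iSup_of_mem j (Submodule.mem_iSup_of_mem (hj ▸ k'.2) ?_)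
        rw [h2, ← theta_eq_thetaER, hj]
        exact Submodule.apply_mem_map₂ _ trivial (mem_frameSpan_self δ k' i)
      · rw [h2, map_zero]
        exact Submodule.zero_mem _

/-- Coefficients at index below `k` have negative degree and vanish, those at index `k` are scalars,
and the terms of larger index lie in the kernel. -/
lemma frameSpan_le_sup {r : Fin (n + 1) → ℕ} {x : M} {δ : ∀ k, Fin (r k) → HomAt d F E x}
    (hδ : ∀ (k : Fin (n + 1)) i, δ k i ∈ A.derFib k x) (k : Fin (n + 1)) :
    A.frameSpan δ (k : ℕ) ≤
      Submodule.span ℝ (Set.range (δ k)) ⊔ LinearMap.ker (resAt d F E k x) := by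
  rintro _ ⟨w, hw, rfl⟩
  refine Submodule.sum_mem _ fun k' _ => Submodule.sum_mem _ fun i _ => ?_
  rcases lt_trichotomy k' k with h | rfl | h
  · rw [eq_zero_of_mem_erDeg (hw k' i) (Or.inl (by have := Fin.lt_def.1 h; omega)), map_zero]
    exact Submodule.zero_mem _
  · have := hw k' i
    rw [sub_self] at this
    rw [eq_scalar_of_mem_erDeg_zero this, thetaER_scalar]
    exact Submodule.mem_sup_left (Submodule.smul_mem _ _ (Submodule.subset_span ⟨i, rfl⟩))
  · exact Submodule.mem_sup_right (thetaER_mem_ker (Fin.lt_def.1 h) (hδ k' i) _)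

/-! ### Products of functions and vector fields, and the modules they generate. -/

lemma funcSmul_add {U : Opens M} (f : A.Func U) (X Y : Module.End ℝ (A.Func U)) :
    A.funcSmul f (X + Y) = A.funcSmul f X + A.funcSmul f Y :=
  LinearMap.ext fun g => mul_add f (X g) (Y g)

lemma funcSmul_smul {U : Opens M} (f : A.Func U) (c : ℝ) (X : Module.End ℝ (A.Func U)) :
    A.funcSmul f (c • X) = c • A.funcSmul f X :=
  LinearMap.ext fun g => mul_smul_comm c f (X g)

lemma funcSmul_zero {U : Opens M} (f : A.Func U) :
    A.funcSmul f (0 : Module.End ℝ (A.Func U)) = 0 :=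
  LinearMap.ext fun _ => mul_zero f

lemma funcSmul_sum {U : Opens M} {ι : Type*} (s : Finset ι) (f : A.Func U)
    (X : ι → Module.End ℝ (A.Func U)) :
    A.funcSmul f (∑ i ∈ s, X i) = ∑ i ∈ s, A.funcSmul f (X i) :=
  map_sum (AddMonoidHom.mk' (A.funcSmul f) (funcSmul_add f)) X s

lemma funcSmul_funcSmul {U : Opens M} (f g : A.Func U) (X : Module.End ℝ (A.Func U)) :
    A.funcSmul f (A.funcSmul g X) = A.funcSmul (f * g) X :=
  LinearMap.ext fun h => (mul_assoc f g (X h)).symm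

lemma add_funcSmul {U : Opens M} (f g : A.Func U) (X : Module.End ℝ (A.Func U)) :
    A.funcSmul (f + g) X = A.funcSmul f X + A.funcSmul g X :=
  LinearMap.ext fun h => add_mul f g (X h)

lemma smul_funcSmul {U : Opens M} (c : ℝ) (f : A.Func U) (X : Module.End ℝ (A.Func U)) :
    A.funcSmul (c • f) X = c • A.funcSmul f X :=
  LinearMap.ext fun h => smul_mul_assoc c f (X h)

lemma zero_funcSmul {U : Opens M} (X : Module.End ℝ (A.Func U)) :
    A.funcSmul (0 : A.Func U) X = 0 :=
  LinearMap.ext fun h => zero_mul (X h)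

lemma one_funcSmul {U : Opens M} (X : Module.End ℝ (A.Func U)) :
    A.funcSmul (1 : A.Func U) X = X :=
  LinearMap.ext fun h => one_mul (X h)

/-- The vector fields of degree `l` that are combinations of the given ones over the functions. -/
def generated {U : Opens M} {r : Fin (n + 1) → ℕ}
    (X : ∀ k : Fin (n + 1), Fin (r k) → Module.End ℝ (A.Func U)) (l : ℤ) :
    Submodule ℝ (Module.End ℝ (A.Func U)) where
  carrier := {Y | ∃ f : ∀ k : Fin (n + 1), Fin (r k) → A.Func U,
    (∀ (k : Fin (n + 1)) (i : Fin (r k)), f k i ∈ A.funcDeg U (l + ((k : ℕ) : ℤ))) ∧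
      Y = ∑ k, ∑ i, A.funcSmul (f k i) (X k i)}
  add_mem' := by
    rintro _ _ ⟨f, hf, rfl⟩ ⟨g, hg, rfl⟩
    refine ⟨fun k i => f k i + g k i, fun k i => add_mem (hf k i) (hg k i), ?_⟩
    simp only [add_funcSmul, Finset.sum_add_distrib]
  zero_mem' := ⟨fun _ _ => 0, fun _ _ => zero_mem _, by simp [zero_funcSmul]⟩
  smul_mem' := by
    rintro c _ ⟨f, hf, rfl⟩
    refine ⟨fun k i => c • f k i, fun k i => Submodule.smul_mem _ c (hf k i), ?_⟩
    simp only [smul_funcSmul, Finset.smul_sum]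

lemma mem_generated_self {U : Opens M} {r : Fin (n + 1) → ℕ}
    (X : ∀ k : Fin (n + 1), Fin (r k) → Module.End ℝ (A.Func U)) (k : Fin (n + 1))
    (i : Fin (r k)) : X k i ∈ generated X (-((k : ℕ) : ℤ)) := by
  classical
  refine ⟨fun k' => if h : k' = k then Function.update 0 (h ▸ i) 1 else 0, fun k' i' => ?_, ?_⟩
  · by_cases h : k' = k
    · subst h
      by_cases h' : i' = i
      · subst h'
        simpa using A.one_mem_funcDeg U
      · simp [Function.update_of_ne h']
    · simp [h]
  · rw [Finset.sum_eq_single k]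
    · rw [Finset.sum_eq_single i]
      · simp [one_funcSmul]
      · intro i' _ h
        simp [Function.update_of_ne h, zero_funcSmul]
      · simp
    · intro k' _ h
      simp [h, zero_funcSmul]
    · simp

lemma funcSmul_mem_generated {U : Opens M} {r : Fin (n + 1) → ℕ}
    {X : ∀ k : Fin (n + 1), Fin (r k) → Module.End ℝ (A.Func U)} {a l : ℤ} {f : A.Func U}
    (hf : f ∈ A.funcDeg U a) {Y : Module.End ℝ (A.Func U)} (hY : Y ∈ generated X l) :
    A.funcSmul f Y ∈ generated X (a + l) := by
  obtain ⟨g, hg, rfl⟩ := hY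
  refine ⟨fun k i => f * g k i, fun k i => ?_, ?_⟩
  · rw [add_assoc]
    exact A.mul_mem_funcDeg hf (hg k i)
  · simp only [funcSmul_sum, funcSmul_funcSmul]

/-- In degree `-l` the coefficients have degree `k - l ≤ n`, so they are sections of `𝐄*_ℝ` and have
values at the point. -/
lemma vfVal_generated {U : Opens M} {r : Fin (n + 1) → ℕ}
    {X : ∀ k : Fin (n + 1), Fin (r k) → Module.End ℝ (A.Func U)} {l : ℕ}
    {Y : Module.End ℝ (A.Func U)} (hY : Y ∈ generated X (-(l : ℤ))) (x : U) :
    A.vfVal Y x ∈ A.frameSpan (fun k i => A.vfVal (X k i) x) l := by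
  obtain ⟨f, hf, rfl⟩ := hY
  choose e he hef using fun (k : Fin (n + 1)) i =>
    A.exists_cls_of_mem_funcDeg (by have := k.2; omega) (hf k i)
  refine ⟨fun k i => (e k i).1 x, fun k i => ?_, ?_⟩
  · have := he k i x
    rwa [neg_add_eq_sub] at this
  · rw [vfVal_sum]
    refine Finset.sum_congr rfl fun k _ => ?_
    rw [vfVal_sum]
    refine Finset.sum_congr rfl fun i _ => ?_
    rw [← hef, vfVal_funcSmul]

/-- The vector fields of degree `l` spanned by the products of functions with members of the
sets `S k` of vector fields of degree `-k`. -/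
def productSpan {U : Opens M} (S : Fin (n + 1) → Submodule ℝ (Module.End ℝ (A.Func U))) (l : ℤ) :
    Submodule ℝ (Module.End ℝ (A.Func U)) :=
  Submodule.span ℝ {Y | ∃ k : Fin (n + 1), ∃ f ∈ A.funcDeg U (l + ((k : ℕ) : ℤ)), ∃ Z ∈ S k,
    Y = A.funcSmul f Z}

lemma productSpan_le_generated {U : Opens M} {r : Fin (n + 1) → ℕ}
    {X : ∀ k : Fin (n + 1), Fin (r k) → Module.End ℝ (A.Func U)}
    {S : Fin (n + 1) → Submodule ℝ (Module.End ℝ (A.Func U))}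
    (hS : ∀ k : Fin (n + 1), S k ≤ generated X (-((k : ℕ) : ℤ))) (l : ℤ) :
    productSpan S l ≤ generated X l := by
  refine Submodule.span_le.2 ?_
  rintro _ ⟨k, f, hf, Z, hZ, rfl⟩
  have := funcSmul_mem_generated hf (hS k hZ)
  rwa [add_neg_cancel_right] at this

lemma generated_le_productSpan {U : Opens M} {r : Fin (n + 1) → ℕ}
    {X : ∀ k : Fin (n + 1), Fin (r k) → Module.End ℝ (A.Func U)}
    {S : Fin (n + 1) → Submodule ℝ (Module.End ℝ (A.Func U))} (hX : ∀ k i, X k i ∈ S k) (l : ℤ) :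
    generated X l ≤ productSpan S l := by
  rintro _ ⟨f, hf, rfl⟩
  exact sum_mem fun k _ => sum_mem fun i _ =>
    Submodule.subset_span ⟨k, f k i, hf k i, X k i, hX k i, rfl⟩

lemma productSpan_le_vectorField {U : Opens M}
    {S : Fin (n + 1) → Submodule ℝ (Module.End ℝ (A.Func U))}
    (hS : ∀ k : Fin (n + 1), S k ≤ A.vectorField U (-((k : ℕ) : ℤ))) (l : ℤ) :
    productSpan S l ≤ A.vectorField U l := by
  refine Submodule.span_le.2 ?_
  rintro _ ⟨k, f, hf, Z, hZ, rfl⟩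
  have := funcSmul_mem hf (hS k hZ)
  rwa [add_neg_cancel_right] at this

lemma productSpan_le_sec (D : A.GradedSubsheaf) {U : Opens M}
    {S : Fin (n + 1) → Submodule ℝ (Module.End ℝ (A.Func U))}
    (hS : ∀ k : Fin (n + 1), S k ≤ D.sec U (-((k : ℕ) : ℤ))) (l : ℤ) :
    productSpan S l ≤ D.sec U l := by
  refine Submodule.span_le.2 ?_
  rintro _ ⟨k, f, hf, Z, hZ, rfl⟩
  have := D.smul_mem U _ _ f hf Z (hS k hZ)
  rwa [add_neg_cancel_right] at this

lemma productSpan_mono {U : Opens M}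
    {S S' : Fin (n + 1) → Submodule ℝ (Module.End ℝ (A.Func U))} (h : ∀ k, S k ≤ S' k) (l : ℤ) :
    productSpan S l ≤ productSpan S' l := by
  refine Submodule.span_mono ?_
  rintro _ ⟨k, f, hf, Z, hZ, rfl⟩
  exact ⟨k, f, hf, Z, h k hZ, rfl⟩

lemma funcSmul_mem_productSpan {U : Opens M}
    {S : Fin (n + 1) → Submodule ℝ (Module.End ℝ (A.Func U))} {a l : ℤ} {f : A.Func U}
    (hf : f ∈ A.funcDeg U a) {Y : Module.End ℝ (A.Func U)} (hY : Y ∈ productSpan S l) :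
    A.funcSmul f Y ∈ productSpan S (a + l) := by
  induction hY using Submodule.span_induction with
  | mem Y h =>
    obtain ⟨k, g, hg, Z, hZ, rfl⟩ := h
    rw [funcSmul_funcSmul]
    refine Submodule.subset_span ⟨k, f * g, ?_, Z, hZ, rfl⟩
    rw [add_assoc]
    exact A.mul_mem_funcDeg hf hg
  | zero => rw [funcSmul_zero]; exact Submodule.zero_mem _
  | add _ _ _ _ h1 h2 => rw [funcSmul_add]; exact Submodule.add_mem _ h1 h2
  | smul c _ _ h => rw [funcSmul_smul]; exact Submodule.smul_mem _ c h

lemma productSpan_restrict {U V : Opens M} (hV : V ≤ U)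
    {S : Fin (n + 1) → Submodule ℝ (Module.End ℝ (A.Func U))}
    {S' : Fin (n + 1) → Submodule ℝ (Module.End ℝ (A.Func V))}
    (h : ∀ k, ∀ Z ∈ S k, ∃ Z' ∈ S' k, A.IsRestriction hV Z Z') {l : ℤ}
    {Y : Module.End ℝ (A.Func U)} (hY : Y ∈ productSpan S l) :
    ∃ Y' ∈ productSpan S' l, A.IsRestriction hV Y Y' := by
  induction hY using Submodule.span_induction with
  | mem Y hY =>
    obtain ⟨k, g, hg, Z, hZ, rfl⟩ := hY
    obtain ⟨Z', hZ', hr⟩ := h k Z hZ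
    exact ⟨_, Submodule.subset_span ⟨k, A.res hV g, A.res_mem_funcDeg hV hg, Z', hZ', rfl⟩,
      hr.funcSmul g⟩
  | zero => exact ⟨0, Submodule.zero_mem _, fun f => (map_zero (A.res hV)).symm⟩
  | add _ _ _ _ h1 h2 =>
    obtain ⟨Y1, hY1, hr1⟩ := h1
    obtain ⟨Y2, hY2, hr2⟩ := h2
    refine ⟨_, Submodule.add_mem _ hY1 hY2, fun f => ?_⟩
    rw [LinearMap.add_apply, LinearMap.add_apply, map_add, hr1 f, hr2 f]
  | smul c _ _ h =>
    obtain ⟨Y1, hY1, hr1⟩ := h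
    refine ⟨_, Submodule.smul_mem _ c hY1, fun f => ?_⟩
    rw [LinearMap.smul_apply, LinearMap.smul_apply, map_smul, hr1 f]

lemma IsRestriction.trans {U V W : Opens M} {hV : V ≤ U} {hW : W ≤ V}
    {X : Module.End ℝ (A.Func U)} {Y : Module.End ℝ (A.Func V)} {Z : Module.End ℝ (A.Func W)}
    (hXY : A.IsRestriction hV X Y) (hYZ : A.IsRestriction hW Y Z) :
    A.IsRestriction (hW.trans hV) X Z := fun f => by
  rw [← res_res A hV hW, ← res_res A hV hW, hYZ, hXY]

lemma IsRestriction.refl {U : Opens M} (X : Module.End ℝ (A.Func U)) :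
    A.IsRestriction le_rfl X X := fun f => by
  rw [res_self, res_self]

lemma GradedSubsheaf.exists_restriction [SecondCountableTopology M] (D : A.GradedSubsheaf)
    {U V : Opens M} (hV : V ≤ U) {l : ℤ} {X : Module.End ℝ (A.Func U)} (hX : X ∈ D.sec U l) :
    ∃ Y ∈ D.sec V l, A.IsRestriction hV X Y := by
  obtain ⟨Y, hY, hr⟩ := CoalgebraBundle.exists_restriction hV (D.le_vectorField U l hX)
  exact ⟨Y, D.res_mem hV l X hX Y hY hr, hr⟩

/-- The sections of degrees `0, …, -n` generate the sheaf locally. -/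
def GradedSubsheaf.IsLocallyGenerated (D : A.GradedSubsheaf) : Prop :=
  ∀ (U : Opens M) (l : ℤ), ∀ Z ∈ D.sec U l, ∀ x : U, ∃ (V : Opens M) (hV : V ≤ U), (x : M) ∈ V ∧
    ∃ Y ∈ productSpan (fun k : Fin (n + 1) => D.sec V (-((k : ℕ) : ℤ))) l, A.IsRestriction hV Z Y

lemma GradedSubsheaf.IsGenerators.sec_eq {D : A.GradedSubsheaf} {U : Opens M}
    {r : Fin (n + 1) → ℕ} {X : ∀ k : Fin (n + 1), Fin (r k) → Module.End ℝ (A.Func U)}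
    (h : D.IsGenerators U r X) (l : ℤ) : D.sec U l = generated X l :=
  Submodule.ext fun Y => h.2.2 l Y

lemma GradedSubsheaf.IsGenerators.mem_sec {D : A.GradedSubsheaf} {U : Opens M}
    {r : Fin (n + 1) → ℕ} {X : ∀ k : Fin (n + 1), Fin (r k) → Module.End ℝ (A.Func U)}
    (h : D.IsGenerators U r X) (k : Fin (n + 1)) (i : Fin (r k)) :
    X k i ∈ D.sec U (-((k : ℕ) : ℤ)) := by
  rw [h.sec_eq]
  exact mem_generated_self X k i

/-- The generators live on their own open set `V`, not on `U`. A global section with the same germ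
is therefore restricted to `V`, expanded there, and compared with the original one on a common
smaller set. -/
lemma GradedSubsheaf.IsDistribution.isLocallyGenerated [SecondCountableTopology M]
    {D : A.GradedSubsheaf} (hD : D.IsDistribution) : D.IsLocallyGenerated := by
  intro U l Z hZ x
  obtain ⟨r, hr⟩ := hD
  obtain ⟨V, hxV, X, hX⟩ := hr x
  obtain ⟨Z', hZ', N, hN, hxN, hag⟩ := D.exists_global_section hZ x.2
  obtain ⟨Z'', hZ'', hr''⟩ := D.exists_restriction (le_top : V ≤ ⊤) hZ'
  rw [hX.sec_eq] at hZ''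
  have h1 : Z'' ∈ productSpan (fun k : Fin (n + 1) => D.sec V (-((k : ℕ) : ℤ))) l :=
    generated_le_productSpan hX.mem_sec l hZ''
  obtain ⟨Y, hY, hrY⟩ := productSpan_restrict (inf_le_right : N ⊓ V ≤ V)
    (S' := fun k : Fin (n + 1) => D.sec (N ⊓ V) (-((k : ℕ) : ℤ)))
    (fun k Z hZ => D.exists_restriction _ hZ) h1
  refine ⟨N ⊓ V, inf_le_left.trans hN, ⟨hxN, hxV⟩, Y, hY, AgreeOn.isRestriction
    (D.le_vectorField U l hZ) (D.le_vectorField _ l (productSpan_le_sec D (fun _ => le_rfl) l hY)) ?_⟩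
  exact (hag.symm.mono inf_le_left).trans (hr''.trans hrY).agreeOn

end LocallyGenerated

end CoalgebraBundle

/-! ## Distributions and families of subbundles -/

section LinearAlgebra

/-- The subfamily is one whose classes form a basis of the image of the span in the quotient by `K`.
-/
lemma exists_independent_mod {V : Type*} [AddCommGroup V] [Module ℝ V] (K : Submodule ℝ V)
    {m : ℕ} (v : Fin m → V) : ∃ (q : ℕ) (a : Fin q → Fin m),
      (∀ c : Fin q → ℝ, ∑ i, c i • v (a i) ∈ K → ∀ i, c i = 0) ∧
      Submodule.span ℝ (Set.range v) ≤ Submodule.span ℝ (Set.range fun i => v (a i)) ⊔ K := by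
  obtain ⟨κ, a, ha, hspan, hli⟩ := exists_linearIndependent' ℝ (K.mkQ ∘ v)
  have : Finite κ := Finite.of_injective a ha
  let e := (Finite.equivFin κ).symm
  refine ⟨_, a ∘ e, fun c hc => ?_, ?_⟩
  · refine Fintype.linearIndependent_iff.1 (hli.comp e e.injective) c ?_
    rw [← Submodule.Quotient.mk_eq_zero, ← Submodule.mkQ_apply, map_sum] at hc
    simp only [map_smul] at hc
    exact hc
  · have h1 : Set.range ((K.mkQ ∘ v) ∘ a) = K.mkQ '' Set.range fun i => v ((a ∘ e) i) := by
      rw [← Set.range_comp]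
      exact (e.surjective.range_comp ((K.mkQ ∘ v) ∘ a)).symm
    rw [h1, Set.range_comp, ← Submodule.map_span, ← Submodule.map_span] at hspan
    intro x hx
    have h2 : K.mkQ x ∈ Submodule.map K.mkQ (Submodule.span ℝ (Set.range v)) := ⟨x, hx, rfl⟩
    rw [← hspan] at h2
    obtain ⟨y, hy, hxy⟩ := h2
    refine Submodule.mem_sup.2 ⟨y, hy, x - y, ?_, add_sub_cancel _ _⟩
    rw [← Submodule.Quotient.mk_eq_zero, ← Submodule.mkQ_apply, map_sub, hxy, sub_self]

/-- By the modular law `C` is the sum of the span of `v` and of `K ⊓ C`; the sum is direct because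
`v` is independent modulo `K`. -/
lemma finrank_inf_eq_sub {V : Type*} [AddCommGroup V] [Module ℝ V] {K C : Submodule ℝ V}
    [FiniteDimensional ℝ C] {q : ℕ} {v : Fin q → V} (hv : ∀ i, v i ∈ C)
    (hind : ∀ c : Fin q → ℝ, ∑ i, c i • v i ∈ K → ∀ i, c i = 0)
    (hspan : C ≤ Submodule.span ℝ (Set.range v) ⊔ K) :
    Module.finrank ℝ ↥(K ⊓ C) = Module.finrank ℝ C - q := by
  have hle : Submodule.span ℝ (Set.range v) ≤ C := Submodule.span_le.2 (by
    rintro _ ⟨i, rfl⟩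
    exact hv i)
  have hli : LinearIndependent ℝ v := Fintype.linearIndependent_iff.2 fun c hc =>
    hind c (hc ▸ K.zero_mem)
  have hfin : FiniteDimensional ℝ ↥(K ⊓ C) := Submodule.finiteDimensional_of_le inf_le_right
  have hfin' : FiniteDimensional ℝ ↥(Submodule.span ℝ (Set.range v)) :=
    Submodule.finiteDimensional_of_le hle
  have h1 : Submodule.span ℝ (Set.range v) ⊔ K ⊓ C = C := by
    rw [← sup_inf_assoc_of_le K hle, inf_eq_right]
    exact hspan
  have h2 : Submodule.span ℝ (Set.range v) ⊓ (K ⊓ C) = ⊥ := by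
    refine (Submodule.eq_bot_iff _).2 fun x hx => ?_
    obtain ⟨c, rfl⟩ := (Submodule.mem_span_range_iff_exists_fun ℝ).1 hx.1
    have := hind c hx.2.1
    exact Finset.sum_eq_zero fun i _ => by rw [this i, zero_smul]
  have h3 := Submodule.finrank_sup_add_finrank_inf_eq (Submodule.span ℝ (Set.range v)) (K ⊓ C)
  rw [h1, h2, finrank_bot, add_zero, finrank_span_eq_card hli, Fintype.card_fin] at h3
  omega

end LinearAlgebra

namespace CoalgebraBundle

section Distributions

variable {d : ℕ} {n : ℕ} {M : Type*} [TopologicalSpace M] [T2Space M]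
  [ChartedSpace (EuclideanSpace ℝ (Fin d)) M] [IsManifold (𝓡 d) ∞ M]
  {F : Fin n → Type*} [∀ i, NormedAddCommGroup (F i)] [∀ i, NormedSpace ℝ (F i)]
  {E : Fin n → M → Type*} [∀ i x, AddCommGroup (E i x)] [∀ i x, Module ℝ (E i x)]
  [∀ i, TopologicalSpace (Bundle.TotalSpace (F i) (E i))] [∀ i x, TopologicalSpace (E i x)]
  [∀ i, FiberBundle (F i) (E i)] [∀ i, VectorBundle ℝ (F i) (E i)]
  [∀ i, FiniteDimensional ℝ (F i)] [∀ i, ContMDiffVectorBundle ∞ (F i) (E i) (𝓡 d)]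

variable {A : CoalgebraBundle d F E} {C : Fin (n + 1) → ∀ x : M, Submodule ℝ (HomAt d F E x)}

lemma vfVal_smul {U : Opens M} (c : ℝ) (X : Module.End ℝ (A.Func U)) (x : U) :
    A.vfVal (c • X) x = c • A.vfVal X x := homAt_ext fun e => by
  rw [homAt_smul_apply, vfVal_apply, vfVal_apply, LinearMap.smul_apply, map_smul,
    LinearMap.smul_apply]

lemma IsDerSection.restrict {U V : Opens M} (h : V ≤ U) {k : ℕ}
    {δ : ∀ x : U, HomAt d F E (x : M)} (hδ : A.IsDerSection U k δ) :
    A.IsDerSection V k (fun x => δ ⟨x, h x.2⟩) :=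
  ⟨fun x => hδ.1 _, fun e => (erRes d F E h ⟨_, hδ.2 e⟩).2⟩

lemma IsSubbundle.le_derFib {k : ℕ} {C : ∀ x : M, Submodule ℝ (HomAt d F E x)}
    (hC : A.IsSubbundle k C) (x : M) : C x ≤ A.derFib k x := by
  obtain ⟨r, h⟩ := hC
  obtain ⟨U, hx, δ, hδ, hU⟩ := h x
  rw [← (hU ⟨x, hx⟩).2]
  refine Submodule.span_le.2 ?_
  rintro _ ⟨i, rfl⟩
  exact (hδ i).1 ⟨x, hx⟩

lemma IsSubbundle.exists_finrank {k : ℕ} {C : ∀ x : M, Submodule ℝ (HomAt d F E x)}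
    (hC : A.IsSubbundle k C) :
    ∃ r : ℕ, ∀ x, Module.finrank ℝ (C x) = r ∧ FiniteDimensional ℝ (C x) := by
  obtain ⟨r, h⟩ := hC
  refine ⟨r, fun x => ?_⟩
  obtain ⟨U, hx, δ, -, hU⟩ := h x
  obtain ⟨hli, hspan⟩ := hU ⟨x, hx⟩
  rw [← hspan]
  exact ⟨by rw [finrank_span_eq_card hli, Fintype.card_fin],
    FiniteDimensional.span_of_finite ℝ (Set.finite_range _)⟩

lemma IsSubbundle.exists_section {k : ℕ} {C : ∀ x : M, Submodule ℝ (HomAt d F E x)}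
    (hC : A.IsSubbundle k C) {x : M} {γ : HomAt d F E x} (hγ : γ ∈ C x) :
    ∃ (U : Opens M) (hx : x ∈ U) (δ : ∀ y : U, HomAt d F E (y : M)), A.IsDerSection U k δ ∧
      (∀ y : U, δ y ∈ C y) ∧ δ ⟨x, hx⟩ = γ := by
  obtain ⟨r, h⟩ := hC
  obtain ⟨U, hx, δ, hδ, hU⟩ := h x
  rw [← (hU ⟨x, hx⟩).2] at hγ
  obtain ⟨c, hc⟩ := (Submodule.mem_span_range_iff_exists_fun ℝ).1 hγ
  refine ⟨U, hx, fun y => ∑ i, c i • δ i y, ⟨fun y => sum_mem fun i _ =>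
    Submodule.smul_mem _ _ ((hδ i).1 y), fun e => ?_⟩, fun y => ?_, hc⟩
  · simp only [homAt_sum_apply, homAt_smul_apply]
    exact erSec_sum _ _ fun i _ => (ERSec d F E U).smul_mem (c i) ((hδ i).2 e)
  · rw [← (hU y).2]
    exact sum_mem fun i _ => Submodule.smul_mem _ _ (Submodule.subset_span ⟨i, rfl⟩)

lemma IsSubbundleFamily.fibreFamily (hC : A.IsSubbundleFamily C) (x : M) :
    A.FibreFamily x (fun k => C k x) :=
  ⟨fun k => hC.2 k x⟩

/-- Near each point, a family of subbundles is generated by vector fields that are independent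
modulo the kernels of the restriction maps. -/
lemma IsSubbundleFamily.exists_resFrame (hC : A.IsSubbundleFamily C) (x₀ : M) :
    ∃ (N : Opens M) (_ : x₀ ∈ N) (q : Fin (n + 1) → ℕ)
      (X : ∀ k : Fin (n + 1), Fin (q k) → Module.End ℝ (A.Func N)),
      (∀ (k : Fin (n + 1)) i, X k i ∈ A.vectorField N (-((k : ℕ) : ℤ))) ∧
      (∀ (y : N) (k : Fin (n + 1)), ResIndependent k fun i => A.vfVal (X k i) y) ∧
      ∀ (y : N) (k : Fin (n + 1)),
        C k y = A.frameSpan (fun k i => A.vfVal (X k i) y) (k : ℕ) := by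
  have hloc : ∀ k : Fin (n + 1), ∃ (N : Opens M) (hx : x₀ ∈ N) (q : ℕ)
      (δ : Fin q → ∀ y : N, HomAt d F E (y : M)), (∀ i, A.IsDerSection N k (δ i)) ∧
      (∀ i (y : N), δ i y ∈ C k y) ∧ (∀ y : N, ResIndependent k fun i => δ i y) ∧
      C k x₀ ≤ Submodule.span ℝ (Set.range fun i => δ i ⟨x₀, hx⟩) ⊔
        LinearMap.ker (resAt d F E k x₀) := by
    intro k
    obtain ⟨r, h⟩ := hC.1 k
    obtain ⟨U, hx, δ, hδ, hU⟩ := h x₀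
    obtain ⟨q, a, hind, hspan⟩ := exists_independent_mod
      (LinearMap.ker (resAt d F E k x₀)) fun i => δ i ⟨x₀, hx⟩
    -- Independence modulo `ker(res_k)` is tested on sections in `erSecLE`, so it is an open
    -- condition and spreads from `x₀` to a neighbourhood.
    obtain ⟨N, hN, hxN, hindN, -⟩ := exists_smooth_coefficients (fun i y => δ (a i) y)
      (fun i e => (hδ (a i)).2 e) (erSecLE d F E k) ⟨x₀, hx⟩
      (fun c hc => hind c (mem_ker_resAt.2 hc))
    refine ⟨N, hxN, q, fun i y => δ (a i) ⟨y, hN y.2⟩, fun i => (hδ (a i)).restrict hN,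
      fun i y => ?_, fun y c hc => hindN y c (mem_ker_resAt.1 hc), ?_⟩
    · rw [← (hU ⟨y, hN y.2⟩).2]
      exact Submodule.subset_span ⟨a i, rfl⟩
    · rw [(hU ⟨x₀, hx⟩).2] at hspan
      exact hspan
  choose N hx q δ hδ hδC hind hspan using hloc
  let N' : Opens M := ⟨⋂ k, (N k : Set M), isOpen_iInter_of_finite fun k => (N k).2⟩
  have hN' : ∀ k, N' ≤ N k := fun k y hy => Set.mem_iInter.1 hy k
  have hx' : x₀ ∈ N' := Set.mem_iInter.2 hx
  choose X hX hXδ using fun (k : Fin (n + 1)) (i : Fin (q k)) =>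
    exists_vf_of_isDerSection ((hδ k i).restrict (hN' k))
  have hind' : ∀ (y : N') (k : Fin (n + 1)), ResIndependent k fun i => A.vfVal (X k i) y := by
    intro y k
    simp only [hXδ]
    exact hind k ⟨y, hN' k y.2⟩
  have hmem : ∀ (y : N') (k : Fin (n + 1)) i, A.vfVal (X k i) y ∈ C k y := by
    intro y k i
    rw [hXδ]
    exact hδC k i ⟨y, hN' k y.2⟩
  refine ⟨N', hx', q, X, hX, hind', fun y k => ?_⟩
  obtain ⟨r, hr⟩ := (hC.1 k).exists_finrank
  -- Spanning modulo the kernels is known only at `x₀`. At nearby points equality follows by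
  -- counting dimensions: the generated space lies in `C k`, its dimension is the same as at `x₀`,
  -- and `C k` has constant rank.
  have h0 : C k x₀ = A.frameSpan (fun k i => A.vfVal (X k i) ⟨x₀, hx'⟩) (k : ℕ) :=
    (hC.fibreFamily x₀).eq_frameSpan (hmem ⟨x₀, hx'⟩) (fun k => by
      simp only [hXδ]
      exact hspan k) k
  have hdim := finrank_frameSpan (fun k i => vfVal_mem_derFib (hX k i) ⟨x₀, hx'⟩)
    (hind' ⟨x₀, hx'⟩) ((k : ℕ) : ℤ)
  rw [← h0, (hr x₀).1] at hdim
  have hdim' := finrank_frameSpan (fun k i => vfVal_mem_derFib (hX k i) y)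
    (hind' y) ((k : ℕ) : ℤ)
  have := (hr y).2
  refine (Submodule.eq_of_le_of_finrank_eq ?_ ?_).symm
  · rintro _ ⟨w, hw, rfl⟩
    exact sum_mem fun k' _ => sum_mem fun i _ => (hC.fibreFamily y).thetaER_mem (hmem y k' i) (hw k' i)
  · rw [hdim', (hr y).1, hdim]

/-- The numbers of members of such frames are constant. -/
lemma IsSubbundleFamily.exists_resRank (hC : A.IsSubbundleFamily C) :
    ∃ q : Fin (n + 1) → ℕ, ∀ x₀ : M, ∃ (N : Opens M) (_ : x₀ ∈ N)
      (X : ∀ k : Fin (n + 1), Fin (q k) → Module.End ℝ (A.Func N)),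
      (∀ (k : Fin (n + 1)) i, X k i ∈ A.vectorField N (-((k : ℕ) : ℤ))) ∧
      (∀ (y : N) (k : Fin (n + 1)), ResIndependent k fun i => A.vfVal (X k i) y) ∧
      ∀ (y : N) (k : Fin (n + 1)),
        C k y = A.frameSpan (fun k i => A.vfVal (X k i) y) (k : ℕ) := by
  -- As `M` need not be connected, the numbers of frame members are compared with those at a fixed
  -- point `x₁`, by means of the constant ranks of the subbundles.
  rcases isEmpty_or_nonempty M with h | ⟨⟨x₁⟩⟩
  · exact ⟨0, fun x₀ => h.elim x₀⟩
  choose N hx q X hX hind hspan using fun x₀ => hC.exists_resFrame x₀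
  refine ⟨q x₁, fun x₀ => ?_⟩
  have hq : q x₀ = q x₁ := by
    refine frame_ranks_unique F fun l => ?_
    obtain ⟨r, hr⟩ := (hC.1 l).exists_finrank
    have key : ∀ x, ∑ k : Fin (n + 1), q x k * frameRank F ((k : ℕ) - (l : ℕ)) = r := by
      intro x
      rw [← finrank_frameSpan (fun k i => vfVal_mem_derFib (hX x k i) ⟨x, hx x⟩)
        (hind x ⟨x, hx x⟩) ((l : ℕ) : ℤ), ← hspan x ⟨x, hx x⟩ l]
      exact (hr x).1
    rw [key, key]
  rw [← hq]
  exact ⟨N x₀, hx x₀, X x₀, hX x₀, hind x₀, hspan x₀⟩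

/-- The bundle `C k` and the number of members of a frame modulo the kernel both have constant rank;
the kernel part accounts for the difference. -/
lemma IsSubbundleFamily.exists_finrank_ker (hC : A.IsSubbundleFamily C) (k : Fin (n + 1)) :
    ∃ r : ℕ, ∀ x : M,
      Module.finrank ℝ ↥(LinearMap.ker (resAt d F E k x) ⊓ C k x) = r := by
  obtain ⟨q, hq⟩ := hC.exists_resRank
  obtain ⟨r, hr⟩ := (hC.1 k).exists_finrank
  refine ⟨r - q k, fun x => ?_⟩
  obtain ⟨N, hx, X, hX, hind, hspan⟩ := hq x
  have := (hr x).2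
  have hk := hspan ⟨x, hx⟩ k
  rw [← (hr x).1]
  refine finrank_inf_eq_sub (v := fun i => A.vfVal (X k i) ⟨x, hx⟩) (fun i => ?_)
    (hind ⟨x, hx⟩ k) ?_
  · change _ ∈ C k ((⟨x, hx⟩ : N) : M)
    rw [hk]
    exact mem_frameSpan_self (fun k i => A.vfVal (X k i) ⟨x, hx⟩) k i
  · change C k ((⟨x, hx⟩ : N) : M) ≤ _
    rw [hk]
    exact frameSpan_le_sup (fun k i => vfVal_mem_derFib (hX k i) ⟨x, hx⟩) k

/-- The correspondence only provides some section with the given values; it is the given field,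
because a vector field is determined by its values. -/
lemma GradedSubsheaf.Corresponds.mem_sec_iff {D : A.GradedSubsheaf} (h : D.Corresponds C)
    {k : Fin (n + 1)} {U : Opens M} {X : Module.End ℝ (A.Func U)} :
    X ∈ D.sec U (-((k : ℕ) : ℤ)) ↔
      X ∈ A.vectorField U (-((k : ℕ) : ℤ)) ∧ ∀ x : U, A.vfVal X x ∈ C k x := by
  constructor
  · intro hX
    obtain ⟨δ, -, hδC, hδ⟩ := (h k U).1 X hX
    refine ⟨D.le_vectorField _ _ hX, fun x => ?_⟩
    rw [← (hδ x).eq_vfVal]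
    exact hδC x
  · rintro ⟨hX, hXC⟩
    obtain ⟨X', hX', hv⟩ := (h k U).2 _ (vfVal_isDerSection hX) hXC
    rw [vf_ext_of_vfVal hX (D.le_vectorField _ _ hX') fun x => (hv x).eq_vfVal]
    exact hX'

/-- An element of the fibre extends to a local section of the subbundle, hence to a local section of
the sheaf, and a bump function makes it global. -/
lemma GradedSubsheaf.Corresponds.exists_section [SecondCountableTopology M] {D : A.GradedSubsheaf}
    (h : D.Corresponds C) {k : Fin (n + 1)} (hC : A.IsSubbundle k (C k)) {x : M}
    {γ : HomAt d F E x} (hγ : γ ∈ C k x) :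
    ∃ Z ∈ D.sec ⊤ (-((k : ℕ) : ℤ)), A.vfVal Z ⟨x, trivial⟩ = γ := by
  obtain ⟨U, hx, δ, hδ, hδC, rfl⟩ := hC.exists_section hγ
  obtain ⟨X, hX, hXδ⟩ := (h k U).2 δ hδ hδC
  obtain ⟨Z, hZ, N, hN, hxN, hag⟩ := D.exists_global_section hX hx
  exact ⟨Z, hZ, (hag.vfVal_eq ⟨x, hxN⟩).trans (hXδ ⟨x, hx⟩).eq_vfVal.symm⟩

lemma GradedSubsheaf.ext_sec {D D' : A.GradedSubsheaf} (h : ∀ U l, D.sec U l = D'.sec U l) :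
    D = D' := by
  cases D
  cases D'
  congr
  exact funext fun U => funext fun l => h U l

/-- The subbundles prescribe only the sections of degrees `0, …, -n`. The other degrees are
recovered because these sections generate the sheaf locally. -/
lemma GradedSubsheaf.Corresponds.eq {D D' : A.GradedSubsheaf} (h : D.Corresponds C)
    (h' : D'.Corresponds C) (hD : D.IsLocallyGenerated) (hD' : D'.IsLocallyGenerated) : D = D' := by
  have key : ∀ {D D' : A.GradedSubsheaf}, D.Corresponds C → D'.Corresponds C →
      D.IsLocallyGenerated → ∀ U l, D.sec U l ≤ D'.sec U l := by
    intro D D' h h' hD U l X hX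
    refine D'.locality U l X (D.le_vectorField U l hX) fun x => ?_
    obtain ⟨V, hV, hx, Y, hY, hr⟩ := hD U l X hX x
    exact ⟨V, hV, hx, Y, productSpan_le_sec D'
      (fun k Z hZ => h'.mem_sec_iff.2 (h.mem_sec_iff.1 hZ)) l hY, hr⟩
  exact ext_sec fun U l => le_antisymm (key h h' hD U l) (key h' h hD' U l)

/-- Each element of a fibre is the value of a global section of the sheaf, and values of such
sections lie in both families. -/
lemma GradedSubsheaf.Corresponds.family_eq [SecondCountableTopology M] {D : A.GradedSubsheaf}
    {C' : Fin (n + 1) → ∀ x : M, Submodule ℝ (HomAt d F E x)}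
    (h : D.Corresponds C) (h' : D.Corresponds C') (hC : A.IsSubbundleFamily C)
    (hC' : A.IsSubbundleFamily C') : C = C' := by
  have key : ∀ {C C' : Fin (n + 1) → ∀ x : M, Submodule ℝ (HomAt d F E x)},
      D.Corresponds C → D.Corresponds C' → A.IsSubbundleFamily C → ∀ k x, C k x ≤ C' k x := by
    intro C C' h h' hC k x γ hγ
    obtain ⟨Z, hZ, rfl⟩ := h.exists_section (hC.1 k) hγ
    exact (h'.mem_sec_iff.1 hZ).2 ⟨x, trivial⟩
  exact funext fun k => funext fun x => le_antisymm (key h h' hC k x) (key h' h hC' k x)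

end Distributions

end CoalgebraBundle

/-! ## The correspondence -/

namespace CoalgebraBundle

section Correspondence

variable {d : ℕ} {n : ℕ} {M : Type*} [TopologicalSpace M] [T2Space M]
  [ChartedSpace (EuclideanSpace ℝ (Fin d)) M] [IsManifold (𝓡 d) ∞ M]
  {F : Fin n → Type*} [∀ i, NormedAddCommGroup (F i)] [∀ i, NormedSpace ℝ (F i)]
  {E : Fin n → M → Type*} [∀ i x, AddCommGroup (E i x)] [∀ i x, Module ℝ (E i x)]
  [∀ i, TopologicalSpace (Bundle.TotalSpace (F i) (E i))] [∀ i x, TopologicalSpace (E i x)]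
  [∀ i, FiberBundle (F i) (E i)] [∀ i, VectorBundle ℝ (F i) (E i)]
  [∀ i, FiniteDimensional ℝ (F i)] [∀ i, ContMDiffVectorBundle ∞ (F i) (E i) (𝓡 d)]

variable [SecondCountableTopology M]

variable {A : CoalgebraBundle d F E} {C : Fin (n + 1) → ∀ x : M, Submodule ℝ (HomAt d F E x)}

/-- A vector field that is locally a combination of the given ones is so globally. -/
lemma mem_generated_of_local {U : Opens M} {r : Fin (n + 1) → ℕ}
    {X : ∀ k : Fin (n + 1), Fin (r k) → Module.End ℝ (A.Func U)}
    (hX : ∀ (k : Fin (n + 1)) i, X k i ∈ A.vectorField U (-((k : ℕ) : ℤ))) {l : ℤ}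
    {Y : Module.End ℝ (A.Func U)} (hY : Y ∈ A.vectorField U l)
    (h : ∀ x : U, ∃ (V : Opens M) (hV : V ≤ U), (x : M) ∈ V ∧
      ∃ X' : ∀ k : Fin (n + 1), Fin (r k) → Module.End ℝ (A.Func V),
        (∀ k i, A.IsRestriction hV (X k i) (X' k i)) ∧
        ∃ Y' ∈ generated X' l, A.IsRestriction hV Y Y') : Y ∈ generated X l := by
  choose V hV hx X' hXX Y' hY' hYY using h
  choose f hf hYf using hY'
  -- The local coefficients need not agree on overlaps. Averaging them with a partition of unity is
  -- harmless, because every choice expresses the same field `Y` and the weights add up to `1`.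
  obtain ⟨g, hg, hloc⟩ := A.exists_glue V hV hx
    (fun x (p : Σ k : Fin (n + 1), Fin (r k)) => f x p.1 p.2)
    (fun p => l + ((p.1 : ℕ) : ℤ))
  have hgd : ∀ (k : Fin (n + 1)) (i : Fin (r k)), g ⟨k, i⟩ ∈ A.funcDeg U (l + ((k : ℕ) : ℤ)) :=
    fun k i => hg ⟨k, i⟩ fun x => hf x k i
  have hgen : ∑ k, ∑ i, A.funcSmul (g ⟨k, i⟩) (X k i) ∈ A.vectorField U l :=
    sum_mem fun k _ => sum_mem fun i _ => by
      have := funcSmul_mem (hgd k i) (hX k i)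
      rwa [add_neg_cancel_right] at this
  refine ⟨fun k i => g ⟨k, i⟩, hgd, AgreeOn.eq (agreeOn_of_local fun y hy => ?_) hY hgen⟩
  obtain ⟨N, hN, S, hS, ρ, hρ, hyN, hone, hres⟩ := hloc ⟨y, hy⟩
  refine ⟨N, hN, hyN, fun φ => ?_⟩
  have h1 : ∀ x (hxS : x ∈ S), A.res hN (Y (A.res le_top φ)) =
      ∑ k, ∑ i, A.res (hS x hxS) (f x k i) * A.res hN (X k i (A.res le_top φ)) := by
    intro x hxS
    have h2 := congrArg (A.res (hS x hxS)) (hYY x (A.res le_top φ))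
    rw [A.res_res (hV x) (hS x hxS)] at h2
    rw [← h2, hYf x]
    simp only [LinearMap.sum_apply, map_sum, funcSmul_apply, map_mul]
    refine Finset.sum_congr rfl fun k _ => Finset.sum_congr rfl fun i _ => ?_
    rw [hXX x k i, A.res_res]
  calc A.res (hN.trans le_rfl) (Y (A.res le_top φ))
      = ∑ x ∈ S.attach, A.fn (hρ x) * A.res hN (Y (A.res le_top φ)) := by
        rw [Finset.sum_attach S fun x => A.fn (hρ x) * A.res hN (Y (A.res le_top φ)),
          ← Finset.sum_mul, hone, one_mul]
    _ = ∑ x ∈ S.attach, A.fn (hρ x) * ∑ k, ∑ i,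
          A.res (hS x x.2) (f x k i) * A.res hN (X k i (A.res le_top φ)) :=
        Finset.sum_congr rfl fun x _ => by rw [h1 x x.2]
    _ = ∑ k, ∑ i, A.res hN (g ⟨k, i⟩) * A.res hN (X k i (A.res le_top φ)) := by
        simp only [hres, Finset.mul_sum, Finset.sum_mul, mul_assoc]
        rw [Finset.sum_comm]
        refine Finset.sum_congr rfl fun k _ => ?_
        rw [Finset.sum_comm]
    _ = _ := by
        simp only [LinearMap.sum_apply, map_sum, funcSmul_apply, map_mul]

/-- Vector fields that form a frame modulo the kernels of the restriction maps are local
generators. -/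
lemma GradedSubsheaf.Corresponds.isGenerators {D : A.GradedSubsheaf} (h : D.Corresponds C)
    (hD : D.IsLocallyGenerated) {U : Opens M} {r : Fin (n + 1) → ℕ}
    {X : ∀ k : Fin (n + 1), Fin (r k) → Module.End ℝ (A.Func U)}
    (hX : ∀ (k : Fin (n + 1)) i, X k i ∈ A.vectorField U (-((k : ℕ) : ℤ)))
    (hind : ∀ (x : U) (k : Fin (n + 1)), ResIndependent k fun i => A.vfVal (X k i) x)
    (hspan : ∀ (x : U) (k : Fin (n + 1)),
      C k x = A.frameSpan (fun k i => A.vfVal (X k i) x) (k : ℕ)) : D.IsGenerators U r X := by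
  have hXD : ∀ (k : Fin (n + 1)) i, X k i ∈ D.sec U (-((k : ℕ) : ℤ)) := fun k i =>
    h.mem_sec_iff.2 ⟨hX k i, fun x => by
      rw [hspan x k]
      exact mem_frameSpan_self (fun k i => A.vfVal (X k i) x) k i⟩
  refine ⟨hX, fun x => (linearIndependent_tangentAt_iff hX x).2 (hind x), fun l Y => ?_⟩
  constructor
  · intro hY
    refine mem_generated_of_local hX (D.le_vectorField U l hY) fun x => ?_
    obtain ⟨V, hV, hx, Y', hY', hr⟩ := hD U l Y hY x
    choose X' hX' hXX using fun (k : Fin (n + 1)) i => D.exists_restriction hV (hXD k i)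
    have hval : ∀ (y : V) (k : Fin (n + 1)) i,
        A.vfVal (X' k i) y = A.vfVal (X k i) ⟨y, hV y.2⟩ := fun y k i =>
      ((hXX k i).agreeOn.vfVal_eq y).symm
    -- Since `D` is locally generated in degrees `0, …, -n`, only sections of these degrees have to
    -- be expanded; for them the frame coefficients are smooth.
    refine ⟨V, hV, hx, X', hXX, Y', productSpan_le_generated (fun k Z hZ => ?_) l hY', hr⟩
    obtain ⟨hZ', hZC⟩ := h.mem_sec_iff.1 hZ
    refine exists_frame_coefficients (fun k i => D.le_vectorField _ _ (hX' k i)) (fun y k => ?_)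
      hZ' fun y => ?_
    · simp only [hval]
      exact hind ⟨y, hV y.2⟩ k
    · simp only [hval]
      rw [← hspan ⟨y, hV y.2⟩ k]
      exact hZC y
  · intro hY
    exact productSpan_le_sec D (fun _ => le_rfl) l (generated_le_productSpan hXD l hY)

/-- The vector fields of degree `-k` with values in `C k`. -/
def valuesIn (A : CoalgebraBundle d F E)
    (C : Fin (n + 1) → ∀ x : M, Submodule ℝ (HomAt d F E x)) (U : Opens M) (k : Fin (n + 1)) :
    Submodule ℝ (Module.End ℝ (A.Func U)) where
  carrier := {X | X ∈ A.vectorField U (-((k : ℕ) : ℤ)) ∧ ∀ x : U, A.vfVal X x ∈ C k x}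
  add_mem' := fun {X Y} hX hY => ⟨add_mem hX.1 hY.1, fun x => by
    rw [vfVal_add]; exact add_mem (hX.2 x) (hY.2 x)⟩
  zero_mem' := ⟨zero_mem _, fun x => by rw [vfVal_zero]; exact zero_mem _⟩
  smul_mem' := fun c X hX => ⟨Submodule.smul_mem _ c hX.1, fun x => by
    rw [vfVal_smul]; exact Submodule.smul_mem _ c (hX.2 x)⟩

lemma valuesIn_le_vectorField (U : Opens M) (k : Fin (n + 1)) :
    A.valuesIn C U k ≤ A.vectorField U (-((k : ℕ) : ℤ)) := fun _ hX => hX.1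

lemma valuesIn_restrict {U V : Opens M} (hV : V ≤ U) {k : Fin (n + 1)}
    {X : Module.End ℝ (A.Func U)} (hX : X ∈ A.valuesIn C U k) :
    ∃ Y ∈ A.valuesIn C V k, A.IsRestriction hV X Y := by
  obtain ⟨Y, hY, hr⟩ := exists_restriction hV hX.1
  exact ⟨Y, ⟨hY, fun x => by rw [← hr.agreeOn.vfVal_eq x]; exact hX.2 ⟨x, hV x.2⟩⟩, hr⟩

/-- The sheaf of vector fields that is generated by the vector fields with values in `C`. -/
def generatedSheaf (A : CoalgebraBundle d F E)
    (C : Fin (n + 1) → ∀ x : M, Submodule ℝ (HomAt d F E x)) : A.GradedSubsheaf where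
  sec U l :=
    { carrier := {X | X ∈ A.vectorField U l ∧ ∀ x : U, ∃ (V : Opens M) (hV : V ≤ U), (x : M) ∈ V ∧
        ∃ Y ∈ productSpan (A.valuesIn C V) l, A.IsRestriction hV X Y}
      add_mem' := by
        rintro X Y ⟨hX, hX'⟩ ⟨hY, hY'⟩
        refine ⟨add_mem hX hY, fun x => ?_⟩
        obtain ⟨V, hV, hx, Z, hZ, hr⟩ := hX' x
        obtain ⟨W, hW, hx', T, hT, hr'⟩ := hY' x
        obtain ⟨Z', hZ', hZr⟩ := productSpan_restrict (inf_le_left : V ⊓ W ≤ V)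
          (fun k Z hZ => A.valuesIn_restrict _ hZ) hZ
        obtain ⟨T', hT', hTr⟩ := productSpan_restrict (inf_le_right : V ⊓ W ≤ W)
          (fun k Z hZ => A.valuesIn_restrict _ hZ) hT
        refine ⟨V ⊓ W, inf_le_left.trans hV, ⟨hx, hx'⟩, _, add_mem hZ' hT', fun f => ?_⟩
        rw [LinearMap.add_apply, LinearMap.add_apply, map_add, (hr.trans hZr) f, (hr'.trans hTr) f]
      zero_mem' := ⟨zero_mem _, fun x => ⟨U, le_rfl, x.2, 0, zero_mem _, IsRestriction.refl 0⟩⟩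
      smul_mem' := by
        rintro c X ⟨hX, hX'⟩
        refine ⟨Submodule.smul_mem _ c hX, fun x => ?_⟩
        obtain ⟨V, hV, hx, Z, hZ, hr⟩ := hX' x
        refine ⟨V, hV, hx, _, Submodule.smul_mem _ c hZ, fun f => ?_⟩
        rw [LinearMap.smul_apply, LinearMap.smul_apply, map_smul, hr f] }
  le_vectorField _ _ _ hX := hX.1
  smul_mem U j l f hf X hX := by
    refine ⟨funcSmul_mem hf hX.1, fun x => ?_⟩
    obtain ⟨V, hV, hx, Z, hZ, hr⟩ := hX.2 x
    exact ⟨V, hV, hx, _, funcSmul_mem_productSpan (A.res_mem_funcDeg hV hf) hZ, hr.funcSmul f⟩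
  res_mem {U V} h l X hX Y hY hXY := by
    refine ⟨hY, fun x => ?_⟩
    obtain ⟨W, hW, hx, Z, hZ, hr⟩ := hX.2 ⟨x, h x.2⟩
    obtain ⟨Z', hZ', hZr⟩ := productSpan_restrict (inf_le_left : W ⊓ V ≤ W)
      (fun k Z hZ => A.valuesIn_restrict _ hZ) hZ
    refine ⟨W ⊓ V, inf_le_right, ⟨hx, x.2⟩, Z', hZ', AgreeOn.isRestriction hY
      (productSpan_le_vectorField (fun k => A.valuesIn_le_vectorField _ k) l hZ') ?_⟩
    exact (hXY.agreeOn.symm.mono inf_le_right).trans (hr.trans hZr).agreeOn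
  locality U l X hX h := by
    refine ⟨hX, fun x => ?_⟩
    obtain ⟨V, hV, hx, Y, hY, hr⟩ := h x
    obtain ⟨W, hW, hx', Z, hZ, hr'⟩ := hY.2 ⟨x, hx⟩
    exact ⟨W, hW.trans hV, hx', Z, hZ, hr.trans hr'⟩

lemma valuesIn_le_generatedSheaf (U : Opens M) (k : Fin (n + 1)) :
    A.valuesIn C U k ≤ (A.generatedSheaf C).sec U (-((k : ℕ) : ℤ)) := fun X hX =>
  ⟨hX.1, fun x => ⟨U, le_rfl, x.2, X, Submodule.subset_span ⟨k, 1, by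
    rw [neg_add_cancel]; exact A.one_mem_funcDeg U, X, hX, (one_funcSmul X).symm⟩,
    IsRestriction.refl X⟩⟩

lemma generatedSheaf_isLocallyGenerated : (A.generatedSheaf C).IsLocallyGenerated := by
  intro U l Z hZ x
  obtain ⟨V, hV, hx, Y, hY, hr⟩ := hZ.2 x
  exact ⟨V, hV, hx, Y, productSpan_mono (fun k => valuesIn_le_generatedSheaf V k) l hY, hr⟩

/-- Multiplication by functions could produce new values in degrees `0, …, -n`. It does not, because
the condition on the kernels makes the family stable under `𝐄*_ℝ`. -/
lemma generatedSheaf_corresponds (hC : A.IsSubbundleFamily C) :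
    (A.generatedSheaf C).Corresponds C := by
  refine fun k U => ⟨fun X hX => ⟨_, vfVal_isDerSection hX.1, fun x => ?_,
    fun x => isValueAt_vfVal hX.1 x⟩, fun δ hδ hδC => ?_⟩
  · obtain ⟨V, hV, hx, Y, hY, hr⟩ := hX.2 x
    rw [show A.vfVal X x = A.vfVal Y ⟨x, hx⟩ from hr.agreeOn.vfVal_eq ⟨x, hx⟩]
    clear hr
    induction hY using Submodule.span_induction with
    | mem Y h =>
      obtain ⟨k', f, hf, Z, hZ, rfl⟩ := h
      obtain ⟨e, he, rfl⟩ := A.exists_cls_of_mem_funcDeg (by have := k'.2; omega) hf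
      rw [vfVal_funcSmul]
      refine (hC.fibreFamily (x : M)).thetaER_mem (hZ.2 ⟨x, hx⟩) ?_
      have := he ⟨x, hx⟩
      rwa [neg_add_eq_sub] at this
    | zero => rw [vfVal_zero]; exact zero_mem _
    | add _ _ _ _ h1 h2 => rw [vfVal_add]; exact add_mem h1 h2
    | smul c _ _ h => rw [vfVal_smul]; exact Submodule.smul_mem _ c h
  · obtain ⟨X, hX, hXδ⟩ := exists_vf_of_isDerSection hδ
    refine ⟨X, valuesIn_le_generatedSheaf U k ⟨hX, fun x => ?_⟩, fun x => ?_⟩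
    · rw [hXδ]
      exact hδC x
    · rw [← hXδ]
      exact isValueAt_vfVal hX x

lemma generatedSheaf_isDistribution (hC : A.IsSubbundleFamily C) :
    (A.generatedSheaf C).IsDistribution := by
  obtain ⟨q, hq⟩ := hC.exists_resRank
  refine ⟨q, fun x => ?_⟩
  obtain ⟨N, hx, X, hX, hind, hspan⟩ := hq x
  exact ⟨N, hx, X, (generatedSheaf_corresponds hC).isGenerators generatedSheaf_isLocallyGenerated
    hX hind hspan⟩

/-- The values at a point of the sections of degree `-k` of a sheaf of vector fields. -/
def GradedSubsheaf.values (D : A.GradedSubsheaf) (k : Fin (n + 1)) (x : M) :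
    Submodule ℝ (HomAt d F E x) where
  carrier := {γ | ∃ Z ∈ D.sec ⊤ (-((k : ℕ) : ℤ)), A.vfVal Z ⟨x, trivial⟩ = γ}
  add_mem' := by
    rintro _ _ ⟨Z, hZ, rfl⟩ ⟨Z', hZ', rfl⟩
    exact ⟨_, add_mem hZ hZ', vfVal_add _ _ _⟩
  zero_mem' := ⟨0, zero_mem _, vfVal_zero _⟩
  smul_mem' := by
    rintro c _ ⟨Z, hZ, rfl⟩
    exact ⟨_, Submodule.smul_mem _ c hZ, vfVal_smul _ _ _⟩

lemma GradedSubsheaf.vfVal_mem_values (D : A.GradedSubsheaf) {U : Opens M} {k : Fin (n + 1)}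
    {Z : Module.End ℝ (A.Func U)} (hZ : Z ∈ D.sec U (-((k : ℕ) : ℤ))) (x : U) :
    A.vfVal Z x ∈ D.values k x := by
  obtain ⟨Z', hZ', N, hN, hxN, hag⟩ := D.exists_global_section hZ x.2
  exact ⟨Z', hZ', hag.vfVal_eq ⟨x, hxN⟩⟩

/-- In one direction the coefficients of a section are evaluated at the point; in the other,
coefficients at the point are extended to global homogeneous sections, which give a section of `D`
with the prescribed value. -/
lemma GradedSubsheaf.IsGenerators.values_eq {D : A.GradedSubsheaf} {U : Opens M}
    {r : Fin (n + 1) → ℕ} {X : ∀ k : Fin (n + 1), Fin (r k) → Module.End ℝ (A.Func U)}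
    (h : D.IsGenerators U r X) (k : Fin (n + 1)) (x : U) :
    D.values k x = A.frameSpan (fun k i => A.vfVal (X k i) x) (k : ℕ) := by
  apply le_antisymm
  · rintro _ ⟨Z, hZ, rfl⟩
    obtain ⟨Z', hZ', hr⟩ := D.exists_restriction (le_top : U ≤ ⊤) hZ
    rw [show A.vfVal Z ⟨x, trivial⟩ = A.vfVal Z' x from hr.agreeOn.vfVal_eq x]
    exact vfVal_generated (h.sec_eq _ ▸ hZ') x
  · rintro _ ⟨w, hw, rfl⟩
    choose e he hew using fun k i => exists_homSec_value (d := d) (F := F) (hw k i)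
    have hY : ∑ k, ∑ i, A.funcSmul (A.cls U (erRes d F E le_top (e k i))) (X k i) ∈
        D.sec U (-((k : ℕ) : ℤ)) := by
      rw [h.sec_eq]
      exact ⟨_, fun k' i => A.cls_mem_funcDeg (by
        rw [neg_add_eq_sub]
        exact (he k' i).restrict le_top), rfl⟩
    have := D.vfVal_mem_values hY x
    rw [vfVal_sum] at this
    simp only [vfVal_sum, vfVal_funcSmul] at this
    convert this using 5 with k' _ i
    exact (hew k' i).symm

lemma GradedSubsheaf.values_le_derFib (D : A.GradedSubsheaf) (k : Fin (n + 1)) (x : M) :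
    D.values k x ≤ A.derFib k x := by
  rintro _ ⟨Z, hZ, rfl⟩
  exact vfVal_mem_derFib (D.le_vectorField _ _ hZ) _

/-- The products of local generators with a frame of `𝐄*_ℝ` are smooth frames of the spaces of
values, of a size that depends only on the rank of the distribution. The condition on the kernels is
a statement at one point. -/
lemma GradedSubsheaf.IsDistribution.values_isSubbundleFamily {D : A.GradedSubsheaf}
    (hD : D.IsDistribution) : A.IsSubbundleFamily D.values := by
  obtain ⟨r, hr⟩ := hD
  refine ⟨fun k => ⟨Fintype.card (DegIndex F r (k : ℕ)), fun x => ?_⟩, fun k x => ?_⟩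
  · obtain ⟨V, hxV, X, hX⟩ := hr x
    obtain ⟨W, hxW, ⟨B⟩⟩ := exists_dualFrame (d := d) F E x
    let e := (Fintype.equivFin (DegIndex F r (k : ℕ))).symm
    refine ⟨V ⊓ W, ⟨hxV, hxW⟩, fun i y =>
      A.frameProduct B (fun k i => A.vfVal (X k i) ⟨y, y.2.1⟩) (e i).1, fun i => ?_, fun y => ?_⟩
    · have h1 := funcSmul_mem (A.cls_mem_funcDeg ((B.sec_hom (e i).1.2).restrict (le_top : V ≤ ⊤)))
        (hX.1 (e i).1.1.1 (e i).1.1.2)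
      have hdeg : (FrameIndex.deg (e i).1.2 : ℤ) = ((e i).1.1.1 : ℕ) - ((k : ℕ) : ℤ) := (e i).2
      rw [hdeg, sub_add_eq_add_sub, add_neg_cancel, zero_sub] at h1
      have h2 := (vfVal_isDerSection h1).restrict (inf_le_left : V ⊓ W ≤ V)
      simp only [vfVal_funcSmul] at h2
      exact h2
    · have hδ : ∀ (k : Fin (n + 1)) i, A.vfVal (X k i) ⟨y, y.2.1⟩ ∈ A.derFib k (y : M) :=
        fun k i => vfVal_mem_derFib (hX.1 k i) _
      have hind := (linearIndependent_tangentAt_iff hX.1 ⟨y, y.2.1⟩).1 (hX.2.1 ⟨y, y.2.1⟩)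
      refine ⟨(frameProduct_independent B y.2.2 hδ hind).comp (fun i => (e i).1)
        (Subtype.val_injective.comp e.injective), ?_⟩
      rw [hX.values_eq k ⟨y, y.2.1⟩, frameSpan_eq_span B y.2.2]
      congr 1
      exact e.surjective.range_comp fun j : DegIndex F r (k : ℕ) =>
        A.frameProduct B (fun k i => A.vfVal (X k i) ⟨y, y.2.1⟩) j.1
  · obtain ⟨V, hxV, X, hX⟩ := hr x
    have hδ : ∀ (k : Fin (n + 1)) i, A.vfVal (X k i) ⟨x, hxV⟩ ∈ A.derFib k x :=
      fun k i => vfVal_mem_derFib (hX.1 k i) ⟨x, hxV⟩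
    have hind := (linearIndependent_tangentAt_iff hX.1 ⟨x, hxV⟩).1 (hX.2.1 ⟨x, hxV⟩)
    have hval := fun k => hX.values_eq k ⟨x, hxV⟩
    have := frameSpan_condition hδ hind (fun l => hval l ▸ D.values_le_derFib l x) k
    rw [hval k, ← this]
    refine iSup_congr fun i => iSup_congr fun h => ?_
    rw [hval ⟨(k : ℕ) + ((i : ℕ) + 1), h⟩]

/-- A field whose values lie in the spaces of values is pointwise a combination of local generators.
The coefficients are smooth, so the field is locally in `D`, and the sheaf property concludes. -/
lemma GradedSubsheaf.IsDistribution.corresponds_values {D : A.GradedSubsheaf}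
    (hD : D.IsDistribution) : D.Corresponds D.values := by
  refine fun k U => ⟨fun X hX => ⟨_, vfVal_isDerSection (D.le_vectorField _ _ hX),
    D.vfVal_mem_values hX, isValueAt_vfVal (D.le_vectorField _ _ hX)⟩, fun δ hδ hδD => ?_⟩
  obtain ⟨X, hX, hXδ⟩ := exists_vf_of_isDerSection hδ
  refine ⟨X, D.locality U _ X hX fun x => ?_, fun x => by
    rw [← hXδ]; exact isValueAt_vfVal hX x⟩
  obtain ⟨r, hr⟩ := hD
  obtain ⟨V, hxV, Y, hY⟩ := hr x
  obtain ⟨X', hX', hXX⟩ := CoalgebraBundle.exists_restriction (inf_le_left : U ⊓ V ≤ U) hX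
  choose Y' hY' hYY using fun (k : Fin (n + 1)) i =>
    D.exists_restriction (inf_le_right : U ⊓ V ≤ V) (hY.mem_sec k i)
  have hval : ∀ (y : (U ⊓ V : Opens M)) (k : Fin (n + 1)) i,
      A.vfVal (Y' k i) y = A.vfVal (Y k i) ⟨y, y.2.2⟩ := fun y k i =>
    ((hYY k i).agreeOn.vfVal_eq y).symm
  refine ⟨U ⊓ V, inf_le_left, ⟨x.2, hxV⟩, X', ?_, hXX⟩
  refine productSpan_le_sec D (fun _ => le_rfl) _ (generated_le_productSpan hY' _
    (exists_frame_coefficients (fun k i => D.le_vectorField _ _ (hY' k i)) (fun y k => ?_)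
      hX' fun y => ?_))
  · simp only [hval]
    exact (linearIndependent_tangentAt_iff hY.1 ⟨y, y.2.2⟩).1 (hY.2.1 ⟨y, y.2.2⟩) k
  · simp only [hval]
    rw [← hY.values_eq k ⟨y, y.2.2⟩, show A.vfVal X' y = A.vfVal X ⟨y, y.2.1⟩ from
      (hXX.agreeOn.vfVal_eq y).symm, hXδ]
    exact hδD ⟨y, y.2.1⟩

lemma isQuotientFrame_iff {U : Opens M} {r : Fin (n + 1) → ℕ}
    {X : ∀ k : Fin (n + 1), Fin (r k) → Module.End ℝ (A.Func U)}
    (hX : ∀ (k : Fin (n + 1)) i, X k i ∈ A.vectorField U (-((k : ℕ) : ℤ))) :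
    A.IsQuotientFrame C U r X ↔ ∀ (k : Fin (n + 1)) (x : U),
      (∀ i, A.vfVal (X k i) x ∈ C k x) ∧ (ResIndependent k fun i => A.vfVal (X k i) x) ∧
      C k x ≤ Submodule.span ℝ (Set.range fun i => A.vfVal (X k i) x) ⊔
        LinearMap.ker (resAt d F E k (x : M)) := by
  refine forall_congr' fun k => forall_congr' fun x => ?_
  constructor
  · rintro ⟨δ, hδ, h1, h2⟩
    have h3 : ∀ i, A.vfVal (X k i) x = δ i := fun i => (isValueAt_iff (hX k i)).1 (hδ i)
    simp only [h3]
    exact ⟨fun i => (δ i).2, (linearIndependent_mkQ_iff _ _ _).1 h1, (span_mkQ_eq_top_iff _ _ _).1 h2⟩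
  · rintro ⟨h0, h1, h2⟩
    exact ⟨fun i => ⟨_, h0 i⟩, fun i => isValueAt_vfVal (hX k i) x,
      (linearIndependent_mkQ_iff _ _ _).2 h1, (span_mkQ_eq_top_iff _ _ _).2 h2⟩

/-- Independence of tangent vectors is independence modulo the kernels. Generators span modulo the
kernels because the other terms of a combination lie there; conversely, spanning modulo the kernels
implies generation by the descending induction in `FibreFamily.eq_frameSpan`. -/
lemma GradedSubsheaf.IsDistribution.isGenerators_iff {D : A.GradedSubsheaf}
    (hD : D.IsDistribution) {U : Opens M} {r : Fin (n + 1) → ℕ}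
    {X : ∀ k : Fin (n + 1), Fin (r k) → Module.End ℝ (A.Func U)}
    (hX : ∀ (k : Fin (n + 1)) i, X k i ∈ A.vectorField U (-((k : ℕ) : ℤ))) :
    D.IsGenerators U r X ↔ A.IsQuotientFrame D.values U r X := by
  rw [isQuotientFrame_iff hX]
  constructor
  · intro h k x
    refine ⟨fun i => D.vfVal_mem_values (h.mem_sec k i) x,
      (linearIndependent_tangentAt_iff hX x).1 (h.2.1 x) k, ?_⟩
    rw [h.values_eq k x]
    exact frameSpan_le_sup (fun k i => vfVal_mem_derFib (hX k i) x) k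
  · intro h
    exact hD.corresponds_values.isGenerators hD.isLocallyGenerated hX (fun x k => (h k x).2.1)
      fun x k => (hD.values_isSubbundleFamily.fibreFamily (x : M)).eq_frameSpan
        (δ := fun k i => A.vfVal (X k i) x) (fun k => (h k x).1) (fun k => (h k x).2.2) k

/-- The correspondence between distributions and families of subbundles. -/
def distributionEquiv (A : CoalgebraBundle d F E) : {D : A.GradedSubsheaf // D.IsDistribution} ≃
    {C : Fin (n + 1) → ∀ x : M, Submodule ℝ (HomAt d F E x) // A.IsSubbundleFamily C} where
  toFun D := ⟨D.1.values, D.2.values_isSubbundleFamily⟩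
  invFun C := ⟨A.generatedSheaf C.1, generatedSheaf_isDistribution C.2⟩
  left_inv D := Subtype.ext ((generatedSheaf_corresponds D.2.values_isSubbundleFamily).eq
    D.2.corresponds_values generatedSheaf_isLocallyGenerated D.2.isLocallyGenerated)
  right_inv C := Subtype.ext ((generatedSheaf_isDistribution C.2).corresponds_values.family_eq
    (generatedSheaf_corresponds C.2) (generatedSheaf_isDistribution C.2).values_isSubbundleFamily
    C.2)

end Correspondence

end CoalgebraBundle

end NManifold

end

open scoped Manifold ContDiff in
open NManifold CoalgebraBundle TopologicalSpace in
theorem mainTheorem6 {d n : ℕ} {M : Type*} [TopologicalSpace M] [T2Space M]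
    [SecondCountableTopology M] [ChartedSpace (EuclideanSpace ℝ (Fin d)) M]
    [IsManifold (𝓡 d) ∞ M]
    (F : Fin n → Type*) [∀ i, NormedAddCommGroup (F i)] [∀ i, NormedSpace ℝ (F i)]
    [∀ i, FiniteDimensional ℝ (F i)]
    (E : Fin n → M → Type*) [∀ i x, AddCommGroup (E i x)] [∀ i x, Module ℝ (E i x)]
    [∀ i, TopologicalSpace (Bundle.TotalSpace (F i) (E i))] [∀ i x, TopologicalSpace (E i x)]
    [∀ i, FiberBundle (F i) (E i)] [∀ i, VectorBundle ℝ (F i) (E i)]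
    [∀ i, ContMDiffVectorBundle ∞ (F i) (E i) (𝓡 d)]
    (A : CoalgebraBundle d F E) (hA : A.IsAdmissible) :
    ∃ Φ : {D : A.GradedSubsheaf // D.IsDistribution} ≃
        {C : Fin (n + 1) → ∀ x : M, Submodule ℝ (HomAt d F E x) // A.IsSubbundleFamily C},
      ∀ D : {D : A.GradedSubsheaf // D.IsDistribution},
        D.1.Corresponds (Φ D).1 ∧
        (∀ k : Fin (n + 1), ∃ r : ℕ, ∀ x : M,
          Module.finrank ℝ ↥(LinearMap.ker (resAt d F E k x) ⊓ (Φ D).1 k x) = r) ∧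
        ∀ (U : Opens M) (r : Fin (n + 1) → ℕ)
          (X : ∀ k : Fin (n + 1), Fin (r k) → Module.End ℝ (A.Func U)),
          (∀ (k : Fin (n + 1)) (i : Fin (r k)), X k i ∈ A.vectorField U (-((k : ℕ) : ℤ))) →
          (D.1.IsGenerators U r X ↔ A.IsQuotientFrame (Φ D).1 U r X) :=
  ⟨A.distributionEquiv, fun D => ⟨D.2.corresponds_values,
    D.2.values_isSubbundleFamily.exists_finrank_ker, fun _ _ _ hX => D.2.isGenerators_iff hX⟩⟩
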